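/- **Setting.** Let $g\ge 0$, $n\ge 1$, $\vartheta\in\mathbb{R}_{>0}^n$, and let $k$ be the number of integral entries of $\vartheta$. Let $\Pi_{g,n}$ be the fundamental group of a compact oriented surface of genus $g$ with $n$ punctures, with standard generators $\mu_j,\nu_j$ ($1\le j\le g$), $\beta_i$ ($1\le i\le n$) and the single relation $[\mu_1,\nu_1]\cdots[\mu_g,\nu_g]\beta_1\cdots\beta_n=1$. Let $\mathcal B$ be the union of the conjugacy classes of the $\beta_i$. On $\mathfrak{su}_2$ put the norm $\|X\|=\sqrt{-2\,\mathrm{tr}(X^2)}$ and let $\mathrm e(X)=-\exp(2\pi X)$. A *decorated homomorphism* is a pair $(\rho,A)$ of a homomorphism $\rho:\Pi_{g,n}\to \mathrm{SU}_2$ and a map $A:\mathcal B\to\mathfrak{su}_2\setminus\{0\}$ with $A(\gamma\beta\gamma^{-1})=\rho(\gamma)A(\beta)\rho(\gamma)^{-1}$ and $\rho(\beta)=\mathrm e(A(\beta))$ for all $\gamma\in\Pi_{g,n}$, $\beta\in\mathcal B$. Let $\widehat{\mathrm{Hom}}_\vartheta$ be the space of the $(\rho,A)$ with $\|A(\beta_i)\|=\vartheta_i$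 for all $i$, and $\widehat{\mathrm{Rep}}_\vartheta$ its topological quotient by conjugation by $\mathrm{PSU}_2$. The injective map $(\rho,A)\mapsto(\rho(\mu_j),\rho(\nu_j),A(\beta_i))$ into $\mathrm{Mat}_2(\mathbb C)^{2g}\times\mathfrak{su}_2^{n}$ gives $\widehat{\mathrm{Hom}}_\vartheta$ its topology and its real-analytic structure, and the equations $M_j,N_j\in\mathrm{SU}_2$, $[M_1,N_1]\cdots[M_g,N_g]\,\mathrm e(X_1)\cdots \mathrm e(X_n)=I$, $\|X_i\|^2=\vartheta_i^2$ that cut out its image give it a structure of real-analytic space; this is called *reduced* if near each point the ideal generated by the equations contains every analytic function vanishing on the space. "Isomorphic" means real-analytically isomorphic, and manifolds are real-analytic. Call $(\rho,A)$ *central* if $\rho$ takes values in $\{\pm I\}$, *coaxial* if $\rho$ takes values in $\exp(\mathfrak h)$ for some $1$-dimensional subalgebra $\mathfrak h$ of $\mathfrak{su}_2$, and *elementary* if for some such $\mathfrak h$ moreover $A$ takes values in $\mathfrak h$. Let $\mathbb S^2$ be the unit sphere in $\mathbb{R}^3$ and $\mathrm{Coax}((\mathbb S^2)^m)$ the set of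 $m$-tuples of points of $\mathbb S^2$ lying on a common line through the origin. Let $\mathbb Z^n_o$ be the set of $m\in\mathbb Z^n$ with $\sum_i|m_i|$ odd, $d_1$ the $\ell^1$-distance in $\mathbb R^n$, $\mathbf 1=(1,\dots,1)$, and $\delta=d_1(\vartheta-\mathbf 1,\mathbb Z^n_o)$. The triple $(g,n,\vartheta)$ is *special* if either $g=1$, $\vartheta\in\mathbb Z^n$ and $\sum_i(\vartheta_i-1)$ is even, or $g=0$ and $\delta\le 1$. **Theorem.** Assume that $(g,n,\vartheta)$ is special. Then all elements of $\widehat{\mathrm{Hom}}_\vartheta$ are coaxial, and the following hold. 1. Let $g=1$ (so that $k=n$ and $\sum_i(\vartheta_i-1)$ is even). (a) The central locus of $\widehat{\mathrm{Hom}}_\vartheta$ is isomorphic to $\{\pm I\}^2\times(\mathbb S^2)^n$, by an isomorphism that carries the central elementary locus onto $\{\pm I\}^2\times\mathrm{Coax}((\mathbb S^2)^n)$. (b) The non-central locus is isomorphic to the total space of an analytic $(\mathbb S^2)^{n+1}$-bundle over $\mathbb S^2$ minus $4$ points, in which the non-central elementary locus is a subbundle with fiber $\mathrm{Coax}((\mathbb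 S^2)^{n+1})$. (c) The non-elementary non-central locus in $\widehat{\mathrm{Hom}}_\vartheta$ is a connected manifold of dimension $2n+4$, and the one in $\widehat{\mathrm{Rep}}_\vartheta$ is a connected manifold of dimension $2n+1$. 2. Let $g=0$, and let $k=n-1$ or $\delta<1$. Then $\widehat{\mathrm{Rep}}_\vartheta$ is empty. 3. Let $g=0$ and $\delta=1$. (a) If $k=0$, then $\widehat{\mathrm{Hom}}_\vartheta$ is isomorphic to $\mathbb S^2$ and is a single conjugacy class of elementary decorated homomorphisms. (b) If $1\le k\le n-2$, then $\widehat{\mathrm{Hom}}_\vartheta$ is isomorphic to $(\mathbb S^2)^{1+k}$, the elementary locus corresponding to $\mathrm{Coax}((\mathbb S^2)^{1+k})$, and the non-elementary locus of $\widehat{\mathrm{Rep}}_\vartheta$ is a connected orientable manifold of dimension $2k-1$. (c) If $k=n\ge 3$, then all elements of $\widehat{\mathrm{Hom}}_\vartheta$ are central, $\widehat{\mathrm{Hom}}_\vartheta$ is isomorphic to $(\mathbb S^2)^n$, the elementary locus corresponding to $\mathrm{Coax}((\mathbb S^2)^n)$, and the non-elementary locus of $\widehat{\mathrm{Rep}}_\vartheta$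 is a connected orientable manifold of dimension $2n-3$. (d) The homomorphisms $\rho$ underlying the elements $(\rho,A)$ of $\widehat{\mathrm{Hom}}_\vartheta$ form a single conjugacy class, and the natural structure of analytic space on $\widehat{\mathrm{Hom}}_\vartheta$ is reduced if and only if $k=n$ or $k=n-2$. -/

import Mathlib

open scoped ContDiff Manifold Topology

attribute [local instance] Matrix.linftyOpNormedRing Matrix.linftyOpNormedAlgebra

noncomputable section

/-! ### The groups and the Lie algebra -/

/-- Complex `2 × 2` matrices. As a normed space this is only used as a finite-dimensional real
vector space, in which analyticity does not depend on the norm. -/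
abbrev Mat2 : Type := Matrix (Fin 2) (Fin 2) ℂ

abbrev SU2 : Type := Matrix.specialUnitaryGroup (Fin 2) ℂ

/-- The Lie algebra of traceless skew-Hermitian matrices. -/
def su2 : Submodule ℝ Mat2 where
  carrier := {X | X.conjTranspose = -X ∧ X.trace = 0}
  zero_mem' := by simp
  add_mem' := by
    rintro X Y ⟨hX, hX'⟩ ⟨hY, hY'⟩
    refine ⟨?_, ?_⟩
    · rw [Matrix.conjTranspose_add, hX, hY, neg_add]
    · rw [Matrix.trace_add, hX', hY', add_zero]
  smul_mem' := by
    rintro c X ⟨hX, hX'⟩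
    refine ⟨?_, ?_⟩
    · rw [Matrix.conjTranspose_smul, hX, star_trivial, smul_neg]
    · rw [Matrix.trace_smul, hX', smul_zero]

/-- The norm `‖X‖ = √K(X, X)` of the Killing form `K(X, Y) = -2 tr(XY)`. -/
def killingNorm (X : su2) : ℝ := Real.sqrt (-2 * (((X : Mat2) * (X : Mat2)).trace).re)

/-- The map `e(X) = -exp(2πX)`. -/
def eMap (X : su2) : Mat2 := -NormedSpace.exp ((2 * Real.pi : ℝ) • (X : Mat2))

/-! ### The surface group -/

/-- Names of the standard generators. -/
inductive SurfaceGen (g n : ℕ) : Type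
  | mu (j : Fin g) : SurfaceGen g n
  | nu (j : Fin g) : SurfaceGen g n
  | beta (i : Fin n) : SurfaceGen g n

/-- The word `[μ₁,ν₁]⋯[μ_g,ν_g]·β₁⋯β_n`. -/
def surfaceRelator (g n : ℕ) : FreeGroup (SurfaceGen g n) :=
  (List.ofFn fun j : Fin g =>
      FreeGroup.of (SurfaceGen.mu j) * FreeGroup.of (SurfaceGen.nu j) *
        (FreeGroup.of (SurfaceGen.mu j))⁻¹ * (FreeGroup.of (SurfaceGen.nu j))⁻¹).prod *
    (List.ofFn fun i : Fin n => FreeGroup.of (SurfaceGen.beta i)).prod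

/-- The fundamental group `Π_{g,n}` of a surface of genus `g` with `n` punctures, in its standard
presentation. -/
abbrev SurfaceGroup (g n : ℕ) : Type := PresentedGroup {surfaceRelator g n}

def muElt {g n : ℕ} (j : Fin g) : SurfaceGroup g n := PresentedGroup.of (SurfaceGen.mu j)

def nuElt {g n : ℕ} (j : Fin g) : SurfaceGroup g n := PresentedGroup.of (SurfaceGen.nu j)

def betaElt {g n : ℕ} (i : Fin n) : SurfaceGroup g n := PresentedGroup.of (SurfaceGen.beta i)

/-- The set of peripheral elements, i.e. the union of the conjugacy classes of the `β_i`. -/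
def peripheral (g n : ℕ) : Set (SurfaceGroup g n) := {b | ∃ i : Fin n, IsConj (betaElt i) b}

/-- `β_i` as a peripheral element. -/
def betaPer {g n : ℕ} (i : Fin n) : peripheral g n := ⟨betaElt i, i, IsConj.refl _⟩

/-! ### Decorated homomorphisms and decorated representations -/

/-- A decorated homomorphism: a homomorphism `ρ : Π_{g,n} → SU₂` together with a decoration `A`. -/
structure DecHom (g n : ℕ) where
  rho : SurfaceGroup g n →* SU2
  A : peripheral g n → su2
  A_ne_zero : ∀ b, A b ≠ 0
  equivariant : ∀ (γ : SurfaceGroup g n) (b b' : peripheral g n),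
    (b' : SurfaceGroup g n) = γ * b * γ⁻¹ →
      (A b' : Mat2) = (rho γ : Mat2) * (A b : Mat2) * ((rho γ)⁻¹ : SU2)
  exp_eq : ∀ b : peripheral g n, (rho b : Mat2) = eMap (A b)

/-- The real vector space `Mat₂(ℂ)^{2g} × su₂^n`. -/
abbrev Ambient (g n : ℕ) : Type := (Fin g → Mat2 × Mat2) × (Fin n → su2)

namespace DecHom

variable {g n : ℕ}

/-- The coordinates `(ρ(μ_j), ρ(ν_j), A(β_i))` of a decorated homomorphism; they induce the topology
and the analytic structure. -/
def coords (x : DecHom g n) : Ambient g n :=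
  (fun j => ((x.rho (muElt j) : Mat2), (x.rho (nuElt j) : Mat2)), fun i => x.A (betaPer i))

instance : TopologicalSpace (DecHom g n) := TopologicalSpace.induced coords inferInstance

/-- The image of `ρ` lies in the center of `SU₂`. -/
def IsCentral (x : DecHom g n) : Prop := ∀ γ, x.rho γ ∈ Subgroup.center SU2

/-- The image of `ρ` lies in a 1-parameter subgroup `exp(h)`, where `h` is a line in `su₂`. -/
def IsCoaxial (x : DecHom g n) : Prop :=
  ∃ h : Submodule ℝ su2, Module.finrank ℝ h = 1 ∧
    ∀ γ, ∃ X ∈ h, (x.rho γ : Mat2) = NormedSpace.exp (X : Mat2)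

/-- For some line `h` in `su₂` (automatically a subalgebra), the decoration takes values in `h` and
`ρ` takes values in `exp(h)`. -/
def IsElementary (x : DecHom g n) : Prop :=
  ∃ h : Submodule ℝ su2, Module.finrank ℝ h = 1 ∧ (∀ b, x.A b ∈ h) ∧
    ∀ γ, ∃ X ∈ h, (x.rho γ : Mat2) = NormedSpace.exp (X : Mat2)

/-- Two decorated homomorphisms have conjugate underlying homomorphisms. -/
def RhoConj (x y : DecHom g n) : Prop := ∃ U : SU2, ∀ γ, y.rho γ = U * x.rho γ * U⁻¹

/-- Conjugacy of decorated homomorphisms. Since `±I` acts trivially, the orbits under `SU₂` are the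
orbits under `PSU₂`. -/
def Conj (x y : DecHom g n) : Prop :=
  ∃ U : SU2, (∀ γ, y.rho γ = U * x.rho γ * U⁻¹) ∧
    ∀ b, (y.A b : Mat2) = (U : Mat2) * (x.A b : Mat2) * (U⁻¹ : SU2)

theorem coe_mul_inv (U : SU2) : (U : Mat2) * ((U⁻¹ : SU2) : Mat2) = 1 := by
  have h : ((U * U⁻¹ : SU2) : Mat2) = 1 := by rw [mul_inv_cancel]; rfl
  exact h

theorem coe_inv_mul (U : SU2) : ((U⁻¹ : SU2) : Mat2) * (U : Mat2) = 1 := by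
  have h : ((U⁻¹ * U : SU2) : Mat2) = 1 := by rw [inv_mul_cancel]; rfl
  exact h

theorem conj_equivalence : Equivalence (Conj (g := g) (n := n)) where
  refl x := ⟨1, fun γ => by simp, fun b => by simp⟩
  symm := by
    rintro x y ⟨U, h1, h2⟩
    refine ⟨U⁻¹, fun γ => ?_, fun b => ?_⟩
    · rw [h1]; group
    · rw [h2, inv_inv]
      calc (x.A b : Mat2)
          = (((U⁻¹ : SU2) : Mat2) * (U : Mat2)) * (x.A b : Mat2)
              * (((U⁻¹ : SU2) : Mat2) * (U : Mat2)) := by rw [coe_inv_mul, one_mul, mul_one]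
        _ = _ := by simp only [mul_assoc]
  trans := by
    rintro x y z ⟨U, h1, h2⟩ ⟨V, h3, h4⟩
    refine ⟨V * U, fun γ => ?_, fun b => ?_⟩
    · rw [h3, h1]; group
    · rw [h4, h2, mul_inv_rev]
      simp only [Submonoid.coe_mul, mul_assoc]

instance conjSetoid (g n : ℕ) : Setoid (DecHom g n) := ⟨Conj, conj_equivalence⟩

/-- The decorated homomorphisms with `‖A(β_i)‖ = ϑ_i` for all `i`. -/
def rel (g : ℕ) {n : ℕ} (θ : Fin n → ℝ) : Set (DecHom g n) :=
  {x | ∀ i, killingNorm (x.A (betaPer i)) = θ i}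

end DecHom

/-- The decorated representation space, with the quotient topology. -/
abbrev DecRep (g n : ℕ) : Type := Quotient (DecHom.conjSetoid g n)

def DecHom.toRep {g n : ℕ} (x : DecHom g n) : DecRep g n := Quotient.mk _ x

/-- The relative decorated representation space. -/
def DecRep.rel (g : ℕ) {n : ℕ} (θ : Fin n → ℝ) : Set (DecRep g n) :=
  DecHom.toRep '' DecHom.rel g θ

/-! ### Special triples -/

/-- The number of integral entries of `ϑ`. -/
def numIntegral {n : ℕ} (θ : Fin n → ℝ) : ℕ := {i : Fin n | ∃ m : ℤ, θ i = m}.ncard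

/-- The `ℓ¹`-distance of `ϑ - (1,…,1)` from the integer vectors with odd `ℓ¹`-norm. -/
def distOdd {n : ℕ} (θ : Fin n → ℝ) : ℝ :=
  Metric.infDist (WithLp.toLp 1 fun i => θ i - 1)
    {p : PiLp 1 fun _ : Fin n => ℝ | ∃ m : Fin n → ℤ, Odd (∑ i, |m i|) ∧ ∀ i, p i = m i}

/-- Special triples `(g, n, ϑ)`. -/
def IsSpecial (g : ℕ) {n : ℕ} (θ : Fin n → ℝ) : Prop :=
  (g = 1 ∧ ∃ m : Fin n → ℤ, (∀ i, θ i = m i) ∧ Even (∑ i, (m i - 1))) ∨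
  (g = 0 ∧ distOdd θ ≤ 1)

/-! ### Products of spheres -/

/-- `(S²)^m`. -/
def spherePow (m : ℕ) : Set (Fin m → EuclideanSpace ℝ (Fin 3)) :=
  {x | ∀ i, x i ∈ Metric.sphere (0 : EuclideanSpace ℝ (Fin 3)) 1}

/-- The `m`-tuples in `(S²)^m` whose entries lie on a common line through the origin. -/
def coaxPow (m : ℕ) : Set (Fin m → EuclideanSpace ℝ (Fin 3)) :=
  {x | x ∈ spherePow m ∧
    ∃ L : Submodule ℝ (EuclideanSpace ℝ (Fin 3)), Module.finrank ℝ L = 1 ∧ ∀ i, x i ∈ L}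

/-! ### Real-analytic notions -/

section Analytic

variable {E F G : Type*} [NormedAddCommGroup E] [NormedSpace ℝ E]
  [NormedAddCommGroup F] [NormedSpace ℝ F] [NormedAddCommGroup G] [NormedSpace ℝ G]

/-- `f` restricts to an isomorphism of `S` onto `T` that, like its inverse, is locally the
restriction of real-analytic maps between open sets of the ambient vector spaces. -/
def IsAnalyticIso (f : E → F) (S : Set E) (T : Set F) : Prop :=
  AnalyticOn ℝ f S ∧ Set.MapsTo f S T ∧
    ∃ f' : F → E, AnalyticOn ℝ f' T ∧ Set.MapsTo f' T S ∧ Set.InvOn f' f S T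

/-- `Z` is a locally trivial analytic bundle over `B` with fiber `K`, and `Z'` is a subbundle with
fiber `K'`: locally on `B` there are trivializations of `Z` that also trivialize `Z'`. -/
def IsAnalyticBundlePair (Z Z' : Set E) (B : Set F) (K K' : Set G) : Prop :=
  Z' ⊆ Z ∧ K' ⊆ K ∧ ∃ p : E → F, Set.MapsTo p Z B ∧
    ∀ b ∈ B, ∃ U : Set F, IsOpen U ∧ b ∈ U ∧ ∃ Φ : E → F × G,
      IsAnalyticIso Φ (Z ∩ p ⁻¹' U) ((B ∩ U) ×ˢ K) ∧
      (∀ z ∈ Z ∩ p ⁻¹' U, (Φ z).1 = p z) ∧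
      Φ '' (Z' ∩ p ⁻¹' U) = (B ∩ U) ×ˢ K'

/-- The closed set `Z`, endowed with the analytic structure given by the equations `f = 0`, is
reduced: near each point of `Z`, every analytic function vanishing on `Z` belongs to the ideal
generated by the components of `f`. -/
def IsReducedStructure (Z : Set E) (f : E → F) : Prop :=
  ∀ p ∈ Z, ∀ u : E → ℝ, AnalyticAt ℝ u p → (∀ᶠ q in 𝓝 p, q ∈ Z → u q = 0) →
    ∃ c : E → (F →L[ℝ] ℝ), AnalyticAt ℝ c p ∧ ∀ᶠ q in 𝓝 p, u q = c q (f q)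

variable {X Q : Type*} [TopologicalSpace Q]

/-- An atlas on `Q` is compatible with the projection `π : X → Q`, where `X` carries the analytic
structure induced by `c : X → E`: in every chart the projection is analytic, and it admits
analytic local sections. (For `X = Q` and `π = id` this says that `Q` is an embedded analytic
submanifold of `E`; for a quotient it singles out the quotient analytic structure.) -/
def AtlasCompatible (c : X → E) (π : X → Q) (d : ℕ)
    [ChartedSpace (EuclideanSpace ℝ (Fin d)) Q] : Prop :=
  ∀ e ∈ atlas (EuclideanSpace ℝ (Fin d)) Q,
    (∃ φ : E → EuclideanSpace ℝ (Fin d), AnalyticOn ℝ φ (c '' (π ⁻¹' e.source)) ∧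
      ∀ x, π x ∈ e.source → φ (c x) = e (π x)) ∧
    (∀ y ∈ e.target, ∃ s : EuclideanSpace ℝ (Fin d) → X,
      AnalyticAt ℝ (fun z => c (s z)) y ∧ ∀ᶠ z in 𝓝 y, π (s z) = e.symm z)

/-- All transition maps of the atlas have positive Jacobian. -/
def AtlasOriented (Q : Type*) [TopologicalSpace Q] (d : ℕ)
    [ChartedSpace (EuclideanSpace ℝ (Fin d)) Q] : Prop :=
  ∀ e ∈ atlas (EuclideanSpace ℝ (Fin d)) Q, ∀ e' ∈ atlas (EuclideanSpace ℝ (Fin d)) Q,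
    ∀ y ∈ (e.symm.trans e').source, 0 < (fderiv ℝ (fun z => e' (e.symm z)) y).det

/-- `Q` is a connected real-analytic manifold of dimension `d`, with the analytic structure coming
from `X`. -/
def IsConnectedManifold (c : X → E) (π : X → Q) (d : ℕ) : Prop :=
  Function.Surjective π ∧ T2Space Q ∧ SecondCountableTopology Q ∧ ConnectedSpace Q ∧
    ∃ _ : ChartedSpace (EuclideanSpace ℝ (Fin d)) Q,
      IsManifold (𝓡 d) ω Q ∧ AtlasCompatible c π d

/-- `Q` is a connected orientable real-analytic manifold of dimension `d`, with the analytic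
structure coming from `X`. -/
def IsConnectedOrientedManifold (c : X → E) (π : X → Q) (d : ℕ) : Prop :=
  Function.Surjective π ∧ T2Space Q ∧ SecondCountableTopology Q ∧ ConnectedSpace Q ∧
    ∃ _ : ChartedSpace (EuclideanSpace ℝ (Fin d)) Q,
      IsManifold (𝓡 d) ω Q ∧ AtlasCompatible c π d ∧ AtlasOriented Q d

end Analytic

/-! ### Analytic structures on loci of decorated homomorphisms -/

namespace DecHom

variable {g n : ℕ}

/-- The image in the ambient vector space of a locus of decorated homomorphisms. -/
def locus (S : Set (DecHom g n)) : Set (Ambient g n) := coords '' S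

/-- A locus in the space of decorated homomorphisms is a connected manifold of dimension `d`. -/
def HomConnectedManifold (S : Set (DecHom g n)) (d : ℕ) : Prop :=
  IsConnectedManifold (fun x : S => coords (x : DecHom g n)) (id : S → S) d

/-- The locus in the decorated representation space consisting of the classes of elements of `S`
is a connected manifold of dimension `d`. -/
def RepConnectedManifold (S : Set (DecHom g n)) (d : ℕ) : Prop :=
  IsConnectedManifold (fun x : S => coords (x : DecHom g n)) (Set.imageFactorization toRep S) d

/-- The locus in the decorated representation space consisting of the classes of elements of `S`
is a connected orientable manifold of dimension `d`. -/
def RepConnectedOrientedManifold (S : Set (DecHom g n)) (d : ℕ) : Prop :=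
  IsConnectedOrientedManifold (fun x : S => coords (x : DecHom g n))
    (Set.imageFactorization toRep S) d

/-- The equations of the relative decorated homomorphism space in `Mat₂(ℂ)^{2g} × su₂^n`:
`M_j, N_j ∈ SU₂`, then `[M₁,N₁]⋯[M_g,N_g]·e(X₁)⋯e(X_n) = I` and `‖X_i‖² = ϑ_i²`. (On `SU₂` the
inverse is the conjugate transpose.) -/
def equations (g : ℕ) {n : ℕ} (θ : Fin n → ℝ) (q : Ambient g n) :
    (Fin g → (Mat2 × ℂ) × (Mat2 × ℂ)) × Mat2 × (Fin n → ℝ) :=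
  (fun j => (((q.1 j).1 * (q.1 j).1.conjTranspose - 1, (q.1 j).1.det - 1),
      ((q.1 j).2 * (q.1 j).2.conjTranspose - 1, (q.1 j).2.det - 1)),
    (List.ofFn fun j : Fin g => (q.1 j).1 * (q.1 j).2 * (q.1 j).1.conjTranspose *
        (q.1 j).2.conjTranspose).prod * (List.ofFn fun i : Fin n => eMap (q.2 i)).prod - 1,
    fun i => killingNorm (q.2 i) ^ 2 - θ i ^ 2)

end DecHom

end

noncomputable section

/-! ### Quaternionic coordinates on `2 × 2` matrices -/

/-! Everything is computed with unit quaternions. By `SU2_eq_quatMat` an element of `SU2` is a + v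
with v in ℝ³, conjugation acts on ℝ³ by rotations, and by `eMap_suEquiv` the value of e on a vector
of norm r and direction y is cos π(r-1) + sin π(r-1) y. So a decorated homomorphism is determined by
the images of the μ_j, ν_j and by the unit vectors `dir`; ρ(β_i) is central exactly when ϑ_i is an
integer, and ρ does not see the direction of A(β_i) in that case.

Conversely, values on generators extend to a decoration of all peripheral elements once ρ(γ) fixes
A(β_i) for every γ commuting with β_i. Centralizers in the surface group are never described.
Instead the group is made to act by affine maps whose linear part comes from ρ, with β_i acting as a
translation; what commutes with a translation has a linear part fixing the translation vector
(`linear_part_fixes`, `DecHom.exists_genus_zero`, `DecHom.exists_genus_one`).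

Genus zero. Let m be an odd integral vector nearest to ϑ - 1 and t_i = |ϑ_i - 1 - m_i|, so that Σ
t_i = δ. After extraction of the signs (-1)^(m_i), whose product is -1, the relation says that
quaternions of angles π t_i multiply to -1. The spherical `polygon_inequality` bounds the real part
of such a product from below by cos(π Σ t_i) if Σ t_i ≤ 1, with equality only if all axes with 0 <
t_i < 1 coincide. Hence nothing exists for δ < 1. For δ = 1 the directions with non-integral ϑ_i
agree up to fixed signs and the others are free (`DecHom.exists_isCoaxialModel`), which yields
(S²)^(1+k), or (S²)^n when k = n. A single non-integral entry is incompatible with δ = 1, since its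
t_i would be an integer.

Genus one. The ρ(β_i) are central with product 1, so the two remaining images commute and have the
form a + bu, c + du with a common axis u. Off the central locus (b, d, u) is unique up to a common
sign. The base of the bundle is the torus of pairs modulo inversion without its four fixed points;
it is embedded in ℝ³ by (a, c, bd) and projected radially to the sphere. The axis u, oriented by b >
0 or by d > 0, and the n directions fill the fiber (`DecHom.hasPillowTriv`,
`DecHom.HasPillowTriv.swap`).

Manifolds. The non-elementary loci correspond to non-coaxial configurations on S², locally times two
torus parameters in genus one. Stereographic projection gives charts; modulo rotations, charts arise
by writing all points in the orthonormal frame of two independent ones (`frameChart`), and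
`exists_chartedSpace` assembles them. For orientability, the derivative of a slice together with the
rotation and radial directions spans (ℝ³)^m, and the sign of the resulting determinant is compared
between charts in `ModelChart.sliceDet_eq`. Chart domains are connected and the dimension 2m - 3 is
odd, so z ↦ -z makes every chart positive.

Reducedness. By the analytic difference quotient `AnalyticAt.exists_difference_quotient`, functions
vanishing on the space lie in the ideal as soon as some analytic retraction R onto the space has q -
R(q) in the ideal. Normalizing the vectors suffices for k = n; for k = n - 2 the relation collapses
to a linear relation between two unit vectors, which supplies the missing part of R. With three
non-integral entries two axes can be tilted so that all equations hold to first order while a third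
axis stays put, and this detects a function outside the ideal (`DecHom.not_isReducedStructure`). -/

abbrev R3 : Type := EuclideanSpace ℝ (Fin 3)

/-- The matrix of the imaginary quaternion with coordinates `v`. -/
def imMat : R3 →ₗ[ℝ] Mat2 where
  toFun v := !![(v 0 : ℂ) * Complex.I, v 1 + v 2 * Complex.I;
    -(v 1 : ℂ) + v 2 * Complex.I, -((v 0 : ℂ) * Complex.I)]
  map_add' v w := by
    ext i j
    fin_cases i <;> fin_cases j <;> simp <;> ring
  map_smul' c v := by
    ext i j
    fin_cases i <;> fin_cases j <;> simp <;> ring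

/-- The vector part of a matrix. -/
def vecPart : Mat2 →ₗ[ℝ] R3 where
  toFun X := !₂[(X 0 0).im, (X 0 1).re, (X 0 1).im]
  map_add' X Y := by ext i; fin_cases i <;> simp
  map_smul' c X := by ext i; fin_cases i <;> simp

/-- The scalar part of a matrix. -/
def rePart : Mat2 →ₗ[ℝ] ℝ where
  toFun X := (X 0 0).re
  map_add' X Y := by simp
  map_smul' c X := by simp

theorem rePart_apply (X : Mat2) : rePart X = (X 0 0).re := rfl

/-- The matrix of the quaternion with real part `a` and imaginary part `v`. -/
def quatMat (a : ℝ) (v : R3) : Mat2 := a • (1 : Mat2) + imMat v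

/-- The cross product. -/
def crossR3 (v w : R3) : R3 :=
  !₂[v 1 * w 2 - v 2 * w 1, v 2 * w 0 - v 0 * w 2, v 0 * w 1 - v 1 * w 0]

theorem inner_R3 (v w : R3) : inner ℝ v w = v 0 * w 0 + v 1 * w 1 + v 2 * w 2 := by
  simp [PiLp.inner_apply, Fin.sum_univ_three]; ring

theorem norm_sq_R3 (v : R3) : ‖v‖ ^ 2 = v 0 ^ 2 + v 1 ^ 2 + v 2 ^ 2 := by
  rw [← real_inner_self_eq_norm_sq, inner_R3]; ring

@[simp] theorem vecPart_imMat (v : R3) : vecPart (imMat v) = v := by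
  ext i; fin_cases i <;> simp [vecPart, imMat]

@[simp] theorem rePart_imMat (v : R3) : rePart (imMat v) = 0 := by
  simp [rePart_apply, imMat]

@[simp] theorem vecPart_one : vecPart 1 = 0 := by
  ext i; fin_cases i <;> simp [vecPart]

@[simp] theorem rePart_one : rePart 1 = 1 := by
  simp [rePart_apply]

@[simp] theorem vecPart_quatMat (a : ℝ) (v : R3) : vecPart (quatMat a v) = v := by
  simp [quatMat]

@[simp] theorem rePart_quatMat (a : ℝ) (v : R3) : rePart (quatMat a v) = a := by
  simp [quatMat]

theorem quatMat_injective {a b : ℝ} {v w : R3} (h : quatMat a v = quatMat b w) : a = b ∧ v = w :=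
  ⟨by simpa using congrArg rePart h, by simpa using congrArg vecPart h⟩

theorem imMat_mul (v w : R3) :
    imMat v * imMat w = quatMat (-inner ℝ v w) (crossR3 v w) := by
  rw [inner_R3]
  ext i j
  fin_cases i <;> fin_cases j <;>
    simp [imMat, quatMat, crossR3, Matrix.mul_apply, Fin.sum_univ_two, Complex.ext_iff] <;>
    first | (constructor <;> ring) | ring

theorem quatMat_mul (a b : ℝ) (v w : R3) :
    quatMat a v * quatMat b w =
      quatMat (a * b - inner ℝ v w) (a • w + b • v + crossR3 v w) := by
  have h : quatMat a v * quatMat b w =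
      (a * b) • (1 : Mat2) + (a • imMat w + b • imMat v) + imMat v * imMat w := by
    simp only [quatMat, add_mul, mul_add, smul_mul_assoc, mul_smul_comm, one_mul, mul_one, smul_add, smul_smul]
    rw [mul_comm b a]
    abel
  rw [h, imMat_mul]
  simp only [quatMat, map_add, map_smul, sub_eq_add_neg, add_smul]
  abel

theorem quatMat_one_zero : quatMat 1 0 = 1 := by simp [quatMat]

theorem quatMat_neg_one_zero : quatMat (-1) 0 = -1 := by simp [quatMat]

theorem neg_quatMat (a : ℝ) (v : R3) : -quatMat a v = quatMat (-a) (-v) := by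
  simp [quatMat, neg_add, add_comm]

theorem smul_quatMat (c a : ℝ) (v : R3) : c • quatMat a v = quatMat (c * a) (c • v) := by
  simp [quatMat, smul_smul]

theorem quatMat_zero_left (v : R3) : quatMat 0 v = imMat v := by simp [quatMat]

theorem crossR3_self (v : R3) : crossR3 v v = 0 := by
  ext i; fin_cases i <;> simp [crossR3] <;> ring

theorem crossR3_zero_left (v : R3) : crossR3 0 v = 0 := by
  ext i; fin_cases i <;> simp [crossR3]

theorem crossR3_zero_right (v : R3) : crossR3 v 0 = 0 := by
  ext i; fin_cases i <;> simp [crossR3]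

theorem crossR3_swap (v w : R3) : crossR3 v w = -crossR3 w v := by
  ext i; fin_cases i <;> simp [crossR3] <;> ring

theorem crossR3_smul_left (c : ℝ) (v w : R3) : crossR3 (c • v) w = c • crossR3 v w := by
  ext i; fin_cases i <;> simp [crossR3] <;> ring

theorem crossR3_smul_right (c : ℝ) (v w : R3) : crossR3 v (c • w) = c • crossR3 v w := by
  ext i; fin_cases i <;> simp [crossR3] <;> ring

theorem crossR3_add_left (u v w : R3) : crossR3 (u + v) w = crossR3 u w + crossR3 v w := by
  ext i; fin_cases i <;> simp [crossR3] <;> ring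

theorem crossR3_add_right (u v w : R3) : crossR3 u (v + w) = crossR3 u v + crossR3 u w := by
  ext i; fin_cases i <;> simp [crossR3] <;> ring

theorem inner_crossR3_left (v w : R3) : inner ℝ v (crossR3 v w) = 0 := by
  rw [inner_R3]; simp [crossR3]; ring

theorem inner_crossR3_right (v w : R3) : inner ℝ w (crossR3 v w) = 0 := by
  rw [inner_R3]; simp [crossR3]; ring

theorem crossR3_crossR3 (u v w : R3) :
    crossR3 u (crossR3 v w) = (inner ℝ u w : ℝ) • v - (inner ℝ u v : ℝ) • w := by
  simp only [inner_R3]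
  ext i; fin_cases i <;> simp [crossR3] <;> ring

theorem norm_sq_crossR3 (v w : R3) :
    ‖crossR3 v w‖ ^ 2 = ‖v‖ ^ 2 * ‖w‖ ^ 2 - (inner ℝ v w) ^ 2 := by
  rw [norm_sq_R3, norm_sq_R3, norm_sq_R3, inner_R3]; simp [crossR3]; ring

theorem conjTranspose_quatMat (a : ℝ) (v : R3) :
    (quatMat a v).conjTranspose = quatMat a (-v) := by
  ext i j
  fin_cases i <;> fin_cases j <;>
    simp [imMat, quatMat, Matrix.conjTranspose_apply, Complex.ext_iff]

theorem det_quatMat (a : ℝ) (v : R3) : (quatMat a v).det = ((a ^ 2 + ‖v‖ ^ 2 : ℝ) : ℂ) := by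
  rw [norm_sq_R3, Matrix.det_fin_two]
  simp [imMat, quatMat, Complex.ext_iff, pow_two]
  constructor <;> ring

theorem quatMat_mem {a : ℝ} {v : R3} (h : a ^ 2 + ‖v‖ ^ 2 = 1) :
    quatMat a v ∈ Matrix.specialUnitaryGroup (Fin 2) ℂ := by
  rw [Matrix.mem_specialUnitaryGroup_iff, Matrix.mem_unitaryGroup_iff, det_quatMat, h,
    Matrix.star_eq_conjTranspose, conjTranspose_quatMat, quatMat_mul]
  refine ⟨?_, by simp⟩
  have h1 : crossR3 v (-v) = 0 := by
    have := crossR3_smul_right (-1) v v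
    simpa [crossR3_self] using this
  rw [h1, inner_neg_right, real_inner_self_eq_norm_sq, ← quatMat_one_zero]
  congr 1
  · linarith
  · simp

/-- The element of `SU₂` given by a unit quaternion. -/
def mkSU (a : ℝ) (v : R3) (h : a ^ 2 + ‖v‖ ^ 2 = 1) : SU2 := ⟨quatMat a v, quatMat_mem h⟩

/-- For determinant one the inverse is the adjugate, and unitarity makes it the conjugate transpose.
Comparing the first rows of the two gives the quaternionic shape. -/
theorem SU2_eq_quatMat (U : SU2) :
    (U : Mat2) = quatMat (rePart U) (vecPart U) ∧ rePart U ^ 2 + ‖vecPart U‖ ^ 2 = 1 := by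
  obtain ⟨A, hA⟩ := U
  rw [Matrix.mem_specialUnitaryGroup_iff] at hA
  obtain ⟨h1, h2⟩ := hA
  have h3 : star A * A = 1 := (Matrix.mem_unitaryGroup_iff').1 h1
  have h4 : A.adjugate = star A := by
    have : star A * A * A.adjugate = star A := by
      rw [mul_assoc, Matrix.mul_adjugate, h2]; simp
    rwa [h3, one_mul] at this
  have e : A = quatMat (rePart A) (vecPart A) := by
    have e00 := congrFun (congrFun h4 0) 0
    have e01 := congrFun (congrFun h4 0) 1
    simp [Matrix.adjugate_fin_two, Matrix.star_eq_conjTranspose, Complex.ext_iff] at e00 e01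
    ext i j
    fin_cases i <;> fin_cases j <;>
      simp [imMat, quatMat, rePart_apply, vecPart, Complex.ext_iff, e00, e01]
  refine ⟨e, ?_⟩
  rw [e, det_quatMat] at h2
  exact_mod_cast h2

@[simp] theorem coe_mkSU {a : ℝ} {v : R3} (h : a ^ 2 + ‖v‖ ^ 2 = 1) :
    (mkSU a v h : Mat2) = quatMat a v := rfl

theorem coe_inv_SU2 (U : SU2) : ((U⁻¹ : SU2) : Mat2) = (U : Mat2).conjTranspose := rfl

theorem coe_inv_mkSU {a : ℝ} {v : R3} (h : a ^ 2 + ‖v‖ ^ 2 = 1) :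
    ((mkSU a v h)⁻¹ : SU2) = quatMat a (-v) := by
  rw [coe_inv_SU2, coe_mkSU, conjTranspose_quatMat]

/-! ### The Lie algebra -/

theorem imMat_mem (v : R3) : imMat v ∈ su2 := by
  constructor
  · have := conjTranspose_quatMat 0 v
    rw [quatMat_zero_left, quatMat_zero_left] at this
    rw [this, map_neg]
  · simp [imMat, Matrix.trace_fin_two]

theorem imMat_vecPart {X : Mat2} (hX : X ∈ su2) : imMat (vecPart X) = X := by
  obtain ⟨h1, h2⟩ := hX
  rw [Matrix.trace_fin_two] at h2
  have e00 := congrFun (congrFun h1 0) 0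
  have e10 := congrFun (congrFun h1 1) 0
  simp [Matrix.conjTranspose_apply, Complex.ext_iff] at e00 e10 h2
  ext i j
  fin_cases i <;> fin_cases j <;> simp [imMat, vecPart, Complex.ext_iff]
  · linarith
  · constructor <;> linarith
  · constructor <;> linarith

/-- Linear coordinates on `su₂`. -/
def suEquiv : R3 ≃ₗ[ℝ] su2 where
  toFun v := ⟨imMat v, imMat_mem v⟩
  map_add' v w := by ext1; simp
  map_smul' c v := by ext1; simp
  invFun X := vecPart X
  left_inv v := by simp
  right_inv X := Subtype.ext (imMat_vecPart X.2)

@[simp] theorem coe_suEquiv (v : R3) : ((suEquiv v : su2) : Mat2) = imMat v := rfl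

/-- This factor 2 is the origin of every `θ i / 2` and `2 / θ i` below. -/
theorem killingNorm_suEquiv (v : R3) : killingNorm (suEquiv v) = 2 * ‖v‖ := by
  have h : (((suEquiv v : su2) : Mat2) * ((suEquiv v : su2) : Mat2)).trace.re = -2 * ‖v‖ ^ 2 := by
    rw [coe_suEquiv, imMat_mul, crossR3_self, real_inner_self_eq_norm_sq]
    simp only [quatMat, map_zero, add_zero, Matrix.trace_smul, Matrix.trace_one, Complex.real_smul,
      Complex.re_ofReal_mul]
    simp
    ring
  rw [killingNorm, h, show -2 * (-2 * ‖v‖ ^ 2) = (2 * ‖v‖) ^ 2 by ring, Real.sqrt_sq (by positivity)]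

/-- A unit imaginary quaternion squares to -1, so it spans with 1 a copy of ℂ; the exponential is
carried over from ℂ by this continuous algebra map. -/
theorem exp_imMat (r : ℝ) {x : R3} (hx : ‖x‖ = 1) :
    NormedSpace.exp (imMat (r • x)) = quatMat (Real.cos r) (Real.sin r • x) := by
  have hJ : imMat x * imMat x = -1 := by
    rw [imMat_mul, crossR3_self, real_inner_self_eq_norm_sq, hx, one_pow, quatMat_neg_one_zero]
  let f : ℂ →ₐ[ℝ] Mat2 := Complex.lift ⟨imMat x, hJ⟩
  have hf : Continuous f := (f.toLinearMap).continuous_of_finiteDimensional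
  have key := NormedSpace.map_exp (f : ℂ →+* Mat2) hf ((r : ℂ) * Complex.I)
  have e1 : f ((r : ℂ) * Complex.I) = imMat (r • x) := by
    simp [f, Complex.liftAux_apply]
  have e2 : f (NormedSpace.exp ((r : ℂ) * Complex.I)) = quatMat (Real.cos r) (Real.sin r • x) := by
    rw [← Complex.exp_eq_exp_ℂ]
    simp [f, Complex.liftAux_apply, quatMat, Complex.exp_ofReal_mul_I_re,
      Complex.exp_ofReal_mul_I_im, Algebra.algebraMap_eq_smul_one]
  rw [← e1, ← e2]
  exact key.symm

/-- The sign in the definition of e becomes a shift of the angle by π. This is why ϑ - 1, and not ϑ,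
is compared with the integral lattice. -/
theorem eMap_suEquiv (r : ℝ) {x : R3} (hx : ‖x‖ = 1) :
    eMap (suEquiv ((r / 2) • x)) =
      quatMat (Real.cos (Real.pi * (r - 1))) (Real.sin (Real.pi * (r - 1)) • x) := by
  have h : (2 * Real.pi : ℝ) • ((suEquiv ((r / 2) • x) : su2) : Mat2) = imMat ((Real.pi * r) • x) := by
    rw [coe_suEquiv, ← map_smul, smul_smul]
    congr 2; ring
  rw [eMap, h, exp_imMat _ hx, neg_quatMat, show Real.pi * (r - 1) = Real.pi * r - Real.pi by ring,
    Real.cos_sub_pi, Real.sin_sub_pi, neg_smul]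


/-! ### The adjoint action -/

theorem conj_mem_su2 (U : SU2) {X : Mat2} (hX : X ∈ su2) :
    (U : Mat2) * X * ((U⁻¹ : SU2) : Mat2) ∈ su2 := by
  obtain ⟨h1, h2⟩ := hX
  constructor
  · rw [coe_inv_SU2, Matrix.conjTranspose_mul, Matrix.conjTranspose_mul,
      Matrix.conjTranspose_conjTranspose, h1]
    simp [mul_assoc]
  · rw [Matrix.trace_mul_comm, ← mul_assoc, DecHom.coe_inv_mul, one_mul, h2]

/-- The action of `SU₂` on `ℝ³` by rotations. -/
def adj (U : SU2) : R3 →ₗ[ℝ] R3 where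
  toFun v := vecPart ((U : Mat2) * imMat v * ((U⁻¹ : SU2) : Mat2))
  map_add' v w := by rw [map_add, mul_add, add_mul, map_add]
  map_smul' c v := by
    rw [map_smul, mul_smul_comm, smul_mul_assoc, map_smul, RingHom.id_apply]

theorem imMat_adj (U : SU2) (v : R3) :
    imMat (adj U v) = (U : Mat2) * imMat v * ((U⁻¹ : SU2) : Mat2) :=
  imMat_vecPart (conj_mem_su2 U (imMat_mem v))

theorem imMat_injective : Function.Injective imMat := fun v w h => by
  simpa using congrArg vecPart h

theorem adj_eq_iff {U : SU2} {v w : R3} :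
    adj U v = w ↔ (U : Mat2) * imMat v = imMat w * (U : Mat2) := by
  rw [← imMat_injective.eq_iff, imMat_adj]
  constructor
  · intro h
    rw [← h, mul_assoc _ _ (U : Mat2), DecHom.coe_inv_mul, mul_one]
  · intro h
    rw [h, mul_assoc, DecHom.coe_mul_inv, mul_one]

theorem adj_one (v : R3) : adj 1 v = v := by
  rw [adj_eq_iff]; simp

theorem adj_mul (U V : SU2) (v : R3) : adj (U * V) v = adj U (adj V v) := by
  apply imMat_injective
  rw [imMat_adj, imMat_adj, imMat_adj, mul_inv_rev]
  simp only [Submonoid.coe_mul, mul_assoc]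

theorem adj_inv_adj (U : SU2) (v : R3) : adj U⁻¹ (adj U v) = v := by
  rw [← adj_mul, inv_mul_cancel, adj_one]

theorem adj_adj_inv (U : SU2) (v : R3) : adj U (adj U⁻¹ v) = v := by
  rw [← adj_mul, mul_inv_cancel, adj_one]

theorem conj_quatMat (U : SU2) (a : ℝ) (v : R3) :
    (U : Mat2) * quatMat a v * ((U⁻¹ : SU2) : Mat2) = quatMat a (adj U v) := by
  rw [quatMat, quatMat, imMat_adj, mul_add, add_mul, mul_smul_comm, smul_mul_assoc, mul_one,
    DecHom.coe_mul_inv]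

/-- Conjugation is multiplicative. Applied to a product of two imaginary quaternions, its real part
says that the action is isometric and its imaginary part that it preserves cross products. -/
theorem adj_mul_aux (U : SU2) (v w : R3) :
    quatMat (-inner ℝ (adj U v) (adj U w)) (crossR3 (adj U v) (adj U w)) =
      quatMat (-inner ℝ v w) (adj U (crossR3 v w)) := by
  rw [← imMat_mul, ← conj_quatMat, ← imMat_mul, imMat_adj, imMat_adj]
  calc _ = (U : Mat2) * imMat v * (((U⁻¹ : SU2) : Mat2) * (U : Mat2)) * imMat w
        * ((U⁻¹ : SU2) : Mat2) := by simp only [mul_assoc]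
    _ = _ := by rw [DecHom.coe_inv_mul, mul_one]; simp only [mul_assoc]

theorem inner_adj (U : SU2) (v w : R3) : inner ℝ (adj U v) (adj U w) = inner ℝ v w :=
  neg_injective (quatMat_injective (adj_mul_aux U v w)).1

theorem crossR3_adj (U : SU2) (v w : R3) :
    crossR3 (adj U v) (adj U w) = adj U (crossR3 v w) :=
  (quatMat_injective (adj_mul_aux U v w)).2

theorem norm_adj (U : SU2) (v : R3) : ‖adj U v‖ = ‖v‖ := by
  have h := inner_adj U v v
  rw [real_inner_self_eq_norm_sq, real_inner_self_eq_norm_sq] at h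
  exact (sq_eq_sq₀ (norm_nonneg _) (norm_nonneg _)).1 h

theorem eMap_conj (U : SU2) {X Y : su2}
    (h : (Y : Mat2) = (U : Mat2) * (X : Mat2) * ((U⁻¹ : SU2) : Mat2)) :
    eMap Y = (U : Mat2) * eMap X * ((U⁻¹ : SU2) : Mat2) := by
  let u : Mat2ˣ := ⟨U, ((U⁻¹ : SU2) : Mat2), DecHom.coe_mul_inv U, DecHom.coe_inv_mul U⟩
  have key := NormedSpace.exp_units_conj u ((2 * Real.pi : ℝ) • (X : Mat2))
  rw [eMap, eMap, h, mul_neg, neg_mul, ← smul_mul_assoc, ← mul_smul_comm]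
  exact congrArg Neg.neg key

theorem exists_unit_orthogonal (x : R3) : ∃ z : R3, ‖z‖ = 1 ∧ inner ℝ x z = 0 := by
  suffices h : ∃ z : R3, z ≠ 0 ∧ inner ℝ x z = 0 by
    obtain ⟨z, hz, h⟩ := h
    exact ⟨‖z‖⁻¹ • z, norm_smul_inv_norm hz, by rw [inner_smul_right, h, mul_zero]⟩
  by_cases h : x 0 = 0 ∧ x 1 = 0
  · refine ⟨!₂[1, 0, 0], fun h0 => ?_, ?_⟩
    · simpa using congrArg (fun v : R3 => v 0) h0
    · rw [inner_R3]; simp [h.1]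
  · refine ⟨!₂[-x 1, x 0, 0], fun h0 => h ⟨?_, ?_⟩, ?_⟩
    · simpa using congrArg (fun v : R3 => v 1) h0
    · simpa using congrArg (fun v : R3 => v 0) h0
    · rw [inner_R3]; simp; ring

theorem neg_one_lt_inner {y y' : R3} (hy : ‖y‖ = 1) (hy' : ‖y'‖ = 1) (h : y' ≠ -y) :
    -1 < (inner ℝ y' y : ℝ) := by
  have h1 : 0 < ‖y' + y‖ := norm_pos_iff.2 fun h0 => h (eq_neg_of_add_eq_zero_left h0)
  have h2 := norm_add_sq_real y' y
  rw [hy, hy'] at h2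
  nlinarith [pow_pos h1 2]

/-- A rotation carrying `y` to `y'` and fixing the vectors orthogonal to both. -/
theorem exists_adj_eq_of_ne_neg {y y' : R3} (hy : ‖y‖ = 1) (hy' : ‖y'‖ = 1) (h : y' ≠ -y) :
    ∃ U : SU2, adj U y = y' ∧
      ∀ x : R3, inner ℝ x y = 0 → inner ℝ x y' = 0 → adj U x = x := by
  have hd := neg_one_lt_inner hy hy' h
  set d : ℝ := inner ℝ y' y with hd'
  -- The rotation is given by the quaternion `1 - y' y`, whose real part is `1 + d`, whose vector
  -- part is minus the cross product, and whose squared length is `2 * (1 + d)`.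
  set l : ℝ := (Real.sqrt (2 * (1 + d)))⁻¹ with hl
  have hl2 : l ^ 2 * (2 * (1 + d)) = 1 := by
    rw [hl, inv_pow, Real.sq_sqrt (by linarith), inv_mul_cancel₀ (by linarith)]
  have hc : ‖crossR3 y' y‖ ^ 2 = 1 - d ^ 2 := by
    rw [norm_sq_crossR3, hy, hy']; ring
  have hn : (l * (1 + d)) ^ 2 + ‖(-l) • crossR3 y' y‖ ^ 2 = 1 := by
    rw [norm_smul, mul_pow ‖-l‖, hc, Real.norm_eq_abs, sq_abs]
    linear_combination hl2
  refine ⟨mkSU _ _ hn, ?_, fun x hxy hxy' => ?_⟩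
  · rw [adj_eq_iff, coe_mkSU, ← quatMat_zero_left, ← quatMat_zero_left, quatMat_mul, quatMat_mul]
    have e1 : crossR3 (crossR3 y' y) y = -(y' - d • y) := by
      rw [crossR3_swap, crossR3_crossR3, real_inner_self_eq_norm_sq, hy, real_inner_comm y' y,
        ← hd']
      simp
    have e2 : crossR3 y' (crossR3 y' y) = d • y' - y := by
      rw [crossR3_crossR3, real_inner_self_eq_norm_sq, hy', ← hd']
      simp
    congr 1
    · rw [inner_smul_left, inner_smul_right, inner_crossR3_left, real_inner_comm,
        inner_crossR3_right]
      simp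
    · rw [crossR3_smul_left, crossR3_smul_right, e1, e2]
      module
  · rw [adj_eq_iff, coe_mkSU, ← quatMat_zero_left, quatMat_mul, quatMat_mul]
    have e1 : crossR3 x (crossR3 y' y) = 0 := by
      rw [crossR3_crossR3, hxy, hxy']; simp
    have e2 : crossR3 (crossR3 y' y) x = 0 := by rw [crossR3_swap, e1, neg_zero]
    rw [real_inner_comm, crossR3_smul_left, crossR3_smul_right, e1, e2]
    congr 1
    · ring
    · module

/-- The quaternion z itself acts as the half turn about z. It covers the antipodal case, where `1 -
y' y` vanishes. -/
theorem adj_imMat_of_orthogonal {y z : R3} (hz : ‖z‖ = 1) (h : inner ℝ y z = 0) :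
    ∃ U : SU2, adj U y = -y ∧ adj U z = z := by
  have hn : (0 : ℝ) ^ 2 + ‖z‖ ^ 2 = 1 := by rw [hz]; norm_num
  refine ⟨mkSU 0 z hn, ?_, ?_⟩
  · rw [adj_eq_iff, coe_mkSU, quatMat_zero_left, imMat_mul, imMat_mul, real_inner_comm,
      crossR3_swap, h]
    congr 1
    · rw [inner_neg_left, h]; simp
    · rw [← neg_one_smul ℝ y, crossR3_smul_left]; simp
  · rw [adj_eq_iff, coe_mkSU, quatMat_zero_left]

theorem exists_adj_eq {y y' : R3} (hy : ‖y‖ = 1) (hy' : ‖y'‖ = 1) : ∃ U : SU2, adj U y = y' := by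
  by_cases h : y' = -y
  · obtain ⟨z, hz, hyz⟩ := exists_unit_orthogonal y
    obtain ⟨U, hU, -⟩ := adj_imMat_of_orthogonal hz hyz
    exact ⟨U, hU.trans h.symm⟩
  · obtain ⟨U, hU, -⟩ := exists_adj_eq_of_ne_neg hy hy' h
    exact ⟨U, hU⟩

/-- `SU₂` acts transitively on orthonormal pairs. -/
theorem exists_adj_pair {x y x' y' : R3} (hx : ‖x‖ = 1) (hy : ‖y‖ = 1) (hxy : inner ℝ x y = 0)
    (hx' : ‖x'‖ = 1) (hy' : ‖y'‖ = 1) (hxy' : inner ℝ x' y' = 0) :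
    ∃ U : SU2, adj U x = x' ∧ adj U y = y' := by
  obtain ⟨U, hU⟩ := exists_adj_eq hx hx'
  have h1 : ‖adj U y‖ = 1 := by rw [norm_adj, hy]
  have h2 : inner ℝ x' (adj U y) = 0 := by rw [← hU, inner_adj, hxy]
  -- Once the first vectors agree, the second ones are matched by a rotation fixing `x'`; both
  -- available rotations leave the common normal vector alone.
  suffices h : ∃ V : SU2, adj V x' = x' ∧ adj V (adj U y) = y' by
    obtain ⟨V, hV1, hV2⟩ := h
    exact ⟨V * U, by rw [adj_mul, hU, hV1], by rw [adj_mul, hV2]⟩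
  by_cases h : y' = -adj U y
  · obtain ⟨V, hV1, hV2⟩ := adj_imMat_of_orthogonal (y := adj U y) hx'
      (by rw [real_inner_comm]; exact h2)
    exact ⟨V, hV2, hV1.trans h.symm⟩
  · obtain ⟨V, hV1, hV2⟩ := exists_adj_eq_of_ne_neg h1 hy' h
    exact ⟨V, hV2 x' h2 hxy', hV1⟩

/-! ### Maximal tori -/

theorem vecPart_mul (U V : SU2) :
    vecPart ((U * V : SU2) : Mat2) = rePart (U : Mat2) • vecPart (V : Mat2) +
      rePart (V : Mat2) • vecPart (U : Mat2) + crossR3 (vecPart (U : Mat2)) (vecPart (V : Mat2)) := by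
  conv_lhs => rw [Submonoid.coe_mul, (SU2_eq_quatMat U).1, (SU2_eq_quatMat V).1]
  rw [quatMat_mul, vecPart_quatMat]

theorem vecPart_inv (U : SU2) : vecPart ((U⁻¹ : SU2) : Mat2) = -vecPart (U : Mat2) := by
  conv_lhs => rw [coe_inv_SU2, (SU2_eq_quatMat U).1]
  rw [conjTranspose_quatMat, vecPart_quatMat]

/-- The maximal torus with axis `u`. -/
def torus (u : R3) : Subgroup SU2 where
  carrier := {U | ∃ b : ℝ, vecPart (U : Mat2) = b • u}
  one_mem' := ⟨0, by simp⟩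
  mul_mem' := by
    rintro U V ⟨b, hb⟩ ⟨c, hc⟩
    refine ⟨rePart (U : Mat2) * c + rePart (V : Mat2) * b, ?_⟩
    rw [vecPart_mul, hb, hc, crossR3_smul_left, crossR3_smul_right, crossR3_self]
    module
  inv_mem' := by
    rintro U ⟨b, hb⟩
    exact ⟨-b, by rw [vecPart_inv, hb, neg_smul]⟩

theorem exists_cos_sin {a b : ℝ} (h : a ^ 2 + b ^ 2 = 1) :
    ∃ r : ℝ, a = Real.cos r ∧ b = Real.sin r := by
  have h1 : ‖(⟨a, b⟩ : ℂ)‖ = 1 := by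
    rw [Complex.norm_def, Complex.normSq_mk, Real.sqrt_eq_one]; linarith
  obtain ⟨r, hr⟩ := (Complex.norm_eq_one_iff _).1 h1
  refine ⟨r, ?_, ?_⟩
  · rw [← Complex.exp_ofReal_mul_I_re, hr]
  · rw [← Complex.exp_ofReal_mul_I_im, hr]

theorem torus_param {u : R3} (hu : ‖u‖ = 1) {U : SU2} (hU : U ∈ torus u) :
    ∃ r : ℝ, (U : Mat2) = quatMat (Real.cos r) (Real.sin r • u) := by
  obtain ⟨b, hb⟩ := hU
  obtain ⟨h1, h2⟩ := SU2_eq_quatMat U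
  rw [hb, norm_smul, hu, mul_one, Real.norm_eq_abs, sq_abs] at h2
  obtain ⟨r, h3, h4⟩ := exists_cos_sin h2
  exact ⟨r, by rw [h1, hb, h3, h4]⟩

theorem quatMat_cos_sin_mem (r : ℝ) {u : R3} (hu : ‖u‖ = 1) :
    (Real.cos r) ^ 2 + ‖Real.sin r • u‖ ^ 2 = 1 := by
  rw [norm_smul, hu, mul_one, Real.norm_eq_abs, sq_abs, Real.cos_sq_add_sin_sq]

/-- Links the description of tori by vector parts with the exponentials occurring in the definitions
of coaxial and elementary. -/
theorem mem_torus_iff_exp {u : R3} (hu : ‖u‖ = 1) {U : SU2} :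
    U ∈ torus u ↔ ∃ X ∈ Submodule.span ℝ {suEquiv u}, (U : Mat2) = NormedSpace.exp (X : Mat2) := by
  constructor
  · intro h
    obtain ⟨r, hr⟩ := torus_param hu h
    refine ⟨r • suEquiv u, Submodule.mem_span_singleton.2 ⟨r, rfl⟩, ?_⟩
    rw [hr, ← exp_imMat r hu, map_smul]
    rfl
  · rintro ⟨X, hX, h⟩
    obtain ⟨r, rfl⟩ := Submodule.mem_span_singleton.1 hX
    refine ⟨Real.sin r, ?_⟩
    rw [h]
    have : ((r • suEquiv u : su2) : Mat2) = imMat (r • u) := by rw [map_smul]; rfl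
    rw [this, exp_imMat r hu, vecPart_quatMat]

theorem exists_mem_torus (U : SU2) : ∃ u : R3, ‖u‖ = 1 ∧ U ∈ torus u := by
  by_cases h : vecPart (U : Mat2) = 0
  · obtain ⟨z, hz, -⟩ := exists_unit_orthogonal 0
    exact ⟨z, hz, 0, by rw [h, zero_smul]⟩
  · exact ⟨‖vecPart (U : Mat2)‖⁻¹ • vecPart (U : Mat2), norm_smul_inv_norm h,
      ‖vecPart (U : Mat2)‖, by rw [smul_inv_smul₀ (norm_ne_zero_iff.2 h)]⟩

/-- Halve the angle in a torus through `U`. Being squares, rotations will have positive determinant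
in every representation. -/
theorem exists_sq_eq (U : SU2) : ∃ W : SU2, W * W = U := by
  obtain ⟨u, hu, hU⟩ := exists_mem_torus U
  obtain ⟨r, hr⟩ := torus_param hu hU
  refine ⟨mkSU _ _ (quatMat_cos_sin_mem (r / 2) hu), Subtype.ext ?_⟩
  rw [Submonoid.coe_mul, coe_mkSU, hr, quatMat_mul, inner_smul_left, inner_smul_right,
    real_inner_self_eq_norm_sq, hu, crossR3_smul_left, crossR3_smul_right, crossR3_self]
  congr 1
  · have := Real.cos_add (r / 2) (r / 2)
    rw [add_halves] at this
    simp [this]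
  · have := Real.sin_add (r / 2) (r / 2)
    rw [add_halves] at this
    rw [this]
    module

theorem adj_eq_self_of_mem_torus {u : R3} {U : SU2} (hU : U ∈ torus u) : adj U u = u := by
  obtain ⟨b, hb⟩ := hU
  rw [adj_eq_iff, (SU2_eq_quatMat U).1, hb, ← quatMat_zero_left, quatMat_mul, quatMat_mul,
    crossR3_smul_left, crossR3_smul_right, inner_smul_left, inner_smul_right]
  congr 1
  · simp
  · simp

theorem SU2_eq_iff {U V : SU2} :
    U = V ↔ rePart (U : Mat2) = rePart (V : Mat2) ∧ vecPart (U : Mat2) = vecPart (V : Mat2) := by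
  constructor
  · rintro rfl; exact ⟨rfl, rfl⟩
  · rintro ⟨h1, h2⟩
    apply Subtype.ext
    rw [(SU2_eq_quatMat U).1, (SU2_eq_quatMat V).1, h1, h2]

/-- In the product of quaternions only the cross product is antisymmetric, so the commutator is
twice the cross product of the vector parts. -/
theorem mul_comm_iff_crossR3 {U V : SU2} :
    U * V = V * U ↔ crossR3 (vecPart (U : Mat2)) (vecPart (V : Mat2)) = 0 := by
  have h1 := vecPart_mul U V
  have h2 := vecPart_mul V U
  constructor
  · intro h
    rw [h, h2, crossR3_swap] at h1
    have h3 : (2 : ℝ) • crossR3 (vecPart (U : Mat2)) (vecPart (V : Mat2)) = 0 := by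
      have h4 := sub_eq_zero.2 h1.symm
      rw [← h4]; module
    exact (smul_eq_zero.1 h3).resolve_left two_ne_zero
  · intro h
    rw [SU2_eq_iff, h1, h2, crossR3_swap (vecPart (V : Mat2)), h]
    refine ⟨?_, by rw [neg_zero, add_comm (rePart (U : Mat2) • _)]⟩
    rw [Submonoid.coe_mul, Submonoid.coe_mul, (SU2_eq_quatMat U).1, (SU2_eq_quatMat V).1,
      quatMat_mul, quatMat_mul]
    simp only [rePart_quatMat]
    rw [real_inner_comm, mul_comm]

theorem eq_smul_of_crossR3_eq_zero {p q : R3} (hp : p ≠ 0) (h : crossR3 p q = 0) :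
    ∃ c : ℝ, q = c • p := by
  have h1 := crossR3_crossR3 p p q
  rw [h, crossR3_zero_right, real_inner_self_eq_norm_sq] at h1
  have h2 : ‖p‖ ^ 2 ≠ 0 := pow_ne_zero 2 (norm_ne_zero_iff.2 hp)
  refine ⟨(‖p‖ ^ 2)⁻¹ * inner ℝ p q, ?_⟩
  rw [mul_smul, sub_eq_zero.1 h1.symm, inv_smul_smul₀ h2]

theorem exists_torus_of_comm {U V : SU2} (h : U * V = V * U) :
    ∃ u : R3, ‖u‖ = 1 ∧ U ∈ torus u ∧ V ∈ torus u := by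
  by_cases hU : vecPart (U : Mat2) = 0
  · obtain ⟨u, hu, hV⟩ := exists_mem_torus V
    exact ⟨u, hu, ⟨0, by rw [hU, zero_smul]⟩, hV⟩
  · have hn := norm_ne_zero_iff.2 hU
    obtain ⟨c, hc⟩ := eq_smul_of_crossR3_eq_zero hU (mul_comm_iff_crossR3.1 h)
    exact ⟨‖vecPart (U : Mat2)‖⁻¹ • vecPart (U : Mat2), norm_smul_inv_norm hU,
      ⟨‖vecPart (U : Mat2)‖, by rw [smul_inv_smul₀ hn]⟩,
      ⟨c * ‖vecPart (U : Mat2)‖, by rw [mul_smul, smul_inv_smul₀ hn, hc]⟩⟩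

/-- A nonzero vector part is detected by a unit imaginary quaternion orthogonal to it, which fails
to commute with `U`. -/
theorem mem_center_iff {U : SU2} : U ∈ Subgroup.center SU2 ↔ vecPart (U : Mat2) = 0 := by
  rw [Subgroup.mem_center_iff]
  constructor
  · intro h
    by_contra h0
    obtain ⟨z, hz, hUz⟩ := exists_unit_orthogonal (vecPart (U : Mat2))
    have hn : (0 : ℝ) ^ 2 + ‖z‖ ^ 2 = 1 := by rw [hz]; norm_num
    have h1 := mul_comm_iff_crossR3.1 (h (mkSU 0 z hn)).symm
    rw [coe_mkSU, vecPart_quatMat] at h1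
    have h2 := norm_sq_crossR3 (vecPart (U : Mat2)) z
    rw [h1, hUz, hz] at h2
    simp only [norm_zero, one_pow, mul_one, sub_zero, ne_eq, OfNat.ofNat_ne_zero, not_false_eq_true,
      zero_pow] at h2
    exact h0 (norm_eq_zero.1 (pow_eq_zero_iff two_ne_zero |>.1 h2.symm))
  · intro h V
    rw [mul_comm_iff_crossR3, h, crossR3_zero_right]

theorem vecPart_eq_zero_iff {U : SU2} :
    vecPart (U : Mat2) = 0 ↔ (U : Mat2) = 1 ∨ (U : Mat2) = -1 := by
  constructor
  · intro h
    obtain ⟨h1, h2⟩ := SU2_eq_quatMat U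
    rw [h, norm_zero, zero_pow two_ne_zero, add_zero] at h2
    rcases (eq_or_eq_neg_of_sq_eq_sq _ 1 (h2.trans (one_pow 2).symm)) with h2 | h2
    · left; rw [h1, h, h2, quatMat_one_zero]
    · right; rw [h1, h, h2, quatMat_neg_one_zero]
  · rintro (h | h) <;> simp [h]

theorem adj_eq_of_mem_center {U : SU2} (hU : vecPart (U : Mat2) = 0) (v : R3) : adj U v = v :=
  adj_eq_self_of_mem_torus ⟨0, by rw [hU, zero_smul]⟩

/-- The group is the continuous image of the unit 3-sphere. Compactness is what makes the
conjugation quotient Hausdorff. -/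
instance compactSpace_SU2 : CompactSpace SU2 := by
  have h1 : IsCompact (Metric.sphere (0 : WithLp 2 (ℝ × R3)) 1) := isCompact_sphere _ _
  have hc : Continuous fun p : WithLp 2 (ℝ × R3) => quatMat p.fst p.snd := by
    have h2 : Continuous imMat := imMat.continuous_of_finiteDimensional
    unfold quatMat
    fun_prop
  have h3 := h1.image hc
  refine isCompact_iff_compactSpace.1 ?_
  convert h3 using 1
  ext A
  constructor
  · intro hA
    obtain ⟨h4, h5⟩ := SU2_eq_quatMat ⟨A, hA⟩
    refine ⟨WithLp.toLp 2 (rePart A, vecPart A), ?_, h4.symm⟩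
    rw [mem_sphere_zero_iff_norm, WithLp.prod_norm_eq_of_L2, Real.sqrt_eq_one]
    simpa using h5
  · rintro ⟨p, hp, rfl⟩
    apply quatMat_mem
    rw [mem_sphere_zero_iff_norm, WithLp.prod_norm_eq_of_L2, Real.sqrt_eq_one] at hp
    simpa using hp


/-! ### Homomorphisms of surface groups -/

section SurfaceGroups

variable {g n : ℕ} {G : Type*} [Group G]

theorem surface_map_mem (f : SurfaceGroup g n →* G) (H : Subgroup G)
    (hm : ∀ j, f (muElt j) ∈ H) (hv : ∀ j, f (nuElt j) ∈ H) (hb : ∀ i, f (betaElt i) ∈ H)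
    (γ : SurfaceGroup g n) : f γ ∈ H := by
  have h : (⊤ : Subgroup (SurfaceGroup g n)) ≤ H.comap f := by
    rw [← PresentedGroup.closure_range_of, Subgroup.closure_le]
    rintro _ ⟨s, rfl⟩
    cases s with
    | mu j => exact hm j
    | nu j => exact hv j
    | beta i => exact hb i
  exact h (Subgroup.mem_top γ)

theorem surface_hom_ext {f f' : SurfaceGroup g n →* G}
    (hm : ∀ j, f (muElt j) = f' (muElt j)) (hv : ∀ j, f (nuElt j) = f' (nuElt j))
    (hb : ∀ i, f (betaElt i) = f' (betaElt i)) : f = f' := by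
  apply PresentedGroup.ext
  rintro (j | j | i)
  exacts [hm j, hv j, hb i]

theorem lift_surfaceRelator (m v : Fin g → G) (b : Fin n → G) :
    FreeGroup.lift (fun s : SurfaceGen g n => match s with
      | .mu j => m j | .nu j => v j | .beta i => b i) (surfaceRelator g n) =
    (List.ofFn fun j => m j * v j * (m j)⁻¹ * (v j)⁻¹).prod * (List.ofFn b).prod := by
  rw [surfaceRelator, map_mul, map_list_prod, map_list_prod, List.map_ofFn, List.map_ofFn]
  congr 3 <;> funext j <;> simp

theorem exists_surface_hom (m v : Fin g → G) (b : Fin n → G)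
    (h : (List.ofFn fun j => m j * v j * (m j)⁻¹ * (v j)⁻¹).prod * (List.ofFn b).prod = 1) :
    ∃ f : SurfaceGroup g n →* G, (∀ j, f (muElt j) = m j) ∧ (∀ j, f (nuElt j) = v j) ∧
      ∀ i, f (betaElt i) = b i := by
  have hr : ∀ r ∈ ({surfaceRelator g n} : Set (FreeGroup (SurfaceGen g n))),
      FreeGroup.lift (fun s : SurfaceGen g n => match s with
        | .mu j => m j | .nu j => v j | .beta i => b i) r = 1 := by
    rintro r rfl
    rw [lift_surfaceRelator, h]
  exact ⟨PresentedGroup.toGroup hr, fun j => PresentedGroup.toGroup.of hr,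
    fun j => PresentedGroup.toGroup.of hr, fun i => PresentedGroup.toGroup.of hr⟩

theorem surface_relation (f : SurfaceGroup g n →* G) :
    (List.ofFn fun j => f (muElt j) * f (nuElt j) * (f (muElt j))⁻¹ * (f (nuElt j))⁻¹).prod *
      (List.ofFn fun i => f (betaElt i)).prod = 1 := by
  have h1 : (PresentedGroup.mk {surfaceRelator g n} (surfaceRelator g n) : SurfaceGroup g n) = 1 :=
    PresentedGroup.one_of_mem rfl
  rw [← lift_surfaceRelator, ← map_one f, ← h1]
  have h2 : (FreeGroup.lift fun s : SurfaceGen g n => match s with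
      | .mu j => f (muElt j) | .nu j => f (nuElt j) | .beta i => f (betaElt i)) =
      f.comp (PresentedGroup.mk {surfaceRelator g n}) := by
    apply FreeGroup.ext_hom
    rintro (j | j | i) <;> simp <;> rfl
  rw [h2]; rfl

/-- The relation permits a homomorphism to ℤ with β_i ↦ 1, β_j ↦ -1 and all other generators ↦ 0,
which separates the two conjugacy classes. A decoration may therefore be prescribed independently on
each β_i. -/
theorem betaElt_conj_injective {i j : Fin n} {γ : SurfaceGroup g n}
    (h : γ * betaElt i * γ⁻¹ = betaElt j) : i = j := by
  by_contra hij
  let a : Multiplicative ℤ := Multiplicative.ofAdd 1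
  obtain ⟨f, -, -, hf⟩ := exists_surface_hom (g := g) (n := n) (G := Multiplicative ℤ)
    (fun _ => 1) (fun _ => 1) (fun l => Pi.mulSingle (M := fun _ => Multiplicative ℤ) i a l *
      (Pi.mulSingle (M := fun _ => Multiplicative ℤ) j a l)⁻¹) (by
      rw [List.prod_ofFn, List.prod_ofFn]
      simp [Finset.prod_mul_distrib, Finset.prod_pi_mulSingle'])
  have h1 := congrArg f h
  rw [map_mul, map_mul, map_inv, mul_comm (f γ), mul_inv_cancel_right, hf, hf,
    Pi.mulSingle_eq_same, Pi.mulSingle_eq_same, Pi.mulSingle_eq_of_ne hij,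
    Pi.mulSingle_eq_of_ne (Ne.symm hij), one_mul, inv_one, mul_one] at h1
  exact absurd (congrArg Multiplicative.toAdd h1) (by simp [a])

end SurfaceGroups

/-! ### Affine representations -/

/-- The affine transformation `Z ↦ U Z V⁻¹ + w` of the space of matrices. -/
def affPerm (U V : SU2) (w : Mat2) : Equiv.Perm Mat2 where
  toFun Z := (U : Mat2) * Z * ((V⁻¹ : SU2) : Mat2) + w
  invFun Z := ((U⁻¹ : SU2) : Mat2) * (Z - w) * (V : Mat2)
  left_inv Z := by
    calc _ = (((U⁻¹ : SU2) : Mat2) * (U : Mat2)) * Z * (((V⁻¹ : SU2) : Mat2) * (V : Mat2)) := by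
          beta_reduce; rw [add_sub_cancel_right]; simp only [mul_assoc]
      _ = Z := by rw [DecHom.coe_inv_mul, DecHom.coe_inv_mul, one_mul, mul_one]
  right_inv Z := by
    calc _ = ((U : Mat2) * ((U⁻¹ : SU2) : Mat2)) * (Z - w) * ((V : Mat2) * ((V⁻¹ : SU2) : Mat2)) + w
          := by simp only [mul_assoc]
      _ = Z := by rw [DecHom.coe_mul_inv, DecHom.coe_mul_inv, one_mul, mul_one, sub_add_cancel]

theorem affPerm_apply (U V : SU2) (w Z : Mat2) :
    affPerm U V w Z = (U : Mat2) * Z * ((V⁻¹ : SU2) : Mat2) + w := rfl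

theorem affPerm_mul (U V U' V' : SU2) (w w' : Mat2) :
    affPerm U V w * affPerm U' V' w' =
      affPerm (U * U') (V * V') ((U : Mat2) * w' * ((V⁻¹ : SU2) : Mat2) + w) := by
  ext1 Z
  rw [Equiv.Perm.mul_apply, affPerm_apply, affPerm_apply, affPerm_apply, mul_inv_rev,
    Submonoid.coe_mul, Submonoid.coe_mul]
  simp only [mul_add, add_mul, mul_assoc, add_assoc]

theorem affPerm_one : affPerm 1 1 0 = 1 := by
  ext1 Z
  simp [affPerm_apply]

theorem affPerm_inv (U V : SU2) (w : Mat2) :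
    (affPerm U V w)⁻¹ =
      affPerm U⁻¹ V⁻¹ (-(((U⁻¹ : SU2) : Mat2) * w * (((V⁻¹)⁻¹ : SU2) : Mat2))) := by
  rw [inv_eq_iff_mul_eq_one, affPerm_mul, mul_inv_cancel, mul_inv_cancel, ← affPerm_one]
  congr 1
  calc _ = -(((U : Mat2) * ((U⁻¹ : SU2) : Mat2)) * w * ((V : Mat2) * ((V⁻¹ : SU2) : Mat2))) + w := by
        rw [inv_inv]; simp only [mul_assoc, mul_neg, neg_mul]
    _ = 0 := by rw [DecHom.coe_mul_inv, DecHom.coe_mul_inv]; simp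

/-- The translation part of a product depends linearly on the translation parts of the factors,
through invertible coefficients that do not involve them. Hence the translation of one factor can
compensate that of another. -/
theorem affPerm_list_prod {n : ℕ} (U V : Fin n → SU2) :
    ∃ P Q : Fin n → SU2, ∀ w : Fin n → Mat2,
      (List.ofFn fun i => affPerm (U i) (V i) (w i)).prod =
        affPerm (List.ofFn U).prod (List.ofFn V).prod
          (∑ i, (P i : Mat2) * w i * ((Q i : SU2) : Mat2)) := by
  induction n with
  | zero => exact ⟨U, V, fun w => by simp [affPerm_one]⟩
  | succ n ih =>
    obtain ⟨P, Q, h⟩ := ih (fun i => U i.succ) (fun i => V i.succ)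
    refine ⟨Fin.cons 1 fun i => U 0 * P i, Fin.cons 1 fun i => Q i * (V 0)⁻¹, fun w => ?_⟩
    rw [List.ofFn_succ, List.prod_cons, h, affPerm_mul, List.ofFn_succ, List.ofFn_succ,
      List.prod_cons, List.prod_cons, Fin.sum_univ_succ]
    congr 1
    simp only [Fin.cons_zero, Fin.cons_succ, Submonoid.coe_mul, Finset.mul_sum, Finset.sum_mul,
      mul_assoc, Submonoid.coe_one, one_mul, mul_one]
    rw [add_comm]

/-- Linear parts multiply like ρ and ρ', so being affine with the prescribed linear part passes from
the generators to the whole group. -/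
theorem exists_affPerm_eq {g n : ℕ} (f : SurfaceGroup g n →* Equiv.Perm Mat2)
    (ρ ρ' : SurfaceGroup g n →* SU2)
    (hm : ∀ j, ∃ w, f (muElt j) = affPerm (ρ (muElt j)) (ρ' (muElt j)) w)
    (hv : ∀ j, ∃ w, f (nuElt j) = affPerm (ρ (nuElt j)) (ρ' (nuElt j)) w)
    (hb : ∀ i, ∃ w, f (betaElt i) = affPerm (ρ (betaElt i)) (ρ' (betaElt i)) w)
    (γ : SurfaceGroup g n) : ∃ w, f γ = affPerm (ρ γ) (ρ' γ) w := by
  let H : Subgroup (Equiv.Perm Mat2 × SU2 × SU2) :=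
    { carrier := {p | ∃ w, p.1 = affPerm p.2.1 p.2.2 w}
      one_mem' := ⟨0, affPerm_one.symm⟩
      mul_mem' := by
        rintro p q ⟨w, hw⟩ ⟨w', hw'⟩
        exact ⟨_, by rw [Prod.fst_mul, hw, hw', affPerm_mul]; rfl⟩
      inv_mem' := by
        rintro p ⟨w, hw⟩
        exact ⟨_, by rw [Prod.fst_inv, hw, affPerm_inv]; rfl⟩ }
  exact surface_map_mem (f.prod (ρ.prod ρ')) H hm hv hb γ

/-- If `f` is an affine action in which `β_i` acts as the translation by `c`, then the linear part of
any element commuting with `β_i` fixes `c`. -/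
theorem linear_part_fixes {g n : ℕ} {f : SurfaceGroup g n →* Equiv.Perm Mat2} {U V : SU2} {w c : Mat2}
    {γ : SurfaceGroup g n} {i : Fin n} (hγ : f γ = affPerm U V w)
    (hi : ∀ Z, f (betaElt i) Z = Z + c) (hc : γ * betaElt i * γ⁻¹ = betaElt i) :
    (U : Mat2) * c * ((V⁻¹ : SU2) : Mat2) = c := by
  have h1 : f γ * f (betaElt i) = f (betaElt i) * f γ := by
    rw [← map_mul, ← map_mul, ← mul_inv_eq_iff_eq_mul.1 hc]
  have h2 := congrArg (fun p : Equiv.Perm Mat2 => p 0) h1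
  simp only [Equiv.Perm.mul_apply, hi, hγ, affPerm_apply, mul_zero, zero_mul, zero_add] at h2
  rw [add_comm] at h2
  exact add_left_cancel h2

/-! ### Construction of decorated homomorphisms -/

namespace DecHom

variable {g n : ℕ}

/-- The decoration of a conjugate γβ_iγ⁻¹ has to be the ρ(γ)-conjugate of `X i`. The index i is
determined by the element, and γ up to elements commuting with β_i, so `hcons` is what
well-definedness requires. -/
theorem exists_of_consistent (ρ : SurfaceGroup g n →* SU2) (X : Fin n → su2) (hX : ∀ i, X i ≠ 0)
    (hexp : ∀ i, (ρ (betaElt i) : Mat2) = eMap (X i))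
    (hcons : ∀ i γ, γ * betaElt i * γ⁻¹ = betaElt i →
      (ρ γ : Mat2) * (X i : Mat2) * ((ρ γ)⁻¹ : SU2) = X i) :
    ∃ x : DecHom g n, x.rho = ρ ∧ ∀ i, x.A (betaPer i) = X i := by
  have hex : ∀ b : peripheral g n, ∃ p : Fin n × SurfaceGroup g n,
      (b : SurfaceGroup g n) = p.2 * betaElt p.1 * p.2⁻¹ := by
    rintro ⟨b, i, hb⟩
    obtain ⟨γ, hγ⟩ := isConj_iff.1 hb
    exact ⟨(i, γ), hγ.symm⟩
  choose p hp using hex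
  let A : peripheral g n → su2 := fun b =>
    ⟨(ρ (p b).2 : Mat2) * (X (p b).1 : Mat2) * ((ρ (p b).2)⁻¹ : SU2), conj_mem_su2 _ (X _).2⟩
  have hA : ∀ (b : peripheral g n) i γ, (b : SurfaceGroup g n) = γ * betaElt i * γ⁻¹ →
      (A b : Mat2) = (ρ γ : Mat2) * (X i : Mat2) * ((ρ γ)⁻¹ : SU2) := by
    intro b i γ hb
    have h1 := hp b
    obtain ⟨⟨i', γ'⟩, hpe⟩ : ∃ q, q = p b := ⟨_, rfl⟩
    change (ρ (p b).2 : Mat2) * (X (p b).1 : Mat2) * ((ρ (p b).2)⁻¹ : SU2) = _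
    rw [← hpe] at h1 ⊢
    simp only at h1 ⊢
    -- Two presentations of the same peripheral element differ by a conjugation between generators;
    -- this identifies the indices and puts `γ⁻¹ * γ'` in the scope of `hcons`.
    have h2 : (γ⁻¹ * γ') * betaElt i' * (γ⁻¹ * γ')⁻¹ = betaElt i := by
      have h3 : γ' * betaElt i' * γ'⁻¹ = γ * betaElt i * γ⁻¹ := h1.symm.trans hb
      calc _ = γ⁻¹ * (γ' * betaElt i' * γ'⁻¹) * γ := by group
        _ = _ := by rw [h3]; group
    obtain rfl := betaElt_conj_injective h2
    have h4 := hcons _ _ h2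
    conv_rhs => rw [← h4]
    rw [map_mul, map_inv, mul_inv_rev, inv_inv, Submonoid.coe_mul, Submonoid.coe_mul]
    symm
    calc _ = ((ρ γ : Mat2) * ((ρ γ)⁻¹ : SU2)) * (ρ γ' : Mat2) * (X i' : Mat2) * ((ρ γ')⁻¹ : SU2)
          * ((ρ γ : Mat2) * ((ρ γ)⁻¹ : SU2)) := by simp only [mul_assoc]
      _ = _ := by rw [coe_mul_inv, one_mul, mul_one]
  refine ⟨⟨ρ, A, ?_, ?_, ?_⟩, rfl, ?_⟩
  · intro b hb
    apply hX (p b).1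
    have h1 : (ρ (p b).2 : Mat2) * (X (p b).1 : Mat2) * ((ρ (p b).2)⁻¹ : SU2) = 0 :=
      congrArg Subtype.val hb
    apply Subtype.ext
    calc (X (p b).1 : Mat2) = (((ρ (p b).2)⁻¹ : SU2) : Mat2) * ((ρ (p b).2 : Mat2) *
          (X (p b).1 : Mat2) * ((ρ (p b).2)⁻¹ : SU2)) * (ρ (p b).2 : Mat2) := by
          simp only [mul_assoc]
          rw [coe_inv_mul, mul_one, ← mul_assoc, coe_inv_mul, one_mul]
      _ = 0 := by rw [h1]; simp
  · intro γ b b' hb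
    have h1 := hp b
    rw [h1] at hb
    rw [hA b' (p b).1 (γ * (p b).2) (by rw [hb]; group), hA b _ _ h1, map_mul, mul_inv_rev]
    simp only [Submonoid.coe_mul, mul_assoc]
  · intro b
    have h1 := hp b
    rw [eMap_conj (ρ (p b).2) (hA b _ _ h1), ← hexp, h1, map_mul, map_mul, map_inv]
    rfl
  · intro i
    apply Subtype.ext
    change (A (betaPer i) : Mat2) = _
    rw [hA (betaPer i) i 1 (by simp [betaPer])]
    simp

/-- Decorated homomorphisms in genus zero with values in a maximal torus. -/
theorem exists_genus_zero {u : R3} (X : Fin n → su2) (hX : ∀ i, X i ≠ 0)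
    (V : Fin n → SU2) (hV : ∀ i, (V i : Mat2) = eMap (X i)) (hVu : ∀ i, V i ∈ torus u)
    (hprod : (List.ofFn V).prod = 1)
    (hXu : ∀ i, vecPart (V i : Mat2) = 0 ∨ ∃ c : ℝ, vecPart (X i : Mat2) = c • u) :
    ∃ x : DecHom 0 n, (∀ i, x.rho (betaElt i) = V i) ∧ ∀ i, x.A (betaPer i) = X i := by
  obtain ⟨ρ, -, -, hρ⟩ := exists_surface_hom (g := 0) (n := n) (G := SU2) Fin.elim0 Fin.elim0 V
    (by simpa using hprod)
  have hρu : ∀ γ, ρ γ ∈ torus u :=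
    surface_map_mem ρ (torus u) (fun j => j.elim0) (fun j => j.elim0) fun i => by
      rw [hρ]; exact hVu i
  obtain ⟨x, h1, h2⟩ := exists_of_consistent ρ X hX (fun i => by rw [hρ, hV]) (by
    intro i γ hγ
    rcases hXu i with h0 | ⟨c, hc⟩
    swap
    · rw [← imMat_vecPart (X i).2, ← imMat_adj, hc, map_smul, adj_eq_self_of_mem_torus (hρu γ)]
    -- A second generator β_j can absorb the translation assigned to β_i. If there is none, the
    -- relation itself says that β_i is trivial.
    by_cases hj : ∃ j, j ≠ i
    · obtain ⟨j, hj⟩ := hj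
      obtain ⟨P, Q, hPQ⟩ := affPerm_list_prod V V
      -- The entry at j is adjusted by the twists `P` and `Q` so that the total translation of the
      -- relator vanishes.
      let w : Fin n → Mat2 := Pi.single i (X i : Mat2) - Pi.single j
        (((P j)⁻¹ : SU2) * ((P i : Mat2) * (X i : Mat2) * (Q i : Mat2)) * ((Q j)⁻¹ : SU2))
      have hw : ∑ l, (P l : Mat2) * w l * (Q l : Mat2) = 0 := by
        simp only [w, Pi.sub_apply, mul_sub, sub_mul, Finset.sum_sub_distrib]
        rw [Finset.sum_eq_single i, Finset.sum_eq_single j, Pi.single_eq_same, Pi.single_eq_same,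
          sub_eq_zero]
        · calc _ = ((P j : Mat2) * ((P j)⁻¹ : SU2)) * ((P i : Mat2) * (X i : Mat2) * (Q i : Mat2)) *
                (((Q j)⁻¹ : SU2) * (Q j : Mat2)) := by
                rw [coe_mul_inv, coe_inv_mul, one_mul, mul_one]
            _ = _ := by simp only [mul_assoc]
        · intro l _ hl; rw [Pi.single_eq_of_ne hl]; simp
        · simp
        · intro l _ hl; rw [Pi.single_eq_of_ne hl]; simp
        · simp
      obtain ⟨f, -, -, hf⟩ := exists_surface_hom (g := 0) (n := n) (G := Equiv.Perm Mat2)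
        Fin.elim0 Fin.elim0 (fun l => affPerm (V l) (V l) (w l)) (by
          rw [hPQ, hw, hprod, affPerm_one]; simp)
      obtain ⟨w', hw'⟩ := exists_affPerm_eq f ρ ρ (fun j => j.elim0) (fun j => j.elim0)
        (fun l => ⟨w l, by rw [hf, hρ]⟩) γ
      refine linear_part_fixes hw' (fun Z => ?_) hγ
      have hwi : w i = X i := by
        simp [w, Pi.single_eq_of_ne hj.symm]
      have hZ : (V i : Mat2) * Z * ((V i)⁻¹ : SU2) = Z := by
        have := Subgroup.mem_center_iff.1 (mem_center_iff.2 h0)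
        rcases vecPart_eq_zero_iff.1 h0 with h | h
        · rw [coe_inv_SU2, h]; simp
        · rw [coe_inv_SU2, h]; simp
      rw [hf, affPerm_apply, hwi, hZ]
    · push Not at hj
      have h1 : ρ γ ∈ (⊥ : Subgroup SU2) := by
        refine surface_map_mem ρ ⊥ (fun j => j.elim0) (fun j => j.elim0) (fun l => ?_) γ
        have h2 := surface_relation ρ
        have hn : n = 1 := le_antisymm (by
          by_contra h
          have h3 := hj ⟨0, by omega⟩
          have h4 := hj ⟨1, by omega⟩
          rw [← h4] at h3
          simp at h3) i.pos
        subst hn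
        rw [Subsingleton.elim l 0]
        simpa using h2
      rw [Subgroup.mem_bot.1 h1]
      simp)
  exact ⟨x, fun i => by rw [h1, hρ], h2⟩

/-- Decorated homomorphisms in genus one with central peripheral values. -/
theorem exists_genus_one (M N : SU2) (hMN : M * N = N * M) (X : Fin n → su2) (hX : ∀ i, X i ≠ 0)
    (V : Fin n → SU2) (hV : ∀ i, (V i : Mat2) = eMap (X i)) (hV0 : ∀ i, vecPart (V i : Mat2) = 0)
    (hprod : (List.ofFn V).prod = 1) :
    ∃ x : DecHom 1 n, x.rho (muElt 0) = M ∧ x.rho (nuElt 0) = N ∧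
      ∀ i, x.A (betaPer i) = X i := by
  obtain ⟨ρ, hm, hv, hρ⟩ := exists_surface_hom (g := 1) (n := n) (G := SU2) (fun _ => M)
    (fun _ => N) V (by rw [hprod]; simp [hMN])
  obtain ⟨x, h1, h2⟩ := exists_of_consistent ρ X hX (fun i => by rw [hρ, hV]) (by
    intro i γ hγ
    -- It is enough that ρ(γ) be central. Peripheral values are central, so this may be tested on
    -- the homomorphism `σ` with the same M, N and trivial peripheral values.
    suffices h : vecPart (ρ γ : Mat2) = 0 by
      rw [← imMat_vecPart (X i).2, ← imMat_adj, adj_eq_of_mem_center h]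
    obtain ⟨σ, hσm, hσv, hσ⟩ := exists_surface_hom (g := 1) (n := n) (G := SU2) (fun _ => M)
      (fun _ => N) (fun _ => 1) (by simp [hMN])
    have hσρ : ∀ γ, ρ γ * (σ γ)⁻¹ ∈ Subgroup.center SU2 := by
      let H : Subgroup (SU2 × SU2) :=
        { carrier := {p | ∃ z ∈ Subgroup.center SU2, p.1 = z * p.2}
          one_mem' := ⟨1, one_mem _, by simp⟩
          mul_mem' := by
            rintro p q ⟨z, hz, hp⟩ ⟨z', hz', hq⟩
            refine ⟨z * z', mul_mem hz hz', ?_⟩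
            rw [Prod.fst_mul, Prod.snd_mul, hp, hq]
            have := Subgroup.mem_center_iff.1 hz' p.2
            calc z * p.2 * (z' * q.2) = z * (p.2 * z') * q.2 := by simp only [mul_assoc]
              _ = _ := by rw [this]; simp only [mul_assoc]
          inv_mem' := by
            rintro p ⟨z, hz, hp⟩
            refine ⟨z⁻¹, inv_mem hz, ?_⟩
            rw [Prod.fst_inv, Prod.snd_inv, hp, mul_inv_rev]
            exact Subgroup.mem_center_iff.1 (inv_mem hz) _ }
      intro γ
      obtain ⟨z, hz, h⟩ : (ρ γ, σ γ) ∈ H := by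
        refine surface_map_mem (ρ.prod σ) H (fun j => ?_) (fun j => ?_) (fun l => ?_) γ
        · exact ⟨1, one_mem _, by simp [hm, hσm]⟩
        · exact ⟨1, one_mem _, by simp [hv, hσv]⟩
        · exact ⟨V l, mem_center_iff.2 (hV0 l), by simp [hρ, hσ]⟩
      simp only at h
      rw [h, mul_inv_cancel_right]
      exact hz
    suffices h : σ γ = 1 by
      have := hσρ γ
      rw [h, inv_one, mul_one] at this
      exact mem_center_iff.1 this
    by_cases hMN1 : M = 1 ∧ N = 1
    · refine Subgroup.mem_bot.1 (surface_map_mem σ ⊥ (fun j => ?_) (fun j => ?_) (fun l => ?_) γ)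
      · rw [hσm]; exact hMN1.1
      · rw [hσv]; exact hMN1.2
      · rw [hσ]; exact one_mem _
    -- `U - 1` is again a quaternion; its determinant is a sum of squares vanishing only at `U = 1`.
    have hsub : ∀ U : SU2, U ≠ 1 → ∃ B : Mat2, ((U : Mat2) - 1) * B = 1 := by
      intro U hU
      have hdet : ((U : Mat2) - 1).det ≠ 0 := by
        obtain ⟨h1, h2⟩ := SU2_eq_quatMat U
        have h3 : (U : Mat2) - 1 = quatMat (rePart (U : Mat2) - 1) (vecPart (U : Mat2)) := by
          conv_lhs => rw [h1]
          simp only [quatMat, sub_smul, one_smul]; abel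
        rw [h3, det_quatMat]
        intro h0
        have h4 : (rePart (U : Mat2) - 1) ^ 2 + ‖vecPart (U : Mat2)‖ ^ 2 = 0 := by exact_mod_cast h0
        have h5 : rePart (U : Mat2) - 1 = 0 := by nlinarith [sq_nonneg ‖vecPart (U : Mat2)‖]
        have h6 : vecPart (U : Mat2) = 0 := by
          rw [h5] at h4
          simpa using h4
        apply hU
        apply Subtype.ext
        rw [h1, h6, sub_eq_zero.1 h5, quatMat_one_zero]; rfl
      exact ⟨_, Matrix.mul_nonsing_inv _ (Ne.isUnit hdet)⟩
    -- With these translation parts the commutator of Z ↦ MZ + w₁ and Z ↦ NZ + w₂ is the translation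
    -- by the identity matrix.
    obtain ⟨w₁, w₂, hw⟩ : ∃ w₁ w₂ : Mat2, ((M : Mat2) - 1) * w₂ - ((N : Mat2) - 1) * w₁ = 1 := by
      by_cases hM : M = 1
      · obtain ⟨B, hB⟩ := hsub N fun h => hMN1 ⟨hM, h⟩
        exact ⟨-B, 0, by rw [mul_neg, hB]; simp⟩
      · obtain ⟨B, hB⟩ := hsub M hM
        exact ⟨0, B, by rw [hB]; simp⟩
    obtain ⟨P, Q, hPQ⟩ := affPerm_list_prod (n := n) (fun _ => 1) (fun _ => 1)
    -- Only β_i translates, by an invertible matrix chosen to cancel the translation coming from the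
    -- commutator.
    let w : Fin n → Mat2 := Pi.single i (-(((P i)⁻¹ : SU2) : Mat2) * ((Q i)⁻¹ : SU2))
    have hw' : ∑ l, (P l : Mat2) * w l * (Q l : Mat2) = -1 := by
      rw [Finset.sum_eq_single i]
      · simp only [w, Pi.single_eq_same]
        calc _ = -(((P i : Mat2) * ((P i)⁻¹ : SU2)) * ((((Q i)⁻¹ : SU2) : Mat2) * (Q i : Mat2))) := by
              simp only [mul_assoc, neg_mul, mul_neg]
          _ = -1 := by rw [coe_mul_inv, coe_inv_mul, one_mul]
      · intro l _ hl
        simp only [w, Pi.single_eq_of_ne hl]; simp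
      · simp
    have hcomm : affPerm M 1 w₁ * affPerm N 1 w₂ * (affPerm M 1 w₁)⁻¹ * (affPerm N 1 w₂)⁻¹ =
        affPerm 1 1 1 := by
      rw [mul_inv_eq_iff_eq_mul, mul_inv_eq_iff_eq_mul, affPerm_mul, affPerm_mul, affPerm_mul, hMN]
      simp only [one_mul, inv_one, Submonoid.coe_one, mul_one]
      congr 1
      have hw2 : (M : Mat2) * w₂ - w₂ - ((N : Mat2) * w₁ - w₁) = 1 := by
        rw [← hw]; simp only [sub_mul, one_mul]
      rw [← hw2]; abel
    obtain ⟨f, hfm, hfv, hf⟩ := exists_surface_hom (g := 1) (n := n) (G := Equiv.Perm Mat2)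
      (fun _ => affPerm M 1 w₁) (fun _ => affPerm N 1 w₂) (fun l => affPerm 1 1 (w l)) (by
        rw [hPQ, hw', List.ofFn_succ, List.ofFn_zero, List.prod_singleton, hcomm, affPerm_mul,
          ← affPerm_one]
        simp)
    obtain ⟨w', hγw⟩ := exists_affPerm_eq f σ 1 (fun j => ⟨w₁, by rw [hfm, hσm]; rfl⟩)
      (fun j => ⟨w₂, by rw [hfv, hσv]; rfl⟩) (fun l => ⟨w l, by rw [hf, hσ]; rfl⟩) γ
    -- The linear part here is left multiplication by σ(γ). Fixing the invertible matrix `w i`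
    -- forces it to be the identity.
    have key := linear_part_fixes hγw (c := w i) (fun Z => by
      rw [hf, affPerm_apply]; simp) hγ
    apply Subtype.ext
    simp only [w, Pi.single_eq_same, MonoidHom.one_apply, inv_one, Submonoid.coe_one, mul_one] at key
    have h3 : (σ γ : Mat2) * (((P i)⁻¹ : SU2) * (((Q i)⁻¹ : SU2) : Mat2)) =
        ((P i)⁻¹ : SU2) * (((Q i)⁻¹ : SU2) : Mat2) := by
      simpa using key
    have h4 := congrArg (fun Z : Mat2 => Z * ((Q i : Mat2) * (P i : Mat2))) h3
    have h5 : (((P i)⁻¹ : SU2) : Mat2) * (((Q i)⁻¹ : SU2) : Mat2) * ((Q i : Mat2) * (P i : Mat2)) = 1 := by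
      calc _ = (((P i)⁻¹ : SU2) : Mat2) * ((((Q i)⁻¹ : SU2) : Mat2) * (Q i : Mat2)) * (P i : Mat2) := by
            simp only [mul_assoc]
        _ = 1 := by rw [coe_inv_mul, mul_one, coe_inv_mul]
    rw [mul_assoc, h5, mul_one] at h4
    exact h4)
  exact ⟨x, by rw [h1, hm], by rw [h1, hv], h2⟩

end DecHom


/-! ### Decorated homomorphisms in terms of generators -/

namespace DecHom

variable {g n : ℕ}

/-- The vector in `ℝ³` corresponding to the decoration of `β_i`. -/
def vec (x : DecHom g n) (i : Fin n) : R3 := suEquiv.symm (x.A (betaPer i))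

theorem suEquiv_vec (x : DecHom g n) (i : Fin n) : suEquiv (x.vec i) = x.A (betaPer i) :=
  suEquiv.apply_symm_apply _

theorem imMat_vec (x : DecHom g n) (i : Fin n) : imMat (x.vec i) = x.A (betaPer i) := by
  rw [← suEquiv_vec]; rfl

theorem mem_rel_iff {θ : Fin n → ℝ} {x : DecHom g n} :
    x ∈ rel g θ ↔ ∀ i, 2 * ‖x.vec i‖ = θ i := by
  refine forall_congr' fun i => ?_
  rw [← suEquiv_vec, killingNorm_suEquiv]

theorem exists_eq_conj (b : peripheral g n) :
    ∃ i γ, (b : SurfaceGroup g n) = γ * (betaPer i : peripheral g n) * γ⁻¹ := by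
  obtain ⟨b, i, hb⟩ := b
  obtain ⟨γ, hγ⟩ := isConj_iff.1 hb
  exact ⟨i, γ, hγ.symm⟩

theorem rho_betaElt (x : DecHom g n) (i : Fin n) :
    (x.rho (betaElt i) : Mat2) = eMap (suEquiv (x.vec i)) := by
  rw [suEquiv_vec]
  exact x.exp_eq (betaPer i)

theorem rho_betaElt_mem_torus (x : DecHom g n) {i : Fin n} {u : R3} (hu : ‖u‖ = 1)
    (h : ∃ c : ℝ, x.vec i = c • u) : x.rho (betaElt i) ∈ torus u := by
  obtain ⟨c, hc⟩ := h
  refine ⟨Real.sin (Real.pi * (2 * c - 1)), ?_⟩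
  have h1 := eMap_suEquiv (2 * c) hu
  rw [show 2 * c / 2 = c by ring] at h1
  rw [rho_betaElt, hc, h1, vecPart_quatMat]

/-- The values ρ(β_i) = e(A(β_i)) are determined by the decoration, and equivariance propagates the
decoration from the β_i to all their conjugates. -/
theorem ext_of_coords {x y : DecHom g n} (hm : ∀ j, x.rho (muElt j) = y.rho (muElt j))
    (hv : ∀ j, x.rho (nuElt j) = y.rho (nuElt j)) (hb : ∀ i, x.vec i = y.vec i) : x = y := by
  have h1 : x.rho = y.rho := surface_hom_ext hm hv fun i => by
    apply Subtype.ext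
    rw [rho_betaElt, rho_betaElt, hb]
  have h2 : x.A = y.A := by
    funext b
    obtain ⟨i, γ, hb'⟩ := exists_eq_conj b
    apply Subtype.ext
    rw [x.equivariant γ _ b hb', y.equivariant γ _ b hb', h1, ← imMat_vec, ← imMat_vec, hb]
  obtain ⟨_, _, _, _, _⟩ := x
  obtain ⟨_, _, _, _, _⟩ := y
  simp only at h1 h2
  subst h1 h2
  rfl

theorem coords_injective : Function.Injective (coords : DecHom g n → Ambient g n) := by
  intro x y h
  have h1 := congrArg Prod.fst h
  have h2 := congrArg Prod.snd h
  refine ext_of_coords (fun j => Subtype.ext ?_) (fun j => Subtype.ext ?_) fun i => ?_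
  · exact congrArg Prod.fst (congrFun h1 j)
  · exact congrArg Prod.snd (congrFun h1 j)
  · exact congrArg suEquiv.symm (congrFun h2 i)

theorem isCentral_iff {x : DecHom g n} :
    x.IsCentral ↔ (∀ j, vecPart (x.rho (muElt j) : Mat2) = 0) ∧
      (∀ j, vecPart (x.rho (nuElt j) : Mat2) = 0) ∧
      ∀ i, vecPart (x.rho (betaElt i) : Mat2) = 0 := by
  constructor
  · intro h
    exact ⟨fun j => mem_center_iff.1 (h _), fun j => mem_center_iff.1 (h _),
      fun j => mem_center_iff.1 (h _)⟩
  · rintro ⟨h1, h2, h3⟩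
    exact surface_map_mem x.rho _ (fun j => mem_center_iff.2 (h1 j))
      (fun j => mem_center_iff.2 (h2 j)) fun j => mem_center_iff.2 (h3 j)

theorem isCoaxial_of_torus {x : DecHom g n} {u : R3} (hu : ‖u‖ = 1)
    (hm : ∀ j, x.rho (muElt j) ∈ torus u) (hv : ∀ j, x.rho (nuElt j) ∈ torus u)
    (hb : ∀ i, x.rho (betaElt i) ∈ torus u) : x.IsCoaxial := by
  refine ⟨Submodule.span ℝ {suEquiv u}, finrank_span_singleton ?_, fun γ => ?_⟩
  · rw [Ne, map_eq_zero_iff _ suEquiv.injective, ← norm_eq_zero, hu]; norm_num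
  · exact (mem_torus_iff_exp hu).1 (surface_map_mem x.rho _ hm hv hb γ)

/-- A line in `su2` is spanned by a unit vector, and equivariance by elements of the torus around
that vector leaves the line fixed. So only generators have to be tested. -/
theorem isElementary_iff {x : DecHom g n} :
    x.IsElementary ↔ ∃ u : R3, ‖u‖ = 1 ∧ (∀ j, x.rho (muElt j) ∈ torus u) ∧
      (∀ j, x.rho (nuElt j) ∈ torus u) ∧ ∀ i, ∃ c : ℝ, x.vec i = c • u := by
  constructor
  · rintro ⟨h, h1, hA, hρ⟩
    haveI : Module.Free ℝ h := Module.Free.of_divisionRing ℝ h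
    obtain ⟨v, hv, -⟩ := (finrank_eq_one_iff' (K := ℝ) (V := h)).1 h1
    have hv0 : suEquiv.symm (v : su2) ≠ 0 := by
      rw [Ne, map_eq_zero_iff _ suEquiv.symm.injective]
      exact fun h0 => hv (Subtype.ext h0)
    set w := suEquiv.symm (v : su2) with hw
    have hu : ‖‖w‖⁻¹ • w‖ = 1 := norm_smul_inv_norm hv0
    have hspan : h = Submodule.span ℝ {suEquiv (‖w‖⁻¹ • w)} := by
      rw [map_smul, hw, suEquiv.apply_symm_apply, Submodule.span_singleton_smul_eq
        (Ne.isUnit (inv_ne_zero (norm_ne_zero_iff.2 hv0)))]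
      symm
      refine Submodule.eq_of_le_of_finrank_eq ?_ ?_
      · rw [Submodule.span_singleton_le_iff_mem]; exact v.2
      · rw [h1, finrank_span_singleton]
        exact fun h0 => hv (Subtype.ext h0)
    rw [hspan] at hA hρ
    refine ⟨_, hu, fun j => (mem_torus_iff_exp hu).2 (hρ _),
      fun j => (mem_torus_iff_exp hu).2 (hρ _), fun i => ?_⟩
    obtain ⟨c, hc⟩ := Submodule.mem_span_singleton.1 (hA (betaPer i))
    exact ⟨c, by rw [vec, ← hc, map_smul, suEquiv.symm_apply_apply]⟩
  · rintro ⟨u, hu, hm, hv, hb⟩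
    have hρ : ∀ γ, x.rho γ ∈ torus u :=
      surface_map_mem x.rho _ hm hv fun i => rho_betaElt_mem_torus x hu (hb i)
    refine ⟨Submodule.span ℝ {suEquiv u}, finrank_span_singleton ?_, fun b => ?_, fun γ => ?_⟩
    · rw [Ne, map_eq_zero_iff _ suEquiv.injective, ← norm_eq_zero, hu]; norm_num
    · obtain ⟨i, γ, hb'⟩ := exists_eq_conj b
      obtain ⟨c, hc⟩ := hb i
      rw [Submodule.mem_span_singleton]
      refine ⟨c, Subtype.ext ?_⟩
      rw [x.equivariant γ _ b hb', ← imMat_vec, ← imMat_adj, hc, map_smul,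
        adj_eq_self_of_mem_torus (hρ γ), ← map_smul]
      rfl
    · exact (mem_torus_iff_exp hu).1 (hρ γ)

theorem rho_conj_of_generators {x y : DecHom g n} {U : SU2}
    (hm : ∀ j, y.rho (muElt j) = U * x.rho (muElt j) * U⁻¹)
    (hv : ∀ j, y.rho (nuElt j) = U * x.rho (nuElt j) * U⁻¹)
    (hb : ∀ i, y.rho (betaElt i) = U * x.rho (betaElt i) * U⁻¹) (γ : SurfaceGroup g n) :
    y.rho γ = U * x.rho γ * U⁻¹ := by
  have h : y.rho = (MulAut.conj U).toMonoidHom.comp x.rho :=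
    surface_hom_ext hm hv hb
  rw [h]; rfl

theorem conj_iff {x y : DecHom g n} :
    x.Conj y ↔ ∃ U : SU2, (∀ j, y.rho (muElt j) = U * x.rho (muElt j) * U⁻¹) ∧
      (∀ j, y.rho (nuElt j) = U * x.rho (nuElt j) * U⁻¹) ∧ ∀ i, y.vec i = adj U (x.vec i) := by
  constructor
  · rintro ⟨U, h1, h2⟩
    refine ⟨U, fun j => h1 _, fun j => h1 _, fun i => imMat_injective ?_⟩
    rw [imMat_adj, imMat_vec, imMat_vec, h2]
  · rintro ⟨U, hm, hv, hb⟩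
    have h1 := rho_conj_of_generators hm hv fun i => by
      apply Subtype.ext
      have h2 : ((suEquiv (y.vec i) : su2) : Mat2) =
          (U : Mat2) * ((suEquiv (x.vec i) : su2) : Mat2) * ((U⁻¹ : SU2) : Mat2) := by
        rw [coe_suEquiv, coe_suEquiv, hb, imMat_adj]
      rw [rho_betaElt, eMap_conj U h2, ← rho_betaElt]
      rfl
    refine ⟨U, h1, fun b => ?_⟩
    obtain ⟨i, γ, hb'⟩ := exists_eq_conj b
    rw [x.equivariant γ _ b hb', y.equivariant γ _ b hb', h1, ← imMat_vec, ← imMat_vec, hb,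
      imMat_adj, mul_inv_rev, mul_inv_rev, inv_inv]
    simp only [Submonoid.coe_mul]
    calc _ = (U : Mat2) * (x.rho γ : Mat2) * (((U⁻¹ : SU2) : Mat2) * (U : Mat2)) * imMat (x.vec i) *
          (((U⁻¹ : SU2) : Mat2) * (U : Mat2)) * ((x.rho γ)⁻¹ : SU2) * ((U⁻¹ : SU2) : Mat2) := by
          simp only [mul_assoc]
      _ = _ := by rw [coe_inv_mul, mul_one, mul_one]; simp only [mul_assoc]

end DecHom

/-! ### The spherical polygon inequality -/

/-- Spherical triangle inequality, iterated: the angle of a product of unit quaternions is at most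
the sum of the angles as long as this sum is at most π. Factors of angle 0 or π are central and have
no axis, so the equality case says nothing about them. -/
theorem polygon_inequality (L : List (ℝ × R3)) (h0 : ∀ p ∈ L, 0 ≤ p.1) (h1 : ∀ p ∈ L, ‖p.2‖ = 1)
    (hs : (L.map Prod.fst).sum ≤ 1) :
    ∃ a v, (L.map fun p => quatMat (Real.cos (Real.pi * p.1)) (Real.sin (Real.pi * p.1) • p.2)).prod
        = quatMat a v ∧ a ^ 2 + ‖v‖ ^ 2 = 1 ∧ Real.cos (Real.pi * (L.map Prod.fst).sum) ≤ a ∧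
      (a = Real.cos (Real.pi * (L.map Prod.fst).sum) → ∃ u : R3, ‖u‖ = 1 ∧
        v = Real.sin (Real.pi * (L.map Prod.fst).sum) • u ∧
        ∀ p ∈ L, 0 < p.1 → p.1 < 1 → p.2 = u) := by
  induction L with
  | nil =>
    obtain ⟨z, hz, -⟩ := exists_unit_orthogonal 0
    exact ⟨1, 0, by simp [quatMat_one_zero], by simp, by simp, fun _ => ⟨z, hz, by simp, by simp⟩⟩
  | cons p L ih =>
    obtain ⟨t, y⟩ := p
    have ht : 0 ≤ t := h0 (t, y) List.mem_cons_self
    have hy : ‖y‖ = 1 := h1 (t, y) List.mem_cons_self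
    have h0' : ∀ p ∈ L, 0 ≤ p.1 := fun p hp => h0 p (List.mem_cons_of_mem _ hp)
    simp only [List.map_cons, List.sum_cons, List.prod_cons] at hs ⊢
    have hT : 0 ≤ (L.map Prod.fst).sum := List.sum_nonneg fun a ha => by
      obtain ⟨p, hp, rfl⟩ := List.mem_map.1 ha
      exact h0' p hp
    have hT0 : (L.map Prod.fst).sum = 0 → ∀ p ∈ L, p.1 = 0 := fun h p hp =>
      List.all_zero_of_le_zero_le_of_sum_eq_zero (l := L.map Prod.fst) (fun a ha => by
        obtain ⟨p, hp, rfl⟩ := List.mem_map.1 ha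
        exact h0' p hp) h (List.mem_map.2 ⟨p, hp, rfl⟩)
    obtain ⟨a, v, hP, hav, hle, heq⟩ := ih h0' (fun p hp => h1 p (List.mem_cons_of_mem _ hp))
      (by linarith)
    set T := (L.map Prod.fst).sum
    have hpi := Real.pi_pos
    have ha1 : -1 ≤ a := by nlinarith [sq_nonneg ‖v‖]
    have ha2 : a ≤ 1 := by nlinarith [sq_nonneg ‖v‖]
    have hα : Real.cos (Real.arccos a) = a := Real.cos_arccos ha1 ha2
    have hα' : Real.sin (Real.arccos a) = ‖v‖ := by
      rw [Real.sin_arccos, show 1 - a ^ 2 = ‖v‖ ^ 2 by linarith, Real.sqrt_sq (norm_nonneg _)]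
    -- The induction hypothesis as a bound on the angle of the partial product; it uses that π T
    -- lies in [0, π].
    have hαT : Real.arccos a ≤ Real.pi * T := by
      have := Real.arccos_le_arccos hle
      rwa [Real.arccos_cos (by positivity) (by nlinarith)] at this
    have hsin : 0 ≤ Real.sin (Real.pi * t) :=
      Real.sin_nonneg_of_nonneg_of_le_pi (by positivity) (by nlinarith)
    have hyv : (inner ℝ y v : ℝ) ≤ ‖v‖ := by
      have := real_inner_le_norm y v
      rwa [hy, one_mul] at this
    -- The real part of the new product is cos(πt) a - sin(πt)⟨y, v⟩. Cauchy–Schwarz compares it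
    -- with this cosine, and monotonicity of the cosine compares the latter with the target.
    have e1 : Real.cos (Real.pi * t + Real.arccos a) =
        Real.cos (Real.pi * t) * a - Real.sin (Real.pi * t) * ‖v‖ := by
      rw [Real.cos_add, hα, hα']
    have e2 : Real.cos (Real.pi * (t + T)) ≤ Real.cos (Real.pi * t + Real.arccos a) :=
      Real.cos_le_cos_of_nonneg_of_le_pi
        (add_nonneg (by positivity) (Real.arccos_nonneg a)) (by nlinarith) (by linarith)
    have e3 := mul_le_mul_of_nonneg_left hyv hsin
    have hunit : (Real.cos (Real.pi * t) * a - inner ℝ (Real.sin (Real.pi * t) • y) v) ^ 2 +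
        ‖Real.cos (Real.pi * t) • v + a • (Real.sin (Real.pi * t) • y) +
          crossR3 (Real.sin (Real.pi * t) • y) v‖ ^ 2 = 1 := by
      have h3 := (SU2_eq_quatMat (mkSU _ _ (quatMat_cos_sin_mem (Real.pi * t) hy) * mkSU a v hav)).2
      rwa [Submonoid.coe_mul, coe_mkSU, coe_mkSU, quatMat_mul, rePart_quatMat,
        vecPart_quatMat] at h3
    refine ⟨_, _, by rw [hP, quatMat_mul], hunit, ?_, fun hEq => ?_⟩
    · rw [inner_smul_left]
      simp only [conj_trivial]
      linarith
    · rw [inner_smul_left] at hEq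
      simp only [conj_trivial] at hEq
      -- Equality at the end forces equality in both estimates; here it is the monotonicity of the
      -- cosine that is exploited.
      have e4 : Real.arccos a = Real.pi * T := by
        have h5 : Real.cos (Real.pi * t + Real.arccos a) = Real.cos (Real.pi * (t + T)) := by
          linarith
        have h6 := Real.injOn_cos ⟨add_nonneg (by positivity) (Real.arccos_nonneg a),
          by nlinarith⟩ ⟨by positivity, by nlinarith⟩ h5
        linarith
      have haT : a = Real.cos (Real.pi * T) := by rw [← e4, hα]
      have hvT : ‖v‖ = Real.sin (Real.pi * T) := by rw [← e4, hα']
      obtain ⟨u, hu, hvu, hL⟩ := heq haT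
      -- If t = 0 the old axis is kept, if T = 0 the new one is taken. Otherwise t and T lie
      -- strictly between 0 and 1, the sines are positive, and equality in Cauchy–Schwarz identifies
      -- the two axes.
      rcases ht.eq_or_lt with rfl | htpos
      · refine ⟨u, hu, ?_, ?_⟩
        · simp [hvu, crossR3_zero_left]
        · intro p hp hp0 hp1
          rcases List.mem_cons.1 hp with rfl | hp
          · exact absurd hp0 (lt_irrefl _)
          · exact hL p hp hp0 hp1
      rcases hT.eq_or_lt with hT' | hTpos
      · refine ⟨y, hy, ?_, ?_⟩
        · rw [← hT'] at haT hvu ⊢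
          simp at haT hvu
          simp [haT, hvu, crossR3_zero_right]
        · intro p hp hp0 hp1
          rcases List.mem_cons.1 hp with rfl | hp
          · rfl
          · exact absurd (hT0 hT'.symm p hp) hp0.ne'
      · have hs1 : 0 < Real.sin (Real.pi * t) := Real.sin_pos_of_pos_of_lt_pi (by positivity)
          (by nlinarith)
        have hs2 : 0 < Real.sin (Real.pi * T) := Real.sin_pos_of_pos_of_lt_pi (by positivity)
          (by nlinarith)
        have h7 : Real.sin (Real.pi * t) * (inner ℝ y v : ℝ) = Real.sin (Real.pi * t) * ‖v‖ := by
          linarith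
        have h8 : (inner ℝ y v : ℝ) = ‖v‖ := mul_left_cancel₀ hs1.ne' h7
        have h9 : y = u := by
          rw [hvT, hvu, inner_smul_right] at h8
          have h10 : (inner ℝ y u : ℝ) = 1 := mul_left_cancel₀ hs2.ne' (by linarith)
          exact (inner_eq_one_iff_of_norm_eq_one hy hu).1 h10
        subst h9
        refine ⟨y, hy, ?_, ?_⟩
        · rw [hvu, crossR3_smul_left, crossR3_smul_right, crossR3_self, mul_add, Real.sin_add, haT]
          module
        · intro p hp hp0 hp1
          rcases List.mem_cons.1 hp with rfl | hp
          · rfl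
          · exact hL p hp hp0 hp1

/-! ### The distance to the odd lattice -/

/-- Closedness ensures that the infimum defining `distOdd` is attained by an odd integral vector. -/
theorem isClosed_odd (n : ℕ) : IsClosed {p : PiLp 1 fun _ : Fin n => ℝ |
    ∃ m : Fin n → ℤ, Odd (∑ i, |m i|) ∧ ∀ i, p i = m i} := by
  have h1 : Topology.IsClosedEmbedding (Pi.map fun _ : Fin n => ((↑) : ℤ → ℝ)) :=
    Topology.IsClosedEmbedding.piMap fun _ => Int.isClosedEmbedding_coe_real
  have h2 := h1.isClosedMap {m : Fin n → ℤ | Odd (∑ i, |m i|)} (isClosed_discrete _)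
  convert h2.preimage (PiLp.continuous_ofLp 1 fun _ : Fin n => ℝ) using 1
  ext p
  constructor
  · rintro ⟨m, hm, h⟩
    exact ⟨m, hm, funext fun i => (h i).symm⟩
  · rintro ⟨m, hm, h⟩
    exact ⟨m, hm, fun i => (congrFun h i).symm⟩

theorem dist_toLp_intCast {n : ℕ} (v : Fin n → ℝ) (p : PiLp 1 fun _ : Fin n => ℝ) {m : Fin n → ℤ}
    (h : ∀ i, p i = m i) : dist (WithLp.toLp 1 v) p = ∑ i, |v i - m i| := by
  rw [PiLp.dist_eq_of_L1]
  refine Finset.sum_congr rfl fun i _ => ?_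
  rw [h, Real.dist_eq]

theorem nonempty_odd {n : ℕ} (hn : 0 < n) : {p : PiLp 1 fun _ : Fin n => ℝ |
    ∃ m : Fin n → ℤ, Odd (∑ i, |m i|) ∧ ∀ i, p i = m i}.Nonempty := by
  refine ⟨WithLp.toLp 1 fun i => ((Pi.single ⟨0, hn⟩ 1 : Fin n → ℤ) i : ℝ),
    Pi.single ⟨0, hn⟩ 1, ?_, fun i => rfl⟩
  rw [Finset.sum_eq_single ⟨0, hn⟩]
  · simp
  · intro i _ hi
    rw [Pi.single_eq_of_ne hi, abs_zero]
  · simp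

theorem exists_odd_eq_distOdd {n : ℕ} (hn : 0 < n) (θ : Fin n → ℝ) :
    ∃ m : Fin n → ℤ, Odd (∑ i, |m i|) ∧ ∑ i, |θ i - 1 - m i| = distOdd θ := by
  obtain ⟨p, ⟨m, hm, hp⟩, h⟩ := (isClosed_odd n).exists_infDist_eq_dist (nonempty_odd hn)
    (WithLp.toLp 1 fun i => θ i - 1)
  exact ⟨m, hm, by rw [distOdd, h, dist_toLp_intCast _ p hp]⟩

theorem prod_neg_one_zpow {n : ℕ} {m : Fin n → ℤ} (hm : Odd (∑ i, |m i|)) :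
    ∏ i, (-1 : ℝ) ^ (m i) = -1 := by
  have h1 : ∀ i, (-1 : ℝ) ^ (m i) = (-1 : ℝ) ^ |m i| := by
    intro i
    rcases Int.even_or_odd (m i) with h | h
    · rw [h.neg_one_zpow, (even_abs.2 h).neg_one_zpow]
    · rw [h.neg_one_zpow, (odd_abs.2 h).neg_one_zpow]
  have h2 : ∀ s : Finset (Fin n), ∏ i ∈ s, (-1 : ℝ) ^ |m i| = (-1 : ℝ) ^ ∑ i ∈ s, |m i| := by
    intro s
    induction s using Finset.induction_on with
    | empty => simp
    | insert a s ha ih =>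
      rw [Finset.prod_insert ha, Finset.sum_insert ha, zpow_add₀ (by norm_num), ih]
  rw [Finset.prod_congr rfl fun i _ => h1 i, h2, hm.neg_one_zpow]

theorem list_prod_smul {n : ℕ} (c : Fin n → ℝ) (A : Fin n → Mat2) :
    (List.ofFn fun i => c i • A i).prod = (∏ i, c i) • (List.ofFn A).prod := by
  induction n with
  | zero => simp
  | succ n ih =>
    rw [List.ofFn_succ, List.prod_cons, ih, List.ofFn_succ, List.prod_cons, Fin.prod_univ_succ,
      smul_mul_smul_comm]


/-! ### Peripheral elements of a given angle -/

/-- The value of `e` on the vector of norm `r` in the direction `y`. -/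
def perMat (r : ℝ) (y : R3) : Mat2 :=
  quatMat (Real.cos (Real.pi * (r - 1))) (Real.sin (Real.pi * (r - 1)) • y)

theorem perMat_mem (r : ℝ) {y : R3} (hy : ‖y‖ = 1) :
    perMat r y ∈ Matrix.specialUnitaryGroup (Fin 2) ℂ :=
  quatMat_mem (quatMat_cos_sin_mem _ hy)

theorem sin_eq_zero_iff_int {r : ℝ} :
    Real.sin (Real.pi * (r - 1)) = 0 ↔ ∃ m : ℤ, r = m := by
  rw [Real.sin_eq_zero_iff]
  constructor
  · rintro ⟨m, hm⟩
    refine ⟨m + 1, ?_⟩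
    have := mul_left_cancel₀ Real.pi_ne_zero ((mul_comm _ _).trans hm)
    push_cast; linarith
  · rintro ⟨m, rfl⟩
    exact ⟨m - 1, by push_cast; ring⟩

/-- The sign of the rotation by `r - 1 - m`. -/
def rotSign (r : ℝ) (m : ℤ) : ℝ := if 0 ≤ r - 1 - m then 1 else -1

theorem rotSign_eq (r : ℝ) (m : ℤ) : rotSign r m = 1 ∨ rotSign r m = -1 := by
  unfold rotSign; split_ifs <;> simp

theorem norm_sign_smul {s : ℝ} (hs : s = 1 ∨ s = -1) (y : R3) : ‖s • y‖ = ‖y‖ := by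
  rcases hs with rfl | rfl <;> simp

theorem sign_smul_sign_smul {s : ℝ} (hs : s = 1 ∨ s = -1) (y : R3) : s • s • y = y := by
  rcases hs with rfl | rfl <;> simp

/-- Shifting the angle by mπ produces the sign (-1)^m, and a negative remaining angle is made
positive by reversing the axis, which is recorded by `rotSign`. -/
theorem perMat_eq_smul (r : ℝ) (m : ℤ) (y : R3) :
    perMat r y = (-1 : ℝ) ^ m • quatMat (Real.cos (Real.pi * |r - 1 - m|))
      (Real.sin (Real.pi * |r - 1 - m|) • rotSign r m • y) := by
  have h1 : Real.pi * (r - 1) = Real.pi * (r - 1 - m) + m * Real.pi := by ring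
  have h2 : Real.sin (Real.pi * |r - 1 - m|) * rotSign r m = Real.sin (Real.pi * (r - 1 - m)) := by
    unfold rotSign
    split_ifs with h
    · rw [abs_of_nonneg h, mul_one]
    · rw [abs_of_neg (not_le.1 h), mul_neg, mul_neg, Real.sin_neg]; ring
  have h3 : Real.cos (Real.pi * |r - 1 - m|) = Real.cos (Real.pi * (r - 1 - m)) := by
    rcases abs_choice (r - 1 - m) with h | h <;> rw [h]
    rw [mul_neg, Real.cos_neg]
  rw [perMat, h1, Real.cos_add_int_mul_pi, Real.sin_add_int_mul_pi, smul_quatMat,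
    smul_smul (Real.sin _), h2, h3, smul_smul]

theorem perMat_list_prod {n : ℕ} (θ : Fin n → ℝ) {m : Fin n → ℤ} (hm : Odd (∑ i, |m i|))
    (y : Fin n → R3) :
    (List.ofFn fun i => perMat (θ i) (y i)).prod =
      -((List.ofFn fun i => (|θ i - 1 - m i|, rotSign (θ i) (m i) • y i)).map fun p : ℝ × R3 =>
        quatMat (Real.cos (Real.pi * p.1)) (Real.sin (Real.pi * p.1) • p.2)).prod := by
  rw [List.map_ofFn]
  have h1 : (fun i => perMat (θ i) (y i)) = fun i => (-1 : ℝ) ^ m i •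
      quatMat (Real.cos (Real.pi * |θ i - 1 - m i|))
        (Real.sin (Real.pi * |θ i - 1 - m i|) • rotSign (θ i) (m i) • y i) :=
    funext fun i => perMat_eq_smul _ _ _
  rw [h1, list_prod_smul, prod_neg_one_zpow hm, neg_one_smul]
  rfl

theorem coe_list_prod (L : List SU2) : ((L.prod : SU2) : Mat2) = (L.map Subtype.val).prod := by
  induction L with
  | nil => rfl
  | cons a L ih => rw [List.prod_cons, List.map_cons, List.prod_cons, ← ih]; rfl

namespace DecHom

variable {g n : ℕ} {θ : Fin n → ℝ}

/-- The unit vector in the direction of the decoration of `β_i`. -/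
def dir (θ : Fin n → ℝ) (x : DecHom g n) (i : Fin n) : R3 := (2 / θ i) • x.vec i

theorem vec_eq_dir (hθ : ∀ i, 0 < θ i) (x : DecHom g n) (i : Fin n) :
    x.vec i = (θ i / 2) • x.dir θ i := by
  have := (hθ i).ne'
  rw [dir, smul_smul, show θ i / 2 * (2 / θ i) = 1 by field_simp, one_smul]

theorem mem_rel_iff_dir (hθ : ∀ i, 0 < θ i) {x : DecHom g n} :
    x ∈ rel g θ ↔ ∀ i, ‖x.dir θ i‖ = 1 := by
  rw [mem_rel_iff]
  refine forall_congr' fun i => ?_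
  have := hθ i
  rw [dir, norm_smul, Real.norm_of_nonneg (by positivity)]
  constructor
  · intro h; rw [div_mul_eq_mul_div, h, div_self this.ne']
  · intro h; rwa [div_mul_eq_mul_div, div_eq_one_iff_eq this.ne'] at h

theorem rho_betaElt_eq (hθ : ∀ i, 0 < θ i) {x : DecHom g n} (hx : x ∈ rel g θ) (i : Fin n) :
    (x.rho (betaElt i) : Mat2) = perMat (θ i) (x.dir θ i) := by
  rw [rho_betaElt, vec_eq_dir hθ, eMap_suEquiv _ ((mem_rel_iff_dir hθ).1 hx i), perMat]

theorem coords_eq (hθ : ∀ i, 0 < θ i) (x : DecHom g n) :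
    x.coords = (fun j => ((x.rho (muElt j) : Mat2), (x.rho (nuElt j) : Mat2)),
      fun i => suEquiv ((θ i / 2) • x.dir θ i)) := by
  rw [coords]
  refine Prod.ext rfl (funext fun i => ?_)
  change x.A (betaPer i) = suEquiv ((θ i / 2) • x.dir θ i)
  rw [← vec_eq_dir hθ, suEquiv_vec]

theorem perMat_prod_eq_one (hθ : ∀ i, 0 < θ i) {x : DecHom 0 n} (hx : x ∈ rel 0 θ) :
    (List.ofFn fun i => perMat (θ i) (x.dir θ i)).prod = 1 := by
  have h1 := congrArg Subtype.val (surface_relation x.rho)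
  rw [List.ofFn_zero, List.prod_nil, one_mul, coe_list_prod, List.map_ofFn] at h1
  rw [← show Subtype.val (1 : SU2) = (1 : Mat2) from rfl, ← h1]
  congr 2
  funext i
  exact (rho_betaElt_eq hθ hx i).symm

/-- The consequence of the spherical polygon inequality for decorated homomorphisms. -/
theorem polygon_of_mem_rel (hθ : ∀ i, 0 < θ i) {m : Fin n → ℤ} (hm : Odd (∑ i, |m i|))
    (hs : ∑ i, |θ i - 1 - m i| ≤ 1) {x : DecHom 0 n} (hx : x ∈ rel 0 θ) :
    ∑ i, |θ i - 1 - m i| = 1 ∧ ∃ u : R3, ‖u‖ = 1 ∧ ∀ i, 0 < |θ i - 1 - m i| → |θ i - 1 - m i| < 1 →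
      rotSign (θ i) (m i) • x.dir θ i = u := by
  have hdir := (mem_rel_iff_dir hθ).1 hx
  have hprod := perMat_prod_eq_one hθ hx
  rw [perMat_list_prod θ hm, neg_eq_iff_eq_neg] at hprod
  have hsum : ((List.ofFn fun i => (|θ i - 1 - m i|, rotSign (θ i) (m i) • x.dir θ i)).map
      Prod.fst).sum = ∑ i, |θ i - 1 - m i| := by
    rw [List.map_ofFn, List.sum_ofFn]; rfl
  obtain ⟨a, v, hP, -, hle, heq⟩ := polygon_inequality
    (List.ofFn fun i => (|θ i - 1 - m i|, rotSign (θ i) (m i) • x.dir θ i))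
    (fun p hp => by
      obtain ⟨i, rfl⟩ := (List.mem_ofFn' _ _).1 hp
      exact abs_nonneg _)
    (fun p hp => by
      obtain ⟨i, rfl⟩ := (List.mem_ofFn' _ _).1 hp
      exact (norm_sign_smul (rotSign_eq _ _) _).trans (hdir i))
    (by rw [hsum]; exact hs)
  rw [hsum] at hle heq
  rw [hprod, ← quatMat_neg_one_zero] at hP
  obtain ⟨rfl, rfl⟩ := quatMat_injective hP
  have h0 : 0 ≤ ∑ i, |θ i - 1 - m i| := Finset.sum_nonneg fun i _ => abs_nonneg _
  have hpi := Real.pi_pos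
  -- The product of the sign-normalized quaternions is -1, so the lower bound for its real part
  -- leaves no room.
  have h1 : Real.cos (Real.pi * ∑ i, |θ i - 1 - m i|) = Real.cos Real.pi := by
    rw [Real.cos_pi]
    exact le_antisymm hle (Real.neg_one_le_cos _)
  have h2 : Real.pi * ∑ i, |θ i - 1 - m i| = Real.pi :=
    Real.injOn_cos ⟨by positivity, by nlinarith⟩ ⟨hpi.le, le_rfl⟩ h1
  have h3 : ∑ i, |θ i - 1 - m i| = 1 := mul_left_cancel₀ hpi.ne' (h2.trans (mul_one _).symm)
  refine ⟨h3, ?_⟩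
  obtain ⟨u, hu, -, hL⟩ := heq (by rw [h2, Real.cos_pi])
  exact ⟨u, hu, fun i h h' => hL _ ((List.mem_ofFn' _ _).2 ⟨i, rfl⟩) h h'⟩

theorem rel_eq_empty (hn : 0 < n) (hθ : ∀ i, 0 < θ i) (h : distOdd θ < 1) :
    rel 0 θ = (∅ : Set (DecHom 0 n)) := by
  obtain ⟨m, hm, hs⟩ := exists_odd_eq_distOdd hn θ
  refine Set.eq_empty_of_forall_notMem fun x hx => ?_
  have := (polygon_of_mem_rel hθ hm (by rw [hs]; exact h.le) hx).1
  rw [hs] at this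
  exact h.ne this

/-- The description of the decorated homomorphisms in genus zero on the boundary of the polytope
of spherical polygons. The signs `σ` are the orientations of the axes. -/
def IsCoaxialModel (θ : Fin n → ℝ) (σ : Fin n → ℝ) : Prop :=
  (∀ i, σ i = 1 ∨ σ i = -1) ∧
  (∀ x ∈ (rel 0 θ : Set (DecHom 0 n)), ∃ u : R3, ‖u‖ = 1 ∧
    ∀ i, (¬ ∃ m : ℤ, θ i = m) → x.dir θ i = σ i • u) ∧
  ∀ (y : Fin n → R3) (u : R3), (∀ i, ‖y i‖ = 1) → ‖u‖ = 1 →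
    (∀ i, (¬ ∃ m : ℤ, θ i = m) → y i = σ i • u) →
      (List.ofFn fun i => perMat (θ i) (y i)).prod = 1

theorem quatMat_torus_list_prod {u : R3} (hu : ‖u‖ = 1) (L : List ℝ) :
    (L.map fun t => quatMat (Real.cos (Real.pi * t)) (Real.sin (Real.pi * t) • u)).prod =
      quatMat (Real.cos (Real.pi * L.sum)) (Real.sin (Real.pi * L.sum) • u) := by
  induction L with
  | nil => simp [quatMat_one_zero]
  | cons t L ih =>
    rw [List.map_cons, List.prod_cons, ih, quatMat_mul, List.sum_cons, crossR3_smul_left,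
      crossR3_smul_right, crossR3_self, inner_smul_left, inner_smul_right,
      real_inner_self_eq_norm_sq, hu, mul_add, Real.cos_add, Real.sin_add]
    congr 1
    · simp
    · module

/-- For a nearest odd vector m the angles add up to exactly π. The equality case of the polygon
inequality yields the common axis; conversely angles about one axis simply add and give -1. The
signs are those of ϑ_i - 1 - m_i. -/
theorem exists_isCoaxialModel (hn : 0 < n) (hθ : ∀ i, 0 < θ i) (h : distOdd θ = 1) :
    (∃ σ, IsCoaxialModel θ σ) ∧ numIntegral θ + 1 ≠ n := by
  obtain ⟨m, hm, hs⟩ := exists_odd_eq_distOdd hn θ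
  rw [h] at hs
  have hle : ∀ i, |θ i - 1 - m i| ≤ 1 := fun i => by
    exact (Finset.single_le_sum (f := fun i => |θ i - 1 - m i|) (fun j _ => abs_nonneg _)
      (Finset.mem_univ i)).trans hs.le
  have hint : ∀ i, (∃ c : ℤ, |θ i - 1 - m i| = c) → ∃ c : ℤ, θ i = c := by
    rintro i ⟨c, hc⟩
    rcases abs_choice (θ i - 1 - m i) with h1 | h1
    · exact ⟨c + 1 + m i, by push_cast; linarith⟩
    · exact ⟨-c + 1 + m i, by push_cast; linarith⟩
  have hni : ∀ i, (¬ ∃ c : ℤ, θ i = c) → 0 < |θ i - 1 - m i| ∧ |θ i - 1 - m i| < 1 := by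
    intro i hi
    refine ⟨lt_of_le_of_ne (abs_nonneg _) fun h0 => hi (hint i ⟨0, by simpa using h0.symm⟩),
      lt_of_le_of_ne (hle i) fun h0 => hi (hint i ⟨1, by simpa using h0⟩)⟩
  refine ⟨⟨fun i => rotSign (θ i) (m i), fun i => rotSign_eq _ _, fun x hx => ?_,
    fun y u hy hu hyu => ?_⟩, fun hk => ?_⟩
  · obtain ⟨-, u, hu, hxu⟩ := polygon_of_mem_rel hθ hm hs.le hx
    refine ⟨u, hu, fun i hi => ?_⟩
    rw [← hxu i (hni i hi).1 (hni i hi).2, sign_smul_sign_smul (rotSign_eq _ _)]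
  · have h1 : (fun i => perMat (θ i) (y i)) = fun i => perMat (θ i) (rotSign (θ i) (m i) • u) := by
      funext i
      by_cases hi : ∃ c : ℤ, θ i = c
      · rw [perMat, perMat, sin_eq_zero_iff_int.2 hi, zero_smul, zero_smul]
      · rw [hyu i hi]
    rw [h1, perMat_list_prod θ hm]
    have h2 : (List.ofFn fun i => (|θ i - 1 - m i|, rotSign (θ i) (m i) • rotSign (θ i) (m i) • u)).map
        (fun p : ℝ × R3 => quatMat (Real.cos (Real.pi * p.1)) (Real.sin (Real.pi * p.1) • p.2)) =
        (List.ofFn fun i => |θ i - 1 - m i|).map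
          fun t => quatMat (Real.cos (Real.pi * t)) (Real.sin (Real.pi * t) • u) := by
      rw [List.map_ofFn, List.map_ofFn]
      congr 1
      funext i
      simp only [Function.comp_apply]
      rw [sign_smul_sign_smul (rotSign_eq _ _)]
    rw [h2, quatMat_torus_list_prod hu, List.sum_ofFn, hs, mul_one, Real.cos_pi, Real.sin_pi,
      zero_smul, quatMat_neg_one_zero, neg_neg]
  · have hc : {i : Fin n | ∃ m : ℤ, θ i = m}ᶜ.ncard = 1 := by
      have := Set.ncard_add_ncard_compl {i : Fin n | ∃ m : ℤ, θ i = m}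
      rw [Nat.card_eq_fintype_card, Fintype.card_fin] at this
      rw [numIntegral] at hk
      omega
    obtain ⟨j, hj⟩ := Set.ncard_eq_one.1 hc
    have hj' : j ∈ {i : Fin n | ∃ m : ℤ, θ i = m}ᶜ := by rw [hj]; rfl
    apply hj'
    apply hint
    have hother : ∀ i ∈ Finset.univ.erase j, ∃ c : ℤ, |θ i - 1 - m i| = c := by
      intro i hi
      have : ∃ c : ℤ, θ i = c := by
        by_contra h'
        have h2 : i ∈ {i : Fin n | ∃ m : ℤ, θ i = m}ᶜ := h'
        rw [hj] at h2
        exact (Finset.ne_of_mem_erase hi) h2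
      obtain ⟨c, hc⟩ := this
      exact ⟨|c - 1 - m i|, by rw [hc]; push_cast; rfl⟩
    choose! c hc using hother
    refine ⟨1 - ∑ i ∈ Finset.univ.erase j, c i, ?_⟩
    rw [← Finset.add_sum_erase _ _ (Finset.mem_univ j), Finset.sum_congr rfl hc] at hs
    push_cast
    linarith

/-- Under a coaxial model, every choice of directions satisfying the model is realized. -/
theorem exists_mem_rel_of_model (hθ : ∀ i, 0 < θ i) {σ : Fin n → ℝ} (hσ : IsCoaxialModel θ σ)
    {y : Fin n → R3} {u : R3} (hy : ∀ i, ‖y i‖ = 1) (hu : ‖u‖ = 1)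
    (hyu : ∀ i, (¬ ∃ m : ℤ, θ i = m) → y i = σ i • u) :
    ∃ x ∈ (rel 0 θ : Set (DecHom 0 n)), ∀ i, x.dir θ i = y i := by
  obtain ⟨x, -, hx⟩ := exists_genus_zero (u := u) (fun i => suEquiv ((θ i / 2) • y i))
    (fun i h0 => by
      rw [map_eq_zero_iff _ suEquiv.injective, smul_eq_zero] at h0
      rcases h0 with h0 | h0
      · have := hθ i; linarith
      · have := hy i; rw [h0, norm_zero] at this; norm_num at this)
    (fun i => ⟨perMat (θ i) (y i), perMat_mem _ (hy i)⟩)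
    (fun i => by rw [eMap_suEquiv _ (hy i)]; rfl)
    (fun i => by
      by_cases hi : ∃ m : ℤ, θ i = m
      · refine ⟨0, ?_⟩
        change vecPart (perMat (θ i) (y i)) = _
        rw [perMat, vecPart_quatMat, sin_eq_zero_iff_int.2 hi, zero_smul, zero_smul]
      · refine ⟨Real.sin (Real.pi * (θ i - 1)) * σ i, ?_⟩
        change vecPart (perMat (θ i) (y i)) = _
        rw [perMat, vecPart_quatMat, hyu i hi, mul_smul])
    (by
      apply Subtype.ext
      rw [coe_list_prod, List.map_ofFn]
      exact hσ.2.2 y u hy hu hyu)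
    (fun i => by
      by_cases hi : ∃ m : ℤ, θ i = m
      · left
        change vecPart (perMat (θ i) (y i)) = 0
        rw [perMat, vecPart_quatMat, sin_eq_zero_iff_int.2 hi, zero_smul]
      · right
        exact ⟨θ i / 2 * σ i, by rw [coe_suEquiv, vecPart_imMat, hyu i hi, mul_smul]⟩)
  have hdir : ∀ i, x.dir θ i = y i := fun i => by
    have := (hθ i).ne'
    rw [dir, vec, hx, suEquiv.symm_apply_apply, smul_smul,
      show 2 / θ i * (θ i / 2) = 1 by field_simp, one_smul]
  exact ⟨x, (mem_rel_iff_dir hθ).2 fun i => by rw [hdir, hy], hdir⟩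

theorem mem_torus_of_model (hθ : ∀ i, 0 < θ i) {σ : Fin n → ℝ} {x : DecHom 0 n} (hx : x ∈ rel 0 θ)
    {u : R3} (hxu : ∀ i, (¬ ∃ m : ℤ, θ i = m) → x.dir θ i = σ i • u) (i : Fin n) :
    x.rho (betaElt i) ∈ torus u := by
  by_cases hi : ∃ m : ℤ, θ i = m
  · exact ⟨0, by rw [rho_betaElt_eq hθ hx, perMat, vecPart_quatMat, sin_eq_zero_iff_int.2 hi,
      zero_smul, zero_smul]⟩
  · exact ⟨Real.sin (Real.pi * (θ i - 1)) * σ i, by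
      rw [rho_betaElt_eq hθ hx, perMat, vecPart_quatMat, hxu i hi, mul_smul]⟩

theorem isCoaxial_of_model (hθ : ∀ i, 0 < θ i) {σ : Fin n → ℝ} (hσ : IsCoaxialModel θ σ)
    {x : DecHom 0 n} (hx : x ∈ rel 0 θ) : x.IsCoaxial := by
  obtain ⟨u, hu, hxu⟩ := hσ.2.1 x hx
  exact isCoaxial_of_torus hu (fun j => j.elim0) (fun j => j.elim0) (mem_torus_of_model hθ hx hxu)

/-- The homomorphism depends only on the common axis, since integral entries contribute central
values independent of their directions; rotating one axis to the other conjugates the homomorphisms.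
-/
theorem rhoConj_of_model (hθ : ∀ i, 0 < θ i) {σ : Fin n → ℝ} (hσ : IsCoaxialModel θ σ)
    {x y : DecHom 0 n} (hx : x ∈ rel 0 θ) (hy : y ∈ rel 0 θ) : x.RhoConj y := by
  obtain ⟨u, hu, hxu⟩ := hσ.2.1 x hx
  obtain ⟨v, hv, hyv⟩ := hσ.2.1 y hy
  obtain ⟨U, hU⟩ := exists_adj_eq hu hv
  refine ⟨U, rho_conj_of_generators (fun j => j.elim0) (fun j => j.elim0) fun i => ?_⟩
  apply Subtype.ext
  rw [Submonoid.coe_mul, Submonoid.coe_mul, rho_betaElt_eq hθ hx, rho_betaElt_eq hθ hy, perMat,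
    perMat, conj_quatMat, map_smul]
  by_cases hi : ∃ m : ℤ, θ i = m
  · rw [sin_eq_zero_iff_int.2 hi, zero_smul, zero_smul]
  · rw [hxu i hi, hyv i hi, map_smul, hU]

theorem isElementary_genus_zero_iff (hθ : ∀ i, 0 < θ i) {x : DecHom 0 n} :
    x.IsElementary ↔ ∃ u : R3, ‖u‖ = 1 ∧ ∀ i, ∃ c : ℝ, x.dir θ i = c • u := by
  rw [isElementary_iff]
  constructor
  · rintro ⟨u, hu, -, -, h⟩
    refine ⟨u, hu, fun i => ?_⟩
    obtain ⟨c, hc⟩ := h i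
    exact ⟨2 / θ i * c, by rw [dir, hc, smul_smul]⟩
  · rintro ⟨u, hu, h⟩
    refine ⟨u, hu, fun j => j.elim0, fun j => j.elim0, fun i => ?_⟩
    obtain ⟨c, hc⟩ := h i
    exact ⟨θ i / 2 * c, by rw [vec_eq_dir hθ, hc, smul_smul]⟩

/-! ### Genus one -/

theorem perMat_int (c : ℤ) (y : R3) : perMat c y = (-1 : ℝ) ^ (c - 1) • (1 : Mat2) := by
  have h1 : Real.pi * ((c : ℝ) - 1) = 0 + (c - 1 : ℤ) * Real.pi := by push_cast; ring
  rw [perMat, h1, Real.cos_add_int_mul_pi, Real.sin_add_int_mul_pi]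
  simp [quatMat]

theorem perMat_prod_int {c : Fin n → ℤ} (hc : ∀ i, θ i = c i) (he : Even (∑ i, (c i - 1)))
    (y : Fin n → R3) : (List.ofFn fun i => perMat (θ i) (y i)).prod = 1 := by
  have h1 : (fun i => perMat (θ i) (y i)) = fun i => (-1 : ℝ) ^ (c i - 1) • (1 : Mat2) :=
    funext fun i => by rw [hc, perMat_int]
  have h2 : ∀ s : Finset (Fin n), ∏ i ∈ s, (-1 : ℝ) ^ (c i - 1) = (-1 : ℝ) ^ ∑ i ∈ s, (c i - 1) := by
    intro s
    induction s using Finset.induction_on with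
    | empty => simp
    | insert a s ha ih =>
      rw [Finset.prod_insert ha, Finset.sum_insert ha, zpow_add₀ (by norm_num), ih]
  rw [h1, list_prod_smul, h2, he.neg_one_zpow, one_smul]
  simp

theorem vecPart_beta_int (hθ : ∀ i, 0 < θ i) {c : Fin n → ℤ} (hc : ∀ i, θ i = c i)
    {x : DecHom g n} (hx : x ∈ rel g θ) (i : Fin n) : vecPart (x.rho (betaElt i) : Mat2) = 0 := by
  rw [rho_betaElt_eq hθ hx, perMat, vecPart_quatMat, sin_eq_zero_iff_int.2 ⟨c i, hc i⟩, zero_smul]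

/-- The peripheral values are the signs (-1)^(c_i - 1), whose product is 1 by the parity hypothesis;
the relation is left with a single commutator. -/
theorem genus_one_comm (hθ : ∀ i, 0 < θ i) {c : Fin n → ℤ} (hc : ∀ i, θ i = c i)
    (he : Even (∑ i, (c i - 1))) {x : DecHom 1 n} (hx : x ∈ rel 1 θ) :
    x.rho (muElt 0) * x.rho (nuElt 0) = x.rho (nuElt 0) * x.rho (muElt 0) := by
  have h1 := surface_relation x.rho
  have h2 : (List.ofFn fun i => x.rho (betaElt i)).prod = 1 := by
    apply Subtype.ext
    rw [coe_list_prod, List.map_ofFn]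
    refine Eq.trans ?_ (perMat_prod_int hc he (x.dir θ))
    congr 2
    funext i
    exact rho_betaElt_eq hθ hx i
  rw [h2, mul_one, List.ofFn_succ, List.ofFn_zero, List.prod_singleton] at h1
  exact mul_inv_eq_iff_eq_mul.1 (mul_inv_eq_one.1 h1)

theorem exists_mem_rel_genus_one (hθ : ∀ i, 0 < θ i) {c : Fin n → ℤ} (hc : ∀ i, θ i = c i)
    (he : Even (∑ i, (c i - 1))) {M N : SU2} (hMN : M * N = N * M) {y : Fin n → R3}
    (hy : ∀ i, ‖y i‖ = 1) :
    ∃ x ∈ (rel 1 θ : Set (DecHom 1 n)), x.rho (muElt 0) = M ∧ x.rho (nuElt 0) = N ∧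
      ∀ i, x.dir θ i = y i := by
  obtain ⟨x, h1, h2, hx⟩ := exists_genus_one M N hMN (fun i => suEquiv ((θ i / 2) • y i))
    (fun i h0 => by
      rw [map_eq_zero_iff _ suEquiv.injective, smul_eq_zero] at h0
      rcases h0 with h0 | h0
      · have := hθ i; linarith
      · have := hy i; rw [h0, norm_zero] at this; norm_num at this)
    (fun i => ⟨perMat (θ i) (y i), perMat_mem _ (hy i)⟩)
    (fun i => by rw [eMap_suEquiv _ (hy i)]; rfl)
    (fun i => by
      change vecPart (perMat (θ i) (y i)) = 0
      rw [perMat, vecPart_quatMat, sin_eq_zero_iff_int.2 ⟨c i, hc i⟩, zero_smul])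
    (by
      apply Subtype.ext
      rw [coe_list_prod, List.map_ofFn]
      exact perMat_prod_int hc he y)
  have hdir : ∀ i, x.dir θ i = y i := fun i => by
    have := (hθ i).ne'
    rw [dir, vec, hx, suEquiv.symm_apply_apply, smul_smul,
      show 2 / θ i * (θ i / 2) = 1 by field_simp, one_smul]
  exact ⟨x, (mem_rel_iff_dir hθ).2 fun i => by rw [hdir, hy], h1, h2, hdir⟩

theorem isCentral_genus_one_iff (hθ : ∀ i, 0 < θ i) {c : Fin n → ℤ} (hc : ∀ i, θ i = c i)
    {x : DecHom 1 n} (hx : x ∈ rel 1 θ) :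
    x.IsCentral ↔ vecPart (x.rho (muElt 0) : Mat2) = 0 ∧ vecPart (x.rho (nuElt 0) : Mat2) = 0 := by
  rw [isCentral_iff]
  constructor
  · rintro ⟨h1, h2, -⟩
    exact ⟨h1 0, h2 0⟩
  · rintro ⟨h1, h2⟩
    refine ⟨fun j => ?_, fun j => ?_, vecPart_beta_int hθ hc hx⟩
    · rw [Subsingleton.elim j 0]; exact h1
    · rw [Subsingleton.elim j 0]; exact h2

theorem isElementary_genus_one_iff (hθ : ∀ i, 0 < θ i) {x : DecHom 1 n} :
    x.IsElementary ↔ ∃ u : R3, ‖u‖ = 1 ∧ x.rho (muElt 0) ∈ torus u ∧ x.rho (nuElt 0) ∈ torus u ∧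
      ∀ i, ∃ c : ℝ, x.dir θ i = c • u := by
  rw [isElementary_iff]
  constructor
  · rintro ⟨u, hu, hm, hv, h⟩
    refine ⟨u, hu, hm 0, hv 0, fun i => ?_⟩
    obtain ⟨c, hc⟩ := h i
    exact ⟨2 / θ i * c, by rw [dir, hc, smul_smul]⟩
  · rintro ⟨u, hu, hm, hv, h⟩
    refine ⟨u, hu, fun j => ?_, fun j => ?_, fun i => ?_⟩
    · rw [Subsingleton.elim j 0]; exact hm
    · rw [Subsingleton.elim j 0]; exact hv
    · obtain ⟨c, hc⟩ := h i
      exact ⟨θ i / 2 * c, by rw [vec_eq_dir hθ, hc, smul_smul]⟩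

theorem isCoaxial_genus_one (hθ : ∀ i, 0 < θ i) {c : Fin n → ℤ} (hc : ∀ i, θ i = c i)
    (he : Even (∑ i, (c i - 1))) {x : DecHom 1 n} (hx : x ∈ rel 1 θ) : x.IsCoaxial := by
  obtain ⟨u, hu, h1, h2⟩ := exists_torus_of_comm (genus_one_comm hθ hc he hx)
  refine isCoaxial_of_torus hu (fun j => ?_) (fun j => ?_)
    fun i => ⟨0, by rw [vecPart_beta_int hθ hc hx, zero_smul]⟩
  · rw [Subsingleton.elim j 0]; exact h1
  · rw [Subsingleton.elim j 0]; exact h2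

end DecHom


/-! ### Analytic isomorphisms -/

section AnalyticIso

variable {E F G : Type*} [NormedAddCommGroup E] [NormedSpace ℝ E]
  [NormedAddCommGroup F] [NormedSpace ℝ F] [NormedAddCommGroup G] [NormedSpace ℝ G]

theorem finiteDimensional_prod_normed (E F : Type*) [NormedAddCommGroup E] [NormedSpace ℝ E]
    [NormedAddCommGroup F] [NormedSpace ℝ F] [FiniteDimensional ℝ E] [FiniteDimensional ℝ F] :
    FiniteDimensional ℝ (E × F) := inferInstance

theorem IsLinearMap.analyticOn [FiniteDimensional ℝ E] {f : E → F} (hf : IsLinearMap ℝ f)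
    (S : Set E) : AnalyticOn ℝ f S := by
  have := (LinearMap.toContinuousLinearMap (hf.mk' f)).analyticOn S
  exact this

theorem IsLinearMap.analyticAt [FiniteDimensional ℝ E] {f : E → F} (hf : IsLinearMap ℝ f)
    (p : E) : AnalyticAt ℝ f p :=
  (LinearMap.toContinuousLinearMap (hf.mk' f)).analyticAt p

theorem IsAnalyticIso.comp {f : E → F} {f₂ : F → G} {S : Set E} {T : Set F} {R : Set G}
    (h₂ : IsAnalyticIso f₂ T R) (h : IsAnalyticIso f S T) : IsAnalyticIso (f₂ ∘ f) S R := by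
  obtain ⟨hf, hm, f', hf', hm', hi⟩ := h
  obtain ⟨hg, hmg, g', hg', hmg', hig⟩ := h₂
  exact ⟨hg.comp hf hm, hmg.comp hm, f' ∘ g', hf'.comp hg' hmg', hm'.comp hmg',
    hi.1.comp hig.1 hm, hi.2.comp hig.2 hmg'⟩

end AnalyticIso

instance finiteDimensional_mixed (n : ℕ) : FiniteDimensional ℝ ((Mat2 × Mat2) × (Fin n → R3)) :=
  finiteDimensional_prod_normed _ _

instance finiteDimensional_ambient (g n : ℕ) : FiniteDimensional ℝ (Ambient g n) :=
  finiteDimensional_prod_normed _ _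

theorem exists_line_iff {ι : Type*} {y : ι → R3} :
    (∃ L : Submodule ℝ R3, Module.finrank ℝ L = 1 ∧ ∀ i, y i ∈ L) ↔
      ∃ u : R3, ‖u‖ = 1 ∧ ∀ i, ∃ c : ℝ, y i = c • u := by
  constructor
  · rintro ⟨L, hL, h⟩
    obtain ⟨v, hv, hs⟩ := finrank_eq_one_iff'.1 hL
    have hv0 : (v : R3) ≠ 0 := fun h0 => hv (Subtype.ext h0)
    refine ⟨‖(v : R3)‖⁻¹ • (v : R3), norm_smul_inv_norm hv0, fun i => ?_⟩
    obtain ⟨c, hc⟩ := hs ⟨y i, h i⟩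
    refine ⟨c * ‖(v : R3)‖, ?_⟩
    rw [mul_smul, smul_inv_smul₀ (norm_ne_zero_iff.2 hv0)]
    exact (congrArg Subtype.val hc).symm
  · rintro ⟨u, hu, h⟩
    refine ⟨Submodule.span ℝ {u}, finrank_span_singleton (fun h0 => by simp [h0] at hu), fun i => ?_⟩
    obtain ⟨c, hc⟩ := h i
    exact Submodule.mem_span_singleton.2 ⟨c, hc.symm⟩

theorem mem_spherePow {m : ℕ} {y : Fin m → R3} : y ∈ spherePow m ↔ ∀ j, ‖y j‖ = 1 :=
  forall_congr' fun _ => mem_sphere_zero_iff_norm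

theorem mem_coaxPow {m : ℕ} {y : Fin m → R3} :
    y ∈ coaxPow m ↔ (∀ j, ‖y j‖ = 1) ∧ ∃ u : R3, ‖u‖ = 1 ∧ ∀ j, ∃ c : ℝ, y j = c • u := by
  rw [← exists_line_iff, ← mem_spherePow]; rfl

namespace DecHom

variable {g n : ℕ} {θ : Fin n → ℝ}

/-- The decorations in genus zero are parametrized by `(S²)^m`: the direction of `A(β_i)` is
`σ_i y_{a(i)}`. -/
def IsSphereModel (θ : Fin n → ℝ) {m : ℕ} (a : Fin n → Fin m) (b : Fin m → Fin n) (σ : Fin n → ℝ) :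
    Prop :=
  (∀ j, a (b j) = j) ∧ (∀ i, σ i = 1 ∨ σ i = -1) ∧
  (∀ x ∈ (rel 0 θ : Set (DecHom 0 n)), ∃ y : Fin m → R3, (∀ j, ‖y j‖ = 1) ∧
    ∀ i, x.dir θ i = σ i • y (a i)) ∧
  ∀ y : Fin m → R3, (∀ j, ‖y j‖ = 1) →
    ∃ x ∈ (rel 0 θ : Set (DecHom 0 n)), ∀ i, x.dir θ i = σ i • y (a i)

theorem numIntegral_eq_iff : numIntegral θ = n ↔ ∀ i, ∃ m : ℤ, θ i = m := by
  rw [numIntegral]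
  constructor
  · intro h i
    have h1 : {i : Fin n | ∃ m : ℤ, θ i = m} = Set.univ := by
      rw [Set.eq_univ_iff_ncard, h, Nat.card_eq_fintype_card, Fintype.card_fin]
    exact (Set.eq_univ_iff_forall.1 h1) i
  · intro h
    have h1 : {i : Fin n | ∃ m : ℤ, θ i = m} = Set.univ := Set.eq_univ_iff_forall.2 h
    rw [h1, Set.ncard_univ, Nat.card_eq_fintype_card, Fintype.card_fin]

theorem isSphereModel_of_integral (hθ : ∀ i, 0 < θ i) {σ : Fin n → ℝ} (hσ : IsCoaxialModel θ σ)
    (hk : ∀ i, ∃ m : ℤ, θ i = m) : IsSphereModel θ id id (fun _ => (1 : ℝ)) := by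
  refine ⟨fun _ => rfl, fun _ => Or.inl rfl, fun x hx => ⟨x.dir θ, (mem_rel_iff_dir hθ).1 hx,
    fun i => (one_smul _ _).symm⟩, fun y hy => ?_⟩
  obtain ⟨u, hu, -⟩ := exists_unit_orthogonal 0
  obtain ⟨x, hx, hxy⟩ := exists_mem_rel_of_model hθ hσ hy hu fun i hi => absurd (hk i) hi
  exact ⟨x, hx, fun i => by rw [hxy, one_smul]; rfl⟩

open Classical in
theorem exists_isSphereModel (hθ : ∀ i, 0 < θ i) {σ : Fin n → ℝ} (hσ : IsCoaxialModel θ σ)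
    (hk : numIntegral θ ≠ n) :
    ∃ (a : Fin n → Fin (1 + numIntegral θ)) (b : _) (σ' : Fin n → ℝ), IsSphereModel θ a b σ' := by
  obtain ⟨i₀, hi₀⟩ : ∃ i, ¬ ∃ m : ℤ, θ i = m := by
    by_contra h
    push Not at h
    exact hk (numIntegral_eq_iff.2 h)
  have hcard : Fintype.card (Option {i : Fin n // ∃ m : ℤ, θ i = m}) =
      Fintype.card (Fin (1 + numIntegral θ)) := by
    rw [Fintype.card_option, Fintype.card_fin, numIntegral, Set.ncard_eq_toFinset_card',
      Set.toFinset_card, add_comm]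
    rfl
  let e := Fintype.equivOfCardEq hcard
  let a : Fin n → Fin (1 + numIntegral θ) := fun i =>
    if h : ∃ m : ℤ, θ i = m then e (some ⟨i, h⟩) else e none
  let σ' : Fin n → ℝ := fun i => if ∃ m : ℤ, θ i = m then 1 else σ i
  have hai : ∀ i (h : ∃ m : ℤ, θ i = m), a i = e (some ⟨i, h⟩) := fun i h => dif_pos h
  have han : ∀ i, (¬ ∃ m : ℤ, θ i = m) → a i = e none := fun i h => dif_neg h
  have hsi : ∀ i, (∃ m : ℤ, θ i = m) → σ' i = 1 := fun i h => if_pos h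
  have hsn : ∀ i, (¬ ∃ m : ℤ, θ i = m) → σ' i = σ i := fun i h => if_neg h
  have hsurj : ∀ j, ∃ i, a i = j := by
    intro j
    rcases h : e.symm j with _ | ⟨i, hi⟩
    · exact ⟨i₀, by rw [han _ hi₀, ← h, e.apply_symm_apply]⟩
    · exact ⟨i, by rw [hai _ hi, ← h, e.apply_symm_apply]⟩
  choose b hb using hsurj
  have hσ' : ∀ i, σ' i = 1 ∨ σ' i = -1 := by
    intro i
    by_cases h : ∃ m : ℤ, θ i = m
    · exact Or.inl (hsi i h)
    · rw [hsn i h]; exact hσ.1 i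
  refine ⟨a, b, σ', hb, hσ', fun x hx => ?_, fun y hy => ?_⟩
  · obtain ⟨u, hu, hxu⟩ := hσ.2.1 x hx
    refine ⟨fun j => (e.symm j).elim u fun i => x.dir θ i, fun j => ?_, fun i => ?_⟩
    · beta_reduce
      rcases e.symm j with _ | i
      · exact hu
      · exact (mem_rel_iff_dir hθ).1 hx i
    · by_cases h : ∃ m : ℤ, θ i = m
      · rw [hai i h, hsi i h, one_smul]; beta_reduce; rw [e.symm_apply_apply]; rfl
      · rw [han i h, hsn i h, hxu i h]; beta_reduce; rw [e.symm_apply_apply]; rfl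
  · obtain ⟨x, hx, hxy⟩ := exists_mem_rel_of_model hθ hσ (y := fun i => σ' i • y (a i))
      (u := y (e none)) (fun i => (norm_sign_smul (hσ' i) _).trans (hy _)) (hy _) fun i hi => by
        rw [hsn i hi, han i hi]
    exact ⟨x, hx, hxy⟩

/-! ### Linear identification of the genus zero spaces with products of spheres -/

section SphereModel

variable {m : ℕ} {a : Fin n → Fin m} {b : Fin m → Fin n} {σ : Fin n → ℝ}

/-- The point of `(S²)^m` corresponding to an element of the ambient space. -/
def sphereCoords (θ : Fin n → ℝ) (b : Fin m → Fin n) (σ : Fin n → ℝ) (q : Ambient g n) :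
    Fin m → R3 :=
  fun j => σ (b j) • (2 / θ (b j)) • suEquiv.symm (q.2 (b j))

theorem isLinearMap_sphereCoords (θ : Fin n → ℝ) (b : Fin m → Fin n) (σ : Fin n → ℝ) :
    IsLinearMap ℝ (sphereCoords θ b σ : Ambient g n → Fin m → R3) where
  map_add p q := by funext j; simp [sphereCoords]
  map_smul c q := by
    funext j
    simp only [sphereCoords, Prod.smul_snd, Pi.smul_apply, map_smul]
    rw [smul_comm (2 / θ (b j)), smul_comm (σ (b j))]

/-- The point of the ambient space corresponding to a point of `(S²)^m`. -/
def ofSphereCoords (θ : Fin n → ℝ) (a : Fin n → Fin m) (σ : Fin n → ℝ) (y : Fin m → R3) :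
    Ambient g n :=
  (0, fun i => suEquiv ((θ i / 2) • σ i • y (a i)))

theorem isLinearMap_ofSphereCoords (θ : Fin n → ℝ) (a : Fin n → Fin m) (σ : Fin n → ℝ) :
    IsLinearMap ℝ (ofSphereCoords θ a σ : (Fin m → R3) → Ambient g n) where
  map_add p q := by
    refine Prod.ext (add_zero _).symm (funext fun i => ?_)
    simp [ofSphereCoords]
  map_smul c q := by
    refine Prod.ext (smul_zero _).symm (funext fun i => ?_)
    simp only [ofSphereCoords, Prod.smul_snd, Pi.smul_apply, ← map_smul]
    rw [smul_comm c, smul_comm c]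

theorem sphereCoords_coords (x : DecHom g n) (j : Fin m) :
    sphereCoords θ b σ x.coords j = σ (b j) • x.dir θ (b j) := rfl

theorem IsSphereModel.sphereCoords_eq (h : IsSphereModel θ a b σ) {x : DecHom 0 n}
    {y : Fin m → R3} (hxy : ∀ i, x.dir θ i = σ i • y (a i)) : sphereCoords θ b σ x.coords = y := by
  funext j
  rw [sphereCoords_coords, hxy, sign_smul_sign_smul (h.2.1 _), h.1]

theorem coords_eq_ofSphereCoords (hθ : ∀ i, 0 < θ i) {x : DecHom 0 n}
    {y : Fin m → R3} (hxy : ∀ i, x.dir θ i = σ i • y (a i)) :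
    x.coords = ofSphereCoords θ a σ y := by
  rw [coords_eq hθ]
  refine Prod.ext (funext fun j => j.elim0) (funext fun i => ?_)
  simp only [ofSphereCoords, hxy]

theorem isElementary_iff_sphere (hθ : ∀ i, 0 < θ i) (h : IsSphereModel θ a b σ) {x : DecHom 0 n}
    {y : Fin m → R3} (hxy : ∀ i, x.dir θ i = σ i • y (a i)) :
    x.IsElementary ↔ ∃ u : R3, ‖u‖ = 1 ∧ ∀ j, ∃ c : ℝ, y j = c • u := by
  rw [isElementary_genus_zero_iff hθ]
  refine exists_congr fun u => and_congr_right fun hu => ?_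
  constructor
  · intro h' j
    obtain ⟨c, hc⟩ := h' (b j)
    refine ⟨σ (b j) * c, ?_⟩
    rw [mul_smul, ← hc, hxy, sign_smul_sign_smul (h.2.1 _), h.1]
  · intro h' i
    obtain ⟨c, hc⟩ := h' (a i)
    exact ⟨σ i * c, by rw [hxy, hc, mul_smul]⟩

/-- Both the identification and its inverse are restrictions of linear maps, so analyticity is
automatic. -/
theorem IsSphereModel.isAnalyticIso (hθ : ∀ i, 0 < θ i) (h : IsSphereModel θ a b σ) :
    IsAnalyticIso (sphereCoords θ b σ : Ambient 0 n → Fin m → R3) (locus (rel 0 θ))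
      (spherePow m) := by
  refine ⟨(isLinearMap_sphereCoords θ b σ).analyticOn _, ?_, ofSphereCoords θ a σ,
    (isLinearMap_ofSphereCoords θ a σ).analyticOn _, ?_, ?_, ?_⟩
  · rintro _ ⟨x, hx, rfl⟩
    obtain ⟨y, hy, hxy⟩ := h.2.2.1 x hx
    rw [h.sphereCoords_eq hxy, mem_spherePow]
    exact hy
  · intro y hy
    obtain ⟨x, hx, hxy⟩ := h.2.2.2 y (mem_spherePow.1 hy)
    exact ⟨x, hx, coords_eq_ofSphereCoords hθ hxy⟩
  · rintro _ ⟨x, hx, rfl⟩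
    obtain ⟨y, hy, hxy⟩ := h.2.2.1 x hx
    rw [h.sphereCoords_eq hxy, coords_eq_ofSphereCoords hθ hxy]
  · intro y hy
    obtain ⟨x, hx, hxy⟩ := h.2.2.2 y (mem_spherePow.1 hy)
    rw [← coords_eq_ofSphereCoords hθ hxy, h.sphereCoords_eq hxy]

theorem IsSphereModel.image_elementary (hθ : ∀ i, 0 < θ i) (h : IsSphereModel θ a b σ) :
    (sphereCoords θ b σ : Ambient 0 n → Fin m → R3) '' locus {x ∈ rel 0 θ | x.IsElementary} =
      coaxPow m := by
  ext y
  rw [mem_coaxPow]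
  constructor
  · rintro ⟨_, ⟨x, ⟨hx, he⟩, rfl⟩, rfl⟩
    obtain ⟨y, hy, hxy⟩ := h.2.2.1 x hx
    rw [h.sphereCoords_eq hxy]
    exact ⟨hy, (isElementary_iff_sphere hθ h hxy).1 he⟩
  · rintro ⟨hy, hu⟩
    obtain ⟨x, hx, hxy⟩ := h.2.2.2 y hy
    exact ⟨_, ⟨x, ⟨hx, (isElementary_iff_sphere hθ h hxy).2 hu⟩, rfl⟩, h.sphereCoords_eq hxy⟩

end SphereModel

theorem isAnalyticIso_eval :
    IsAnalyticIso (fun y : Fin (1 + 0) → R3 => y 0) (spherePow (1 + 0))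
      (Metric.sphere (0 : EuclideanSpace ℝ (Fin 3)) 1) := by
  refine ⟨IsLinearMap.analyticOn ⟨fun _ _ => rfl, fun _ _ => rfl⟩ _, fun y hy => hy 0,
    fun u _ => u, IsLinearMap.analyticOn ⟨fun _ _ => rfl, fun _ _ => rfl⟩ _, fun u hu _ => hu,
    fun y _ => funext fun j => ?_, fun u _ => rfl⟩
  have : j = 0 := Fin.ext (by have := j.2; simp only [Fin.val_zero]; omega)
  rw [this]

theorem genus_zero_no_integral (hθ : ∀ i, 0 < θ i) {σ : Fin n → ℝ} (hσ : IsCoaxialModel θ σ)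
    (hk : ∀ i, ¬ ∃ m : ℤ, θ i = m) :
    (∀ x ∈ (rel 0 θ : Set (DecHom 0 n)), x.IsElementary) ∧
      ∀ x ∈ (rel 0 θ : Set (DecHom 0 n)), ∀ y ∈ (rel 0 θ : Set (DecHom 0 n)), x.Conj y := by
  constructor
  · intro x hx
    obtain ⟨u, hu, hxu⟩ := hσ.2.1 x hx
    exact (isElementary_genus_zero_iff hθ).2 ⟨u, hu, fun i => ⟨σ i, hxu i (hk i)⟩⟩
  · intro x hx y hy
    obtain ⟨u, hu, hxu⟩ := hσ.2.1 x hx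
    obtain ⟨v, hv, hyv⟩ := hσ.2.1 y hy
    obtain ⟨U, hU⟩ := exists_adj_eq hu hv
    refine conj_iff.2 ⟨U, fun j => j.elim0, fun j => j.elim0, fun i => ?_⟩
    rw [vec_eq_dir hθ, vec_eq_dir hθ, hyv i (hk i), hxu i (hk i), map_smul, map_smul, hU]

/-! ### The central locus in genus one -/

/-- The directions of the decorations in the ambient space. -/
def ambDir (θ : Fin n → ℝ) (q : Ambient g n) (i : Fin n) : R3 := (2 / θ i) • suEquiv.symm (q.2 i)

theorem ambDir_coords (x : DecHom g n) (i : Fin n) : ambDir θ x.coords i = x.dir θ i := rfl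

/-- The element of the ambient space in genus one with prescribed monodromy and directions. -/
def ofDir (θ : Fin n → ℝ) (A B : Mat2) (y : Fin n → R3) : Ambient 1 n :=
  (fun _ => (A, B), fun i => suEquiv ((θ i / 2) • y i))

theorem coords_eq_ofDir (hθ : ∀ i, 0 < θ i) (x : DecHom 1 n) :
    x.coords = ofDir θ (x.rho (muElt 0)) (x.rho (nuElt 0)) (x.dir θ) := by
  rw [coords_eq hθ, ofDir]
  refine Prod.ext (funext fun j => ?_) rfl
  rw [Subsingleton.elim j 0]

theorem ambDir_ofDir (hθ : ∀ i, 0 < θ i) (A B : Mat2) (y : Fin n → R3) :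
    ambDir θ (ofDir θ A B y) = y := by
  funext i
  have := (hθ i).ne'
  rw [ambDir, ofDir, suEquiv.symm_apply_apply, smul_smul,
    show 2 / θ i * (θ i / 2) = 1 by field_simp, one_smul]

theorem isLinearMap_ambDir (θ : Fin n → ℝ) : IsLinearMap ℝ (ambDir θ : Ambient g n → Fin n → R3) where
  map_add p q := by funext j; simp [ambDir]
  map_smul c q := by
    funext j
    simp only [ambDir, Prod.smul_snd, Pi.smul_apply, map_smul]
    rw [smul_comm (2 / θ j)]

theorem isLinearMap_ofDir (θ : Fin n → ℝ) :
    IsLinearMap ℝ (fun p : (Mat2 × Mat2) × (Fin n → R3) => ofDir θ p.1.1 p.1.2 p.2) where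
  map_add p q := by
    refine Prod.ext rfl (funext fun i => ?_)
    simp [ofDir]
  map_smul c q := by
    refine Prod.ext rfl (funext fun i => ?_)
    simp only [ofDir, Prod.smul_snd, Pi.smul_apply, ← map_smul]
    rw [smul_comm c]

theorem SU2_mem_pm_one {U : SU2} (h : vecPart (U : Mat2) = 0) : (U : Mat2) ∈ ({1, -1} : Set Mat2) :=
  vecPart_eq_zero_iff.1 h

theorem exists_SU2_of_pm_one {A : Mat2} (h : A ∈ ({1, -1} : Set Mat2)) :
    ∃ U : SU2, (U : Mat2) = A ∧ vecPart (U : Mat2) = 0 := by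
  rcases h with rfl | h
  · exact ⟨1, rfl, vecPart_one⟩
  · rw [Set.mem_singleton_iff] at h
    subst h
    have hn : (-1 : ℝ) ^ 2 + ‖(0 : R3)‖ ^ 2 = 1 := by simp
    refine ⟨mkSU (-1) 0 hn, quatMat_neg_one_zero, ?_⟩
    rw [coe_mkSU, vecPart_quatMat]

/-- When both images are signs the commutation condition is void and the directions are arbitrary.
The identification is again linear in both directions. -/
theorem central_locus_genus_one (hθ : ∀ i, 0 < θ i) {c : Fin n → ℤ} (hc : ∀ i, θ i = c i)
    (he : Even (∑ i, (c i - 1))) :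
    ∃ Φ : Ambient 1 n → (Mat2 × Mat2) × (Fin n → EuclideanSpace ℝ (Fin 3)),
      IsAnalyticIso Φ (DecHom.locus {x ∈ DecHom.rel 1 θ | x.IsCentral})
        ((({1, -1} : Set Mat2) ×ˢ ({1, -1} : Set Mat2)) ×ˢ spherePow n) ∧
      Φ '' DecHom.locus {x ∈ DecHom.rel 1 θ | x.IsCentral ∧ x.IsElementary} =
        (({1, -1} : Set Mat2) ×ˢ ({1, -1} : Set Mat2)) ×ˢ coaxPow n := by
  let Φ : Ambient 1 n → (Mat2 × Mat2) × (Fin n → R3) := fun q => (q.1 0, ambDir θ q)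
  have hΦ : IsLinearMap ℝ Φ :=
    ⟨fun p q => Prod.ext rfl ((isLinearMap_ambDir θ).map_add p q),
      fun r q => Prod.ext rfl ((isLinearMap_ambDir θ).map_smul r q)⟩
  have hback : ∀ p : (Mat2 × Mat2) × (Fin n → R3),
      p ∈ (({1, -1} : Set Mat2) ×ˢ ({1, -1} : Set Mat2)) ×ˢ spherePow n →
      ∃ x ∈ (rel 1 θ : Set (DecHom 1 n)), x.IsCentral ∧ x.coords = ofDir θ p.1.1 p.1.2 p.2 ∧
        Φ x.coords = p ∧ x.dir θ = p.2 := by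
    rintro ⟨⟨A, B⟩, y⟩ ⟨⟨hA, hB⟩, hy⟩
    obtain ⟨M, rfl, hM⟩ := exists_SU2_of_pm_one hA
    obtain ⟨N, rfl, hN⟩ := exists_SU2_of_pm_one hB
    obtain ⟨x, hx, h1, h2, h3⟩ := exists_mem_rel_genus_one hθ hc he (M := M) (N := N)
      (mul_comm_iff_crossR3.2 (by rw [hM, crossR3_zero_left])) (mem_spherePow.1 hy)
    have h4 : x.coords = ofDir θ M N y := by
      rw [coords_eq_ofDir hθ, h1, h2]; congr 1; exact funext h3
    exact ⟨x, hx, (isCentral_genus_one_iff hθ hc hx).2 ⟨by rw [h1, hM], by rw [h2, hN]⟩, h4,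
      Prod.ext (by rw [h4]; rfl) (funext h3), funext h3⟩
  have hforth : ∀ x ∈ (rel 1 θ : Set (DecHom 1 n)), x.IsCentral →
      Φ x.coords ∈ (({1, -1} : Set Mat2) ×ˢ ({1, -1} : Set Mat2)) ×ˢ spherePow n := by
    intro x hx hcen
    obtain ⟨h1, h2⟩ := (isCentral_genus_one_iff hθ hc hx).1 hcen
    exact ⟨⟨SU2_mem_pm_one h1, SU2_mem_pm_one h2⟩, mem_spherePow.2 ((mem_rel_iff_dir hθ).1 hx)⟩
  refine ⟨Φ, ⟨hΦ.analyticOn _, ?_, fun p => ofDir θ p.1.1 p.1.2 p.2,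
    (isLinearMap_ofDir θ).analyticOn _, ?_, ?_, ?_⟩, ?_⟩
  · rintro _ ⟨x, ⟨hx, hcen⟩, rfl⟩
    exact hforth x hx hcen
  · intro p hp
    obtain ⟨x, hx, hcen, h1, -, -⟩ := hback p hp
    exact ⟨x, ⟨hx, hcen⟩, h1⟩
  · rintro _ ⟨x, ⟨hx, hcen⟩, rfl⟩
    exact (coords_eq_ofDir hθ x).symm
  · intro p hp
    obtain ⟨x, hx, hcen, h1, h2, -⟩ := hback p hp
    simp only
    rw [← h1, h2]
  · ext p
    constructor
    · rintro ⟨_, ⟨x, ⟨hx, hcen, hel⟩, rfl⟩, rfl⟩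
      refine ⟨(hforth x hx hcen).1, mem_coaxPow.2 ⟨(mem_rel_iff_dir hθ).1 hx, ?_⟩⟩
      obtain ⟨u, hu, -, -, h⟩ := (isElementary_genus_one_iff hθ).1 hel
      exact ⟨u, hu, h⟩
    · rintro ⟨hp1, hp2⟩
      obtain ⟨hy, u, hu, h⟩ := mem_coaxPow.1 hp2
      obtain ⟨x, hx, hcen, h1, h2, h3⟩ := hback p ⟨hp1, mem_spherePow.2 hy⟩
      refine ⟨_, ⟨x, ⟨hx, hcen, (isElementary_genus_one_iff hθ).2 ⟨u, hu, ?_, ?_, ?_⟩⟩, rfl⟩, h2⟩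
      · exact ⟨0, by rw [((isCentral_genus_one_iff hθ hc hx).1 hcen).1, zero_smul]⟩
      · exact ⟨0, by rw [((isCentral_genus_one_iff hθ hc hx).1 hcen).2, zero_smul]⟩
      · rw [h3]; exact h

end DecHom


/-! ### Smoothness of the basic operations -/

section Smooth

variable {E : Type*} [NormedAddCommGroup E] [NormedSpace ℝ E] {F : Type*} [NormedAddCommGroup F]
  [NormedSpace ℝ F] {p : E}

/-- Regularity is proved throughout in the form `ContDiffAt ℝ ω` and converted to analyticity only
where the statement demands it. -/
theorem analyticOn_of_contDiffAt {f : E → F} {S : Set E} (h : ∀ p ∈ S, ContDiffAt ℝ ω f p)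
    : AnalyticOn ℝ f S := fun p hp => (h p hp).analyticAt.analyticWithinAt

theorem IsLinearMap.contDiffAt [FiniteDimensional ℝ E] {f : E → F} (hf : IsLinearMap ℝ f) (p : E) :
    ContDiffAt ℝ ω f p :=
  (LinearMap.toContinuousLinearMap (hf.mk' f)).contDiff.contDiffAt

theorem LinearMap.contDiffAt_comp {G : Type*} [NormedAddCommGroup G] [NormedSpace ℝ G]
    [FiniteDimensional ℝ F] (L : F →ₗ[ℝ] G) {f : E → F} (hf : ContDiffAt ℝ ω f p) :
    ContDiffAt ℝ ω (fun x => L (f x)) p :=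
  ((LinearMap.toContinuousLinearMap L).contDiff.contDiffAt).comp p hf

@[fun_prop]
theorem contDiffAt_inner_R3 {f g : E → R3} (hf : ContDiffAt ℝ ω f p) (hg : ContDiffAt ℝ ω g p) :
    ContDiffAt ℝ ω (fun x => (inner ℝ (f x) (g x) : ℝ)) p := hf.inner ℝ hg

@[fun_prop]
theorem contDiffAt_norm_R3 {f : E → R3} (hf : ContDiffAt ℝ ω f p) (h : f p ≠ 0) :
    ContDiffAt ℝ ω (fun x => ‖f x‖) p := hf.norm ℝ h

theorem contDiffAt_vec3 {f g h : E → ℝ} (hf : ContDiffAt ℝ ω f p) (hg : ContDiffAt ℝ ω g p)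
    (hh : ContDiffAt ℝ ω h p) : ContDiffAt ℝ ω (fun x => (!₂[f x, g x, h x] : R3)) p := by
  have : ContDiffAt ℝ ω (fun x => ![f x, g x, h x]) p := by
    rw [contDiffAt_pi]
    intro i; fin_cases i <;> assumption
  fun_prop

@[fun_prop]
theorem contDiffAt_crossR3 {f g : E → R3} (hf : ContDiffAt ℝ ω f p) (hg : ContDiffAt ℝ ω g p) :
    ContDiffAt ℝ ω (fun x => crossR3 (f x) (g x)) p := by
  unfold crossR3
  apply contDiffAt_vec3 <;> fun_prop

@[fun_prop]
theorem contDiffAt_imMat {f : E → R3} (hf : ContDiffAt ℝ ω f p) :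
    ContDiffAt ℝ ω (fun x => imMat (f x)) p := imMat.contDiffAt_comp hf

@[fun_prop]
theorem contDiffAt_vecPart {f : E → Mat2} (hf : ContDiffAt ℝ ω f p) :
    ContDiffAt ℝ ω (fun x => vecPart (f x)) p := vecPart.contDiffAt_comp hf

@[fun_prop]
theorem contDiffAt_rePart {f : E → Mat2} (hf : ContDiffAt ℝ ω f p) :
    ContDiffAt ℝ ω (fun x => rePart (f x)) p := rePart.contDiffAt_comp hf

@[fun_prop]
theorem contDiffAt_quatMat {f : E → ℝ} {g : E → R3} (hf : ContDiffAt ℝ ω f p)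
    (hg : ContDiffAt ℝ ω g p) : ContDiffAt ℝ ω (fun x => quatMat (f x) (g x)) p := by
  unfold quatMat
  fun_prop

end Smooth

/-! ### The non-central locus in genus one -/

namespace DecHom

variable {g n : ℕ} {θ : Fin n → ℝ}

/-- Coordinates of non-central elements in genus one: the monodromy is `(a + b u, c + d u)` and the
directions of the decorations are `y`. -/
structure IsTorusRep (a b c d : ℝ) (u : R3) (y : Fin n → R3) : Prop where
  ab : a ^ 2 + b ^ 2 = 1
  cd : c ^ 2 + d ^ 2 = 1
  norm_u : ‖u‖ = 1
  norm_y : ∀ i, ‖y i‖ = 1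
  ne : ¬ (b = 0 ∧ d = 0)

/-- The element of the ambient space with given torus coordinates. -/
def torusPt (θ : Fin n → ℝ) (a b c d : ℝ) (u : R3) (y : Fin n → R3) : Ambient 1 n :=
  ofDir θ (quatMat a (b • u)) (quatMat c (d • u)) y

theorem unit_quat_smul {a b : ℝ} {u : R3} (h : a ^ 2 + b ^ 2 = 1) (hu : ‖u‖ = 1) :
    a ^ 2 + ‖b • u‖ ^ 2 = 1 := by
  rw [norm_smul, hu, mul_one, Real.norm_eq_abs, sq_abs, h]

section TorusPt

variable (hθ : ∀ i, 0 < θ i) {cθ : Fin n → ℤ} (hc : ∀ i, θ i = cθ i) (he : Even (∑ i, (cθ i - 1)))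
include hθ hc he

/-- Vector parts on one axis commute, so the data are realized. Since b or d is nonzero, the line of
u is determined by the homomorphism, and being elementary becomes a condition on the directions
alone. -/
theorem exists_torusPt {a b c d : ℝ} {u : R3} {y : Fin n → R3} (h : IsTorusRep a b c d u y) :
    ∃ x ∈ (rel 1 θ : Set (DecHom 1 n)), ¬ x.IsCentral ∧ x.coords = torusPt θ a b c d u y ∧
      (x.IsElementary ↔ ∀ i, ∃ t : ℝ, y i = t • u) := by
  have hu0 : u ≠ 0 := fun h0 => by have := h.norm_u; simp [h0] at this
  obtain ⟨x, hx, h1, h2, h3⟩ := exists_mem_rel_genus_one hθ hc he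
    (M := mkSU a (b • u) (unit_quat_smul h.ab h.norm_u))
    (N := mkSU c (d • u) (unit_quat_smul h.cd h.norm_u))
    (mul_comm_iff_crossR3.2 (by
      rw [coe_mkSU, coe_mkSU, vecPart_quatMat, vecPart_quatMat, crossR3_smul_left,
        crossR3_smul_right, crossR3_self, smul_zero, smul_zero])) h.norm_y
  have hncen : ¬ x.IsCentral := by
    rw [isCentral_genus_one_iff hθ hc hx, h1, h2, coe_mkSU, coe_mkSU, vecPart_quatMat,
      vecPart_quatMat, smul_eq_zero, smul_eq_zero, or_iff_left hu0, or_iff_left hu0]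
    exact h.ne
  refine ⟨x, hx, hncen, ?_, ?_⟩
  · rw [coords_eq_ofDir hθ, h1, h2, funext h3]; rfl
  · rw [isElementary_genus_one_iff hθ]
    constructor
    · rintro ⟨v, hv, ⟨s, hs⟩, ⟨t, ht⟩, hy⟩ i
      rw [h1, coe_mkSU, vecPart_quatMat] at hs
      rw [h2, coe_mkSU, vecPart_quatMat] at ht
      -- Whichever of b and d is nonzero shows that the axis of the elementary pair is the line of
      -- `u`.
      have key : ∃ r : ℝ, v = r • u := by
        have h0 : ∀ {b s : ℝ}, b ≠ 0 → b • u = s • v → ∃ r : ℝ, v = r • u := by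
          intro b s hb hbs
          have hs0 : s ≠ 0 := by
            rintro rfl
            rw [zero_smul, smul_eq_zero] at hbs
            exact hbs.elim hb hu0
          exact ⟨s⁻¹ * b, by rw [mul_smul, hbs, inv_smul_smul₀ hs0]⟩
        by_cases hb : b = 0
        · exact h0 (fun hd => h.ne ⟨hb, hd⟩) ht
        · exact h0 hb hs
      obtain ⟨r, rfl⟩ := key
      obtain ⟨t, ht⟩ := hy i
      exact ⟨t * r, by rw [← h3, ht, mul_smul]⟩
    · intro hy
      refine ⟨u, h.norm_u, ⟨b, ?_⟩, ⟨d, ?_⟩, fun i => ?_⟩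
      · rw [h1, coe_mkSU, vecPart_quatMat]
      · rw [h2, coe_mkSU, vecPart_quatMat]
      · rw [h3]; exact hy i

theorem exists_torusRep {x : DecHom 1 n} (hx : x ∈ rel 1 θ) (hcen : ¬ x.IsCentral) :
    ∃ a b c d u y, IsTorusRep a b c d u y ∧ x.coords = torusPt θ a b c d u y := by
  obtain ⟨u, hu, ⟨b, hb⟩, ⟨d, hd⟩⟩ := exists_torus_of_comm (genus_one_comm hθ hc he hx)
  obtain ⟨hM1, hM2⟩ := SU2_eq_quatMat (x.rho (muElt 0))
  obtain ⟨hN1, hN2⟩ := SU2_eq_quatMat (x.rho (nuElt 0))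
  rw [hb] at hM1 hM2
  rw [hd] at hN1 hN2
  refine ⟨rePart (x.rho (muElt 0) : Mat2), b, rePart (x.rho (nuElt 0) : Mat2), d, u, x.dir θ, ⟨?_, ?_, hu, (mem_rel_iff_dir hθ).1 hx, ?_⟩, ?_⟩
  · rwa [norm_smul, hu, mul_one, Real.norm_eq_abs, sq_abs] at hM2
  · rwa [norm_smul, hu, mul_one, Real.norm_eq_abs, sq_abs] at hN2
  · rintro ⟨rfl, rfl⟩
    exact hcen ((isCentral_genus_one_iff hθ hc hx).2 ⟨by rw [hb, zero_smul], by rw [hd, zero_smul]⟩)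
  · rw [coords_eq_ofDir hθ, torusPt, ← hM1, ← hN1]

theorem mem_noncentral_iff {q : Ambient 1 n} :
    q ∈ locus {x ∈ (rel 1 θ : Set (DecHom 1 n)) | ¬ x.IsCentral} ↔
      ∃ a b c d u y, IsTorusRep a b c d u y ∧ q = torusPt θ a b c d u y := by
  constructor
  · rintro ⟨x, ⟨hx, hcen⟩, rfl⟩
    exact exists_torusRep hθ hc he hx hcen
  · rintro ⟨a, b, c, d, u, y, h, rfl⟩
    obtain ⟨x, hx, hcen, h1, -⟩ := exists_torusPt hθ hc he h
    exact ⟨x, ⟨hx, hcen⟩, h1⟩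

theorem torusPt_mem_elementary_iff {a b c d : ℝ} {u : R3} {y : Fin n → R3}
    (h : IsTorusRep a b c d u y) :
    torusPt θ a b c d u y ∈
        locus {x ∈ (rel 1 θ : Set (DecHom 1 n)) | ¬ x.IsCentral ∧ x.IsElementary} ↔
      ∀ i, ∃ t : ℝ, y i = t • u := by
  obtain ⟨x, hx, hcen, h1, h2⟩ := exists_torusPt hθ hc he h
  rw [← h2]
  constructor
  · rintro ⟨x', ⟨-, -, hel⟩, h'⟩
    rw [← h1] at h'
    rwa [← coords_injective h']
  · intro hel
    exact ⟨x, ⟨hx, hcen, hel⟩, h1⟩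

end TorusPt

/-- The invariants `(a, c, bd)` of a commuting pair `(a + b u, c + d u)`. -/
def pillow (q : Ambient 1 n) : R3 :=
  !₂[rePart (q.1 0).1, rePart (q.1 0).2, inner ℝ (vecPart (q.1 0).1) (vecPart (q.1 0).2)]

/-- The projection of the non-central locus onto the four-punctured sphere. -/
def pillowProj (q : Ambient 1 n) : R3 := ‖pillow q‖⁻¹ • pillow q

/-- The four punctures. -/
def punctures : Set R3 :=
  (fun s : ℝ × ℝ => (!₂[s.1, s.2, 0] : R3)) ''
    (({Real.sqrt (1 / 2), -Real.sqrt (1 / 2)} : Set ℝ) ×ˢ {Real.sqrt (1 / 2), -Real.sqrt (1 / 2)})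

theorem ncard_punctures : punctures.ncard = 4 := by
  have hr : Real.sqrt (1 / 2) ≠ -Real.sqrt (1 / 2) := by
    have : 0 < Real.sqrt (1 / 2) := Real.sqrt_pos.2 (by norm_num)
    intro h; linarith
  rw [punctures, Set.ncard_image_of_injective, Set.ncard_prod, Set.ncard_pair hr]
  rintro ⟨s, t⟩ ⟨s', t'⟩ h
  have h0 := congrArg (fun v : R3 => v 0) h
  have h1 := congrArg (fun v : R3 => v 1) h
  simp at h0 h1
  rw [h0, h1]

theorem punctures_subset : punctures ⊆ Metric.sphere (0 : R3) 1 := by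
  rintro _ ⟨⟨s, t⟩, ⟨hs, ht⟩, rfl⟩
  have hr : Real.sqrt (1 / 2) ^ 2 = 1 / 2 := Real.sq_sqrt (by norm_num)
  have h : ∀ s ∈ ({Real.sqrt (1 / 2), -Real.sqrt (1 / 2)} : Set ℝ), s ^ 2 = 1 / 2 := by
    rintro s (rfl | rfl)
    · exact hr
    · rw [neg_sq]; exact hr
  have h1 : ‖(!₂[s, t, 0] : R3)‖ ^ 2 = 1 := by
    rw [norm_sq_R3]
    simp only [PiLp.toLp_apply, Matrix.cons_val]
    rw [h s hs, h t ht]; norm_num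
  rw [mem_sphere_zero_iff_norm]
  exact (pow_eq_one_iff_of_nonneg (norm_nonneg _) two_ne_zero).1 h1

theorem mem_punctures_of_sq {w : R3} (h0 : w 0 ^ 2 = 1 / 2) (h1 : w 1 ^ 2 = 1 / 2)
    (h2 : w 2 = 0) : w ∈ punctures := by
  have hr : Real.sqrt (1 / 2) ^ 2 = 1 / 2 := Real.sq_sqrt (by norm_num)
  have h : ∀ s : ℝ, s ^ 2 = 1 / 2 → s ∈ ({Real.sqrt (1 / 2), -Real.sqrt (1 / 2)} : Set ℝ) :=
    fun s hs => sq_eq_sq_iff_eq_or_eq_neg.1 (hs.trans hr.symm)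
  refine ⟨(w 0, w 1), ⟨h _ h0, h _ h1⟩, ?_⟩
  ext i; fin_cases i <;> simp [h2]

/-- On the unit sphere the expression equals (w₀² - w₁²)² + (1 + w₀² + w₁²) w₂², which vanishes only
for w₂ = 0 and w₀² = w₁² = 1/2, that is, at the punctures. -/
theorem disc_pos {w : R3} (hw : w ∈ Metric.sphere (0 : R3) 1 \ punctures) :
    0 < 1 - 4 * w 0 ^ 2 * w 1 ^ 2 := by
  have h1 : w 0 ^ 2 + w 1 ^ 2 + w 2 ^ 2 = 1 := by
    rw [← norm_sq_R3, mem_sphere_zero_iff_norm.1 hw.1, one_pow]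
  by_contra h
  apply hw.2
  have h3 : (w 0 ^ 2 - w 1 ^ 2) ^ 2 + (1 + (w 0 ^ 2 + w 1 ^ 2)) * w 2 ^ 2 ≤ 0 := by nlinarith
  have h4 : w 2 ^ 2 = 0 := by
    nlinarith [sq_nonneg (w 0 ^ 2 - w 1 ^ 2), sq_nonneg (w 0), sq_nonneg (w 1), sq_nonneg (w 2)]
  have h5 : (w 0 ^ 2 - w 1 ^ 2) ^ 2 = 0 := by
    nlinarith [sq_nonneg (w 0 ^ 2 - w 1 ^ 2), sq_nonneg (w 0), sq_nonneg (w 1), sq_nonneg (w 2)]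
  have h6 : w 0 ^ 2 - w 1 ^ 2 = 0 := by simpa using h5
  exact mem_punctures_of_sq (by linarith) (by linarith) (by simpa using h4)

theorem pillow_torusPt {a b c d : ℝ} {u : R3} {y : Fin n → R3} (h : IsTorusRep a b c d u y) :
    pillow (torusPt θ a b c d u y) = !₂[a, c, b * d] := by
  simp [pillow, torusPt, ofDir, inner_smul_left, inner_smul_right, h.norm_u]
  ring

/-- Expand (bd)² = (1 - a²)(1 - c²). In particular the pillow avoids the origin and radial
projection is analytic along it. -/
theorem norm_sq_pillow {a b c d : ℝ} {u : R3} {y : Fin n → R3} (h : IsTorusRep a b c d u y) :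
    ‖pillow (torusPt θ a b c d u y)‖ ^ 2 = 1 + a ^ 2 * c ^ 2 := by
  rw [pillow_torusPt h, norm_sq_R3]
  simp only [PiLp.toLp_apply, Matrix.cons_val]
  have h1 := h.ab
  have h2 := h.cd
  rw [mul_pow, show b ^ 2 = 1 - a ^ 2 by linarith, show d ^ 2 = 1 - c ^ 2 by linarith]
  ring

theorem pillow_ne_zero {a b c d : ℝ} {u : R3} {y : Fin n → R3} (h : IsTorusRep a b c d u y) :
    pillow (torusPt θ a b c d u y) ≠ 0 := by
  intro h0
  have := norm_sq_pillow (θ := θ) h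
  rw [h0, norm_zero] at this
  nlinarith [sq_nonneg (a * c)]

/-- Equality would require a² = c² = 1, hence b = d = 0, the excluded central pairs. -/
theorem IsTorusRep.sq_mul_sq_lt {a b c d : ℝ} {u : R3} {y : Fin n → R3}
    (h : IsTorusRep a b c d u y) : a ^ 2 * c ^ 2 < 1 := by
  have h1 := h.ab
  have h2 := h.cd
  have h3 : 0 < b ^ 2 ∨ 0 < d ^ 2 := by
    by_contra h'
    push Not at h'
    exact h.ne ⟨by nlinarith [sq_nonneg b], by nlinarith [sq_nonneg d]⟩
  rcases h3 with h3 | h3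
  · nlinarith [sq_nonneg a, sq_nonneg c, sq_nonneg d]
  · nlinarith [sq_nonneg a, sq_nonneg c, sq_nonneg b]

/-- The radial function of the pillow. -/
def pillowRadius (w : R3) : ℝ :=
  Real.sqrt (2 / (1 + Real.sqrt (1 - 4 * w 0 ^ 2 * w 1 ^ 2)))

/-- With squared radius 1 + a²c² the discriminant is a perfect square, and `sq_mul_sq_lt` selects
its root. Solving for the radius shows that radial projection is injective on the pillow, with
inverse given by `pillowRadius`. -/
theorem sqrt_disc {a b c d : ℝ} {u : R3} {y : Fin n → R3} (h : IsTorusRep a b c d u y) :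
    Real.sqrt (1 - 4 * (pillowProj (torusPt θ a b c d u y)) 0 ^ 2 *
      (pillowProj (torusPt θ a b c d u y)) 1 ^ 2) = (1 - a ^ 2 * c ^ 2) / (1 + a ^ 2 * c ^ 2) := by
  have h1 := norm_sq_pillow (θ := θ) h
  have h2 := h.sq_mul_sq_lt
  have h3 : 0 < 1 + a ^ 2 * c ^ 2 := by positivity
  have e0 : (pillowProj (torusPt θ a b c d u y)) 0 = ‖pillow (torusPt θ a b c d u y)‖⁻¹ * a := by
    rw [pillowProj, PiLp.smul_apply, pillow_torusPt h]; rfl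
  have e1 : (pillowProj (torusPt θ a b c d u y)) 1 = ‖pillow (torusPt θ a b c d u y)‖⁻¹ * c := by
    rw [pillowProj, PiLp.smul_apply, pillow_torusPt h]; rfl
  rw [e0, e1, mul_pow, mul_pow, inv_pow, h1]
  rw [show 1 - 4 * ((1 + a ^ 2 * c ^ 2)⁻¹ * a ^ 2) * ((1 + a ^ 2 * c ^ 2)⁻¹ * c ^ 2) =
    ((1 - a ^ 2 * c ^ 2) / (1 + a ^ 2 * c ^ 2)) ^ 2 by field_simp; ring]
  exact Real.sqrt_sq (div_nonneg (by linarith) h3.le)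

theorem pillowRadius_proj {a b c d : ℝ} {u : R3} {y : Fin n → R3} (h : IsTorusRep a b c d u y) :
    pillowRadius (pillowProj (torusPt θ a b c d u y)) = ‖pillow (torusPt θ a b c d u y)‖ := by
  have h3 : 0 < 1 + a ^ 2 * c ^ 2 := by positivity
  rw [pillowRadius, sqrt_disc h]
  rw [show 2 / (1 + (1 - a ^ 2 * c ^ 2) / (1 + a ^ 2 * c ^ 2)) = 1 + a ^ 2 * c ^ 2 by
    field_simp; ring, ← norm_sq_pillow (θ := θ) h, Real.sqrt_sq (norm_nonneg _)]

theorem pillowRadius_smul_proj {a b c d : ℝ} {u : R3} {y : Fin n → R3}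
    (h : IsTorusRep a b c d u y) :
    pillowRadius (pillowProj (torusPt θ a b c d u y)) • pillowProj (torusPt θ a b c d u y) =
      !₂[a, c, b * d] := by
  rw [pillowRadius_proj h, pillowProj, smul_inv_smul₀ (norm_ne_zero_iff.2 (pillow_ne_zero h)),
    pillow_torusPt h]

/-- At a puncture the discriminant is zero, while `sqrt_disc` gives a positive root for every
non-central pair. -/
theorem pillowProj_mem {a b c d : ℝ} {u : R3} {y : Fin n → R3} (h : IsTorusRep a b c d u y) :
    pillowProj (torusPt θ a b c d u y) ∈ Metric.sphere (0 : R3) 1 \ punctures := by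
  constructor
  · rw [mem_sphere_zero_iff_norm]
    exact norm_smul_inv_norm (pillow_ne_zero h)
  · rintro ⟨⟨s, t⟩, ⟨hs, ht⟩, hst⟩
    have hr : Real.sqrt (1 / 2) ^ 2 = 1 / 2 := Real.sq_sqrt (by norm_num)
    have h' : ∀ s ∈ ({Real.sqrt (1 / 2), -Real.sqrt (1 / 2)} : Set ℝ), s ^ 2 = 1 / 2 := by
      rintro s (rfl | rfl)
      · exact hr
      · rw [neg_sq]; exact hr
    have h1 := sqrt_disc (θ := θ) h
    rw [← hst] at h1
    simp only [PiLp.toLp_apply, Matrix.cons_val] at h1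
    rw [h' s hs, h' t ht] at h1
    have h2 : 0 < (1 - a ^ 2 * c ^ 2) / (1 + a ^ 2 * c ^ 2) :=
      div_pos (by linarith [h.sq_mul_sq_lt]) (by positivity)
    rw [← h1] at h2
    norm_num at h2

/-- The part of the base where the first monodromy matrix is not central. -/
def pillowOpen : Set R3 := {w | 2 * w 0 ^ 2 < 1 + Real.sqrt (1 - 4 * w 0 ^ 2 * w 1 ^ 2)}

theorem isOpen_pillowOpen : IsOpen pillowOpen :=
  isOpen_lt (by fun_prop) (by fun_prop)

theorem pillowRadius_pos (w : R3) : 0 < pillowRadius w := by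
  have := Real.sqrt_nonneg (1 - 4 * w 0 ^ 2 * w 1 ^ 2)
  exact Real.sqrt_pos.2 (by positivity)

theorem pillowRadius_sq (w : R3) :
    pillowRadius w ^ 2 = 2 / (1 + Real.sqrt (1 - 4 * w 0 ^ 2 * w 1 ^ 2)) := by
  have := Real.sqrt_nonneg (1 - 4 * w 0 ^ 2 * w 1 ^ 2)
  exact Real.sq_sqrt (by positivity)

theorem mem_pillowOpen_iff {w : R3} : w ∈ pillowOpen ↔ (pillowRadius w * w 0) ^ 2 < 1 := by
  have := Real.sqrt_nonneg (1 - 4 * w 0 ^ 2 * w 1 ^ 2)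
  rw [mul_pow, pillowRadius_sq, div_mul_eq_mul_div, div_lt_one (by positivity)]
  rfl

theorem torusPt_mem_pillowOpen_iff {a b c d : ℝ} {u : R3} {y : Fin n → R3}
    (h : IsTorusRep a b c d u y) :
    pillowProj (torusPt θ a b c d u y) ∈ pillowOpen ↔ b ≠ 0 := by
  have h1 := congrArg (fun v : R3 => v 0) (pillowRadius_smul_proj (θ := θ) h)
  simp only [PiLp.smul_apply, smul_eq_mul, PiLp.toLp_apply, Matrix.cons_val] at h1
  rw [mem_pillowOpen_iff, h1]
  have h2 := h.ab
  constructor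
  · rintro h3 rfl; nlinarith
  · intro hb
    have : 0 < b ^ 2 := by positivity
    linarith

/-- The equation of the pillow in radial coordinates. -/
theorem pillow_equation {w : R3} (hw : w ∈ Metric.sphere (0 : R3) 1 \ punctures) :
    (pillowRadius w * w 2) ^ 2 =
      (1 - (pillowRadius w * w 0) ^ 2) * (1 - (pillowRadius w * w 1) ^ 2) := by
  have h1 : w 0 ^ 2 + w 1 ^ 2 + w 2 ^ 2 = 1 := by
    rw [← norm_sq_R3, mem_sphere_zero_iff_norm.1 hw.1, one_pow]
  have h2 := Real.sq_sqrt (disc_pos hw).le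
  have h3 := Real.sqrt_nonneg (1 - 4 * w 0 ^ 2 * w 1 ^ 2)
  have h4 : pillowRadius w ^ 2 * (1 + Real.sqrt (1 - 4 * w 0 ^ 2 * w 1 ^ 2)) = 2 := by
    rw [pillowRadius_sq]; field_simp
  set T := pillowRadius w ^ 2
  set s := Real.sqrt (1 - 4 * w 0 ^ 2 * w 1 ^ 2)
  have hT : T * s = 2 - T := by linarith
  -- Equivalently T - 1 = T² w₀² w₁² for the squared radius T, which on the unit sphere is the
  -- equation of the pillow.
  have h5 : T ^ 2 * (1 - 4 * w 0 ^ 2 * w 1 ^ 2) = (2 - T) ^ 2 := by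
    rw [← h2, ← mul_pow, hT]
  rw [mul_pow, mul_pow, mul_pow]
  change T * w 2 ^ 2 = (1 - T * w 0 ^ 2) * (1 - T * w 1 ^ 2)
  rw [show w 2 ^ 2 = 1 - w 0 ^ 2 - w 1 ^ 2 by linarith]
  linarith

end DecHom


/-! ### Local trivializations over the four-punctured sphere -/

namespace DecHom

variable {n : ℕ} {θ : Fin n → ℝ}

/-- The triple (b, d, u) may be replaced by its negative without changing the point; for b ≠ 0 this
orients the axis. -/
theorem IsTorusRep.exists_pos {a b c d : ℝ} {u : R3} {y : Fin n → R3}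
    (h : IsTorusRep a b c d u y) (hb : b ≠ 0) :
    ∃ b' d' u', 0 < b' ∧ IsTorusRep a b' c d' u' y ∧
      torusPt θ a b c d u y = torusPt θ a b' c d' u' y ∧
      ((∀ i, ∃ t : ℝ, y i = t • u) ↔ ∀ i, ∃ t : ℝ, y i = t • u') := by
  rcases hb.lt_or_gt with h0 | h0
  · refine ⟨-b, -d, -u, by linarith, ⟨by rw [neg_sq]; exact h.ab, by rw [neg_sq]; exact h.cd,
      by rw [norm_neg]; exact h.norm_u, h.norm_y, fun h' => hb (neg_eq_zero.1 h'.1)⟩, ?_, ?_⟩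
    · rw [torusPt, torusPt, neg_smul_neg, neg_smul_neg]
    · refine forall_congr' fun i => ⟨?_, ?_⟩ <;> rintro ⟨t, ht⟩ <;> refine ⟨-t, ?_⟩
      · rw [neg_smul_neg, ht]
      · rw [ht, smul_neg, neg_smul]
  · exact ⟨b, d, u, h0, h, rfl, Iff.rfl⟩

/-- The trivialization of the non-central locus over `pillowOpen`. -/
def pillowTriv (θ : Fin n → ℝ) (q : Ambient 1 n) : R3 × (Fin (n + 1) → R3) :=
  (pillowProj q, Fin.cons (‖vecPart (q.1 0).1‖⁻¹ • vecPart (q.1 0).1) (ambDir θ q))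

/-- The inverse of the trivialization. -/
def pillowTrivInv (θ : Fin n → ℝ) (p : R3 × (Fin (n + 1) → R3)) : Ambient 1 n :=
  torusPt θ (pillowRadius p.1 * p.1 0) (Real.sqrt (1 - (pillowRadius p.1 * p.1 0) ^ 2))
    (pillowRadius p.1 * p.1 1)
    (pillowRadius p.1 * p.1 2 / Real.sqrt (1 - (pillowRadius p.1 * p.1 0) ^ 2))
    (p.2 0) (Fin.tail p.2)

theorem pillowTriv_torusPt (hθ : ∀ i, 0 < θ i) {a b c d : ℝ} {u : R3} {y : Fin n → R3}
    (h : IsTorusRep a b c d u y) (hb : 0 < b) :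
    pillowTriv θ (torusPt θ a b c d u y) =
      (pillowProj (torusPt θ a b c d u y), Fin.cons u y) := by
  have h1 : vecPart ((torusPt θ a b c d u y).1 0).1 = b • u := by simp [torusPt, ofDir]
  rw [pillowTriv, h1, norm_smul, h.norm_u, mul_one, Real.norm_of_nonneg hb.le,
    inv_smul_smul₀ hb.ne']
  congr 2
  exact ambDir_ofDir hθ _ _ _

/-- The base point gives a, c and bd. Taking the positive root for b determines d, and c² + d² = 1
is then the pillow equation. -/
theorem isTorusRep_base {w : R3} (hw : w ∈ Metric.sphere (0 : R3) 1 \ punctures)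
    (hU : w ∈ pillowOpen) {Y : Fin (n + 1) → R3} (hY : Y ∈ spherePow (n + 1)) :
    0 < Real.sqrt (1 - (pillowRadius w * w 0) ^ 2) ∧
    IsTorusRep (pillowRadius w * w 0) (Real.sqrt (1 - (pillowRadius w * w 0) ^ 2))
      (pillowRadius w * w 1)
      (pillowRadius w * w 2 / Real.sqrt (1 - (pillowRadius w * w 0) ^ 2)) (Y 0) (Fin.tail Y) := by
  have h1 : 0 < 1 - (pillowRadius w * w 0) ^ 2 := sub_pos.2 (mem_pillowOpen_iff.1 hU)
  have h2 := Real.sqrt_pos.2 h1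
  refine ⟨h2, ?_, ?_, mem_spherePow.1 hY 0, fun i => mem_spherePow.1 hY _, fun h => h2.ne' h.1⟩
  · rw [Real.sq_sqrt h1.le]; ring
  · rw [div_pow, Real.sq_sqrt h1.le, pillow_equation hw, mul_div_cancel_left₀ _ h1.ne']
    ring

theorem pillowProj_trivInv {w : R3} (hw : w ∈ Metric.sphere (0 : R3) 1 \ punctures)
    (hU : w ∈ pillowOpen) {Y : Fin (n + 1) → R3} (hY : Y ∈ spherePow (n + 1)) :
    pillowProj (pillowTrivInv θ (w, Y)) = w := by
  obtain ⟨hb, h⟩ := isTorusRep_base hw hU hY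
  have h1 : pillow (pillowTrivInv θ (w, Y)) = pillowRadius w • w := by
    rw [pillowTrivInv, pillow_torusPt h, mul_div_cancel₀ _ hb.ne']
    ext i; fin_cases i <;> rfl
  rw [pillowProj, h1, norm_smul, mem_sphere_zero_iff_norm.1 hw.1, mul_one,
    Real.norm_of_nonneg (pillowRadius_pos w).le, inv_smul_smul₀ (pillowRadius_pos w).ne']

theorem pillowTriv_trivInv (hθ : ∀ i, 0 < θ i) {w : R3}
    (hw : w ∈ Metric.sphere (0 : R3) 1 \ punctures)
    (hU : w ∈ pillowOpen) {Y : Fin (n + 1) → R3} (hY : Y ∈ spherePow (n + 1)) :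
    pillowTriv θ (pillowTrivInv θ (w, Y)) = (w, Y) := by
  obtain ⟨hb, h⟩ := isTorusRep_base hw hU hY
  have h1 := pillowTriv_torusPt hθ h hb
  have h2 := pillowProj_trivInv (θ := θ) hw hU hY
  rw [pillowTrivInv] at h2 ⊢
  rw [h1, h2]
  congr 1
  exact Fin.cons_self_tail Y

theorem pillowTrivInv_triv (hθ : ∀ i, 0 < θ i) {a b c d : ℝ} {u : R3} {y : Fin n → R3}
    (h : IsTorusRep a b c d u y) (hb : 0 < b) :
    pillowTrivInv θ (pillowTriv θ (torusPt θ a b c d u y)) = torusPt θ a b c d u y := by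
  have h1 := pillowRadius_smul_proj (θ := θ) h
  rw [pillowTriv_torusPt hθ h hb, pillowTrivInv]
  set w := pillowProj (torusPt θ a b c d u y)
  have e0 : pillowRadius w * w 0 = a := congrArg (fun v : R3 => v 0) h1
  have e1 : pillowRadius w * w 1 = c := congrArg (fun v : R3 => v 1) h1
  have e2 : pillowRadius w * w 2 = b * d := congrArg (fun v : R3 => v 2) h1
  have e3 : Real.sqrt (1 - a ^ 2) = b := by
    rw [show 1 - a ^ 2 = b ^ 2 by linarith [h.ab], Real.sqrt_sq hb.le]
  simp only [e0, e1, e2, e3, mul_div_cancel_left₀ _ hb.ne', Fin.cons_zero, Fin.tail_cons]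

theorem contDiffAt_pillow (q : Ambient 1 n) : ContDiffAt ℝ ω (pillow (n := n)) q := by
  unfold pillow
  apply contDiffAt_vec3 <;> fun_prop

theorem contDiffAt_pillowProj {q : Ambient 1 n} (h : pillow q ≠ 0) :
    ContDiffAt ℝ ω (pillowProj (n := n)) q := by
  have h1 := contDiffAt_pillow q
  have h2 := norm_ne_zero_iff.2 h
  unfold pillowProj
  exact ((h1.norm ℝ h).inv h2).smul h1

theorem contDiffAt_pillowTriv {q : Ambient 1 n} (h : pillow q ≠ 0)
    (h' : vecPart (q.1 0).1 ≠ 0) : ContDiffAt ℝ ω (pillowTriv θ) q := by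
  have h3 : ContDiffAt ℝ ω (fun q : Ambient 1 n => vecPart (q.1 0).1) q := by fun_prop
  have h2 := norm_ne_zero_iff.2 h'
  refine (contDiffAt_pillowProj h).prodMk (contDiffAt_pi.2 fun i => ?_)
  refine Fin.cases ?_ (fun i => ?_) i
  · exact ((h3.norm ℝ h').inv h2).smul h3
  · exact contDiffAt_pi.1 ((isLinearMap_ambDir θ).contDiffAt q) i

theorem contDiffAt_pillowRadius {w : R3} (h : 0 < 1 - 4 * w 0 ^ 2 * w 1 ^ 2) :
    ContDiffAt ℝ ω pillowRadius w := by
  have h1 : ContDiffAt ℝ ω (fun w : R3 => 1 - 4 * w 0 ^ 2 * w 1 ^ 2) w := by fun_prop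
  have h2 : ContDiffAt ℝ ω (fun w : R3 => Real.sqrt (1 - 4 * w 0 ^ 2 * w 1 ^ 2)) w :=
    (Real.contDiffAt_sqrt h.ne').comp w h1
  have h3 := Real.sqrt_nonneg (1 - 4 * w 0 ^ 2 * w 1 ^ 2)
  have h4 : ContDiffAt ℝ ω (fun w : R3 => 2 / (1 + Real.sqrt (1 - 4 * w 0 ^ 2 * w 1 ^ 2))) w :=
    contDiffAt_const.div (contDiffAt_const.add h2) (by positivity)
  exact (Real.contDiffAt_sqrt (by positivity)).comp w h4

theorem contDiffAt_ofDir {E : Type*} [NormedAddCommGroup E] [NormedSpace ℝ E] {p : E}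
    {A B : E → Mat2} {y : E → Fin n → R3} (hA : ContDiffAt ℝ ω A p) (hB : ContDiffAt ℝ ω B p)
    (hy : ContDiffAt ℝ ω y p) : ContDiffAt ℝ ω (fun q => ofDir θ (A q) (B q) (y q)) p :=
  ContDiffAt.comp (g := fun q : (Mat2 × Mat2) × (Fin n → R3) => ofDir θ q.1.1 q.1.2 q.2) p
    ((isLinearMap_ofDir θ).contDiffAt ((A p, B p), y p)) ((hA.prodMk hB).prodMk hy)

theorem contDiffAt_pillowTrivInv {p : R3 × (Fin (n + 1) → R3)}
    (h : 0 < 1 - 4 * p.1 0 ^ 2 * p.1 1 ^ 2) (h' : 0 < 1 - (pillowRadius p.1 * p.1 0) ^ 2) :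
    ContDiffAt ℝ ω (pillowTrivInv θ) p := by
  have h1 : ContDiffAt ℝ ω (fun p : R3 × (Fin (n + 1) → R3) => pillowRadius p.1) p :=
    (contDiffAt_pillowRadius h).comp p contDiffAt_fst
  have h2 : ContDiffAt ℝ ω
      (fun p : R3 × (Fin (n + 1) → R3) => 1 - (pillowRadius p.1 * p.1 0) ^ 2) p := by fun_prop
  have h3 : ContDiffAt ℝ ω
      (fun p : R3 × (Fin (n + 1) → R3) => Real.sqrt (1 - (pillowRadius p.1 * p.1 0) ^ 2)) p :=
    (Real.contDiffAt_sqrt h'.ne').comp p h2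
  have h4 := (Real.sqrt_pos.2 h').ne'
  have h5 : ContDiffAt ℝ ω (fun p : R3 × (Fin (n + 1) → R3) =>
      pillowRadius p.1 * p.1 2 / Real.sqrt (1 - (pillowRadius p.1 * p.1 0) ^ 2)) p :=
    ContDiffAt.div (by fun_prop) h3 h4
  unfold pillowTrivInv torusPt
  refine contDiffAt_ofDir ?_ ?_ ?_
  · fun_prop
  · fun_prop
  · rw [contDiffAt_pi]; intro i; unfold Fin.tail; fun_prop

/-- A trivialization over `U` of the pair of the non-central locus and its elementary part. -/
def HasPillowTriv (θ : Fin n → ℝ) (U : Set R3) : Prop :=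
  ∃ Φ : Ambient 1 n → R3 × (Fin (n + 1) → R3),
    IsAnalyticIso Φ (locus {x ∈ (rel 1 θ : Set (DecHom 1 n)) | ¬ x.IsCentral} ∩ pillowProj ⁻¹' U)
      (((Metric.sphere (0 : R3) 1 \ punctures) ∩ U) ×ˢ spherePow (n + 1)) ∧
    (∀ z ∈ locus {x ∈ (rel 1 θ : Set (DecHom 1 n)) | ¬ x.IsCentral} ∩ pillowProj ⁻¹' U,
      (Φ z).1 = pillowProj z) ∧
    Φ '' (locus {x ∈ (rel 1 θ : Set (DecHom 1 n)) | ¬ x.IsCentral ∧ x.IsElementary} ∩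
      pillowProj ⁻¹' U) = ((Metric.sphere (0 : R3) 1 \ punctures) ∩ U) ×ˢ coaxPow (n + 1)

section

variable (hθ : ∀ i, 0 < θ i) {cθ : Fin n → ℤ} (hc : ∀ i, θ i = cθ i) (he : Even (∑ i, (cθ i - 1)))
include hθ hc he

theorem exists_torusRep_pos {q : Ambient 1 n}
    (hq : q ∈ locus {x ∈ (rel 1 θ : Set (DecHom 1 n)) | ¬ x.IsCentral})
    (hU : pillowProj q ∈ pillowOpen) :
    ∃ a b c d u y, 0 < b ∧ IsTorusRep a b c d u y ∧ q = torusPt θ a b c d u y := by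
  obtain ⟨a, b, c, d, u, y, h, rfl⟩ := (mem_noncentral_iff hθ hc he).1 hq
  obtain ⟨b', d', u', h1, h2, h3, -⟩ :=
    h.exists_pos (θ := θ) ((torusPt_mem_pillowOpen_iff h).1 hU)
  exact ⟨a, b', c, d', u', y, h1, h2, h3⟩

theorem noncentral_elementary_subset :
    locus {x ∈ (rel 1 θ : Set (DecHom 1 n)) | ¬ x.IsCentral ∧ x.IsElementary} ⊆
      locus {x ∈ (rel 1 θ : Set (DecHom 1 n)) | ¬ x.IsCentral} :=
  Set.image_mono fun _ h => ⟨h.1, h.2.1⟩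

/-- Where b ≠ 0, the axis oriented by b > 0 is the normalized vector part of the first matrix, an
analytic function. Together with the directions it forms the fiber coordinate, and directions
parallel to the axis correspond to a coaxial (n+1)-tuple. -/
theorem hasPillowTriv : HasPillowTriv θ pillowOpen := by
  refine ⟨pillowTriv θ, ⟨?_, ?_, pillowTrivInv θ, ?_, ?_, ?_, ?_⟩, fun _ _ => rfl, ?_⟩
  · refine analyticOn_of_contDiffAt ?_
    rintro q ⟨hq, hU⟩
    obtain ⟨a, b, c, d, u, y, hb, h, rfl⟩ := exists_torusRep_pos hθ hc he hq hU
    refine contDiffAt_pillowTriv (pillow_ne_zero h) ?_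
    have h1 : vecPart ((torusPt θ a b c d u y).1 0).1 = b • u := by simp [torusPt, ofDir]
    rw [h1]
    refine smul_ne_zero hb.ne' fun h0 => ?_
    have := h.norm_u
    simp [h0] at this
  · rintro q ⟨hq, hU⟩
    obtain ⟨a, b, c, d, u, y, hb, h, rfl⟩ := exists_torusRep_pos hθ hc he hq hU
    rw [pillowTriv_torusPt hθ h hb]
    refine ⟨⟨pillowProj_mem h, hU⟩, mem_spherePow.2 (Fin.cases h.norm_u h.norm_y)⟩
  · refine analyticOn_of_contDiffAt ?_
    rintro ⟨w, Y⟩ ⟨⟨hw, hU⟩, hY⟩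
    exact contDiffAt_pillowTrivInv (disc_pos hw) (sub_pos.2 (mem_pillowOpen_iff.1 hU))
  · rintro ⟨w, Y⟩ ⟨⟨hw, hU⟩, hY⟩
    refine ⟨(mem_noncentral_iff hθ hc he).2 ⟨_, _, _, _, _, _, (isTorusRep_base hw hU hY).2, rfl⟩, ?_⟩
    rw [Set.mem_preimage, pillowProj_trivInv hw hU hY]
    exact hU
  · rintro q ⟨hq, hU⟩
    obtain ⟨a, b, c, d, u, y, hb, h, rfl⟩ := exists_torusRep_pos hθ hc he hq hU
    exact pillowTrivInv_triv hθ h hb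
  · rintro ⟨w, Y⟩ ⟨⟨hw, hU⟩, hY⟩
    exact pillowTriv_trivInv hθ hw hU hY
  · apply Set.Subset.antisymm
    · rintro _ ⟨q, ⟨hq, hU⟩, rfl⟩
      obtain ⟨a, b, c, d, u, y, hb, h, rfl⟩ :=
        exists_torusRep_pos hθ hc he (noncentral_elementary_subset hθ hc he hq) hU
      have hel := (torusPt_mem_elementary_iff hθ hc he h).1 hq
      rw [pillowTriv_torusPt hθ h hb]
      refine ⟨⟨pillowProj_mem h, hU⟩, mem_coaxPow.2 ⟨Fin.cases h.norm_u h.norm_y, u, h.norm_u, ?_⟩⟩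
      exact Fin.cases ⟨1, (one_smul _ _).symm⟩ hel
    · rintro ⟨w, Y⟩ ⟨⟨hw, hU⟩, hY⟩
      replace hY : Y ∈ coaxPow (n + 1) := hY
      have hY' : Y ∈ spherePow (n + 1) := hY.1
      obtain ⟨hb, h⟩ := isTorusRep_base hw hU hY'
      refine ⟨pillowTrivInv θ (w, Y), ⟨?_, ?_⟩, pillowTriv_trivInv hθ hw hU hY'⟩
      · refine (torusPt_mem_elementary_iff hθ hc he h).2 fun i => ?_
        obtain ⟨h1, v, hv, h2⟩ := mem_coaxPow.1 hY
        obtain ⟨s, hs⟩ := h2 0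
        obtain ⟨t, ht⟩ := h2 i.succ
        have hs0 : s ≠ 0 := by
          rintro rfl
          have := h1 0
          rw [hs, zero_smul, norm_zero] at this
          exact zero_ne_one this
        refine ⟨t * s⁻¹, ?_⟩
        change Y i.succ = (t * s⁻¹) • Y 0
        rw [ht, hs, mul_smul, inv_smul_smul₀ hs0]
      · rw [Set.mem_preimage, pillowProj_trivInv hw hU hY']
        exact hU

end

/-- Exchange of the two monodromy matrices. -/
def swapMono (q : Ambient 1 n) : Ambient 1 n := (fun j => (q.1 j).swap, q.2)

/-- Exchange of the first two coordinates. -/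
def swapR3 (w : R3) : R3 := !₂[w 1, w 0, w 2]

theorem swapR3_swapR3 (w : R3) : swapR3 (swapR3 w) = w := by
  ext i; fin_cases i <;> rfl

theorem norm_swapR3 (w : R3) : ‖swapR3 w‖ = ‖w‖ := by
  have : ‖swapR3 w‖ ^ 2 = ‖w‖ ^ 2 := by
    rw [norm_sq_R3, norm_sq_R3]
    simp only [swapR3, PiLp.toLp_apply, Matrix.cons_val]
    ring
  exact (sq_eq_sq₀ (norm_nonneg _) (norm_nonneg _)).1 this

theorem contDiffAt_swapR3 (w : R3) : ContDiffAt ℝ ω swapR3 w := by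
  unfold swapR3
  apply contDiffAt_vec3 <;> fun_prop

theorem contDiffAt_swapMono (q : Ambient 1 n) : ContDiffAt ℝ ω (swapMono (n := n)) q := by
  unfold swapMono Prod.swap
  refine ContDiffAt.prodMk (contDiffAt_pi.2 fun j => ?_) (by fun_prop)
  fun_prop

theorem pillowProj_swapMono (q : Ambient 1 n) : pillowProj (swapMono q) = swapR3 (pillowProj q) := by
  have h : pillow (swapMono q) = swapR3 (pillow q) := by
    ext i
    fin_cases i
    · rfl
    · rfl
    · exact real_inner_comm _ _
  rw [pillowProj, h, norm_swapR3]
  ext i; fin_cases i <;> rfl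

theorem swapR3_mem_base {w : R3} (hw : w ∈ Metric.sphere (0 : R3) 1 \ punctures) :
    swapR3 w ∈ Metric.sphere (0 : R3) 1 \ punctures := by
  refine ⟨?_, ?_⟩
  · rw [mem_sphere_zero_iff_norm, norm_swapR3]
    exact mem_sphere_zero_iff_norm.1 hw.1
  · rintro ⟨⟨s, t⟩, ⟨hs, ht⟩, hst⟩
    refine hw.2 ⟨(t, s), ⟨ht, hs⟩, ?_⟩
    rw [← swapR3_swapR3 w, ← hst]
    rfl

theorem IsTorusRep.swap {a b c d : ℝ} {u : R3} {y : Fin n → R3} (h : IsTorusRep a b c d u y) :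
    IsTorusRep c d a b u y := ⟨h.cd, h.ab, h.norm_u, h.norm_y, fun h' => h.ne h'.symm⟩

section

variable (hθ : ∀ i, 0 < θ i) {cθ : Fin n → ℤ} (hc : ∀ i, θ i = cθ i) (he : Even (∑ i, (cθ i - 1)))
include hθ hc he

theorem swapMono_mem_noncentral {q : Ambient 1 n}
    (hq : q ∈ locus {x ∈ (rel 1 θ : Set (DecHom 1 n)) | ¬ x.IsCentral}) :
    swapMono q ∈ locus {x ∈ (rel 1 θ : Set (DecHom 1 n)) | ¬ x.IsCentral} := by
  rw [mem_noncentral_iff hθ hc he] at hq ⊢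
  obtain ⟨a, b, c, d, u, y, h, rfl⟩ := hq
  exact ⟨c, d, a, b, u, y, h.swap, rfl⟩

theorem swapMono_mem_elementary {q : Ambient 1 n}
    (hq : q ∈ locus {x ∈ (rel 1 θ : Set (DecHom 1 n)) | ¬ x.IsCentral ∧ x.IsElementary}) :
    swapMono q ∈ locus {x ∈ (rel 1 θ : Set (DecHom 1 n)) | ¬ x.IsCentral ∧ x.IsElementary} := by
  obtain ⟨a, b, c, d, u, y, h, rfl⟩ :=
    (mem_noncentral_iff hθ hc he).1 (noncentral_elementary_subset hθ hc he hq)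
  rw [torusPt_mem_elementary_iff hθ hc he h] at hq
  exact (torusPt_mem_elementary_iff hθ hc he h.swap).2 hq

/-- The two monodromy matrices play symmetric roles. Conjugating a trivialization by their exchange
covers the points where the first matrix is central. -/
theorem HasPillowTriv.swap {U : Set R3} (hU : HasPillowTriv θ U) :
    HasPillowTriv θ (swapR3 ⁻¹' U) := by
  obtain ⟨Φ, ⟨hΦ, hm, Ψ, hΨ, hmΨ, hi⟩, hp, hel⟩ := hU
  have hE : Set.MapsTo swapMono
      (locus {x ∈ (rel 1 θ : Set (DecHom 1 n)) | ¬ x.IsCentral} ∩ pillowProj ⁻¹' (swapR3 ⁻¹' U))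
      (locus {x ∈ (rel 1 θ : Set (DecHom 1 n)) | ¬ x.IsCentral} ∩ pillowProj ⁻¹' U) :=
    fun q hq => ⟨swapMono_mem_noncentral hθ hc he hq.1, by
      rw [Set.mem_preimage, pillowProj_swapMono]; exact hq.2⟩
  have hE' : Set.MapsTo swapMono
      (locus {x ∈ (rel 1 θ : Set (DecHom 1 n)) | ¬ x.IsCentral} ∩ pillowProj ⁻¹' U)
      (locus {x ∈ (rel 1 θ : Set (DecHom 1 n)) | ¬ x.IsCentral} ∩
        pillowProj ⁻¹' (swapR3 ⁻¹' U)) :=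
    fun q hq => ⟨swapMono_mem_noncentral hθ hc he hq.1, by
      rw [Set.mem_preimage, pillowProj_swapMono, Set.mem_preimage, swapR3_swapR3]; exact hq.2⟩
  let S : R3 × (Fin (n + 1) → R3) → R3 × (Fin (n + 1) → R3) := fun p => (swapR3 p.1, p.2)
  have hS : ∀ p, ContDiffAt ℝ ω S p := fun p =>
    ((contDiffAt_swapR3 _).comp p contDiffAt_fst).prodMk contDiffAt_snd
  have hSS : ∀ p, S (S p) = p := fun p => Prod.ext (swapR3_swapR3 _) rfl
  have hm1 : ∀ K : Set (Fin (n + 1) → R3), Set.MapsTo S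
      (((Metric.sphere (0 : R3) 1 \ punctures) ∩ U) ×ˢ K)
      (((Metric.sphere (0 : R3) 1 \ punctures) ∩ swapR3 ⁻¹' U) ×ˢ K) :=
    fun K p hp => ⟨⟨swapR3_mem_base hp.1.1, by
      rw [Set.mem_preimage, swapR3_swapR3]; exact hp.1.2⟩, hp.2⟩
  have hm2 : ∀ K : Set (Fin (n + 1) → R3), Set.MapsTo S
      (((Metric.sphere (0 : R3) 1 \ punctures) ∩ swapR3 ⁻¹' U) ×ˢ K)
      (((Metric.sphere (0 : R3) 1 \ punctures) ∩ U) ×ˢ K) :=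
    fun K p hp => ⟨⟨swapR3_mem_base hp.1.1, hp.1.2⟩, hp.2⟩
  have hswap : ∀ q : Ambient 1 n, swapMono (swapMono q) = q := fun q => rfl
  have aE : ∀ T : Set (Ambient 1 n), AnalyticOn ℝ swapMono T :=
    fun T => analyticOn_of_contDiffAt fun p _ => contDiffAt_swapMono p
  have aS : ∀ T, AnalyticOn ℝ S T := fun T => analyticOn_of_contDiffAt fun p _ => hS p
  refine ⟨S ∘ Φ ∘ swapMono, ⟨?_, ?_, swapMono ∘ Ψ ∘ S, ?_, ?_, ?_, ?_⟩, ?_, ?_⟩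
  · exact (aS Set.univ).comp (hΦ.comp (aE _) hE) (Set.mapsTo_univ _ _)
  · exact (hm1 _).comp (hm.comp hE)
  · exact (aE Set.univ).comp (hΨ.comp (aS _) (hm2 _)) (Set.mapsTo_univ _ _)
  · exact hE'.comp (hmΨ.comp (hm2 _))
  · intro q hq
    simp only [Function.comp]
    rw [hSS, hi.1 (hE hq), hswap]
  · intro p hp
    simp only [Function.comp]
    rw [hswap, hi.2 (hm2 _ hp), hSS]
  · intro q hq
    change swapR3 (Φ (swapMono q)).1 = _
    rw [hp _ (hE hq), pillowProj_swapMono, swapR3_swapR3]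
  · apply Set.Subset.antisymm
    · rintro _ ⟨q, hq, rfl⟩
      refine hm1 _ (hel ▸ ⟨swapMono q, ⟨swapMono_mem_elementary hθ hc he hq.1, ?_⟩, rfl⟩)
      rw [Set.mem_preimage, pillowProj_swapMono]; exact hq.2
    · intro p hp
      have hp' := hm2 _ hp
      rw [← hel] at hp'
      obtain ⟨q, hq, hqp⟩ := hp'
      refine ⟨swapMono q, ⟨swapMono_mem_elementary hθ hc he hq.1, ?_⟩, ?_⟩
      · rw [Set.mem_preimage, pillowProj_swapMono, Set.mem_preimage, swapR3_swapR3]; exact hq.2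
      · simp only [Function.comp]
        rw [hswap, hqp, hSS]

omit hθ hc he in
-- If both conditions failed, adding them would give 2(w₀² + w₁²) > 2, by positivity of the
-- discriminant.
theorem mem_pillowOpen_or {w : R3} (hw : w ∈ Metric.sphere (0 : R3) 1 \ punctures) :
    w ∈ pillowOpen ∨ swapR3 w ∈ pillowOpen := by
  have h2 := Real.sq_sqrt (disc_pos hw).le
  have h3 := Real.sqrt_pos.2 (disc_pos hw)
  have e : 1 - 4 * w 1 ^ 2 * w 0 ^ 2 = 1 - 4 * w 0 ^ 2 * w 1 ^ 2 := by ring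
  by_contra h
  rw [not_or] at h
  have h4 : ¬ (2 * w 0 ^ 2 < 1 + Real.sqrt (1 - 4 * w 0 ^ 2 * w 1 ^ 2)) := h.1
  have h5 : ¬ (2 * w 1 ^ 2 < 1 + Real.sqrt (1 - 4 * w 1 ^ 2 * w 0 ^ 2)) := h.2
  rw [e] at h5
  push Not at h4 h5
  have h1 : w 0 ^ 2 + w 1 ^ 2 + w 2 ^ 2 = 1 := by
    rw [← norm_sq_R3, mem_sphere_zero_iff_norm.1 hw.1, one_pow]
  nlinarith [sq_nonneg (w 2)]

theorem noncentral_bundle_genus_one :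
    ∃ P ⊆ Metric.sphere (0 : EuclideanSpace ℝ (Fin 3)) 1, P.ncard = 4 ∧
      IsAnalyticBundlePair
        (DecHom.locus {x ∈ (DecHom.rel 1 θ : Set (DecHom 1 n)) | ¬ x.IsCentral})
        (DecHom.locus {x ∈ (DecHom.rel 1 θ : Set (DecHom 1 n)) | ¬ x.IsCentral ∧ x.IsElementary})
        (Metric.sphere (0 : EuclideanSpace ℝ (Fin 3)) 1 \ P)
        (spherePow (n + 1)) (coaxPow (n + 1)) := by
  refine ⟨punctures, punctures_subset, ncard_punctures,
    noncentral_elementary_subset hθ hc he, fun y hy => hy.1, pillowProj, ?_, fun w hw => ?_⟩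
  · intro q hq
    obtain ⟨a, b, c, d, u, y, h, rfl⟩ := (mem_noncentral_iff hθ hc he).1 hq
    exact pillowProj_mem h
  · rcases mem_pillowOpen_or hw with h | h
    · exact ⟨pillowOpen, isOpen_pillowOpen, h, hasPillowTriv hθ hc he⟩
    · refine ⟨swapR3 ⁻¹' pillowOpen, isOpen_pillowOpen.preimage ?_, h,
        (hasPillowTriv hθ hc he).swap hθ hc he⟩
      exact continuous_iff_continuousAt.2 fun w => (contDiffAt_swapR3 w).continuousAt

end

end DecHom

/-! ### Analytic atlases on quotients -/

section QuotientAtlas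

variable {E : Type*} [NormedAddCommGroup E] [NormedSpace ℝ E] {X Q : Type*} [TopologicalSpace X]
  [TopologicalSpace Q] {c : X → E} {π : X → Q} {d : ℕ}

/-- A chart of the quotient of `X`: a local analytic parametrization by elements of `X` together
with an invariant analytic coordinate map. -/
structure QuotChart (c : X → E) (π : X → Q) (d : ℕ) where
  param : EuclideanSpace ℝ (Fin d) → X
  dom : Set (EuclideanSpace ℝ (Fin d))
  coord : E → EuclideanSpace ℝ (Fin d)
  range : Set X
  isOpen_dom : IsOpen dom
  isOpen_range : IsOpen range
  analyticAt_param : ∀ z ∈ dom, AnalyticAt ℝ (fun z => c (param z)) z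
  analyticOn_coord : AnalyticOn ℝ coord (c '' range)
  param_mem : ∀ z ∈ dom, param z ∈ range
  coord_mem : ∀ x ∈ range, coord (c x) ∈ dom
  coord_param : ∀ z ∈ dom, coord (c (param z)) = z
  param_coord : ∀ x ∈ range, π (param (coord (c x))) = π x
  saturated : ∀ x ∈ range, ∀ x', π x' = π x → x' ∈ range ∧ coord (c x') = coord (c x)

namespace QuotChart

variable (hc : Topology.IsInducing c) (hπ : IsOpenQuotientMap π) (e e' : QuotChart c π d)

theorem mem_range_of_image {x : X} (hx : π x ∈ π '' e.range) : x ∈ e.range := by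
  obtain ⟨x', hx', h⟩ := hx
  exact (e.saturated x' hx' x h.symm).1

include hc in
theorem continuousOn_param : ContinuousOn e.param e.dom := fun z hz =>
  ((hc.continuousAt_iff).2 (e.analyticAt_param z hz).continuousAt).continuousWithinAt

/-- The chart as a partial homeomorphism of the quotient. -/
def toChart : OpenPartialHomeomorph Q (EuclideanSpace ℝ (Fin d)) where
  toFun q := e.coord (c (Function.surjInv hπ.surjective q))
  invFun z := π (e.param z)
  source := π '' e.range
  target := e.dom
  map_source' := by
    rintro q hq
    refine e.coord_mem _ (e.mem_range_of_image ?_)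
    rwa [Function.surjInv_eq hπ.surjective]
  map_target' z hz := ⟨_, e.param_mem z hz, rfl⟩
  left_inv' := by
    rintro q hq
    have h : Function.surjInv hπ.surjective q ∈ e.range :=
      e.mem_range_of_image (by rwa [Function.surjInv_eq hπ.surjective])
    rw [e.param_coord _ h, Function.surjInv_eq hπ.surjective]
  right_inv' z hz := by
    rw [(e.saturated _ (e.param_mem z hz) _ (Function.surjInv_eq hπ.surjective _)).2,
      e.coord_param z hz]
  open_source := hπ.isOpenMap _ e.isOpen_range
  open_target := e.isOpen_dom
  continuousOn_toFun := by
    rw [(hπ.isOpenMap _ e.isOpen_range).continuousOn_iff]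
    rintro _ ⟨x, hx, rfl⟩
    have h1 : ContinuousAt (fun x => e.coord (c x)) x := by
      have h2 : ContinuousOn (fun x => e.coord (c x)) e.range :=
        e.analyticOn_coord.continuousOn.comp hc.continuous.continuousOn (Set.mapsTo_image _ _)
      exact h2.continuousAt (e.isOpen_range.mem_nhds hx)
    -- Continuity at π(x) may be tested after composing with the open quotient map; there saturation
    -- replaces the chosen preimage by the point itself.
    have h3 : ContinuousAt
        ((fun q => e.coord (c (Function.surjInv hπ.surjective q))) ∘ π) x := by
      refine h1.congr ?_
      filter_upwards [e.isOpen_range.mem_nhds hx] with x' hx'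
      exact ((e.saturated x' hx' _ (Function.surjInv_eq hπ.surjective _)).2).symm
    exact hπ.continuousAt_comp_iff.1 h3
  continuousOn_invFun := hπ.continuous.comp_continuousOn (e.continuousOn_param hc)

theorem toChart_apply {x : X} (hx : x ∈ e.range) : e.toChart hc hπ (π x) = e.coord (c x) :=
  (e.saturated x hx _ (Function.surjInv_eq hπ.surjective _)).2

theorem transition_source {z : EuclideanSpace ℝ (Fin d)} :
    z ∈ ((e.toChart hc hπ).symm.trans (e'.toChart hc hπ)).source ↔
      z ∈ e.dom ∧ e.param z ∈ e'.range := by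
  rw [OpenPartialHomeomorph.trans_source]
  refine and_congr_right fun hz => ⟨fun h => e'.mem_range_of_image h, fun h => ⟨_, h, rfl⟩⟩

include hc in
theorem isOpen_transition : IsOpen {z | z ∈ e.dom ∧ e.param z ∈ e'.range} :=
  (e.continuousOn_param hc).isOpen_inter_preimage e.isOpen_dom e'.isOpen_range

include hc in
theorem analyticAt_transition {z : EuclideanSpace ℝ (Fin d)} (hz : z ∈ e.dom)
    (h : e.param z ∈ e'.range) : AnalyticAt ℝ (fun z => e'.coord (c (e.param z))) z := by
  have h1 : AnalyticOn ℝ (fun z => e'.coord (c (e.param z)))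
      {z | z ∈ e.dom ∧ e.param z ∈ e'.range} :=
    AnalyticOn.comp (g := fun z => c (e.param z))
      (t := {z | z ∈ e.dom ∧ e.param z ∈ e'.range}) e'.analyticOn_coord
      (fun z hz => (e.analyticAt_param z hz.1).analyticWithinAt) fun z hz => ⟨_, hz.2, rfl⟩
  exact ((e.isOpen_transition hc e').analyticOn_iff_analyticOnNhd.1 h1) z ⟨hz, h⟩

theorem transition_eventuallyEq {z : EuclideanSpace ℝ (Fin d)} (hz : z ∈ e.dom)
    (h : e.param z ∈ e'.range) :
    (fun z => e'.toChart hc hπ ((e.toChart hc hπ).symm z)) =ᶠ[𝓝 z]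
      fun z => e'.coord (c (e.param z)) := by
  filter_upwards [(e.isOpen_transition hc e').mem_nhds (show z ∈ _ from ⟨hz, h⟩)] with z hz
  exact toChart_apply hc hπ e' hz.2

end QuotChart

/-- The atlas is oriented. -/
def OrientedCharts (A : Set (QuotChart c π d)) : Prop :=
  ∀ e ∈ A, ∀ e' ∈ A, ∀ z ∈ e.dom, e.param z ∈ e'.range →
    0 < (fderiv ℝ (fun z => e'.coord (c (e.param z))) z).det

/-- A transition map is the coordinate map of one chart applied to the parametrization of another,
hence a composition of analytic maps upstairs. The same data provide the analytic projections and
sections demanded by `AtlasCompatible`. -/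
theorem exists_chartedSpace (hc : Topology.IsInducing c) (hπ : IsOpenQuotientMap π)
    (A : Set (QuotChart c π d)) (hA : ∀ x, ∃ e ∈ A, x ∈ e.range) :
    ∃ _ : ChartedSpace (EuclideanSpace ℝ (Fin d)) Q,
      IsManifold (𝓡 d) ω Q ∧ AtlasCompatible c π d ∧ (OrientedCharts A → AtlasOriented Q d) := by
  have hA' : ∀ q : Q, ∃ e ∈ A, q ∈ (e.toChart hc hπ).source := by
    intro q
    obtain ⟨x, rfl⟩ := hπ.surjective q
    obtain ⟨e, he, hx⟩ := hA x
    exact ⟨e, he, x, hx, rfl⟩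
  choose ch hch hmem using hA'
  letI inst : ChartedSpace (EuclideanSpace ℝ (Fin d)) Q :=
    { atlas := (fun e : QuotChart c π d => e.toChart hc hπ) '' A
      chartAt := fun q => (ch q).toChart hc hπ
      mem_chart_source := hmem
      chart_mem_atlas := fun q => ⟨_, hch q, rfl⟩ }
  refine ⟨inst, ?_, ?_, ?_⟩
  · refine isManifold_of_contDiffOn (𝓡 d) ω Q ?_
    rintro _ _ ⟨e, -, rfl⟩ ⟨e', -, rfl⟩
    rintro z ⟨hz, -⟩
    have hz' := (e.transition_source hc hπ e').1 hz
    exact ((e.analyticAt_transition hc e' hz'.1 hz'.2).congr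
      (e.transition_eventuallyEq hc hπ e' hz'.1 hz'.2).symm).contDiffAt.contDiffWithinAt
  · rintro _ ⟨e, -, rfl⟩
    refine ⟨⟨e.coord, ?_, fun x hx => ?_⟩, fun z hz => ⟨e.param, e.analyticAt_param z hz, ?_⟩⟩
    · refine e.analyticOn_coord.mono (Set.image_mono fun x hx => e.mem_range_of_image hx)
    · exact (e.toChart_apply hc hπ (e.mem_range_of_image hx)).symm
    · exact Filter.Eventually.of_forall fun z => rfl
  · rintro hor _ ⟨e, he, rfl⟩ _ ⟨e', he', rfl⟩ z hz
    have hz' := (e.transition_source hc hπ e').1 hz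
    rw [(e.transition_eventuallyEq hc hπ e' hz'.1 hz'.2).fderiv_eq]
    exact hor e he e' he' z hz'.1 hz'.2

end QuotientAtlas

/-! ### Transfer of charts from a model space -/

/-- A chart of the quotient of a subset `C` of a vector space by a relation `r`: a local analytic
parametrization of a slice, together with an invariant analytic coordinate map. -/
structure ModelChart (V : Type*) [NormedAddCommGroup V] [NormedSpace ℝ V]
    {W : Type*} [NormedAddCommGroup W] [NormedSpace ℝ W] (r : W → W → Prop) (C : Set W) where
  param : V → W
  dom : Set V
  coord : W → V
  range : Set W
  isOpen_dom : IsOpen dom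
  isOpen_range : IsOpen range
  contDiffAt_param : ∀ z ∈ dom, ContDiffAt ℝ ω param z
  contDiffAt_coord : ∀ w ∈ range, ContDiffAt ℝ ω coord w
  param_mem : ∀ z ∈ dom, param z ∈ C ∧ param z ∈ range
  coord_mem : ∀ w ∈ C, w ∈ range → coord w ∈ dom
  coord_param : ∀ z ∈ dom, coord (param z) = z
  param_coord : ∀ w ∈ C, w ∈ range → r (param (coord w)) w
  invariant : ∀ w ∈ C, w ∈ range → ∀ w' ∈ C, r w' w → w' ∈ range ∧ coord w' = coord w

section

variable {V V' W : Type*} [NormedAddCommGroup V] [NormedSpace ℝ V] [NormedAddCommGroup V']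
  [NormedSpace ℝ V'] [NormedAddCommGroup W] [NormedSpace ℝ W] {r : W → W → Prop} {C : Set W}

/-- Linear change of coordinates in a chart. -/
def ModelChart.map (e : ModelChart V r C) (L : V ≃L[ℝ] V') : ModelChart V' r C where
  param z := e.param (L.symm z)
  dom := L.symm ⁻¹' e.dom
  coord w := L (e.coord w)
  range := e.range
  isOpen_dom := e.isOpen_dom.preimage L.symm.continuous
  isOpen_range := e.isOpen_range
  contDiffAt_param z hz := (e.contDiffAt_param _ hz).comp z L.symm.contDiff.contDiffAt
  contDiffAt_coord w hw := L.contDiff.contDiffAt.comp w (e.contDiffAt_coord w hw)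
  param_mem z hz := e.param_mem _ hz
  coord_mem w hw hw' := by
    rw [Set.mem_preimage, L.symm_apply_apply]
    exact e.coord_mem w hw hw'
  coord_param z hz := by rw [e.coord_param _ hz, L.apply_symm_apply]
  param_coord w hw hw' := by
    rw [L.symm_apply_apply]
    exact e.param_coord w hw hw'
  invariant w hw hw' w' h hr := ⟨(e.invariant w hw hw' w' h hr).1, by
    rw [(e.invariant w hw hw' w' h hr).2]⟩

variable {E : Type*} [NormedAddCommGroup E] [NormedSpace ℝ E] {X Q : Type*} [TopologicalSpace X]
  [TopologicalSpace Q] {P : Type*} [NormedAddCommGroup P] [NormedSpace ℝ P]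

/-- An identification of an invariant open subset of `X` with a product of an open set of
parameters and the model space `C`. -/
structure ModelPatch (c : X → E) (π : X → Q) (P : Type*) [NormedAddCommGroup P] [NormedSpace ℝ P]
    (r : W → W → Prop) (C : Set W) where
  base : Set P
  source : Set X
  lift : P × W → X
  toModel : E → P × W
  ofModel : P × W → E
  isOpen_base : IsOpen base
  isOpen_source : IsOpen source
  contDiffAt_toModel : ∀ x ∈ source, ContDiffAt ℝ ω toModel (c x)
  contDiffAt_ofModel : ∀ p ∈ base, ∀ w ∈ C, ContDiffAt ℝ ω ofModel (p, w)
  lift_mem : ∀ p ∈ base, ∀ w ∈ C, lift (p, w) ∈ source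
  coe_lift : ∀ p ∈ base, ∀ w ∈ C, c (lift (p, w)) = ofModel (p, w)
  toModel_mem : ∀ x ∈ source, (toModel (c x)).1 ∈ base ∧ (toModel (c x)).2 ∈ C
  toModel_ofModel : ∀ p ∈ base, ∀ w ∈ C, toModel (ofModel (p, w)) = (p, w)
  rel_iff : ∀ x ∈ source, ∀ x', π x' = π x ↔ x' ∈ source ∧
    (toModel (c x')).1 = (toModel (c x)).1 ∧ r (toModel (c x')).2 (toModel (c x)).2

variable {c : X → E} {π : X → Q} {d : ℕ}

/-- The chart of the quotient of `X` induced by a chart of the model. -/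
def ModelPatch.quotChart (hc : Topology.IsInducing c) (T : ModelPatch c π P r C)
    (e : ModelChart V r C) (L : (P × V) ≃L[ℝ] EuclideanSpace ℝ (Fin d)) : QuotChart c π d where
  param z := T.lift ((L.symm z).1, e.param (L.symm z).2)
  dom := L.symm ⁻¹' (T.base ×ˢ e.dom)
  coord q := L ((T.toModel q).1, e.coord (T.toModel q).2)
  range := {x | x ∈ T.source ∧ (T.toModel (c x)).2 ∈ e.range}
  isOpen_dom := (T.isOpen_base.prod e.isOpen_dom).preimage L.symm.continuous
  isOpen_range := by
    refine ContinuousOn.isOpen_inter_preimage (f := fun x => (T.toModel (c x)).2) ?_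
      T.isOpen_source e.isOpen_range
    intro x hx
    exact (continuousAt_snd.comp ((T.contDiffAt_toModel x hx).continuousAt.comp
      hc.continuous.continuousAt)).continuousWithinAt
  analyticAt_param z hz := by
    have h1 : ContDiffAt ℝ ω (fun z => ((L.symm z).1, e.param (L.symm z).2)) z :=
      ContDiffAt.prodMk (contDiffAt_fst.comp z L.symm.contDiff.contDiffAt)
        ((e.contDiffAt_param _ hz.2).comp z
          (contDiffAt_snd.comp z L.symm.contDiff.contDiffAt))
    have h2 : ContDiffAt ℝ ω (fun z => T.ofModel ((L.symm z).1, e.param (L.symm z).2)) z :=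
      (T.contDiffAt_ofModel _ hz.1 _ (e.param_mem _ hz.2).1).comp z h1
    refine h2.analyticAt.congr ?_
    filter_upwards [((T.isOpen_base.prod e.isOpen_dom).preimage L.symm.continuous).mem_nhds hz]
      with z hz
    exact (T.coe_lift _ hz.1 _ (e.param_mem _ hz.2).1).symm
  analyticOn_coord := by
    refine analyticOn_of_contDiffAt ?_
    rintro _ ⟨x, ⟨hx, hx'⟩, rfl⟩
    have h1 := T.contDiffAt_toModel x hx
    exact L.contDiff.contDiffAt.comp _ (ContDiffAt.prodMk h1.fst
      (ContDiffAt.comp (f := fun q => (T.toModel q).2) _ (e.contDiffAt_coord _ hx') h1.snd))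
  param_mem z hz := by
    have h := (e.param_mem _ hz.2)
    refine ⟨T.lift_mem _ hz.1 _ h.1, ?_⟩
    rw [T.coe_lift _ hz.1 _ h.1, T.toModel_ofModel _ hz.1 _ h.1]
    exact h.2
  coord_mem x hx := by
    rw [Set.mem_preimage, L.symm_apply_apply]
    exact ⟨(T.toModel_mem x hx.1).1, e.coord_mem _ (T.toModel_mem x hx.1).2 hx.2⟩
  coord_param z hz := by
    have h := (e.param_mem _ hz.2)
    rw [T.coe_lift _ hz.1 _ h.1, T.toModel_ofModel _ hz.1 _ h.1, e.coord_param _ hz.2]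
    exact L.apply_symm_apply z
  param_coord x hx := by
    have h1 := T.toModel_mem x hx.1
    have h2 := e.coord_mem _ h1.2 hx.2
    have h3 := e.param_mem _ h2
    simp only [L.symm_apply_apply]
    refine (T.rel_iff x hx.1 _).2 ⟨T.lift_mem _ h1.1 _ h3.1, ?_⟩
    rw [T.coe_lift _ h1.1 _ h3.1, T.toModel_ofModel _ h1.1 _ h3.1]
    exact ⟨rfl, e.param_coord _ h1.2 hx.2⟩
  saturated x hx x' h := by
    obtain ⟨h1, h2, h3⟩ := (T.rel_iff x hx.1 x').1 h
    obtain ⟨h4, h5⟩ := e.invariant _ (T.toModel_mem x hx.1).2 hx.2 _ (T.toModel_mem x' h1).2 h3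
    exact ⟨⟨h1, h4⟩, by rw [h2, h5]⟩

theorem ModelPatch.mem_quotChart_range (hc : Topology.IsInducing c) (T : ModelPatch c π P r C)
    (e : ModelChart V r C) (L : (P × V) ≃L[ℝ] EuclideanSpace ℝ (Fin d)) {x : X}
    (hx : x ∈ T.source) (h : (T.toModel (c x)).2 ∈ e.range) :
    x ∈ (T.quotChart hc e L).range := ⟨hx, h⟩

/-- Within one patch the parameters in P are untouched, so orientation questions reduce to
transitions of the model. -/
theorem ModelPatch.quotChart_transition (hc : Topology.IsInducing c) (T : ModelPatch c π P r C)
    (e e' : ModelChart V r C) (L : (P × V) ≃L[ℝ] EuclideanSpace ℝ (Fin d))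
    {z : EuclideanSpace ℝ (Fin d)} (hz : z ∈ (T.quotChart hc e L).dom) :
    (T.quotChart hc e' L).coord (c ((T.quotChart hc e L).param z)) =
      L ((L.symm z).1, e'.coord (e.param (L.symm z).2)) ∧
    ((T.quotChart hc e L).param z ∈ (T.quotChart hc e' L).range →
      e.param (L.symm z).2 ∈ e'.range) := by
  have h := (e.param_mem _ hz.2)
  have h1 : T.toModel (c ((T.quotChart hc e L).param z)) =
      ((L.symm z).1, e.param (L.symm z).2) := by
    rw [← T.toModel_ofModel _ hz.1 _ h.1, ← T.coe_lift _ hz.1 _ h.1]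
    rfl
  refine ⟨?_, fun h2 => ?_⟩
  · change L ((T.toModel _).1, e'.coord (T.toModel _).2) = _
    rw [h1]
  · have h3 := h2.2
    rw [h1] at h3
    exact h3

end

/-! ### Charts on configurations of points on the sphere -/

/-- Stereographic projection from the direction of `(ε, 0, 0)`, extended to be homogeneous. -/
def stereo (ε : ℝ) (z : R3) : ℝ × ℝ := (z 1 / (‖z‖ - ε * z 0), z 2 / (‖z‖ - ε * z 0))

/-- The inverse of the stereographic projection. -/
def stereoInv (ε : ℝ) (v : ℝ × ℝ) : R3 :=
  !₂[ε * (v.1 ^ 2 + v.2 ^ 2 - 1) / (v.1 ^ 2 + v.2 ^ 2 + 1), 2 * v.1 / (v.1 ^ 2 + v.2 ^ 2 + 1),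
    2 * v.2 / (v.1 ^ 2 + v.2 ^ 2 + 1)]

theorem norm_stereoInv {ε : ℝ} (hε : ε ^ 2 = 1) (v : ℝ × ℝ) : ‖stereoInv ε v‖ = 1 := by
  have h1 : 0 < v.1 ^ 2 + v.2 ^ 2 + 1 := by positivity
  have h : ‖stereoInv ε v‖ ^ 2 = 1 := by
    rw [norm_sq_R3]
    simp only [stereoInv, PiLp.toLp_apply, Matrix.cons_val]
    rw [div_pow, mul_pow, hε]
    field_simp
    ring
  exact (pow_eq_one_iff_of_nonneg (norm_nonneg _) two_ne_zero).1 h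

theorem stereoInv_denom {ε : ℝ} (hε : ε ^ 2 = 1) (v : ℝ × ℝ) :
    1 - ε * stereoInv ε v 0 = 2 / (v.1 ^ 2 + v.2 ^ 2 + 1) := by
  have h1 : 0 < v.1 ^ 2 + v.2 ^ 2 + 1 := by positivity
  simp only [stereoInv, PiLp.toLp_apply, Matrix.cons_val]
  rw [mul_div_assoc', ← mul_assoc, ← pow_two, hε]
  field_simp
  ring

theorem stereo_stereoInv {ε : ℝ} (hε : ε ^ 2 = 1) (v : ℝ × ℝ) : stereo ε (stereoInv ε v) = v := by
  have h1 : 0 < v.1 ^ 2 + v.2 ^ 2 + 1 := by positivity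
  rw [stereo, norm_stereoInv hε, stereoInv_denom hε]
  simp only [stereoInv, PiLp.toLp_apply, Matrix.cons_val]
  ext <;> simp only <;> field_simp

theorem stereoInv_stereo {ε : ℝ} (hε : ε ^ 2 = 1) {z : R3} (hz : ‖z‖ = 1) (h : 1 - ε * z 0 ≠ 0) :
    stereoInv ε (stereo ε z) = z := by
  have h1 : z 0 ^ 2 + z 1 ^ 2 + z 2 ^ 2 = 1 := by rw [← norm_sq_R3, hz, one_pow]
  have h2 : (z 1 / (1 - ε * z 0)) ^ 2 + (z 2 / (1 - ε * z 0)) ^ 2 =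
      (1 + ε * z 0) / (1 - ε * z 0) := by
    rw [div_pow, div_pow, ← add_div, div_eq_div_iff (pow_ne_zero 2 h) h]
    have : z 1 ^ 2 + z 2 ^ 2 = 1 - ε ^ 2 * z 0 ^ 2 := by rw [hε]; linarith
    rw [this]; ring
  have h3 : (1 + ε * z 0) / (1 - ε * z 0) + 1 = 2 / (1 - ε * z 0) := by
    field_simp; ring
  have h4 : (1 + ε * z 0) / (1 - ε * z 0) - 1 = 2 * (ε * z 0) / (1 - ε * z 0) := by
    field_simp; ring
  rw [stereo, hz, stereoInv, h2, h3, h4]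
  ext k
  fin_cases k
  · change ε * (2 * (ε * z 0) / (1 - ε * z 0)) / (2 / (1 - ε * z 0)) = z 0
    field_simp
    rw [hε, one_mul]
  · change 2 * (z 1 / (1 - ε * z 0)) / (2 / (1 - ε * z 0)) = z 1
    field_simp
  · change 2 * (z 2 / (1 - ε * z 0)) / (2 / (1 - ε * z 0)) = z 2
    field_simp

theorem stereo_smul {c : ℝ} (hc : 0 < c) (ε : ℝ) (z : R3) : stereo ε (c • z) = stereo ε z := by
  simp only [stereo, norm_smul, Real.norm_of_nonneg hc.le, PiLp.smul_apply, smul_eq_mul]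
  rw [show c * ‖z‖ - ε * (c * z 0) = c * (‖z‖ - ε * z 0) by ring, mul_div_mul_left _ _ hc.ne',
    mul_div_mul_left _ _ hc.ne']

theorem contDiffAt_stereoInv (ε : ℝ) (v : ℝ × ℝ) : ContDiffAt ℝ ω (stereoInv ε) v := by
  have h1 : v.1 ^ 2 + v.2 ^ 2 + 1 ≠ 0 := by positivity
  unfold stereoInv
  apply contDiffAt_vec3 <;> fun_prop (disch := assumption)

theorem ContDiffAt.stereoInv {E : Type*} [NormedAddCommGroup E] [NormedSpace ℝ E] {p : E}
    {f : E → ℝ × ℝ} (hf : ContDiffAt ℝ ω f p) (ε : ℝ) :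
    ContDiffAt ℝ ω (fun x => stereoInv ε (f x)) p := (contDiffAt_stereoInv ε (f p)).comp p hf

theorem continuous_stereoInv (ε : ℝ) : Continuous (stereoInv ε) :=
  continuous_iff_continuousAt.2 fun v => (contDiffAt_stereoInv ε v).continuousAt

theorem contDiffAt_stereo {ε : ℝ} {z : R3} (hz : z ≠ 0) (h : ‖z‖ - ε * z 0 ≠ 0) :
    ContDiffAt ℝ ω (stereo ε) z := by
  unfold stereo
  fun_prop (disch := assumption)

theorem ContDiffAt.stereo {E : Type*} [NormedAddCommGroup E] [NormedSpace ℝ E] {p : E}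
    {f : E → R3} (hf : ContDiffAt ℝ ω f p) {ε : ℝ} (hz : f p ≠ 0) (h : ‖f p‖ - ε * f p 0 ≠ 0) :
    ContDiffAt ℝ ω (fun x => stereo ε (f x)) p := (contDiffAt_stereo hz h).comp p hf

/-- The expressions for the two signs add up to a positive number, so they cannot both vanish: every
point is seen by one of the two stereographic projections. -/
theorem exists_stereo_sign (a z : R3) (ha : a ≠ 0) (hz : z ≠ 0) :
    ∃ ε : ℝ, ε ^ 2 = 1 ∧ ‖a‖ * ‖z‖ - ε * inner ℝ a z ≠ 0 := by
  have h := mul_pos (norm_pos_iff.2 ha) (norm_pos_iff.2 hz)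
  by_cases h1 : ‖a‖ * ‖z‖ - inner ℝ a z = 0
  · exact ⟨-1, by norm_num, by rw [neg_one_mul, sub_neg_eq_add]; linarith⟩
  · exact ⟨1, by norm_num, by rwa [one_mul]⟩

/-- Configurations that are not coaxial. -/
def nonCoax (m : ℕ) : Set (Fin m → R3) := spherePow m \ coaxPow m

theorem mem_nonCoax {m : ℕ} {w : Fin m → R3} :
    w ∈ nonCoax m ↔ (∀ k, ‖w k‖ = 1) ∧ ∃ i j, crossR3 (w i) (w j) ≠ 0 := by
  rw [nonCoax, Set.mem_diff, mem_spherePow, mem_coaxPow]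
  refine and_congr_right fun hw => ?_
  rw [not_and, ← not_iff_not]
  push Not
  constructor
  · rintro h i j
    obtain ⟨-, u, -, h⟩ := h
    obtain ⟨s, hs⟩ := h i
    obtain ⟨t, ht⟩ := h j
    rw [hs, ht, crossR3_smul_left, crossR3_smul_right, crossR3_self, smul_zero, smul_zero]
  · intro h
    refine ⟨hw, ?_⟩
    rcases m with _ | m
    · obtain ⟨u, hu, -⟩ := exists_unit_orthogonal (0 : R3)
      exact ⟨u, hu, fun j => j.elim0⟩
    · refine ⟨w 0, hw 0, fun j => ?_⟩
      exact eq_smul_of_crossR3_eq_zero (by rw [← norm_ne_zero_iff, hw]; exact one_ne_zero) (h 0 j)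

theorem isOpen_exists_cross (m : ℕ) :
    IsOpen {w : Fin m → R3 | ∃ i j, crossR3 (w i) (w j) ≠ 0} := by
  simp only [Set.setOf_exists]
  refine isOpen_iUnion fun i => isOpen_iUnion fun j => ?_
  refine isOpen_ne_fun (continuous_iff_continuousAt.2 fun w => ?_) continuous_const
  exact (contDiffAt_crossR3 (f := fun w : Fin m → R3 => w i) (g := fun w => w j) (p := w)
    (by fun_prop) (by fun_prop)).continuousAt

/-- The stereographic chart of the manifold of non-coaxial configurations. -/
def stereoChart {m : ℕ} (ε : Fin m → ℝ) (hε : ∀ k, ε k ^ 2 = 1) :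
    ModelChart (Fin m → ℝ × ℝ) (Eq : (Fin m → R3) → (Fin m → R3) → Prop) (nonCoax m) where
  param v k := stereoInv (ε k) (v k)
  dom := {v | ∃ i j, crossR3 (stereoInv (ε i) (v i)) (stereoInv (ε j) (v j)) ≠ 0}
  coord w k := stereo (ε k) (w k)
  range := {w | ∀ k, ‖w k‖ * (‖w k‖ - ε k * w k 0) ≠ 0}
  isOpen_dom := by
    have h : Continuous fun (v : Fin m → ℝ × ℝ) k => stereoInv (ε k) (v k) :=
      continuous_pi fun k => (continuous_stereoInv (ε k)).comp (continuous_apply k)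
    exact (isOpen_exists_cross m).preimage h
  isOpen_range := by
    simp only [Set.setOf_forall]
    exact isOpen_iInter_of_finite fun k => isOpen_ne_fun (by fun_prop) (by fun_prop)
  contDiffAt_param v _ := contDiffAt_pi.2 fun k => (contDiffAt_apply ℝ _ k v).stereoInv (ε k)
  contDiffAt_coord w hw := contDiffAt_pi.2 fun k => (contDiffAt_apply ℝ _ k w).stereo
    (norm_ne_zero_iff.1 (left_ne_zero_of_mul (hw k))) (right_ne_zero_of_mul (hw k))
  param_mem v hv := by
    refine ⟨mem_nonCoax.2 ⟨fun k => norm_stereoInv (hε k) _, hv⟩, fun k => ?_⟩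
    rw [norm_stereoInv (hε k), stereoInv_denom (hε k)]
    positivity
  coord_mem w hw hw' := by
    obtain ⟨h1, h2⟩ := mem_nonCoax.1 hw
    have h3 : ∀ k, stereoInv (ε k) (stereo (ε k) (w k)) = w k := fun k =>
      stereoInv_stereo (hε k) (h1 k) (by simpa [h1 k] using hw' k)
    simpa only [Set.mem_setOf_eq, h3] using h2
  coord_param v _ := funext fun k => stereo_stereoInv (hε k) _
  param_coord w hw hw' := funext fun k =>
    stereoInv_stereo (hε k) ((mem_nonCoax.1 hw).1 k)
      (by simpa [(mem_nonCoax.1 hw).1 k] using hw' k)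
  invariant w _ hw w' _ h := ⟨h ▸ hw, congrArg (fun (w : Fin m → R3) k => stereo (ε k) (w k)) h⟩

theorem exists_stereoChart {m : ℕ} {w : Fin m → R3} (hw : w ∈ nonCoax m) :
    ∃ ε, ∃ hε : ∀ k, ε k ^ 2 = 1, w ∈ (stereoChart ε hε).range := by
  have h1 := (mem_nonCoax.1 hw).1
  have h2 : ∀ k, ∃ ε : ℝ, ε ^ 2 = 1 ∧ ‖w k‖ * (‖w k‖ - ε * w k 0) ≠ 0 := by
    intro k
    obtain ⟨ε, hε, h⟩ := exists_stereo_sign !₂[1, 0, 0] (w k)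
      (fun h => by simpa using congrArg (fun v : R3 => v 0) h)
      (by rw [← norm_ne_zero_iff, h1]; exact one_ne_zero)
    refine ⟨ε, hε, ?_⟩
    have h3 : ‖(!₂[1, 0, 0] : R3)‖ = 1 := by
      rw [EuclideanSpace.norm_eq]; simp [Fin.sum_univ_three]
    rw [h3, h1, inner_R3] at h
    rw [h1]
    simpa using h
  choose ε hε h using h2
  exact ⟨ε, hε, h⟩

/-! ### Slices for the rotation action -/

/-- Coordinates of `x` in the orthonormal frame of the independent vectors `a`, `b`. -/
def frameCoord (a b x : R3) : R3 :=
  !₂[inner ℝ a x / ‖a‖, inner ℝ (crossR3 (crossR3 a b) a) x / (‖crossR3 a b‖ * ‖a‖),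
    inner ℝ (crossR3 a b) x / ‖crossR3 a b‖]

theorem left_ne_zero_of_crossR3 {a b : R3} (h : crossR3 a b ≠ 0) : a ≠ 0 := by
  rintro rfl; exact h (crossR3_zero_left _)

theorem right_ne_zero_of_crossR3 {a b : R3} (h : crossR3 a b ≠ 0) : b ≠ 0 := by
  rintro rfl; exact h (crossR3_zero_right _)

theorem norm_vec3 (a b c : ℝ) : ‖(!₂[a, b, c] : R3)‖ ^ 2 = a ^ 2 + b ^ 2 + c ^ 2 := norm_sq_R3 _

/-- Take the rotation sending the direction of a to the first basis vector and that of a × b to the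
third. It also determines the second coordinate, since rotations respect cross products. -/
theorem exists_adj_frame {a b : R3} (h : crossR3 a b ≠ 0) :
    ∃ U : SU2, ∀ x, frameCoord a b x = adj U x := by
  have ha := left_ne_zero_of_crossR3 h
  have ha' := norm_ne_zero_iff.2 ha
  have h' := norm_ne_zero_iff.2 h
  have h1 : ∀ a b c : ℝ, a ^ 2 + b ^ 2 + c ^ 2 = 1 → ‖(!₂[a, b, c] : R3)‖ = 1 := fun a b c h =>
    (pow_eq_one_iff_of_nonneg (norm_nonneg _) two_ne_zero).1 ((norm_vec3 a b c).trans h)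
  obtain ⟨U, hU1, hU3⟩ := exists_adj_pair (x := ‖a‖⁻¹ • a) (y := ‖crossR3 a b‖⁻¹ • crossR3 a b)
    (norm_smul_inv_norm ha) (norm_smul_inv_norm h)
    (by rw [inner_smul_left, inner_smul_right, inner_crossR3_left, mul_zero, mul_zero])
    (h1 1 0 0 (by norm_num)) (h1 0 0 1 (by norm_num)) (by simp [inner_R3])
  have hU2 : adj U (crossR3 (‖crossR3 a b‖⁻¹ • crossR3 a b) (‖a‖⁻¹ • a)) = !₂[0, 1, 0] := by
    rw [← crossR3_adj, hU1, hU3]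
    ext i; fin_cases i <;> simp [crossR3]
  refine ⟨U, fun x => ?_⟩
  have e0 : adj U x 0 = inner ℝ (‖a‖⁻¹ • a) x := by
    rw [← inner_adj U, hU1, inner_R3]; simp
  have e2 : adj U x 2 = inner ℝ (‖crossR3 a b‖⁻¹ • crossR3 a b) x := by
    rw [← inner_adj U, hU3, inner_R3]; simp
  have e1 : adj U x 1 =
      inner ℝ (crossR3 (‖crossR3 a b‖⁻¹ • crossR3 a b) (‖a‖⁻¹ • a)) x := by
    rw [← inner_adj U, hU2, inner_R3]; simp
  simp only [crossR3_smul_left, crossR3_smul_right, real_inner_smul_left] at e0 e1 e2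
  ext i
  fin_cases i
  · change inner ℝ a x / ‖a‖ = adj U x 0
    rw [e0, div_eq_inv_mul]
  · change inner ℝ (crossR3 (crossR3 a b) a) x / (‖crossR3 a b‖ * ‖a‖) = adj U x 1
    rw [e1, div_eq_inv_mul, mul_inv, mul_assoc, ← mul_assoc]
    ring
  · change inner ℝ (crossR3 a b) x / ‖crossR3 a b‖ = adj U x 2
    rw [e2, div_eq_inv_mul]

theorem frameCoord_adj (U : SU2) (a b x : R3) :
    frameCoord (adj U a) (adj U b) (adj U x) = frameCoord a b x := by
  simp only [frameCoord, crossR3_adj, inner_adj, norm_adj]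

/-- Homogeneity makes the chart coordinates constant along the radial directions, which is used in
the orientation argument. -/
theorem frameCoord_smul {r s t : ℝ} (hr : 0 < r) (hs : 0 < s) (a b x : R3) :
    frameCoord (r • a) (s • b) (t • x) = t • frameCoord a b x := by
  have h1 : ∀ y : ℝ, t * (r * y) = r * (t * y) := fun y => by ring
  ext i
  fin_cases i
  · simp only [frameCoord, crossR3_smul_left, crossR3_smul_right, real_inner_smul_left,
      real_inner_smul_right, norm_smul, Real.norm_of_nonneg hr.le, Real.norm_of_nonneg hs.le]
    change t * (r * inner ℝ a x) / (r * ‖a‖) = t * (inner ℝ a x / ‖a‖)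
    rw [h1, mul_div_mul_left _ _ hr.ne', mul_div_assoc]
  · simp only [frameCoord, crossR3_smul_left, crossR3_smul_right, real_inner_smul_left,
      real_inner_smul_right, norm_smul, Real.norm_of_nonneg hr.le, Real.norm_of_nonneg hs.le]
    change t * (r * (s * (r * inner ℝ (crossR3 (crossR3 a b) a) x))) /
      (s * (r * ‖crossR3 a b‖) * (r * ‖a‖)) =
      t * (inner ℝ (crossR3 (crossR3 a b) a) x / (‖crossR3 a b‖ * ‖a‖))
    rw [show t * (r * (s * (r * inner ℝ (crossR3 (crossR3 a b) a) x))) =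
      (r * r * s) * (t * inner ℝ (crossR3 (crossR3 a b) a) x) by ring,
      show s * (r * ‖crossR3 a b‖) * (r * ‖a‖) = (r * r * s) * (‖crossR3 a b‖ * ‖a‖) by ring,
      mul_div_mul_left _ _ (by positivity), mul_div_assoc]
  · simp only [frameCoord, crossR3_smul_left, crossR3_smul_right, real_inner_smul_left,
      real_inner_smul_right, norm_smul, Real.norm_of_nonneg hr.le, Real.norm_of_nonneg hs.le]
    change t * (s * (r * inner ℝ (crossR3 a b) x)) / (s * (r * ‖crossR3 a b‖)) =
      t * (inner ℝ (crossR3 a b) x / ‖crossR3 a b‖)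
    rw [show t * (s * (r * inner ℝ (crossR3 a b) x)) = s * r * (t * inner ℝ (crossR3 a b) x) by ring,
      ← mul_assoc s, mul_div_mul_left _ _ (by positivity), mul_div_assoc]

theorem frameCoord_left {a b : R3} (ha : ‖a‖ = 1) : frameCoord a b a = !₂[1, 0, 0] := by
  have h1 : inner ℝ (crossR3 (crossR3 a b) a) a = 0 := by
    rw [real_inner_comm]; exact inner_crossR3_right _ _
  have h2 : inner ℝ (crossR3 a b) a = 0 := by
    rw [real_inner_comm]; exact inner_crossR3_left _ _
  rw [frameCoord, h1, h2, real_inner_self_eq_norm_sq, ha]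
  simp

theorem frameCoord_right {a b : R3} (ha : ‖a‖ = 1) (hb : ‖b‖ = 1) (h : crossR3 a b ≠ 0) :
    frameCoord a b b = !₂[inner ℝ a b, Real.sqrt (1 - (inner ℝ a b) ^ 2), 0] := by
  have h1 : inner ℝ (crossR3 (crossR3 a b) a) b = ‖crossR3 a b‖ ^ 2 := by
    rw [← real_inner_self_eq_norm_sq, inner_R3, inner_R3]
    simp [crossR3]; ring
  have h2 : inner ℝ (crossR3 a b) b = 0 := by
    rw [real_inner_comm]; exact inner_crossR3_right _ _
  have h3 : ‖crossR3 a b‖ = Real.sqrt (1 - (inner ℝ a b) ^ 2) := by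
    rw [← Real.sqrt_sq (norm_nonneg (crossR3 a b)), norm_sq_crossR3, ha, hb]; norm_num
  rw [frameCoord, h1, h2, ha, ← h3, mul_one, div_one, zero_div, pow_two,
    mul_div_cancel_right₀ _ (norm_ne_zero_iff.2 h)]

/-- Configurations in normal position have the standard frame, so they form a slice on which the
chart coordinates can be read off directly. -/
theorem frameCoord_standard {s t : ℝ} (ht : 0 < t) (x : R3) :
    frameCoord !₂[1, 0, 0] !₂[s, t, 0] x = x := by
  have h1 : crossR3 !₂[1, 0, 0] !₂[s, t, 0] = t • (!₂[0, 0, 1] : R3) := by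
    ext i; fin_cases i <;> simp [crossR3]
  have h2 : crossR3 (crossR3 !₂[1, 0, 0] !₂[s, t, 0]) !₂[1, 0, 0] = t • (!₂[0, 1, 0] : R3) := by
    rw [h1]
    ext i; fin_cases i <;> simp [crossR3]
  have h3 : ‖(!₂[1, 0, 0] : R3)‖ = 1 := by simp [EuclideanSpace.norm_eq, Fin.sum_univ_three]
  have h4 : ‖t • (!₂[0, 0, 1] : R3)‖ = t := by
    rw [norm_smul, Real.norm_of_nonneg ht.le]
    simp [EuclideanSpace.norm_eq, Fin.sum_univ_three]
  rw [frameCoord, h2, h1, h3, h4]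
  ext i
  fin_cases i <;> simp [inner_R3, inner_smul_left, ht.ne']

theorem ContDiffAt.frameCoord {E : Type*} [NormedAddCommGroup E] [NormedSpace ℝ E] {p : E}
    {a b x : E → R3} (ha : ContDiffAt ℝ ω a p) (hb : ContDiffAt ℝ ω b p)
    (hx : ContDiffAt ℝ ω x p) (h : crossR3 (a p) (b p) ≠ 0) :
    ContDiffAt ℝ ω (fun q => frameCoord (a q) (b q) (x q)) p := by
  have h1 := contDiffAt_crossR3 ha hb
  have h2 := contDiffAt_norm_R3 h1 h
  have h3 := contDiffAt_norm_R3 ha (left_ne_zero_of_crossR3 h)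
  have h4 := norm_ne_zero_iff.2 h
  have h5 := norm_ne_zero_iff.2 (left_ne_zero_of_crossR3 h)
  unfold _root_.frameCoord
  apply contDiffAt_vec3
  · exact (ha.inner ℝ hx).div h3 h5
  · exact ((contDiffAt_crossR3 h1 ha).inner ℝ hx).div (h2.mul h3) (mul_ne_zero h4 h5)
  · exact (h1.inner ℝ hx).div h2 h4

/-- Configurations that differ by a rotation. -/
def RotRel {m : ℕ} (w w' : Fin m → R3) : Prop := ∃ U : SU2, ∀ k, w' k = adj U (w k)

section FrameChart

variable {m : ℕ} (i j : Fin m) (ε : Fin m → ℝ)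

/-- Configurations in normal position with respect to the `i`-th and `j`-th point. -/
def frameParam (z : ℝ × ({k : Fin m // k ≠ i ∧ k ≠ j} → ℝ × ℝ)) (k : Fin m) : R3 :=
  if hi : k = i then !₂[1, 0, 0]
  else if hj : k = j then !₂[z.1, Real.sqrt (1 - z.1 ^ 2), 0]
  else stereoInv (ε k) (z.2 ⟨k, hi, hj⟩)

/-- The invariant coordinates given by the frame of the `i`-th and `j`-th point. -/
def frameChartCoord (w : Fin m → R3) : ℝ × ({k : Fin m // k ≠ i ∧ k ≠ j} → ℝ × ℝ) :=
  (inner ℝ (w i) (w j) / (‖w i‖ * ‖w j‖),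
    fun k => stereo (ε k) (frameCoord (w i) (w j) (w k)))

/-- The domain of the frame coordinates. -/
def frameRange : Set (Fin m → R3) :=
  {w | crossR3 (w i) (w j) ≠ 0 ∧ ∀ k : {k : Fin m // k ≠ i ∧ k ≠ j},
    ‖w i‖ * ‖w k‖ - ε k * inner ℝ (w i) (w k) ≠ 0}

variable {i j ε}

theorem frameParam_left (z : ℝ × ({k : Fin m // k ≠ i ∧ k ≠ j} → ℝ × ℝ)) :
    frameParam i j ε z i = !₂[1, 0, 0] := dif_pos rfl

theorem frameParam_right (hij : i ≠ j) (z : ℝ × ({k : Fin m // k ≠ i ∧ k ≠ j} → ℝ × ℝ)) :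
    frameParam i j ε z j = !₂[z.1, Real.sqrt (1 - z.1 ^ 2), 0] := by
  rw [frameParam, dif_neg hij.symm, dif_pos rfl]

theorem frameParam_other (z : ℝ × ({k : Fin m // k ≠ i ∧ k ≠ j} → ℝ × ℝ))
    (k : {k : Fin m // k ≠ i ∧ k ≠ j}) : frameParam i j ε z k = stereoInv (ε k) (z.2 k) := by
  rw [frameParam, dif_neg k.2.1, dif_neg k.2.2]

theorem norm_frameParam (hε : ∀ k, ε k ^ 2 = 1) {z : ℝ × ({k : Fin m // k ≠ i ∧ k ≠ j} → ℝ × ℝ)}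
    (hz : z.1 ^ 2 < 1) (k : Fin m) : ‖frameParam i j ε z k‖ = 1 := by
  rw [frameParam]
  split_ifs
  · refine (pow_eq_one_iff_of_nonneg (norm_nonneg _) two_ne_zero).1 ((norm_vec3 _ _ _).trans ?_)
    norm_num
  · refine (pow_eq_one_iff_of_nonneg (norm_nonneg _) two_ne_zero).1 ((norm_vec3 _ _ _).trans ?_)
    rw [Real.sq_sqrt (by linarith)]
    ring
  · exact norm_stereoInv (hε k) _

theorem cross_frameParam (hij : i ≠ j) {z : ℝ × ({k : Fin m // k ≠ i ∧ k ≠ j} → ℝ × ℝ)}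
    (hz : z.1 ^ 2 < 1) : crossR3 (frameParam i j ε z i) (frameParam i j ε z j) ≠ 0 := by
  rw [frameParam_left, frameParam_right hij]
  intro h
  have h1 := congrArg (fun v : R3 => v 2) h
  simp only [crossR3] at h1
  have h2 : 0 < Real.sqrt (1 - z.1 ^ 2) := Real.sqrt_pos.2 (by linarith)
  simp at h1
  exact h2.ne' h1

theorem mem_frameRange_ne_zero {w : Fin m → R3} (hw : w ∈ frameRange i j ε)
    (k : {k : Fin m // k ≠ i ∧ k ≠ j}) : w k ≠ 0 := by
  intro h
  have := hw.2 k
  rw [h] at this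
  simp at this

theorem frameCoord_denom {w : Fin m → R3} (hw : w ∈ frameRange i j ε)
    (k : {k : Fin m // k ≠ i ∧ k ≠ j}) :
    ‖frameCoord (w i) (w j) (w k)‖ = ‖w k‖ ∧
    ‖frameCoord (w i) (w j) (w k)‖ - ε k * frameCoord (w i) (w j) (w k) 0 ≠ 0 := by
  obtain ⟨U, hU⟩ := exists_adj_frame hw.1
  have h1 : ‖frameCoord (w i) (w j) (w k)‖ = ‖w k‖ := by rw [hU, norm_adj]
  refine ⟨h1, ?_⟩
  rw [h1]
  have h2 := norm_ne_zero_iff.2 (left_ne_zero_of_crossR3 hw.1)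
  change ‖w k‖ - ε k * (inner ℝ (w i) (w k) / ‖w i‖) ≠ 0
  intro h3
  apply hw.2 k
  field_simp at h3
  rw [mul_comm, h3, mul_zero]

theorem isOpen_frameRange : IsOpen (frameRange i j ε) := by
  unfold frameRange
  simp only [Set.setOf_and, Set.setOf_forall]
  refine IsOpen.inter ?_ (isOpen_iInter_of_finite fun k => isOpen_ne_fun ?_ continuous_const)
  · refine isOpen_ne_fun (continuous_iff_continuousAt.2 fun w => ?_) continuous_const
    exact (contDiffAt_crossR3 (f := fun w : Fin m → R3 => w i) (g := fun w => w j) (p := w)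
      (by fun_prop) (by fun_prop)).continuousAt
  · fun_prop

theorem contDiffAt_frameParam {z : ℝ × ({k : Fin m // k ≠ i ∧ k ≠ j} → ℝ × ℝ)}
    (hz : z.1 ^ 2 < 1) : ContDiffAt ℝ ω (frameParam i j ε) z := by
  rw [contDiffAt_pi]
  intro k
  unfold frameParam
  split_ifs with hi hj
  · fun_prop
  · refine contDiffAt_vec3 (by fun_prop) ?_ (by fun_prop)
    exact (Real.contDiffAt_sqrt (by linarith)).comp z
      (f := fun z : ℝ × ({k : Fin m // k ≠ i ∧ k ≠ j} → ℝ × ℝ) => 1 - z.1 ^ 2) (by fun_prop)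
  · exact ContDiffAt.stereoInv (by fun_prop) _

theorem contDiffAt_frameChartCoord {w : Fin m → R3} (hw : w ∈ frameRange i j ε) :
    ContDiffAt ℝ ω (frameChartCoord i j ε) w := by
  have hi := left_ne_zero_of_crossR3 hw.1
  have hj := right_ne_zero_of_crossR3 hw.1
  unfold frameChartCoord
  refine ContDiffAt.prodMk ?_ (contDiffAt_pi.2 fun k => ?_)
  · refine ContDiffAt.div (by fun_prop) ?_ (mul_ne_zero (norm_ne_zero_iff.2 hi)
      (norm_ne_zero_iff.2 hj))
    exact (contDiffAt_norm_R3 (contDiffAt_apply ℝ _ i w) hi).mul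
      (contDiffAt_norm_R3 (contDiffAt_apply ℝ _ j w) hj)
  · refine ContDiffAt.stereo (ContDiffAt.frameCoord (by fun_prop) (by fun_prop) (by fun_prop) hw.1)
      ?_ (frameCoord_denom hw k).2
    rw [← norm_ne_zero_iff, (frameCoord_denom hw k).1, norm_ne_zero_iff]
    exact mem_frameRange_ne_zero hw k

theorem frameChartCoord_adj (U : SU2) (w : Fin m → R3) :
    frameChartCoord i j ε (fun k => adj U (w k)) = frameChartCoord i j ε w := by
  simp only [frameChartCoord, inner_adj, norm_adj, frameCoord_adj]

theorem frameChartCoord_smul {t : Fin m → ℝ} (ht : ∀ k, 0 < t k) (w : Fin m → R3) :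
    frameChartCoord i j ε (fun k => t k • w k) = frameChartCoord i j ε w := by
  refine Prod.ext ?_ (funext fun k => ?_)
  · simp only [frameChartCoord, real_inner_smul_left, real_inner_smul_right, norm_smul,
      Real.norm_of_nonneg (ht _).le]
    rw [show t j * (t i * inner ℝ (w i) (w j)) = t i * t j * inner ℝ (w i) (w j) by ring,
      show t i * ‖w i‖ * (t j * ‖w j‖) = t i * t j * (‖w i‖ * ‖w j‖) by ring,
      mul_div_mul_left _ _ (mul_pos (ht i) (ht j)).ne']
  · simp only [frameChartCoord]
    rw [frameCoord_smul (ht i) (ht j), stereo_smul (ht _)]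

/-- The chart of the space of non-coaxial configurations modulo rotations given by the frame of
the `i`-th and `j`-th point. -/
def frameChart (hij : i ≠ j) (hε : ∀ k, ε k ^ 2 = 1) :
    ModelChart (ℝ × ({k : Fin m // k ≠ i ∧ k ≠ j} → ℝ × ℝ)) (RotRel (m := m)) (nonCoax m) where
  param := frameParam i j ε
  dom := {z | z.1 ^ 2 < 1}
  coord := frameChartCoord i j ε
  range := frameRange i j ε
  isOpen_dom := isOpen_lt (by fun_prop) continuous_const
  isOpen_range := isOpen_frameRange
  contDiffAt_param z hz := contDiffAt_frameParam hz
  contDiffAt_coord w hw := contDiffAt_frameChartCoord hw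
  param_mem z hz := by
    have h := norm_frameParam (i := i) (j := j) hε hz
    have h' := cross_frameParam (ε := ε) hij hz
    refine ⟨mem_nonCoax.2 ⟨h, i, j, h'⟩, h', fun k => ?_⟩
    rw [h, h, frameParam_left, frameParam_other, inner_R3]
    simp only [PiLp.toLp_apply, Matrix.cons_val]
    rw [one_mul, zero_mul, zero_mul, one_mul, add_zero, add_zero, stereoInv_denom (hε k)]
    positivity
  coord_mem w hw hw' := by
    have h1 := (mem_nonCoax.1 hw).1
    have h2 : 0 < ‖crossR3 (w i) (w j)‖ ^ 2 := by
      have := norm_pos_iff.2 hw'.1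
      positivity
    rw [norm_sq_crossR3, h1, h1] at h2
    change (inner ℝ (w i) (w j) / (‖w i‖ * ‖w j‖)) ^ 2 < 1
    rw [h1, h1]
    norm_num at h2 ⊢
    rwa [abs_lt, ← abs_lt] 
  coord_param z hz := by
    have h := norm_frameParam (i := i) (j := j) hε hz
    have h2 : 0 < Real.sqrt (1 - z.1 ^ 2) := Real.sqrt_pos.2 (sub_pos.2 hz)
    refine Prod.ext ?_ (funext fun k => ?_)
    · simp only [frameChartCoord]
      rw [h, h, frameParam_left, frameParam_right hij, inner_R3]
      simp
    · simp only [frameChartCoord]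
      rw [frameParam_left, frameParam_right hij, frameCoord_standard h2, frameParam_other,
        stereo_stereoInv (hε k)]
  param_coord w hw hw' := by
    have h1 := (mem_nonCoax.1 hw).1
    obtain ⟨U, hU⟩ := exists_adj_frame hw'.1
    -- The normal form of a configuration is its image under its own frame rotation.
    have h2 : ∀ k, frameParam i j ε (frameChartCoord i j ε w) k = adj U (w k) := by
      intro k
      rw [← hU]
      by_cases hi : k = i
      · subst hi
        rw [frameParam_left, frameCoord_left (h1 k)]
      by_cases hj : k = j
      · subst hj
        rw [frameParam_right hij, frameCoord_right (h1 i) (h1 k) hw'.1]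
        simp only [frameChartCoord, h1, mul_one, div_one]
      · have h3 := frameCoord_denom hw' ⟨k, hi, hj⟩
        have h4 := frameParam_other (ε := ε) (frameChartCoord i j ε w) ⟨k, hi, hj⟩
        simp only at h3 h4
        rw [h4]
        rw [h1] at h3
        exact stereoInv_stereo (hε k) h3.1 (by rw [← h3.1]; exact h3.2)
    exact ⟨U⁻¹, fun k => by rw [h2, adj_inv_adj]⟩
  invariant w hw hw' w' _ h := by
    obtain ⟨U, hU⟩ := h
    have hU' : w = fun k => adj U (w' k) := funext hU
    refine ⟨?_, by rw [hU', frameChartCoord_adj]⟩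
    rw [hU'] at hw'
    refine ⟨fun h0 => hw'.1 ?_, fun k => ?_⟩
    · simp only [crossR3_adj, h0, map_zero]
    · have := hw'.2 k
      simpa only [norm_adj, inner_adj] using this

theorem exists_frameChart {w : Fin m → R3} (hw : w ∈ nonCoax m) :
    ∃ i j, ∃ hij : i ≠ j, ∃ ε, ∃ hε : ∀ k, ε k ^ 2 = 1,
      w ∈ (frameChart (m := m) (i := i) (j := j) (ε := ε) hij hε).range := by
  obtain ⟨h1, i, j, h⟩ := mem_nonCoax.1 hw
  have h0 : ∀ k, w k ≠ 0 := fun k => by rw [← norm_ne_zero_iff, h1]; exact one_ne_zero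
  choose ε hε h3 using fun k => exists_stereo_sign (w i) (w k) (h0 i) (h0 k)
  refine ⟨i, j, ?_, ε, hε, h, fun k => h3 k⟩
  rintro rfl
  exact h (crossR3_self _)

/-- One coordinate is the inner product of the two frame points and two belong to each of the m - 2
others; distinct i and j give m ≥ 2, so the truncated subtractions are harmless. -/
theorem finrank_frameSpace (hij : i ≠ j) :
    Module.finrank ℝ (ℝ × ({k : Fin m // k ≠ i ∧ k ≠ j} → ℝ × ℝ)) = 2 * m - 3 := by
  have h1 : Fintype.card {k : Fin m // k ≠ i ∧ k ≠ j} = m - 2 := by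
    rw [Fintype.card_subtype]
    have : (Finset.univ.filter fun k : Fin m => k ≠ i ∧ k ≠ j) = (Finset.univ.erase i).erase j := by
      ext k; simp [and_comm]
    rw [this, Finset.card_erase_of_mem (by simp [hij.symm]), Finset.card_erase_of_mem (by simp)]
    simp; omega
  have h2 : 2 ≤ m := by
    have := i.2; have := j.2
    have : (i : ℕ) ≠ j := fun h => hij (Fin.ext h)
    omega
  rw [Module.finrank_prod, Module.finrank_self, Module.finrank_pi_fintype]
  simp only [Module.finrank_prod, Module.finrank_self, Finset.sum_const, Finset.card_univ, h1]
  simp; omega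

end FrameChart

/-! ### Orientation of the space of configurations modulo rotations -/

theorem vecPart_imMat_adj (U : SU2) (x : R3) : vecPart (imMat (adj U x)) = adj U x := by
  have h := vecPart_quatMat 0 (adj U x)
  rwa [quatMat, zero_smul, zero_add] at h

theorem adj_mkSU {a : ℝ} {v : R3} (h : a ^ 2 + ‖v‖ ^ 2 = 1) (x : R3) :
    adj (mkSU a v h) x = a ^ 2 • x + (2 * a) • crossR3 v x +
      ((inner ℝ v x : ℝ) • v - crossR3 (crossR3 v x) v) := by
  rw [← vecPart_imMat_adj, imMat_adj, coe_mkSU, coe_inv_mkSU,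
    show imMat x = quatMat 0 x by rw [quatMat, zero_smul, zero_add], quatMat_mul, quatMat_mul,
    vecPart_quatMat]
  ext i
  fin_cases i <;> simp [crossR3, inner_R3] <;> ring

theorem adj_rotation {u : R3} {s : ℝ} (h : Real.cos s ^ 2 + ‖Real.sin s • u‖ ^ 2 = 1) (x : R3) :
    adj (mkSU (Real.cos s) (Real.sin s • u) h) x = Real.cos s ^ 2 • x +
      (2 * Real.cos s * Real.sin s) • crossR3 u x +
      Real.sin s ^ 2 • ((inner ℝ u x : ℝ) • u - crossR3 (crossR3 u x) u) := by
  rw [adj_mkSU]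
  simp only [crossR3_smul_left, crossR3_smul_right, real_inner_smul_left, smul_smul, smul_sub]
  ring_nf

/-- The quaternion with angle s rotates by 2s, whence the factor 2. -/
theorem hasDerivAt_rotation (u x : R3) :
    HasDerivAt (fun s => Real.cos s ^ 2 • x + (2 * Real.cos s * Real.sin s) • crossR3 u x +
      Real.sin s ^ 2 • ((inner ℝ u x : ℝ) • u - crossR3 (crossR3 u x) u))
      ((2 : ℝ) • crossR3 u x) 0 := by
  have hc : HasDerivAt (fun s => Real.cos s ^ 2) 0 0 := by
    have h := (Real.hasDerivAt_cos 0).fun_pow 2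
    rwa [Real.sin_zero, neg_zero, mul_zero] at h
  have hs : HasDerivAt (fun s => Real.sin s ^ 2) 0 0 := by
    have h := (Real.hasDerivAt_sin 0).fun_pow 2
    rwa [Real.sin_zero, zero_pow (by norm_num), mul_zero, zero_mul] at h
  have hcs : HasDerivAt (fun s => 2 * Real.cos s * Real.sin s) 2 0 := by
    have h := ((Real.hasDerivAt_cos 0).const_mul 2).fun_mul (Real.hasDerivAt_sin 0)
    rwa [Real.sin_zero, mul_zero, Real.cos_zero, mul_one, mul_one, add_comm, add_zero] at h
  have h := ((hc.smul_const x).add (hcs.smul_const (crossR3 u x))).add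
    (hs.smul_const ((inner ℝ u x : ℝ) • u - crossR3 (crossR3 u x) u))
  rw [zero_smul, zero_smul, zero_add, add_zero] at h
  exact h

section Homogeneous

variable {V : Type*} [NormedAddCommGroup V] [NormedSpace ℝ V] {m : ℕ}

/-- The coordinates are defined by expressions that are invariant under rotations and under
rescaling of the vectors. -/
def ModelChart.IsHomogeneous (e : ModelChart V (RotRel (m := m)) (nonCoax m)) : Prop :=
  (∀ U w, e.coord (fun k => adj U (w k)) = e.coord w) ∧
    ∀ t : Fin m → ℝ, (∀ k, 0 < t k) → ∀ w, e.coord (fun k => t k • w k) = e.coord w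

theorem isHomogeneous_frameChart {i j : Fin m} {ε : Fin m → ℝ} (hij : i ≠ j)
    (hε : ∀ k, ε k ^ 2 = 1) : (frameChart hij hε).IsHomogeneous :=
  ⟨fun U w => frameChartCoord_adj U w, fun _ ht w => frameChartCoord_smul ht w⟩

theorem ModelChart.IsHomogeneous.map {V' : Type*} [NormedAddCommGroup V'] [NormedSpace ℝ V']
    {e : ModelChart V (RotRel (m := m)) (nonCoax m)} (he : e.IsHomogeneous) (L : V ≃L[ℝ] V') :
    (e.map L).IsHomogeneous :=
  ⟨fun U w => congrArg L (he.1 U w), fun t ht w => congrArg L (he.2 t ht w)⟩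

/-- The derivative of a map with constant restriction to a curve. -/
theorem fderiv_eq_zero_of_curve {W : Type*} [NormedAddCommGroup W] [NormedSpace ℝ W] {f : W → V}
    {w w' : W} (hf : DifferentiableAt ℝ f w) {γ : ℝ → W} (hγ : HasDerivAt γ w' 0) (h0 : γ 0 = w)
    (hc : ∀ᶠ s in 𝓝 0, f (γ s) = f w) : fderiv ℝ f w w' = 0 := by
  subst h0
  have h1 := hf.hasFDerivAt.comp_hasDerivAt (0 : ℝ) hγ
  have h2 : HasDerivAt (f ∘ γ) 0 0 := (hasDerivAt_const (0 : ℝ) (f (γ 0))).congr_of_eventuallyEq hc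
  exact h1.unique h2

/-- The linearization of the action of rotations and rescalings, together with the derivative of
a slice. -/
def sliceMap (s : V → Fin m → R3) (z : V) : V × (R3 × (Fin m → ℝ)) →ₗ[ℝ] (Fin m → R3) where
  toFun y k := fderiv ℝ s z y.1 k + crossR3 y.2.1 (s z k) + y.2.2 k • s z k
  map_add' y y' := by
    funext k
    simp only [Prod.fst_add, Prod.snd_add, map_add, Pi.add_apply, crossR3_add_left, add_smul]
    abel
  map_smul' c y := by
    funext k
    simp only [Prod.smul_fst, Prod.smul_snd, map_smul, Pi.smul_apply, crossR3_smul_left,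
      RingHom.id_apply, smul_add, smul_smul, smul_eq_mul]

namespace ModelChart

variable {e e' : ModelChart V (RotRel (m := m)) (nonCoax m)}

theorem differentiableAt_coord (e : ModelChart V (RotRel (m := m)) (nonCoax m)) {w : Fin m → R3}
    (hw : w ∈ e.range) : DifferentiableAt ℝ e.coord w :=
  (e.contDiffAt_coord w hw).differentiableAt (by simp)

/-- Differentiate the constant function of s obtained by rescaling the k-th point by 1 + s t_k,
which is positive for small s. -/
theorem IsHomogeneous.fderiv_smul (he : e.IsHomogeneous) {w : Fin m → R3} (hw : w ∈ e.range)
    (t : Fin m → ℝ) : fderiv ℝ e.coord w (fun k => t k • w k) = 0 := by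
  refine fderiv_eq_zero_of_curve (e.differentiableAt_coord hw)
    (γ := fun s k => (1 + s * t k) • w k) ?_ (by simp) ?_
  · rw [hasDerivAt_pi]
    intro k
    have h : HasDerivAt (fun s : ℝ => 1 + s * t k) (t k) 0 := by
      simpa using ((hasDerivAt_id (0 : ℝ)).mul_const (t k)).const_add 1
    exact h.smul_const (w k)
  · have h1 : ∀ k, ∀ᶠ s : ℝ in 𝓝 0, 0 < 1 + s * t k := fun k =>
      (show Continuous fun s : ℝ => 1 + s * t k by fun_prop).continuousAt.eventually
        (lt_mem_nhds (by simp))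
    filter_upwards [Filter.eventually_all.2 h1] with s hs
    exact he.2 _ hs w

theorem IsHomogeneous.fderiv_cross (he : e.IsHomogeneous) {w : Fin m → R3} (hw : w ∈ e.range)
    (x : R3) : fderiv ℝ e.coord w (fun k => crossR3 x (w k)) = 0 := by
  by_cases hx : x = 0
  · subst hx
    simp only [crossR3_zero_left]
    exact map_zero _
  have hu : ‖‖x‖⁻¹ • x‖ = 1 := norm_smul_inv_norm hx
  set u := ‖x‖⁻¹ • x with hu'
  have h0 : ∀ s, Real.cos s ^ 2 + ‖Real.sin s • u‖ ^ 2 = 1 := fun s => by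
    rw [norm_smul, hu, mul_one, Real.norm_eq_abs, sq_abs, Real.cos_sq_add_sin_sq]
  have h1 : fderiv ℝ e.coord w (fun k => (2 : ℝ) • crossR3 u (w k)) = 0 := by
    refine fderiv_eq_zero_of_curve (e.differentiableAt_coord hw)
      (γ := fun s k => adj (mkSU (Real.cos s) (Real.sin s • u) (h0 s)) (w k)) ?_ ?_
      (Filter.Eventually.of_forall fun s => he.1 _ w)
    · rw [hasDerivAt_pi]
      intro k
      simp only [adj_rotation]
      exact hasDerivAt_rotation u (w k)
    · funext k
      rw [adj_rotation]
      simp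
  have h2 : (fun k => crossR3 x (w k)) = (‖x‖ / 2) • fun k => (2 : ℝ) • crossR3 u (w k) := by
    funext k
    rw [Pi.smul_apply, smul_smul, div_mul_cancel₀ _ two_ne_zero, hu', crossR3_smul_left,
      smul_inv_smul₀ (norm_ne_zero_iff.2 hx)]
  rw [h2, map_smul, h1, smul_zero]

/-- Invariant coordinates are blind to the rotation and radial directions, so only the derivative
along the slice survives. -/
theorem fderiv_coord_sliceMap (he' : e'.IsHomogeneous) {z : V} (hz : z ∈ e.dom)
    (h : e.param z ∈ e'.range) (y : V × (R3 × (Fin m → ℝ))) :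
    fderiv ℝ e'.coord (e.param z) (sliceMap e.param z y) =
      fderiv ℝ (fun z => e'.coord (e.param z)) z y.1 := by
  have h1 : sliceMap e.param z y = fderiv ℝ e.param z y.1 +
      (fun k => crossR3 y.2.1 (e.param z k)) + fun k => y.2.2 k • e.param z k := rfl
  have h2 : DifferentiableAt ℝ e.param z := (e.contDiffAt_param z hz).differentiableAt (by simp)
  rw [h1, map_add, map_add, he'.fderiv_cross h, he'.fderiv_smul h, add_zero, add_zero,
    fderiv_comp' z (e'.differentiableAt_coord h) h2]
  rfl

theorem fderiv_coord_param {z : V} (hz : z ∈ e.dom) :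
    fderiv ℝ (fun z => e.coord (e.param z)) z = ContinuousLinearMap.id ℝ V := by
  have h : (fun z => e.coord (e.param z)) =ᶠ[𝓝 z] id := by
    filter_upwards [e.isOpen_dom.mem_nhds hz] with z hz
    exact e.coord_param z hz
  rw [h.fderiv_eq, fderiv_id]

theorem fderiv_coord_sliceMap_self (he : e.IsHomogeneous) {z : V} (hz : z ∈ e.dom)
    (y : V × (R3 × (Fin m → ℝ))) :
    fderiv ℝ e.coord (e.param z) (sliceMap e.param z y) = y.1 := by
  rw [fderiv_coord_sliceMap he hz (e.param_mem z hz).2, fderiv_coord_param hz]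
  rfl

/-- For a kernel element, the derivative of the coordinates kills the slice component, pairing with
the k-th point kills t_k, and a rotation vector parallel to two independent points is zero. -/
theorem sliceMap_injective (he : e.IsHomogeneous) {z : V} (hz : z ∈ e.dom) :
    Function.Injective (sliceMap e.param z) := by
  rw [← LinearMap.ker_eq_bot, LinearMap.ker_eq_bot']
  rintro ⟨v, x, t⟩ h
  obtain ⟨h1, i, j, hij⟩ := mem_nonCoax.1 (e.param_mem z hz).1
  have hv : v = 0 := by
    have := fderiv_coord_sliceMap_self he hz (v, x, t)
    rw [h, map_zero] at this
    exact this.symm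
  subst hv
  have h2 : ∀ k, crossR3 x (e.param z k) + t k • e.param z k = 0 := by
    intro k
    have := congrFun h k
    simpa [sliceMap] using this
  have ht : ∀ k, t k = 0 := by
    intro k
    have := congrArg (fun v => inner ℝ (e.param z k) v) (h2 k)
    simpa [inner_add_right, inner_crossR3_right, real_inner_smul_right,
      real_inner_self_eq_norm_sq, h1] using this
  have h3 : ∀ k, crossR3 x (e.param z k) = 0 := by
    intro k
    simpa [ht] using h2 k
  have hx : x = 0 := by
    by_contra hx
    obtain ⟨a, ha⟩ := eq_smul_of_crossR3_eq_zero hx (h3 i)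
    obtain ⟨b, hb⟩ := eq_smul_of_crossR3_eq_zero hx (h3 j)
    apply hij
    rw [ha, hb, crossR3_smul_left, crossR3_smul_right, crossR3_self, smul_zero, smul_zero]
  rw [hx, funext ht]
  rfl

end ModelChart

end Homogeneous

section Det

/-- The determinant is a square and, by the left inverse, nonzero. -/
theorem det_pos_of_sq {M : Type*} [AddCommGroup M] [Module ℝ M] {f g h : M →ₗ[ℝ] M}
    (hf : f = g ∘ₗ g) (hh : h ∘ₗ f = LinearMap.id) : 0 < LinearMap.det f := by
  have h1 : LinearMap.det h * LinearMap.det f = 1 := by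
    rw [← LinearMap.det_comp, hh, LinearMap.det_id]
  have h2 : LinearMap.det f ≠ 0 := right_ne_zero_of_mul_eq_one h1
  rw [hf, LinearMap.det_comp] at h2 ⊢
  exact lt_of_le_of_ne (mul_self_nonneg _) h2.symm

variable {A B : Type*} [AddCommGroup A] [Module ℝ A] [AddCommGroup B] [Module ℝ B]

/-- The shear `(a, b) ↦ (a, C a + b)`. -/
def shearMap (C : A →ₗ[ℝ] B) : A × B →ₗ[ℝ] A × B :=
  (LinearMap.fst ℝ A B).prod (C ∘ₗ LinearMap.fst ℝ A B + LinearMap.snd ℝ A B)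

theorem shearMap_comp (C C' : A →ₗ[ℝ] B) : shearMap C ∘ₗ shearMap C' = shearMap (C + C') := by
  ext <;> simp [shearMap]

theorem shearMap_zero : shearMap (0 : A →ₗ[ℝ] B) = LinearMap.id := by
  ext <;> simp [shearMap]

/-- Every shear is the square of the shear by half its amount. -/
theorem det_shearMap_pos (C : A →ₗ[ℝ] B) : 0 < LinearMap.det (shearMap C) :=
  det_pos_of_sq (g := shearMap ((1 / 2 : ℝ) • C)) (h := shearMap (-C))
    (by rw [shearMap_comp, ← add_smul]; norm_num)
    (by rw [shearMap_comp, neg_add_cancel, shearMap_zero])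

end Det

section Orientation

variable {m : ℕ} {V : Type*} [NormedAddCommGroup V] [NormedSpace ℝ V] [FiniteDimensional ℝ V]

/-- The diagonal rotation. -/
def adjPi (m : ℕ) (U : SU2) : (Fin m → R3) →ₗ[ℝ] (Fin m → R3) := LinearMap.compLeft (adj U) (Fin m)

theorem adjPi_comp (U U' : SU2) : adjPi m U ∘ₗ adjPi m U' = adjPi m (U * U') :=
  LinearMap.ext fun w => funext fun k => (adj_mul U U' (w k)).symm

theorem adjPi_one : adjPi m 1 = LinearMap.id :=
  LinearMap.ext fun w => funext fun k => adj_one (w k)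

theorem det_adjPi_pos (U : SU2) : 0 < LinearMap.det (adjPi m U) := by
  obtain ⟨W, rfl⟩ := exists_sq_eq U
  exact det_pos_of_sq (adjPi_comp W W).symm (h := adjPi m (W * W)⁻¹)
    (by rw [adjPi_comp, inv_mul_cancel, adjPi_one])

theorem det_adj_prod_pos {T : Type*} [AddCommGroup T] [Module ℝ T] (U : SU2) :
    0 < LinearMap.det ((adj U).prodMap (LinearMap.id : T →ₗ[ℝ] T)) := by
  obtain ⟨W, rfl⟩ := exists_sq_eq U
  refine det_pos_of_sq (g := (adj W).prodMap LinearMap.id)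
    (h := (adj (W * W)⁻¹).prodMap LinearMap.id) ?_ ?_
  · refine LinearMap.ext fun p => Prod.ext (adj_mul W W p.1) rfl
  · refine LinearMap.ext fun p => Prod.ext (adj_inv_adj _ p.1) rfl

/-- The orientation sign of a slice is the sign of this determinant. -/
def sliceDet (Λ : (Fin m → R3) ≃ₗ[ℝ] V × (R3 × (Fin m → ℝ))) (s : V → Fin m → R3) (z : V) : ℝ :=
  LinearMap.det (Λ.toLinearMap ∘ₗ sliceMap s z)

variable (Λ : (Fin m → R3) ≃ₗ[ℝ] V × (R3 × (Fin m → ℝ)))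
  {e e' : ModelChart V (RotRel (m := m)) (nonCoax m)}

theorem ModelChart.IsHomogeneous.fderiv_coord_adjPi (he : e.IsHomogeneous) (U : SU2)
    {w : Fin m → R3} (hw : adjPi m U w ∈ e.range) (v : Fin m → R3) :
    fderiv ℝ e.coord (adjPi m U w) (adjPi m U v) = fderiv ℝ e.coord w v := by
  have h1 : e.coord ∘ adjPi m U = e.coord :=
    funext fun w => he.1 U w
  have h2 := (e.differentiableAt_coord hw).hasFDerivAt.comp w
    (LinearMap.toContinuousLinearMap (adjPi m U)).hasFDerivAt
  rw [h1] at h2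
  rw [h2.fderiv]
  rfl

/-- Points of the two slices in the same orbit differ by a rotation U. Transporting by U, the slice
maps differ by a block triangular map whose diagonal blocks are the derivative of the transition and
a rotation; rotations and shears have positive determinant. -/
theorem ModelChart.sliceDet_eq (he : e.IsHomogeneous) (he' : e'.IsHomogeneous) {z : V}
    (hz : z ∈ e.dom) (h : e.param z ∈ e'.range) :
    ∃ c : ℝ, 0 < c ∧ sliceDet Λ e.param z = c * sliceDet Λ e'.param (e'.coord (e.param z)) *
      (fderiv ℝ (fun z => e'.coord (e.param z)) z).det := by
  have hw := (e.param_mem z hz).1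
  set z' := e'.coord (e.param z) with hz'
  have hz'd : z' ∈ e'.dom := e'.coord_mem _ hw h
  obtain ⟨U, hU⟩ := e'.param_coord _ hw h
  replace hU : ∀ k, e.param z k = adj U (e'.param z' k) := hU
  have hU' : e.param z = adjPi m U (e'.param z') := funext hU
  have hinj := ModelChart.sliceMap_injective he' hz'd
  let M' := LinearEquiv.ofInjectiveOfFinrankEq (sliceMap e'.param z') hinj
    (Λ.finrank_eq).symm
  have hM' : ∀ y, M' y = sliceMap e'.param z' y := fun y => rfl
  -- The comparison map exists because the second slice map is injective between spaces of equal
  -- dimension, the equality coming from `Λ`.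
  obtain ⟨B, hB⟩ : ∃ B : V × (R3 × (Fin m → ℝ)) →ₗ[ℝ] V × (R3 × (Fin m → ℝ)),
      ∀ y, sliceMap e.param z y = adjPi m U (sliceMap e'.param z' (B y)) := by
    refine ⟨M'.symm.toLinearMap ∘ₗ adjPi m U⁻¹ ∘ₗ sliceMap e.param z, fun y => ?_⟩
    change _ = adjPi m U (sliceMap e'.param z' (M'.symm (adjPi m U⁻¹ (sliceMap e.param z y))))
    rw [← hM', M'.apply_symm_apply]
    exact funext fun k => (adj_adj_inv U _).symm
  -- Apply the derivative of the invariant coordinates of `e'` to both sides of `hB`.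
  have hB1 : ∀ y, (B y).1 = fderiv ℝ (fun z => e'.coord (e.param z)) z y.1 := by
    intro y
    rw [← ModelChart.fderiv_coord_sliceMap he' hz h y, hB, hU',
      he'.fderiv_coord_adjPi U (by rw [← hU']; exact h),
      ModelChart.fderiv_coord_sliceMap_self he' hz'd]
  -- Rotation vectors are themselves rotated and scalings are unchanged; this gives the vanishing
  -- block.
  have hB2 : ∀ η : R3 × (Fin m → ℝ), B (0, η) = (0, (adj U⁻¹ η.1, η.2)) := by
    intro η
    apply hinj
    have h1 : sliceMap e'.param z' (B (0, η)) = adjPi m U⁻¹ (sliceMap e.param z (0, η)) := by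
      rw [hB]
      exact funext fun k => (adj_inv_adj U _).symm
    rw [h1]
    funext k
    change adj U⁻¹ (sliceMap e.param z (0, η) k) = _
    simp only [sliceMap, LinearMap.coe_mk, AddHom.coe_mk, map_zero, Pi.zero_apply, zero_add,
      map_add, map_smul, hU, ← crossR3_adj, adj_inv_adj]
  let G : R3 × (Fin m → ℝ) →ₗ[ℝ] R3 × (Fin m → ℝ) := (adj U⁻¹).prodMap LinearMap.id
  let G' : R3 × (Fin m → ℝ) →ₗ[ℝ] R3 × (Fin m → ℝ) := (adj U).prodMap LinearMap.id
  let C : V →ₗ[ℝ] R3 × (Fin m → ℝ) :=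
    G' ∘ₗ LinearMap.snd ℝ _ _ ∘ₗ B ∘ₗ LinearMap.inl ℝ V (R3 × (Fin m → ℝ))
  have hBdec : B = ((fderiv ℝ (fun z => e'.coord (e.param z)) z).toLinearMap.prodMap G) ∘ₗ
      shearMap C := by
    refine LinearMap.ext fun y => Prod.ext ?_ ?_
    · rw [hB1]
      simp [shearMap]
    · have h1 : B y = B (y.1, 0) + B (0, y.2) := by rw [← map_add]; simp
      rw [h1, hB2]
      have h2 : ∀ p, G (G' p) = p := fun p => Prod.ext (adj_inv_adj U p.1) rfl
      change _ = G (G' (B (y.1, 0)).2 + y.2)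
      rw [map_add, h2]
      rfl
  refine ⟨LinearMap.det (adjPi m U) * (LinearMap.det G * LinearMap.det (shearMap C)),
    mul_pos (det_adjPi_pos U) (mul_pos (det_adj_prod_pos _) (det_shearMap_pos C)), ?_⟩
  have h3 : Λ.toLinearMap ∘ₗ sliceMap e.param z =
      ((Λ : (Fin m → R3) →ₗ[ℝ] _) ∘ₗ adjPi m U ∘ₗ (Λ.symm : _ →ₗ[ℝ] (Fin m → R3))) ∘ₗ
        (Λ.toLinearMap ∘ₗ sliceMap e'.param z') ∘ₗ B := by
    refine LinearMap.ext fun y => ?_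
    simp only [LinearMap.comp_apply, LinearEquiv.coe_coe, Λ.symm_apply_apply, hB]
  have h4 : (fderiv ℝ (fun z => e'.coord (e.param z)) z).det =
    LinearMap.det (fderiv ℝ (fun z => e'.coord (e.param z)) z).toLinearMap := rfl
  rw [sliceDet, h3, LinearMap.det_comp, LinearMap.det_conj, LinearMap.det_comp, hBdec,
    LinearMap.det_comp, LinearMap.det_prodMap, sliceDet, h4]
  ring

theorem sliceDet_ne_zero (he : e.IsHomogeneous) {z : V} (hz : z ∈ e.dom) :
    sliceDet Λ e.param z ≠ 0 := by
  have h := ModelChart.sliceMap_injective he hz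
  have h1 : Function.Injective (Λ.toLinearMap ∘ₗ sliceMap e.param z) := Λ.injective.comp h
  intro h0
  have := LinearMap.bot_lt_ker_of_det_eq_zero h0
  rw [LinearMap.ker_eq_bot.2 h1] at this
  exact lt_irrefl _ this

theorem continuousOn_sliceDet : ContinuousOn (sliceDet Λ e.param) e.dom := by
  let b := Module.finBasis ℝ (V × (R3 × (Fin m → ℝ)))
  have h : sliceDet Λ e.param = fun z =>
      (LinearMap.toMatrix b b (Λ.toLinearMap ∘ₗ sliceMap e.param z)).det :=
    funext fun z => (LinearMap.det_toMatrix b _).symm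
  rw [h, continuousOn_iff_continuous_restrict]
  refine Continuous.matrix_det (continuous_pi fun i => continuous_pi fun j => ?_)
  simp only [Set.restrict_apply, LinearMap.toMatrix_apply]
  let F : (Fin m → R3) →ₗ[ℝ] ℝ := b.coord i ∘ₗ Λ.toLinearMap
  suffices h : ContinuousOn (fun z => sliceMap e.param z (b j)) e.dom from
    (LinearMap.continuous_of_finiteDimensional F).comp h.restrict
  intro z hz
  refine ContinuousAt.continuousWithinAt ?_
  have h1 := e.contDiffAt_param z hz
  have h2 : ContinuousAt (fderiv ℝ e.param) z :=
    (h1.fderiv_right (m := 0) (by simp)).continuousAt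
  refine continuousAt_pi.2 fun k => ?_
  have h3 : ContinuousAt (fun z => e.param z k) z := (continuousAt_pi.1 h1.continuousAt) k
  have h4 : ContinuousAt (fun z => fderiv ℝ e.param z (b j).1 k) z :=
    continuousAt_pi.1 (h2.clm_apply continuousAt_const) k
  have h5 : Continuous (crossR3 (b j).2.1) := continuous_iff_continuousAt.2 fun x =>
    (contDiffAt_crossR3 contDiffAt_const contDiffAt_id).continuousAt
  have h6 : ContinuousAt (fun z => (b j).2.2 k • e.param z k) z := by fun_prop
  exact (h4.add (h5.continuousAt.comp h3)).add h6

theorem sliceMap_map {V' : Type*} [NormedAddCommGroup V'] [NormedSpace ℝ V']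
    (L : V ≃L[ℝ] V') {z : V'} (hz : L.symm z ∈ e.dom) :
    sliceMap (e.map L).param z = sliceMap e.param (L.symm z) ∘ₗ
      (L.symm : V' →ₗ[ℝ] V).prodMap LinearMap.id := by
  have h1 : fderiv ℝ (e.map L).param z = (fderiv ℝ e.param (L.symm z)).comp
      (L.symm : V' →L[ℝ] V) := by
    have := fderiv_comp' z ((e.contDiffAt_param _ hz).differentiableAt (by simp))
      L.symm.differentiableAt
    rw [L.symm.fderiv] at this
    exact this
  refine LinearMap.ext fun y => funext fun k => ?_
  simp only [sliceMap, LinearMap.coe_mk, AddHom.coe_mk, h1]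
  rfl

/-- A homogeneous chart with connected domain can be made positively oriented. -/
theorem exists_oriented_chart (hodd : Odd (Module.finrank ℝ V)) (he : e.IsHomogeneous)
    (hdom : IsPreconnected e.dom) :
    ∃ e' : ModelChart V (RotRel (m := m)) (nonCoax m), e'.IsHomogeneous ∧ e'.range = e.range ∧
      ∀ z ∈ e'.dom, 0 < sliceDet Λ e'.param z := by
  have hpre := hdom.image _ (continuousOn_sliceDet Λ (e := e))
  by_cases hpos : ∀ z ∈ e.dom, 0 < sliceDet Λ e.param z
  · exact ⟨e, he, rfl, hpos⟩
  -- The determinant is continuous and never zero on a connected domain, so its sign is constant.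
  · have hneg : ∀ z ∈ e.dom, sliceDet Λ e.param z < 0 := by
      push Not at hpos
      obtain ⟨z₀, hz₀, h0⟩ := hpos
      intro z hz
      by_contra h
      push Not at h
      obtain ⟨z', hz', h'⟩ := hpre.Icc_subset ⟨z₀, hz₀, rfl⟩ ⟨z, hz, rfl⟩ ⟨h0, h⟩
      exact sliceDet_ne_zero Λ he hz' h'
    -- In odd dimension z ↦ -z has determinant -1 and flips the sign.
    refine ⟨e.map (ContinuousLinearEquiv.neg ℝ), he.map _, rfl, fun z hz => ?_⟩
    rw [sliceDet, sliceMap_map _ hz, ← LinearMap.comp_assoc, LinearMap.det_comp,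
      LinearMap.det_prodMap, LinearMap.det_id, mul_one]
    refine mul_pos_of_neg_of_neg (hneg _ hz) ?_
    have h1 : (((ContinuousLinearEquiv.neg ℝ : V ≃L[ℝ] V).symm : V ≃L[ℝ] V) : V →ₗ[ℝ] V) =
        (-1 : ℝ) • LinearMap.id := by
      refine LinearMap.ext fun v => ?_
      simp
    rw [h1, LinearMap.det_smul, LinearMap.det_id, hodd.neg_one_pow]
    norm_num

end Orientation

/-! ### The oriented atlas of the space of configurations modulo rotations -/

/-- The stereographic coordinates are unrestricted, so the domain is a strip between two
hyperplanes, hence convex. -/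
theorem isPreconnected_frameChart_dom {m d : ℕ} {i j : Fin m} {ε : Fin m → ℝ} (hij : i ≠ j)
    (hε : ∀ k, ε k ^ 2 = 1)
    (L : (ℝ × ({k : Fin m // k ≠ i ∧ k ≠ j} → ℝ × ℝ)) ≃L[ℝ] EuclideanSpace ℝ (Fin d)) :
    IsPreconnected ((frameChart hij hε).map L).dom := by
  have h : ((frameChart hij hε).map L).dom =
      (LinearMap.fst ℝ ℝ ({k : Fin m // k ≠ i ∧ k ≠ j} → ℝ × ℝ) ∘ₗ
        (L.symm : EuclideanSpace ℝ (Fin d) →ₗ[ℝ] _)) ⁻¹' Set.Ioo (-1) 1 := by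
    ext z
    change (L.symm z).1 ^ 2 < 1 ↔ -1 < (L.symm z).1 ∧ (L.symm z).1 < 1
    rw [sq_lt_one_iff_abs_lt_one, abs_lt]
  rw [h]
  exact ((convex_Ioo (-1 : ℝ) 1).linear_preimage _).isPreconnected

theorem two_le_of_ne {m : ℕ} {i j : Fin m} (hij : i ≠ j) : 2 ≤ m := by
  have := i.2; have := j.2
  have : (i : ℕ) ≠ j := fun h => hij (Fin.ext h)
  omega

theorem exists_oriented_frameChart {m : ℕ}
    (Λ : (Fin m → R3) ≃ₗ[ℝ] EuclideanSpace ℝ (Fin (2 * m - 3)) × (R3 × (Fin m → ℝ)))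
    {w : Fin m → R3} (hw : w ∈ nonCoax m) :
    ∃ e : ModelChart (EuclideanSpace ℝ (Fin (2 * m - 3))) (RotRel (m := m)) (nonCoax m),
      e.IsHomogeneous ∧ w ∈ e.range ∧ ∀ z ∈ e.dom, 0 < sliceDet Λ e.param z := by
  obtain ⟨i, j, hij, ε, hε, h⟩ := exists_frameChart hw
  have hm := two_le_of_ne hij
  have L : (ℝ × ({k : Fin m // k ≠ i ∧ k ≠ j} → ℝ × ℝ)) ≃L[ℝ]
      EuclideanSpace ℝ (Fin (2 * m - 3)) := ContinuousLinearEquiv.ofFinrankEq (by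
    rw [finrank_frameSpace hij, finrank_euclideanSpace_fin])
  obtain ⟨e, he, hr, hpos⟩ := exists_oriented_chart Λ
    (e := (frameChart hij hε).map L)
    (by rw [finrank_euclideanSpace_fin]; exact ⟨m - 2, by omega⟩)
    ((isHomogeneous_frameChart hij hε).map L) (isPreconnected_frameChart_dom hij hε L)
  exact ⟨e, he, by rw [hr]; exact h, hpos⟩

section

variable {E : Type*} [NormedAddCommGroup E] [NormedSpace ℝ E] {X Q : Type*} [TopologicalSpace X]
  [TopologicalSpace Q] {c : X → E} {π : X → Q} {m : ℕ}

theorem exists_oriented_chartedSpace (hm : 2 ≤ m) {P : Type*} [NormedAddCommGroup P]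
    [NormedSpace ℝ P] [Unique P] (hc : Topology.IsInducing c) (hπ : IsOpenQuotientMap π)
    (T : ModelPatch c π P (RotRel (m := m)) (nonCoax m)) (hT : T.source = Set.univ) :
    ∃ _ : ChartedSpace (EuclideanSpace ℝ (Fin (2 * m - 3))) Q,
      IsManifold (𝓡 (2 * m - 3)) ω Q ∧ AtlasCompatible c π (2 * m - 3) ∧
        AtlasOriented Q (2 * m - 3) := by
  have Λ : (Fin m → R3) ≃ₗ[ℝ] EuclideanSpace ℝ (Fin (2 * m - 3)) × (R3 × (Fin m → ℝ)) :=
    LinearEquiv.ofFinrankEq _ _ (by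
      simp only [Module.finrank_prod, Module.finrank_pi_fintype, finrank_euclideanSpace_fin,
        Module.finrank_self, Finset.sum_const, Finset.card_univ, Fintype.card_fin, smul_eq_mul]
      omega)
  let L : (P × EuclideanSpace ℝ (Fin (2 * m - 3))) ≃L[ℝ] EuclideanSpace ℝ (Fin (2 * m - 3)) :=
    ContinuousLinearEquiv.uniqueProd ℝ _ P
  let A : Set (QuotChart c π (2 * m - 3)) := (fun e => T.quotChart hc e L) ''
    {e | e.IsHomogeneous ∧ ∀ z ∈ e.dom, 0 < sliceDet Λ e.param z}
  obtain ⟨inst, h1, h2, h3⟩ := exists_chartedSpace hc hπ A (fun x => by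
    have hx : x ∈ T.source := hT ▸ Set.mem_univ x
    obtain ⟨e, he, hr, hpos⟩ := exists_oriented_frameChart Λ (T.toModel_mem x hx).2
    exact ⟨_, ⟨e, ⟨he, hpos⟩, rfl⟩, T.mem_quotChart_range hc e L hx hr⟩)
  refine ⟨inst, h1, h2, h3 ?_⟩
  rintro _ ⟨e, ⟨he, hpos⟩, rfl⟩ _ ⟨e', ⟨he', hpos'⟩, rfl⟩ z hz hz'
  have hze : z ∈ e.dom := hz.2
  have hr := (T.quotChart_transition hc e e' L hz).2 hz'
  have heq : (fun z => (T.quotChart hc e' L).coord (c ((T.quotChart hc e L).param z))) =ᶠ[𝓝 z]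
      fun z => e'.coord (e.param z) := by
    filter_upwards [(T.quotChart hc e L).isOpen_dom.mem_nhds hz] with z hz
    exact (T.quotChart_transition hc e e' L hz).1
  rw [heq.fderiv_eq]
  -- Both slice determinants are positive by the choice of charts, hence so is the Jacobian relating
  -- them.
  obtain ⟨r, hr0, hr1⟩ := ModelChart.sliceDet_eq Λ he he' hze hr
  have h4 := hpos z hze
  have h5 := hpos' _ (e'.coord_mem _ (e.param_mem z hze).1 hr)
  rw [hr1] at h4
  exact pos_of_mul_pos_right h4 (mul_pos hr0 h5).le

end

/-! ### The topology of the decorated representation space -/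

namespace DecHom

variable {g n : ℕ}

theorem isInducing_coords : Topology.IsInducing (coords : DecHom g n → Ambient g n) := ⟨rfl⟩

theorem isInducing_coords_subtype (S : Set (DecHom g n)) :
    Topology.IsInducing fun x : S => coords (x : DecHom g n) :=
  isInducing_coords.comp Topology.IsInducing.subtypeVal

instance : SecondCountableTopology (DecHom g n) :=
  haveI : SecondCountableTopology (Ambient g n) :=
    secondCountable_of_proper (α := Ambient g n) 
  isInducing_coords.secondCountableTopology

/-- Conjugation of a decorated homomorphism. -/
def conjBy (U : SU2) (x : DecHom g n) : DecHom g n where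
  rho := (MulAut.conj U).toMonoidHom.comp x.rho
  A b := ⟨(U : Mat2) * (x.A b : Mat2) * ((U⁻¹ : SU2) : Mat2), conj_mem_su2 U (x.A b).2⟩
  A_ne_zero b h := by
    have h1 : (U : Mat2) * (x.A b : Mat2) * ((U⁻¹ : SU2) : Mat2) = 0 := congrArg Subtype.val h
    apply x.A_ne_zero b
    apply Subtype.ext
    calc (x.A b : Mat2) = (((U⁻¹ : SU2) : Mat2) * (U : Mat2)) * (x.A b : Mat2)
              * (((U⁻¹ : SU2) : Mat2) * (U : Mat2)) := by rw [coe_inv_mul, one_mul, mul_one]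
      _ = ((U⁻¹ : SU2) : Mat2) * ((U : Mat2) * (x.A b : Mat2) * ((U⁻¹ : SU2) : Mat2)) *
            (U : Mat2) := by simp only [mul_assoc]
      _ = 0 := by rw [h1, mul_zero, zero_mul]
  equivariant γ b b' h := by
    have h1 := x.equivariant γ b b' h
    simp only [MonoidHom.comp_apply, MulEquiv.coe_toMonoidHom, MulAut.conj_apply, mul_inv_rev,
      inv_inv, Submonoid.coe_mul, h1]
    calc _ = (U : Mat2) * (x.rho γ : Mat2) * 1 * (x.A b : Mat2) * 1 *
            (((x.rho γ)⁻¹ : SU2) : Mat2) * ((U⁻¹ : SU2) : Mat2) := by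
          simp only [mul_one, mul_assoc]
      _ = _ := by
          rw [← coe_inv_mul U]
          simp only [mul_assoc]
  exp_eq b := by
    refine Eq.trans ?_ (eMap_conj U (X := x.A b) rfl).symm
    rw [← x.exp_eq]
    rfl

theorem conj_conjBy (U : SU2) (x : DecHom g n) : x.Conj (conjBy U x) :=
  ⟨U, fun _ => rfl, fun _ => rfl⟩

theorem conj_iff_exists {x y : DecHom g n} :
    x.Conj y ↔ ∃ U : SU2, y.coords = (conjBy U x).coords := by
  constructor
  · rintro ⟨U, h1, h2⟩
    refine ⟨U, Prod.ext (funext fun j => Prod.ext ?_ ?_) (funext fun i => Subtype.ext ?_)⟩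
    · exact congrArg Subtype.val (h1 _)
    · exact congrArg Subtype.val (h1 _)
    · exact h2 _
  · rintro ⟨U, h⟩
    rw [coords_injective h]
    exact conj_conjBy U x

theorem continuous_conjBy_coords :
    Continuous fun p : SU2 × DecHom g n => (conjBy p.1 p.2).coords := by
  have hc : Continuous fun p : SU2 × DecHom g n => p.2.coords :=
    isInducing_coords.continuous.comp continuous_snd
  have hU : Continuous fun p : SU2 × DecHom g n => (p.1 : Mat2) :=
    continuous_subtype_val.comp continuous_fst
  have hU' : Continuous fun p : SU2 × DecHom g n => ((p.1⁻¹ : SU2) : Mat2) := by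
    simp only [coe_inv_SU2]
    exact hU.matrix_conjTranspose
  refine Continuous.prodMk (continuous_pi fun j => ?_) (continuous_pi fun i => ?_)
  · have h1 := (continuous_apply j).comp (continuous_fst.comp hc)
    exact ((hU.mul (continuous_fst.comp h1)).mul hU').prodMk
      ((hU.mul (continuous_snd.comp h1)).mul hU')
  · have h1 := continuous_subtype_val.comp ((continuous_apply i).comp (continuous_snd.comp hc))
    exact Continuous.subtype_mk ((hU.mul h1).mul hU') _

theorem continuous_conjBy (U : SU2) : Continuous (conjBy U : DecHom g n → DecHom g n) := by
  have h := (continuous_conjBy_coords (g := g) (n := n)).comp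
    (f := fun x : DecHom g n => (U, x)) (continuous_const.prodMk continuous_id)
  exact isInducing_coords.continuous_iff.2 h

theorem toRep_eq_iff {x y : DecHom g n} : x.toRep = y.toRep ↔ x.Conj y :=
  ⟨fun h => Quotient.exact h, fun h => Quotient.sound h⟩

/-- The saturation of an open set is the union of its preimages under conjugations, each of which is
continuous. -/
theorem isOpenQuotientMap_toRep : IsOpenQuotientMap (toRep : DecHom g n → DecRep g n) where
  surjective := Quotient.exists_rep
  continuous := continuous_quot_mk
  isOpenMap O hO := by
    change IsOpen (toRep ⁻¹' (toRep '' O))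
    have h : (toRep ⁻¹' (toRep '' O) : Set (DecHom g n)) = ⋃ U : SU2, conjBy U ⁻¹' O := by
      ext x
      simp only [Set.mem_preimage, Set.mem_image, Set.mem_iUnion]
      constructor
      · rintro ⟨y, hy, hyx⟩
        obtain ⟨U, hU⟩ := conj_iff_exists.1 (conj_equivalence.symm (toRep_eq_iff.1 hyx))
        exact ⟨U, by rwa [← coords_injective hU]⟩
      · rintro ⟨U, hU⟩
        exact ⟨_, hU, toRep_eq_iff.2 (conj_equivalence.symm (conj_conjBy U x))⟩
    rw [h]
    exact isOpen_iUnion fun U => hO.preimage (continuous_conjBy U)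

/-- The conjugacy relation is the projection, along the compact group `SU2`, of the closed set of
triples (U, x, y) with y the conjugate of x by U. It is therefore closed, and for an open quotient
map that is enough. -/
instance t2Space_decRep : T2Space (DecRep g n) := by
  rw [t2Space_iff_of_isOpenQuotientMap isOpenQuotientMap_toRep]
  have h : {q : DecHom g n × DecHom g n | q.1.toRep = q.2.toRep} =
      Prod.snd '' {p : SU2 × (DecHom g n × DecHom g n) |
        p.2.2.coords = (conjBy p.1 p.2.1).coords} := by
    ext ⟨x, y⟩
    simp only [Set.mem_setOf_eq, toRep_eq_iff, conj_iff_exists, Set.mem_image, Prod.exists,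
      Prod.mk.injEq]
    constructor
    · rintro ⟨U, hU⟩
      exact ⟨U, x, y, hU, rfl, rfl⟩
    · rintro ⟨U, _, _, hU, rfl, rfl⟩
      exact ⟨U, hU⟩
  rw [h]
  have h1 : Continuous fun p : SU2 × (DecHom g n × DecHom g n) => p.2.2 :=
    continuous_snd.comp continuous_snd
  have h2 : Continuous fun p : SU2 × (DecHom g n × DecHom g n) => (p.1, p.2.1) :=
    continuous_fst.prodMk (continuous_fst.comp continuous_snd)
  have h3 := (isInducing_coords (g := g) (n := n)).continuous.comp h1
  have h4 := (continuous_conjBy_coords (g := g) (n := n)).comp h2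
  exact isClosedMap_snd_of_compactSpace _ (isClosed_eq h3 h4)

instance secondCountableTopology_decRep : SecondCountableTopology (DecRep g n) :=
  isOpenQuotientMap_toRep.isQuotientMap.secondCountableTopology isOpenQuotientMap_toRep.isOpenMap

/-- For a conjugation-invariant set the restricted projection stays open, because every preimage of
a class already lies in the set. -/
theorem isOpenQuotientMap_imageFactorization {S : Set (DecHom g n)}
    (hS : ∀ x ∈ S, ∀ y, x.Conj y → y ∈ S) :
    IsOpenQuotientMap (Set.imageFactorization toRep S) where
  surjective := Set.imageFactorization_surjective
  continuous := (isOpenQuotientMap_toRep.continuous.comp continuous_subtype_val).subtype_mk _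
  isOpenMap := by
    rintro _ ⟨O, hO, rfl⟩
    refine ⟨toRep '' O, isOpenQuotientMap_toRep.isOpenMap O hO, ?_⟩
    ext ⟨_, x, hx, rfl⟩
    constructor
    · rintro ⟨y, hy, hyx⟩
      have h : y ∈ S := hS x hx y (conj_equivalence.symm (toRep_eq_iff.1 hyx))
      exact ⟨⟨y, h⟩, hy, Subtype.ext hyx⟩
    · rintro ⟨y, hy, hyx⟩
      exact ⟨y, hy, congrArg Subtype.val hyx⟩

end DecHom

/-! ### Connectedness of the space of non-coaxial configurations -/

/-- Rotation by the angle `2 r` about the axis `u`. -/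
def rot (r : ℝ) (u x : R3) : R3 :=
  Real.cos r ^ 2 • x + (2 * Real.cos r * Real.sin r) • crossR3 u x +
    Real.sin r ^ 2 • ((inner ℝ u x : ℝ) • u - crossR3 (crossR3 u x) u)

theorem exists_adj_eq_rot (r : ℝ) {u : R3} (hu : ‖u‖ = 1) : ∃ U : SU2, ∀ x, rot r u x = adj U x :=
  ⟨mkSU _ _ (quatMat_cos_sin_mem r hu), fun x => (adj_rotation _ x).symm⟩

theorem exists_rot_eq_adj (U : SU2) : ∃ r u, ‖u‖ = 1 ∧ ∀ x, rot r u x = adj U x := by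
  obtain ⟨u, hu, hU⟩ := exists_mem_torus U
  obtain ⟨r, hr⟩ := torus_param hu hU
  refine ⟨r, u, hu, fun x => ?_⟩
  have h : U = mkSU _ _ (quatMat_cos_sin_mem r hu) := Subtype.ext hr
  rw [h, adj_rotation]
  rfl

theorem continuous_crossR3 {T : Type*} [TopologicalSpace T] {f g : T → R3} (hf : Continuous f)
    (hg : Continuous g) : Continuous fun t => crossR3 (f t) (g t) := by
  have h : Continuous fun p : R3 × R3 => crossR3 p.1 p.2 := continuous_iff_continuousAt.2 fun p =>
    (contDiffAt_crossR3 contDiffAt_fst contDiffAt_snd).continuousAt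
  exact h.comp (hf.prodMk hg)

theorem continuous_rot {T : Type*} [TopologicalSpace T] {r : T → ℝ} {u x : T → R3}
    (hr : Continuous r) (hu : Continuous u) (hx : Continuous x) :
    Continuous fun t => rot (r t) (u t) (x t) := by
  have h1 := continuous_crossR3 hu hx
  have h2 := continuous_crossR3 h1 hu
  unfold rot
  fun_prop

theorem isConnected_sphere_R3 : IsConnected (Metric.sphere (0 : R3) 1) :=
  isConnected_sphere (by
    rw [← Module.finrank_eq_rank, finrank_euclideanSpace_fin]; norm_num) _ zero_le_one

theorem isConnected_spherePow (m : ℕ) : IsConnected (spherePow m) := by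
  have h : spherePow m = Set.univ.pi fun _ : Fin m => Metric.sphere (0 : R3) 1 := by
    ext w; simp [spherePow]
  rw [h]
  exact isConnected_univ_pi.2 fun _ => isConnected_sphere_R3

section

variable {m : ℕ}

theorem norm_e0 : ‖(!₂[1, 0, 0] : R3)‖ = 1 := by simp [EuclideanSpace.norm_eq, Fin.sum_univ_three]

theorem norm_cos_sin (t : ℝ) : ‖(!₂[Real.cos t, Real.sin t, 0] : R3)‖ = 1 := by
  refine (pow_eq_one_iff_of_nonneg (norm_nonneg _) two_ne_zero).1 ((norm_vec3 _ _ _).trans ?_)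
  rw [Real.cos_sq_add_sin_sq]; norm_num

/-- A parametrization of the configurations with independent `i`-th and `j`-th point. -/
def pairParam (i j : Fin m) (p : (ℝ × R3) × ℝ × (Fin m → R3)) : Fin m → R3 :=
  Function.update (Function.update p.2.2 i (rot p.1.1 p.1.2 !₂[1, 0, 0])) j
    (rot p.1.1 p.1.2 !₂[Real.cos p.2.1, Real.sin p.2.1, 0])

theorem continuous_pairParam (i j : Fin m) : Continuous (pairParam i j) := by
  have h : Continuous fun p : (ℝ × R3) × ℝ × (Fin m → R3) =>
      (!₂[Real.cos p.2.1, Real.sin p.2.1, 0] : R3) := by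
    refine (PiLp.continuous_toLp 2 _).comp (continuous_pi fun k => ?_)
    fin_cases k
    · exact Real.continuous_cos.comp (continuous_fst.comp continuous_snd)
    · exact Real.continuous_sin.comp (continuous_fst.comp continuous_snd)
    · exact continuous_const
  refine Continuous.update (Continuous.update (by fun_prop) i ?_) j ?_
  · exact continuous_rot (by fun_prop) (by fun_prop) continuous_const
  · exact continuous_rot (by fun_prop) (by fun_prop) h

/-- An independent pair of unit vectors is a rotated copy of a pair at angle t in (0, π), and the
other points are free. Rotations are parametrized by angle and axis so that the parameter space is
visibly connected. -/
theorem image_pairParam {i j : Fin m} (hij : i ≠ j) :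
    pairParam i j '' ((Set.univ ×ˢ Metric.sphere (0 : R3) 1) ×ˢ
      (Set.Ioo 0 Real.pi ×ˢ spherePow m)) =
      {w | w ∈ spherePow m ∧ crossR3 (w i) (w j) ≠ 0} := by
  ext w
  constructor
  · rintro ⟨⟨⟨r, u⟩, t, y⟩, ⟨⟨-, hu⟩, ht, hy⟩, rfl⟩
    obtain ⟨U, hU⟩ := exists_adj_eq_rot r (mem_sphere_zero_iff_norm.1 hu)
    have hj : pairParam i j ((r, u), t, y) j = adj U !₂[Real.cos t, Real.sin t, 0] := by
      rw [pairParam, Function.update_self, hU]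
    have hi : pairParam i j ((r, u), t, y) i = adj U !₂[1, 0, 0] := by
      rw [pairParam, Function.update_of_ne hij, Function.update_self, hU]
    refine ⟨mem_spherePow.2 fun k => ?_, ?_⟩
    · by_cases hkj : k = j
      · rw [hkj, hj, norm_adj, norm_cos_sin]
      by_cases hki : k = i
      · rw [hki, hi, norm_adj, norm_e0]
      · rw [pairParam, Function.update_of_ne hkj, Function.update_of_ne hki]
        exact mem_spherePow.1 hy k
    · rw [hi, hj, crossR3_adj]
      intro h
      have h1 := norm_adj U (crossR3 !₂[1, 0, 0] !₂[Real.cos t, Real.sin t, 0])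
      rw [h, norm_zero] at h1
      have h2 := congrArg (fun v : R3 => v 2) (norm_eq_zero.1 h1.symm)
      simp [crossR3] at h2
      exact (Real.sin_pos_of_mem_Ioo ht).ne' h2
  · rintro ⟨hw, h⟩
    have hw' := mem_spherePow.1 hw
    set c := inner ℝ (w i) (w j) with hc
    have hpos : 0 < 1 - c ^ 2 := by
      have := norm_sq_crossR3 (w i) (w j)
      rw [hw', hw', ← hc] at this
      have h3 := pow_pos (norm_pos_iff.2 h) 2
      linarith
    have hc1 : -1 < c ∧ c < 1 := by rw [← abs_lt, ← sq_lt_one_iff_abs_lt_one]; linarith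
    set s := Real.sqrt (1 - c ^ 2) with hs
    have hs0 : 0 < s := Real.sqrt_pos.2 hpos
    have hs2 : s ^ 2 = 1 - c ^ 2 := Real.sq_sqrt hpos.le
    -- Gram–Schmidt: this vector completes `w i` to an orthonormal pair, onto which the standard
    -- pair is rotated.
    have hz0 : inner ℝ (w i) (s⁻¹ • (w j - c • w i)) = 0 := by
      rw [real_inner_smul_right, inner_sub_right, real_inner_smul_right,
        real_inner_self_eq_norm_sq, hw', ← hc]
      ring
    have hz1 : ‖s⁻¹ • (w j - c • w i)‖ = 1 := by
      refine (pow_eq_one_iff_of_nonneg (norm_nonneg _) two_ne_zero).1 ?_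
      rw [norm_smul, mul_pow, norm_sub_sq_real, norm_smul, hw', hw', real_inner_smul_right,
        real_inner_comm, ← hc, norm_inv, Real.norm_of_nonneg hs0.le, inv_pow, hs2,
        Real.norm_eq_abs, mul_one, sq_abs]
      rw [inv_mul_eq_one₀ hpos.ne']
      ring
    have hf0 : ‖(!₂[0, 1, 0] : R3)‖ = 1 := by
      simp [EuclideanSpace.norm_eq, Fin.sum_univ_three]
    obtain ⟨U, hU1, hU2⟩ := exists_adj_pair norm_e0 hf0 (by simp [inner_R3]) (hw' i) hz1 hz0
    obtain ⟨r, u, hu, hr⟩ := exists_rot_eq_adj U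
    refine ⟨((r, u), Real.arccos c, w), ⟨⟨Set.mem_univ _, mem_sphere_zero_iff_norm.2 hu⟩,
      ⟨Real.arccos_pos.2 hc1.2, ?_⟩, hw⟩, ?_⟩
    · rw [lt_iff_le_and_ne]
      exact ⟨Real.arccos_le_pi c, fun h => by rw [Real.arccos_eq_pi] at h; linarith⟩
    · have h1 : rot r u !₂[1, 0, 0] = w i := by rw [hr, hU1]
      have h2 : rot r u !₂[Real.cos (Real.arccos c), Real.sin (Real.arccos c), 0] = w j := by
        have h3 : (!₂[Real.cos (Real.arccos c), Real.sin (Real.arccos c), 0] : R3) =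
            c • !₂[1, 0, 0] + s • !₂[0, 1, 0] := by
          rw [Real.cos_arccos hc1.1.le hc1.2.le, Real.sin_arccos, ← hs]
          ext k; fin_cases k <;> simp
        rw [hr, h3, map_add, map_smul, map_smul, hU1, hU2, smul_inv_smul₀ hs0.ne']
        abel
      change Function.update (Function.update w i _) j _ = w
      rw [h1, h2, Function.update_eq_self, Function.update_eq_self]

theorem isPreconnected_cross {i j : Fin m} (hij : i ≠ j) :
    IsPreconnected {w : Fin m → R3 | w ∈ spherePow m ∧ crossR3 (w i) (w j) ≠ 0} := by
  rw [← image_pairParam hij]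
  refine (IsPreconnected.prod (isPreconnected_univ.prod isConnected_sphere_R3.isPreconnected)
    (isPreconnected_Ioo.prod (isConnected_spherePow m).isPreconnected)).image _
    (continuous_pairParam i j).continuousOn

/-- A configuration of pairwise independent points. -/
def genericPt (m : ℕ) (k : Fin m) : R3 := ‖(!₂[1, (k : ℝ), 0] : R3)‖⁻¹ • !₂[1, (k : ℝ), 0]

theorem genericPt_aux (k : Fin m) : (!₂[1, (k : ℝ), 0] : R3) ≠ 0 := fun h => by
  simpa using congrArg (fun v : R3 => v 0) h

theorem genericPt_mem : genericPt m ∈ spherePow m :=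
  mem_spherePow.2 fun k => norm_smul_inv_norm (genericPt_aux k)

theorem cross_genericPt {i j : Fin m} (hij : i ≠ j) :
    crossR3 (genericPt m i) (genericPt m j) ≠ 0 := by
  rw [genericPt, genericPt, crossR3_smul_left, crossR3_smul_right]
  refine smul_ne_zero (inv_ne_zero (norm_ne_zero_iff.2 (genericPt_aux i)))
    (smul_ne_zero (inv_ne_zero (norm_ne_zero_iff.2 (genericPt_aux j))) fun h => hij ?_)
  have h2 := congrArg (fun v : R3 => v 2) h
  simp [crossR3] at h2
  exact Fin.ext (by exact_mod_cast (sub_eq_zero.1 h2).symm)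

/-- The set is the union, over pairs of distinct indices, of the connected sets where that pair is
independent. All of them contain the configuration of pairwise independent points. -/
theorem isConnected_nonCoax (hm : 2 ≤ m) : IsConnected (nonCoax m) := by
  have h01 : (⟨0, by omega⟩ : Fin m) ≠ ⟨1, by omega⟩ := fun h => by simpa using congrArg Fin.val h
  refine ⟨⟨genericPt m, mem_nonCoax.2 ⟨mem_spherePow.1 genericPt_mem, _, _,
    cross_genericPt h01⟩⟩, ?_⟩
  refine isPreconnected_of_forall (genericPt m) fun w hw => ?_
  obtain ⟨h1, i, j, h⟩ := mem_nonCoax.1 hw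
  have hij : i ≠ j := by
    rintro rfl
    exact h (crossR3_self _)
  refine ⟨{w | w ∈ spherePow m ∧ crossR3 (w i) (w j) ≠ 0}, ?_,
    ⟨genericPt_mem, cross_genericPt hij⟩, ⟨mem_spherePow.2 h1, h⟩, isPreconnected_cross hij⟩
  rintro v ⟨hv, hv'⟩
  exact mem_nonCoax.2 ⟨mem_spherePow.1 hv, i, j, hv'⟩

end

/-! ### The manifolds in genus zero -/

namespace DecHom

variable {g n : ℕ} {θ : Fin n → ℝ}

theorem dir_of_vec {x y : DecHom g n} {U : SU2} (h : ∀ i, y.vec i = adj U (x.vec i)) (i : Fin n) :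
    y.dir θ i = adj U (x.dir θ i) := by
  rw [dir, dir, h, map_smul]

theorem isConnectedManifold_aux {S : Set (DecHom g n)} (hS : ∀ x ∈ S, ∀ y, x.Conj y → y ∈ S)
    (hconn : IsConnected (locus S)) :
    Function.Surjective (Set.imageFactorization toRep S) ∧ T2Space (toRep '' S) ∧
      SecondCountableTopology (toRep '' S) ∧ ConnectedSpace (toRep '' S) := by
  have hπ := isOpenQuotientMap_imageFactorization hS
  refine ⟨hπ.surjective, inferInstance, inferInstance, ?_⟩
  have h1 : IsConnected S := by
    have h2 : locus S = coords '' S := rfl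
    rw [h2] at hconn
    exact ⟨hconn.nonempty.of_image, isInducing_coords.isPreconnected_image.1 hconn.isPreconnected⟩
  haveI : ConnectedSpace S := isConnected_iff_connectedSpace.1 h1
  exact hπ.surjective.connectedSpace hπ.continuous

theorem mem_rel_of_conj (hθ : ∀ i, 0 < θ i) {x y : DecHom g n} (hx : x ∈ rel g θ) (h : x.Conj y) :
    y ∈ rel g θ := by
  obtain ⟨U, -, -, hU⟩ := conj_iff.1 h
  rw [mem_rel_iff_dir hθ] at hx ⊢
  intro i
  rw [dir_of_vec hU, norm_adj, hx]

theorem isElementary_of_conj_genus_zero (hθ : ∀ i, 0 < θ i) {x y : DecHom 0 n}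
    (hx : x.IsElementary) (h : x.Conj y) : y.IsElementary := by
  obtain ⟨U, -, -, hU⟩ := conj_iff.1 h
  rw [isElementary_genus_zero_iff hθ] at hx ⊢
  obtain ⟨u, hu, h⟩ := hx
  refine ⟨adj U u, by rw [norm_adj, hu], fun i => ?_⟩
  obtain ⟨c, hc⟩ := h i
  exact ⟨c, by rw [dir_of_vec hU, hc, map_smul]⟩

variable {m : ℕ} {a : Fin n → Fin m} {b : Fin m → Fin n} {σ : Fin n → ℝ}

theorem IsSphereModel.mem_nonCoax (hθ : ∀ i, 0 < θ i) (h : IsSphereModel θ a b σ) {x : DecHom 0 n}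
    (hx : x ∈ (rel 0 θ : Set (DecHom 0 n))) :
    sphereCoords θ b σ x.coords ∈ nonCoax m ↔ ¬ x.IsElementary := by
  obtain ⟨y, hy, hxy⟩ := h.2.2.1 x hx
  rw [h.sphereCoords_eq hxy, isElementary_iff_sphere hθ h hxy, nonCoax, Set.mem_diff, mem_spherePow,
    mem_coaxPow]
  simp [hy]

theorem IsSphereModel.ofSphereCoords_sphereCoords (hθ : ∀ i, 0 < θ i) (h : IsSphereModel θ a b σ)
    {x : DecHom 0 n} (hx : x ∈ (rel 0 θ : Set (DecHom 0 n))) :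
    ofSphereCoords θ a σ (sphereCoords θ b σ x.coords) = x.coords := by
  obtain ⟨y, hy, hxy⟩ := h.2.2.1 x hx
  rw [h.sphereCoords_eq hxy, coords_eq_ofSphereCoords hθ hxy]

theorem IsSphereModel.exists_lift (hθ : ∀ i, 0 < θ i) (h : IsSphereModel θ a b σ)
    {w : Fin m → R3} (hw : w ∈ nonCoax m) :
    ∃ x : {x ∈ (rel 0 θ : Set (DecHom 0 n)) | ¬ x.IsElementary},
      (x : DecHom 0 n).coords = ofSphereCoords θ a σ w ∧
        sphereCoords θ b σ (x : DecHom 0 n).coords = w := by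
  obtain ⟨x, hx, hxy⟩ := h.2.2.2 w (_root_.mem_nonCoax.1 hw).1
  have h1 := h.sphereCoords_eq hxy
  exact ⟨⟨x, hx, (h.mem_nonCoax hθ hx).1 (h1.symm ▸ hw)⟩, coords_eq_ofSphereCoords hθ hxy, h1⟩

theorem IsSphereModel.locus_eq (hθ : ∀ i, 0 < θ i) (h : IsSphereModel θ a b σ) :
    locus {x ∈ (rel 0 θ : Set (DecHom 0 n)) | ¬ x.IsElementary} =
      ofSphereCoords θ a σ '' nonCoax m := by
  ext q
  constructor
  · rintro ⟨x, ⟨hx, hel⟩, rfl⟩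
    exact ⟨_, (h.mem_nonCoax hθ hx).2 hel, h.ofSphereCoords_sphereCoords hθ hx⟩
  · rintro ⟨w, hw, rfl⟩
    obtain ⟨x, hx, -⟩ := h.exists_lift hθ hw
    exact ⟨x, x.2, hx⟩

theorem IsSphereModel.conj_iff_rotRel (hθ : ∀ i, 0 < θ i) (h : IsSphereModel θ a b σ)
    {x y : DecHom 0 n} (hx : x ∈ (rel 0 θ : Set (DecHom 0 n)))
    (hy : y ∈ (rel 0 θ : Set (DecHom 0 n))) :
    x.Conj y ↔ RotRel (sphereCoords θ b σ x.coords) (sphereCoords θ b σ y.coords) := by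
  rw [conj_iff]
  refine exists_congr fun U => ⟨fun hU k => ?_, fun hU => ⟨fun j => j.elim0, fun j => j.elim0,
    fun i => ?_⟩⟩
  · rw [sphereCoords_coords, sphereCoords_coords, dir_of_vec hU.2.2, map_smul]
  · obtain ⟨z, -, hz⟩ := h.2.2.1 x hx
    obtain ⟨z', -, hz'⟩ := h.2.2.1 y hy
    rw [h.sphereCoords_eq hz, h.sphereCoords_eq hz'] at hU
    rw [vec_eq_dir hθ, vec_eq_dir hθ, hz, hz', hU, map_smul, map_smul]

/-- In genus zero one patch covers everything and there are no extra parameters, which is expressed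
by the zero space `Fin 0 → ℝ`. Conjugacy becomes simultaneous rotation of the sphere points. -/
theorem IsSphereModel.repConnectedOrientedManifold (hθ : ∀ i, 0 < θ i)
    (h : IsSphereModel θ a b σ) (hm : 2 ≤ m) :
    RepConnectedOrientedManifold {x ∈ (rel 0 θ : Set (DecHom 0 n)) | ¬ x.IsElementary}
      (2 * m - 3) := by
  set S := {x ∈ (rel 0 θ : Set (DecHom 0 n)) | ¬ x.IsElementary} with hSdef
  have hS : ∀ x ∈ S, ∀ y, x.Conj y → y ∈ S := fun x hx y hxy =>
    ⟨mem_rel_of_conj hθ hx.1 hxy, fun hel =>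
      hx.2 (isElementary_of_conj_genus_zero hθ hel (conj_equivalence.symm hxy))⟩
  have hconn : IsConnected (locus S) := by
    rw [h.locus_eq hθ]
    exact (isConnected_nonCoax hm).image _ ((LinearMap.continuous_of_finiteDimensional
      ((isLinearMap_ofSphereCoords θ a σ).mk' _)).continuousOn)
  obtain ⟨h1, h2, h3, h4⟩ := isConnectedManifold_aux hS hconn
  refine ⟨h1, h2, h3, h4, ?_⟩
  haveI : Nonempty S := by
    obtain ⟨_, x, hx, -⟩ := hconn.nonempty
    exact ⟨⟨x, hx⟩⟩
  have hlift : ∀ w, w ∈ nonCoax m → ∃ x : S,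
      (x : DecHom 0 n).coords = ofSphereCoords θ a σ w ∧
        sphereCoords θ b σ (x : DecHom 0 n).coords = w := fun w hw => h.exists_lift hθ hw
  choose! lift hl1 hl2 using hlift
  let T : ModelPatch (fun x : S => coords (x : DecHom 0 n)) (Set.imageFactorization toRep S)
      (Fin 0 → ℝ) (RotRel (m := m)) (nonCoax m) :=
    { base := Set.univ
      source := Set.univ
      lift := fun p => lift p.2
      toModel := fun q => (0, sphereCoords θ b σ q)
      ofModel := fun p => ofSphereCoords θ a σ p.2
      isOpen_base := isOpen_univ
      isOpen_source := isOpen_univ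
      contDiffAt_toModel := fun x _ =>
        contDiffAt_const.prodMk ((isLinearMap_sphereCoords θ b σ).contDiffAt _)
      contDiffAt_ofModel := fun p _ w _ =>
        ContDiffAt.comp (g := ofSphereCoords θ a σ) (p, w)
          ((isLinearMap_ofSphereCoords θ a σ).contDiffAt w) contDiffAt_snd
      lift_mem := fun _ _ _ _ => Set.mem_univ _
      coe_lift := fun p _ w hw => hl1 w hw
      toModel_mem := fun x _ => ⟨Set.mem_univ _, (h.mem_nonCoax hθ x.2.1).2 x.2.2⟩
      toModel_ofModel := fun p _ w hw =>
        Prod.ext (Subsingleton.elim _ _) (by rw [← hl1 w hw]; exact hl2 w hw)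
      rel_iff := fun x _ x' => by
        have e1 : Set.imageFactorization toRep S x' = Set.imageFactorization toRep S x ↔
            (x' : DecHom 0 n).Conj x := by
          rw [← toRep_eq_iff]
          exact Subtype.ext_iff
        rw [e1, h.conj_iff_rotRel hθ x'.2.1 x.2.1]
        simp }
  exact exists_oriented_chartedSpace hm (isInducing_coords_subtype S)
    (isOpenQuotientMap_imageFactorization hS) T rfl

end DecHom

/-! ### The manifolds in genus one -/

/-- With the axis adjoined as an additional point, a common line can only be the line of u; so
non-elementary means non-coaxial. -/
theorem cons_mem_nonCoax {n : ℕ} {u : R3} {y : Fin n → R3} (hu : ‖u‖ = 1) (hy : ∀ i, ‖y i‖ = 1) :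
    (Fin.cons u y : Fin (n + 1) → R3) ∈ nonCoax (n + 1) ↔ ¬ ∀ i, ∃ t : ℝ, y i = t • u := by
  have h1 : ∀ j, ‖(Fin.cons u y : Fin (n + 1) → R3) j‖ = 1 := Fin.cases hu hy
  rw [nonCoax, Set.mem_diff, mem_spherePow, mem_coaxPow, and_iff_right h1, and_iff_right h1, not_iff_not]
  constructor
  · rintro ⟨v, hv, h⟩ i
    obtain ⟨s, hs⟩ := h 0
    obtain ⟨t, ht⟩ := h i.succ
    rw [Fin.cons_zero] at hs
    rw [Fin.cons_succ] at ht
    have hs0 : s ≠ 0 := by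
      rintro rfl
      rw [hs, zero_smul, norm_zero] at hu
      exact zero_ne_one hu
    exact ⟨t * s⁻¹, by rw [ht, hs, mul_smul, inv_smul_smul₀ hs0]⟩
  · intro h
    exact ⟨u, hu, Fin.cases ⟨1, (one_smul _ _).symm⟩ h⟩

theorem adj_mem_nonCoax {m : ℕ} (U : SU2) {w : Fin m → R3} (hw : w ∈ nonCoax m) :
    (fun k => adj U (w k)) ∈ nonCoax m := by
  rw [mem_nonCoax] at hw ⊢
  obtain ⟨h1, i, j, h⟩ := hw
  refine ⟨fun k => by rw [norm_adj, h1], i, j, fun h0 => h ?_⟩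
  rw [crossR3_adj] at h0
  rw [← adj_inv_adj U (crossR3 (w i) (w j)), h0, map_zero]

/-- Rational parametrization of the circle. -/
def circ (ε τ : ℝ) : ℝ × ℝ := (ε * (1 - τ ^ 2) / (1 + τ ^ 2), 2 * τ / (1 + τ ^ 2))

theorem circ_sq {ε : ℝ} (hε : ε ^ 2 = 1) (τ : ℝ) : (circ ε τ).1 ^ 2 + (circ ε τ).2 ^ 2 = 1 := by
  have h : 0 < 1 + τ ^ 2 := by positivity
  simp only [circ]
  rw [div_pow, mul_pow, hε, div_pow]
  field_simp
  ring

theorem circ_denom {ε : ℝ} (hε : ε ^ 2 = 1) (τ : ℝ) : 1 + ε * (circ ε τ).1 = 2 / (1 + τ ^ 2) := by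
  have h : 0 < 1 + τ ^ 2 := by positivity
  simp only [circ]
  rw [mul_div_assoc', ← mul_assoc, ← pow_two, hε]
  field_simp
  ring

theorem circ_inv {ε : ℝ} (hε : ε ^ 2 = 1) (τ : ℝ) :
    (circ ε τ).2 / (1 + ε * (circ ε τ).1) = τ := by
  have h : 0 < 1 + τ ^ 2 := by positivity
  rw [circ_denom hε]
  simp only [circ]
  field_simp

/-- The half-angle tangent d/(1 + εc) inverts the parametrization away from the point c = -ε. -/
theorem circ_of_sq {ε c d : ℝ} (hε : ε ^ 2 = 1) (h : c ^ 2 + d ^ 2 = 1) (h0 : 1 + ε * c ≠ 0) :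
    circ ε (d / (1 + ε * c)) = (c, d) := by
  have h1 : (d / (1 + ε * c)) ^ 2 = (1 - ε * c) / (1 + ε * c) := by
    rw [div_pow, div_eq_div_iff (pow_ne_zero 2 h0) h0]
    have : d ^ 2 = 1 - ε ^ 2 * c ^ 2 := by rw [hε]; linarith
    rw [this]; ring
  have h2 : 1 + (1 - ε * c) / (1 + ε * c) = 2 / (1 + ε * c) := by field_simp; ring
  have h3 : 1 - (1 - ε * c) / (1 + ε * c) = 2 * (ε * c) / (1 + ε * c) := by field_simp; ring
  rw [circ, h1, h2, h3]
  ext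
  · simp only
    rw [show ε * (2 * (ε * c) / (1 + ε * c)) = 2 * (ε ^ 2 * c) / (1 + ε * c) by ring, hε, one_mul,
      div_div_div_cancel_right₀ h0, mul_div_cancel_left₀ c two_ne_zero]
  · simp only
    field_simp

theorem contDiffAt_circ (ε τ : ℝ) : ContDiffAt ℝ ω (circ ε) τ := by
  have h : 1 + τ ^ 2 ≠ 0 := by positivity
  unfold circ
  fun_prop (disch := assumption)

namespace DecHom

variable {n : ℕ} {θ : Fin n → ℝ}

/-- The monodromy and direction coordinates of a point of the ambient space. -/
def torusModel (θ : Fin n → ℝ) (ε : ℝ) (q : Ambient 1 n) : (ℝ × ℝ) × (Fin (n + 1) → R3) :=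
  ((‖vecPart (q.1 0).1‖ / (1 + 1 * rePart (q.1 0).1),
    inner ℝ (‖vecPart (q.1 0).1‖⁻¹ • vecPart (q.1 0).1) (vecPart (q.1 0).2) /
      (1 + ε * rePart (q.1 0).2)),
    Fin.cons (‖vecPart (q.1 0).1‖⁻¹ • vecPart (q.1 0).1) (ambDir θ q))

/-- The inverse of `torusModel`. -/
def torusOfModel (θ : Fin n → ℝ) (ε : ℝ) (p : (ℝ × ℝ) × (Fin (n + 1) → R3)) : Ambient 1 n :=
  torusPt θ (circ 1 p.1.1).1 (circ 1 p.1.1).2 (circ ε p.1.2).1 (circ ε p.1.2).2 (p.2 0)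
    (Fin.tail p.2)

theorem torusModel_torusPt (hθ : ∀ i, 0 < θ i) (ε : ℝ) {a b c d : ℝ} {u : R3} {y : Fin n → R3}
    (h : IsTorusRep a b c d u y) (hb : 0 < b) :
    torusModel θ ε (torusPt θ a b c d u y) =
      ((b / (1 + 1 * a), d / (1 + ε * c)), Fin.cons u y) := by
  have h1 : vecPart ((torusPt θ a b c d u y).1 0).1 = b • u := by simp [torusPt, ofDir]
  have h2 : vecPart ((torusPt θ a b c d u y).1 0).2 = d • u := by simp [torusPt, ofDir]
  have h3 : rePart ((torusPt θ a b c d u y).1 0).1 = a := by simp [torusPt, ofDir]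
  have h4 : rePart ((torusPt θ a b c d u y).1 0).2 = c := by simp [torusPt, ofDir]
  have h5 : ambDir θ (torusPt θ a b c d u y) = y := ambDir_ofDir hθ _ _ _
  rw [torusModel, h1, h2, h3, h4, h5, norm_smul, h.norm_u, mul_one, Real.norm_of_nonneg hb.le,
    inv_smul_smul₀ hb.ne', real_inner_smul_right, real_inner_self_eq_norm_sq, h.norm_u, one_pow,
    mul_one]

theorem isTorusRep_ofModel {ε : ℝ} (hε : ε ^ 2 = 1) {p : ℝ × ℝ} (hp : 0 < p.1)
    {w : Fin (n + 1) → R3} (hw : w ∈ nonCoax (n + 1)) :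
    0 < (circ 1 p.1).2 ∧ IsTorusRep (circ 1 p.1).1 (circ 1 p.1).2 (circ ε p.2).1 (circ ε p.2).2
      (w 0) (Fin.tail w) ∧ 1 + ε * (circ ε p.2).1 ≠ 0 := by
  have h1 : 0 < (circ 1 p.1).2 := by
    simp only [circ]
    positivity
  refine ⟨h1, ⟨circ_sq (one_pow 2) _, circ_sq hε _, (mem_nonCoax.1 hw).1 0,
    fun i => (mem_nonCoax.1 hw).1 _, fun h => h1.ne' h.1⟩, ?_⟩
  rw [circ_denom hε]
  positivity

theorem torusModel_ofModel (hθ : ∀ i, 0 < θ i) {ε : ℝ} (hε : ε ^ 2 = 1) {p : ℝ × ℝ} (hp : 0 < p.1)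
    {w : Fin (n + 1) → R3} (hw : w ∈ nonCoax (n + 1)) :
    torusModel θ ε (torusOfModel θ ε (p, w)) = (p, w) := by
  obtain ⟨h1, h2, -⟩ := isTorusRep_ofModel hε hp hw
  rw [torusOfModel, torusModel_torusPt hθ ε h2 h1, circ_inv (one_pow 2), circ_inv hε]
  exact Prod.ext rfl (Fin.cons_self_tail w)

/-- Since b > 0 excludes a = -1, one rational chart suffices for the first circle; the second circle
needs both signs ε. -/
theorem IsTorusRep.one_add_ne_zero {a b c d : ℝ} {u : R3} {y : Fin n → R3}
    (h : IsTorusRep a b c d u y) (hb : 0 < b) : 1 + 1 * a ≠ 0 := by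
  intro h0
  have h1 := h.ab
  rw [show a = -1 by linarith] at h1
  nlinarith

theorem torusOfModel_torusPt (hθ : ∀ i, 0 < θ i) {ε : ℝ} (hε : ε ^ 2 = 1) {a b c d : ℝ} {u : R3}
    {y : Fin n → R3} (h : IsTorusRep a b c d u y) (hb : 0 < b) (hc : 1 + ε * c ≠ 0) :
    torusOfModel θ ε (torusModel θ ε (torusPt θ a b c d u y)) = torusPt θ a b c d u y := by
  rw [torusModel_torusPt hθ ε h hb, torusOfModel]
  simp only [circ_of_sq (one_pow 2) h.ab (h.one_add_ne_zero hb), circ_of_sq hε h.cd hc,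
    Fin.cons_zero, Fin.tail_cons]

theorem contDiffAt_torusModel {ε : ℝ} {q : Ambient 1 n} (h1 : vecPart (q.1 0).1 ≠ 0)
    (h2 : 1 + 1 * rePart (q.1 0).1 ≠ 0) (h3 : 1 + ε * rePart (q.1 0).2 ≠ 0) :
    ContDiffAt ℝ ω (torusModel θ ε) q := by
  have e1 : ContDiffAt ℝ ω (fun q : Ambient 1 n => vecPart (q.1 0).1) q := by fun_prop
  have e2 := e1.norm ℝ h1
  have e3 : ContDiffAt ℝ ω
      (fun q : Ambient 1 n => ‖vecPart (q.1 0).1‖⁻¹ • vecPart (q.1 0).1) q :=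
    (e2.inv (norm_ne_zero_iff.2 h1)).smul e1
  refine ContDiffAt.prodMk (ContDiffAt.prodMk ?_ ?_) (contDiffAt_pi.2 fun i => ?_)
  · exact e2.div (by fun_prop) h2
  · exact (e3.inner ℝ (by fun_prop)).div (by fun_prop) h3
  · refine Fin.cases e3 (fun i => ?_) i
    exact contDiffAt_pi.1 ((isLinearMap_ambDir θ).contDiffAt q) i

theorem contDiffAt_torusPt {E : Type*} [NormedAddCommGroup E] [NormedSpace ℝ E] {p : E}
    {a b c d : E → ℝ} {u : E → R3} {y : E → Fin n → R3} (ha : ContDiffAt ℝ ω a p)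
    (hb : ContDiffAt ℝ ω b p) (hc : ContDiffAt ℝ ω c p) (hd : ContDiffAt ℝ ω d p)
    (hu : ContDiffAt ℝ ω u p) (hy : ContDiffAt ℝ ω y p) :
    ContDiffAt ℝ ω (fun q => torusPt θ (a q) (b q) (c q) (d q) (u q) (y q)) p :=
  contDiffAt_ofDir (by fun_prop) (by fun_prop) hy

theorem contDiffAt_torusOfModel (ε : ℝ) (p : (ℝ × ℝ) × (Fin (n + 1) → R3)) :
    ContDiffAt ℝ ω (torusOfModel θ ε) p := by
  have h1 : ContDiffAt ℝ ω (fun p : (ℝ × ℝ) × (Fin (n + 1) → R3) => circ 1 p.1.1) p :=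
    ContDiffAt.comp (g := circ 1) (f := fun p : (ℝ × ℝ) × (Fin (n + 1) → R3) => p.1.1) p
      (contDiffAt_circ 1 p.1.1) (by fun_prop)
  have h2 : ContDiffAt ℝ ω (fun p : (ℝ × ℝ) × (Fin (n + 1) → R3) => circ ε p.1.2) p :=
    ContDiffAt.comp (g := circ ε) (f := fun p : (ℝ × ℝ) × (Fin (n + 1) → R3) => p.1.2) p
      (contDiffAt_circ ε p.1.2) (by fun_prop)
  refine contDiffAt_torusPt h1.fst h1.snd h2.fst h2.snd (by fun_prop) ?_
  rw [contDiffAt_pi]; intro i; unfold Fin.tail; fun_prop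

/-- Conjugation on the ambient space. -/
def actCoords (U : SU2) (q : Ambient 1 n) : Ambient 1 n :=
  (fun j => ((U : Mat2) * (q.1 j).1 * ((U⁻¹ : SU2) : Mat2),
    (U : Mat2) * (q.1 j).2 * ((U⁻¹ : SU2) : Mat2)),
    fun i => suEquiv (adj U (suEquiv.symm (q.2 i))))

theorem coords_conjBy (U : SU2) (x : DecHom 1 n) : (conjBy U x).coords = actCoords U x.coords := by
  refine Prod.ext rfl (funext fun i => Subtype.ext ?_)
  change (U : Mat2) * (x.A (betaPer i) : Mat2) * ((U⁻¹ : SU2) : Mat2) = imMat (adj U (x.vec i))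
  rw [imMat_adj, imMat_vec]

theorem actCoords_torusPt (U : SU2) (a b c d : ℝ) (u : R3) (y : Fin n → R3) :
    actCoords U (torusPt θ a b c d u y) = torusPt θ a b c d (adj U u) (fun i => adj U (y i)) := by
  refine Prod.ext (funext fun j => Prod.ext ?_ ?_) (funext fun i => ?_)
  · change (U : Mat2) * quatMat a (b • u) * ((U⁻¹ : SU2) : Mat2) = _
    rw [conj_quatMat, map_smul]
    rfl
  · change (U : Mat2) * quatMat c (d • u) * ((U⁻¹ : SU2) : Mat2) = _
    rw [conj_quatMat, map_smul]
    rfl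
  · change suEquiv (adj U (suEquiv.symm (suEquiv ((θ i / 2) • y i)))) = _
    rw [suEquiv.symm_apply_apply, map_smul]
    rfl

theorem IsTorusRep.adj {a b c d : ℝ} {u : R3} {y : Fin n → R3} (h : IsTorusRep a b c d u y)
    (U : SU2) : IsTorusRep a b c d (adj U u) (fun i => adj U (y i)) :=
  ⟨h.ab, h.cd, by rw [norm_adj, h.norm_u], fun i => by rw [norm_adj, h.norm_y], h.ne⟩

/-- The non-elementary non-central locus. -/
def genericLocus (θ : Fin n → ℝ) : Set (DecHom 1 n) :=
  {x ∈ rel 1 θ | ¬ x.IsElementary ∧ ¬ x.IsCentral}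

/-- The identity or the exchange of the monodromy matrices. -/
def swapIf (s : Bool) (q : Ambient 1 n) : Ambient 1 n := if s then swapMono q else q

theorem swapIf_swapIf (s : Bool) (q : Ambient 1 n) : swapIf s (swapIf s q) = q := by
  cases s <;> rfl

theorem contDiffAt_swapIf (s : Bool) (q : Ambient 1 n) : ContDiffAt ℝ ω (swapIf s) q := by
  cases s
  · exact contDiffAt_id
  · exact contDiffAt_swapMono q

theorem swapIf_actCoords (s : Bool) (U : SU2) (q : Ambient 1 n) :
    swapIf s (actCoords U q) = actCoords U (swapIf s q) := by
  cases s <;> rfl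

/-! ### Patches, connectedness and manifold structure of the generic locus -/

section

variable (hθ : ∀ i, 0 < θ i) {cθ : Fin n → ℤ} (hc : ∀ i, θ i = cθ i) (he : Even (∑ i, (cθ i - 1)))
include hθ hc he

theorem mem_genericLocus_iff {x : DecHom 1 n} :
    x ∈ genericLocus θ ↔ ∃ a b c d u y, IsTorusRep a b c d u y ∧
      (Fin.cons u y : Fin (n + 1) → R3) ∈ nonCoax (n + 1) ∧ x.coords = torusPt θ a b c d u y := by
  constructor
  · rintro ⟨hx, hel, hcen⟩
    obtain ⟨a, b, c, d, u, y, h, h'⟩ := exists_torusRep hθ hc he hx hcen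
    refine ⟨a, b, c, d, u, y, h, ?_, h'⟩
    obtain ⟨x', -, -, h1, h2⟩ := exists_torusPt hθ hc he h
    rw [cons_mem_nonCoax h.norm_u h.norm_y, ← h2, coords_injective (h1.trans h'.symm)]
    exact hel
  · rintro ⟨a, b, c, d, u, y, h, hw, h'⟩
    obtain ⟨x', hx', hcen, h1, h2⟩ := exists_torusPt hθ hc he h
    rw [cons_mem_nonCoax h.norm_u h.norm_y, ← h2] at hw
    rw [← coords_injective (h1.trans h'.symm)]
    exact ⟨hx', hw, hcen⟩

theorem mem_locus_genericLocus_iff {q : Ambient 1 n} :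
    q ∈ locus (genericLocus θ) ↔ ∃ a b c d u y, IsTorusRep a b c d u y ∧
      (Fin.cons u y : Fin (n + 1) → R3) ∈ nonCoax (n + 1) ∧ q = torusPt θ a b c d u y := by
  constructor
  · rintro ⟨x, hx, rfl⟩
    exact (mem_genericLocus_iff hθ hc he).1 hx
  · rintro ⟨a, b, c, d, u, y, h, hw, rfl⟩
    obtain ⟨x', hx', hcen, h1, h2⟩ := exists_torusPt hθ hc he h
    exact ⟨x', (mem_genericLocus_iff hθ hc he).2 ⟨a, b, c, d, u, y, h, hw, h1⟩, h1⟩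

theorem swapIf_mem_locus (s : Bool) {q : Ambient 1 n} (hq : q ∈ locus (genericLocus θ)) :
    swapIf s q ∈ locus (genericLocus θ) := by
  cases s
  · exact hq
  · rw [mem_locus_genericLocus_iff hθ hc he] at hq ⊢
    obtain ⟨a, b, c, d, u, y, h, hw, rfl⟩ := hq
    exact ⟨c, d, a, b, u, y, h.swap, hw, rfl⟩

theorem exists_torusRep_generic {q : Ambient 1 n} (hq : q ∈ locus (genericLocus θ))
    (h0 : vecPart (q.1 0).1 ≠ 0) :
    ∃ a b c d u y, 0 < b ∧ IsTorusRep a b c d u y ∧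
      (Fin.cons u y : Fin (n + 1) → R3) ∈ nonCoax (n + 1) ∧ q = torusPt θ a b c d u y := by
  obtain ⟨a, b, c, d, u, y, h, hw, rfl⟩ := (mem_locus_genericLocus_iff hθ hc he).1 hq
  have hb : b ≠ 0 := by
    rintro rfl
    apply h0
    simp [torusPt, ofDir]
  obtain ⟨b', d', u', hb', h', heq, hiff⟩ := h.exists_pos (θ := θ) hb
  rw [cons_mem_nonCoax h.norm_u h.norm_y, hiff,
    ← cons_mem_nonCoax h'.norm_u h'.norm_y] at hw
  exact ⟨a, b', c, d', u', y, hb', h', hw, heq⟩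

theorem genericLocus_conj {x : DecHom 1 n} (hx : x ∈ genericLocus θ) {y : DecHom 1 n}
    (h : x.Conj y) : y ∈ genericLocus θ := by
  obtain ⟨U, hU⟩ := conj_iff_exists.1 h
  obtain ⟨a, b, c, d, u, v, hr, hw, hq⟩ := (mem_genericLocus_iff hθ hc he).1 hx
  refine (mem_genericLocus_iff hθ hc he).2 ⟨a, b, c, d, _, _, hr.adj U, ?_, ?_⟩
  · have h1 := adj_mem_nonCoax U hw
    have h2 : (fun k => _root_.adj U ((Fin.cons u v : Fin (n + 1) → R3) k)) =
        Fin.cons (_root_.adj U u) fun i => _root_.adj U (v i) := by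
      funext k
      refine Fin.cases ?_ (fun i => ?_) k <;> simp
    rwa [h2] at h1
  · rw [hU, coords_conjBy, hq, actCoords_torusPt]

theorem exists_lift_torusOfModel (s : Bool) {ε : ℝ} (hε : ε ^ 2 = 1) {p : ℝ × ℝ} (hp : 0 < p.1)
    {w : Fin (n + 1) → R3} (hw : w ∈ nonCoax (n + 1)) :
    ∃ x : genericLocus θ, (x : DecHom 1 n).coords = swapIf s (torusOfModel θ ε (p, w)) := by
  obtain ⟨-, h2, -⟩ := isTorusRep_ofModel hε hp hw
  have h3 : torusOfModel θ ε (p, w) ∈ locus (genericLocus θ) :=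
    (mem_locus_genericLocus_iff hθ hc he).2
      ⟨_, _, _, _, _, _, h2, by rw [Fin.cons_self_tail]; exact hw, rfl⟩
  obtain ⟨x, hx, h⟩ := swapIf_mem_locus hθ hc he s h3
  exact ⟨⟨x, hx⟩, h⟩

/-- The points of the generic locus covered by a patch. -/
theorem exists_patch_sign {x : DecHom 1 n} (hx : x ∈ genericLocus θ) :
    ∃ s : Bool, ∃ ε : ℝ, ε ^ 2 = 1 ∧ vecPart ((swapIf s x.coords).1 0).1 ≠ 0 ∧
      1 + ε * rePart ((swapIf s x.coords).1 0).2 ≠ 0 := by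
  obtain ⟨a, b, c, d, u, y, h, hw, hq⟩ := (mem_genericLocus_iff hθ hc he).1 hx
  have hu0 : u ≠ 0 := by
    rw [← norm_ne_zero_iff, h.norm_u]; exact one_ne_zero
  have h1 : ∃ s : Bool, vecPart ((swapIf s x.coords).1 0).1 ≠ 0 := by
    by_cases hb : b = 0
    · refine ⟨true, ?_⟩
      have hd : d ≠ 0 := fun hd => h.ne ⟨hb, hd⟩
      have h2 : vecPart ((swapIf true x.coords).1 0).1 = d • u := by
        rw [hq]; exact vecPart_quatMat _ _
      rw [h2]
      exact smul_ne_zero hd hu0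
    · refine ⟨false, ?_⟩
      have h2 : vecPart ((swapIf false x.coords).1 0).1 = b • u := by
        rw [hq]; exact vecPart_quatMat _ _
      rw [h2]
      exact smul_ne_zero hb hu0
  obtain ⟨s, hs⟩ := h1
  -- If 1 + c vanishes then 1 - c = 2, so one of the two signs always works.
  by_cases h2 : 1 + 1 * rePart ((swapIf s x.coords).1 0).2 = 0
  · exact ⟨s, -1, by norm_num, hs, by linarith⟩
  · exact ⟨s, 1, by norm_num, hs, h2⟩

/-- The relation is left general so that the same patches serve the space of homomorphisms, with
equality, and its quotient, with simultaneous rotation. The Boolean chooses which monodromy matrix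
is required to be non-central. -/
theorem exists_modelPatch {Q : Type*} [TopologicalSpace Q] {π : genericLocus θ → Q}
    {r : (Fin (n + 1) → R3) → (Fin (n + 1) → R3) → Prop}
    (hr : ∀ s : Bool, ∀ ε : ℝ, ε ^ 2 = 1 → ∀ p p' : ℝ × ℝ, 0 < p.1 → 0 < p'.1 →
      ∀ w ∈ nonCoax (n + 1), ∀ w' ∈ nonCoax (n + 1), ∀ x x' : genericLocus θ,
      (x : DecHom 1 n).coords = swapIf s (torusOfModel θ ε (p, w)) →
      (x' : DecHom 1 n).coords = swapIf s (torusOfModel θ ε (p', w')) →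
      (π x' = π x ↔ p' = p ∧ r w' w))
    (hsat : ∀ (s : Bool) (ε : ℝ) (x x' : genericLocus θ), π x' = π x →
      vecPart ((swapIf s (x : DecHom 1 n).coords).1 0).1 ≠ 0 →
      1 + ε * rePart ((swapIf s (x : DecHom 1 n).coords).1 0).2 ≠ 0 →
      vecPart ((swapIf s (x' : DecHom 1 n).coords).1 0).1 ≠ 0 ∧
      1 + ε * rePart ((swapIf s (x' : DecHom 1 n).coords).1 0).2 ≠ 0)
    (x₀ : genericLocus θ) :
    ∃ T : ModelPatch (fun x : genericLocus θ => coords (x : DecHom 1 n)) π (ℝ × ℝ) r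
      (nonCoax (n + 1)), x₀ ∈ T.source := by
  obtain ⟨s, ε, hε, hx₀⟩ := exists_patch_sign hθ hc he x₀.2
  have hrep : ∀ x : genericLocus θ, vecPart ((swapIf s (x : DecHom 1 n).coords).1 0).1 ≠ 0 →
      1 + ε * rePart ((swapIf s (x : DecHom 1 n).coords).1 0).2 ≠ 0 →
      ContDiffAt ℝ ω (torusModel θ ε) (swapIf s (x : DecHom 1 n).coords) ∧
      0 < (torusModel θ ε (swapIf s (x : DecHom 1 n).coords)).1.1 ∧
      (torusModel θ ε (swapIf s (x : DecHom 1 n).coords)).2 ∈ nonCoax (n + 1) ∧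
      (x : DecHom 1 n).coords =
        swapIf s (torusOfModel θ ε (torusModel θ ε (swapIf s (x : DecHom 1 n).coords))) := by
    intro x h1 h2
    obtain ⟨a, b, c, d, u, y, hb, h, hw, hq⟩ := exists_torusRep_generic hθ hc he
      (swapIf_mem_locus hθ hc he s ⟨x, x.2, rfl⟩) h1
    have h3 : rePart ((swapIf s (x : DecHom 1 n).coords).1 0).1 = a := by
      rw [hq]; exact rePart_quatMat _ _
    have h4 : rePart ((swapIf s (x : DecHom 1 n).coords).1 0).2 = c := by
      rw [hq]; exact rePart_quatMat _ _
    have h5 := h.one_add_ne_zero hb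
    have h6 : 0 < 1 + 1 * a := by
      have h7 := h.ab
      refine lt_of_le_of_ne ?_ h5.symm
      nlinarith [sq_nonneg b, sq_nonneg (a + 1)]
    refine ⟨contDiffAt_torusModel h1 (by rw [h3]; exact h5) h2, ?_, ?_, ?_⟩
    · rw [hq, torusModel_torusPt hθ ε h hb]
      exact div_pos hb h6
    · rw [hq, torusModel_torusPt hθ ε h hb]
      exact hw
    · rw [h4] at h2
      rw [hq, torusOfModel_torusPt hθ hε h hb h2, ← hq, swapIf_swapIf]
  have hlift : ∀ p : (ℝ × ℝ) × (Fin (n + 1) → R3), 0 < p.1.1 → p.2 ∈ nonCoax (n + 1) →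
      ∃ x : genericLocus θ, (x : DecHom 1 n).coords = swapIf s (torusOfModel θ ε p) :=
    fun p hp hw => exists_lift_torusOfModel hθ hc he s hε hp hw
  haveI : Nonempty (genericLocus θ) := ⟨x₀⟩
  choose! lift hl using hlift
  refine ⟨{ base := {p | 0 < p.1}
            source := {x | vecPart ((swapIf s (x : DecHom 1 n).coords).1 0).1 ≠ 0 ∧
              1 + ε * rePart ((swapIf s (x : DecHom 1 n).coords).1 0).2 ≠ 0}
            lift := lift
            toModel := fun q => torusModel θ ε (swapIf s q)
            ofModel := fun p => swapIf s (torusOfModel θ ε p)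
            isOpen_base := isOpen_lt continuous_const continuous_fst
            isOpen_source := ?_
            contDiffAt_toModel := ?_
            contDiffAt_ofModel := ?_
            lift_mem := ?_
            coe_lift := fun p hp w hw => hl (p, w) hp hw
            toModel_mem := fun x hx => ⟨(hrep x hx.1 hx.2).2.1, (hrep x hx.1 hx.2).2.2.1⟩
            toModel_ofModel := ?_
            rel_iff := ?_ }, hx₀⟩
  · have h1 : Continuous fun x : genericLocus θ => swapIf s (x : DecHom 1 n).coords :=
      (continuous_iff_continuousAt.2 fun q => (contDiffAt_swapIf s q).continuousAt).comp
        (isInducing_coords_subtype (genericLocus θ)).continuous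
    have h2 : Continuous fun q : Ambient 1 n => vecPart (q.1 0).1 :=
      (LinearMap.continuous_of_finiteDimensional vecPart).comp (by fun_prop)
    have h3 : Continuous fun q : Ambient 1 n => 1 + ε * rePart (q.1 0).2 :=
      continuous_const.add (continuous_const.mul
        ((LinearMap.continuous_of_finiteDimensional rePart).comp (by fun_prop)))
    exact (isOpen_ne_fun (h2.comp h1) continuous_const).inter
      (isOpen_ne_fun (h3.comp h1) continuous_const)
  · intro x hx
    exact ContDiffAt.comp (g := torusModel θ ε) _ (hrep x hx.1 hx.2).1 (contDiffAt_swapIf s _)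
  · intro p _ w _
    exact ContDiffAt.comp (g := swapIf s) (p, w) (contDiffAt_swapIf s _)
      (contDiffAt_torusOfModel ε _)
  · intro p hp w hw
    obtain ⟨h1, h2, h3⟩ := isTorusRep_ofModel hε hp hw
    rw [Set.mem_setOf_eq, hl (p, w) hp hw, swapIf_swapIf]
    refine ⟨?_, ?_⟩
    · have h4 : vecPart ((torusOfModel θ ε (p, w)).1 0).1 = (circ 1 p.1).2 • w 0 :=
        vecPart_quatMat _ _
      rw [h4]
      refine smul_ne_zero h1.ne' ?_
      rw [← norm_ne_zero_iff, h2.norm_u]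
      exact one_ne_zero
    · have h4 : rePart ((torusOfModel θ ε (p, w)).1 0).2 = (circ ε p.2).1 := rePart_quatMat _ _
      rw [h4]
      exact h3
  · intro p hp w hw
    rw [swapIf_swapIf, torusModel_ofModel hθ hε hp hw]
  · rintro x ⟨hx1, hx2⟩ x'
    have h1 := hrep x hx1 hx2
    constructor
    · intro h
      obtain ⟨hx1', hx2'⟩ := hsat s ε x x' h hx1 hx2
      have h1' := hrep x' hx1' hx2'
      exact ⟨⟨hx1', hx2'⟩, (hr s ε hε _ _ h1.2.1 h1'.2.1 _ h1.2.2.1 _ h1'.2.2.1 x x' h1.2.2.2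
        h1'.2.2.2).1 h⟩
    · rintro ⟨⟨hx1', hx2'⟩, h⟩
      have h1' := hrep x' hx1' hx2'
      exact (hr s ε hε _ _ h1.2.1 h1'.2.1 _ h1.2.2.1 _ h1'.2.2.1 x x' h1.2.2.2
        h1'.2.2.2).2 h

/-- The part where the first matrix is non-central is the image of an interval times ℝ times the
connected space of non-coaxial (n+1)-tuples. Its image under the exchange of the matrices covers the
rest, and the two parts meet. -/
theorem isConnected_genericLocus (hn : 0 < n) : IsConnected (locus (genericLocus θ)) := by
  let F : ℝ × ℝ × (Fin (n + 1) → R3) → Ambient 1 n := fun p =>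
    torusPt θ (Real.cos p.1) (Real.sin p.1) (Real.cos p.2.1) (Real.sin p.2.1) (p.2.2 0)
      (Fin.tail p.2.2)
  have hF : Continuous F := by
    refine continuous_iff_continuousAt.2 fun p => ContDiffAt.continuousAt (𝕜 := ℝ) (n := ω) ?_
    refine contDiffAt_torusPt (by fun_prop) (by fun_prop) (by fun_prop) (by fun_prop)
      (by fun_prop) ?_
    rw [contDiffAt_pi]; intro i; unfold Fin.tail; fun_prop
  have hD : IsConnected (Set.Ioo 0 Real.pi ×ˢ (Set.univ : Set ℝ) ×ˢ nonCoax (n + 1)) :=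
    (isConnected_Ioo Real.pi_pos).prod (isConnected_univ.prod (isConnected_nonCoax (by omega)))
  have h1 := hD.image F hF.continuousOn
  have h2 := h1.image swapMono (continuous_iff_continuousAt.2 fun q =>
    (contDiffAt_swapMono q).continuousAt).continuousOn
  have h3 : locus (genericLocus θ) =
      F '' (Set.Ioo 0 Real.pi ×ˢ (Set.univ : Set ℝ) ×ˢ nonCoax (n + 1)) ∪
      swapMono '' (F '' (Set.Ioo 0 Real.pi ×ˢ (Set.univ : Set ℝ) ×ˢ nonCoax (n + 1))) := by
    have hsub : ∀ q ∈ F '' (Set.Ioo 0 Real.pi ×ˢ (Set.univ : Set ℝ) ×ˢ nonCoax (n + 1)),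
        q ∈ locus (genericLocus θ) := by
      rintro _ ⟨⟨r, s, w⟩, ⟨hr, -, hw⟩, rfl⟩
      refine (mem_locus_genericLocus_iff hθ hc he).2 ⟨_, _, _, _, _, _,
        ⟨Real.cos_sq_add_sin_sq r, Real.cos_sq_add_sin_sq s, (mem_nonCoax.1 hw).1 0,
          fun i => (mem_nonCoax.1 hw).1 _, fun h => (Real.sin_pos_of_mem_Ioo hr).ne' h.1⟩, ?_, rfl⟩
      change Fin.cons (w 0) (Fin.tail w) ∈ _
      rw [Fin.cons_self_tail]
      exact hw
    have hmem : ∀ q ∈ locus (genericLocus θ), vecPart (q.1 0).1 ≠ 0 →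
        q ∈ F '' (Set.Ioo 0 Real.pi ×ˢ (Set.univ : Set ℝ) ×ˢ nonCoax (n + 1)) := by
      intro q hq h0
      obtain ⟨a, b, c, d, u, y, hb, h, hw, rfl⟩ := exists_torusRep_generic hθ hc he hq h0
      have hab := h.ab
      have ha : -1 < a ∧ a < 1 := by
        rw [← abs_lt, ← sq_lt_one_iff_abs_lt_one]
        nlinarith [pow_pos hb 2]
      obtain ⟨s, hs1, hs2⟩ := exists_cos_sin h.cd
      refine ⟨(Real.arccos a, s, Fin.cons u y), ⟨⟨Real.arccos_pos.2 ha.2, ?_⟩, trivial, hw⟩, ?_⟩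
      · rw [lt_iff_le_and_ne]
        exact ⟨Real.arccos_le_pi a, fun h => by rw [Real.arccos_eq_pi] at h; linarith⟩
      · have e1 : Real.sin (Real.arccos a) = b := by
          rw [Real.sin_arccos, show 1 - a ^ 2 = b ^ 2 by linarith, Real.sqrt_sq hb.le]
        simp only [F, Real.cos_arccos ha.1.le ha.2.le, e1, Fin.cons_zero, Fin.tail_cons]
        rw [hs1, hs2]
    apply Set.Subset.antisymm
    · intro q hq
      by_cases h0 : vecPart (q.1 0).1 = 0
      · right
        refine ⟨swapMono q, hmem _ (swapIf_mem_locus hθ hc he true hq) ?_, rfl⟩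
        obtain ⟨a, b, c, d, u, y, h, hw, rfl⟩ := (mem_locus_genericLocus_iff hθ hc he).1 hq
        have e1 : vecPart ((torusPt θ a b c d u y).1 0).1 = b • u := vecPart_quatMat _ _
        have e2 : vecPart ((swapMono (torusPt θ a b c d u y)).1 0).1 = d • u :=
          vecPart_quatMat _ _
        have hu0 : u ≠ 0 := by
          rw [← norm_ne_zero_iff, h.norm_u]; exact one_ne_zero
        rw [e1, smul_eq_zero, or_iff_left hu0] at h0
        rw [e2]
        exact smul_ne_zero (fun hd => h.ne ⟨h0, hd⟩) hu0
      · exact Or.inl (hmem q hq h0)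
    · rintro q (hq | ⟨q, hq, rfl⟩)
      · exact hsub q hq
      · exact swapIf_mem_locus hθ hc he true (hsub q hq)
  rw [h3]
  -- With both angles equal to π/2 the two matrices coincide, so this point is fixed by the exchange
  -- and lies in both parts.
  refine IsConnected.union ?_ h1 h2
  obtain ⟨w, hw⟩ := (isConnected_nonCoax (m := n + 1) (by omega)).nonempty
  have hp : (Real.pi / 2, Real.pi / 2, w) ∈
      Set.Ioo 0 Real.pi ×ˢ (Set.univ : Set ℝ) ×ˢ nonCoax (n + 1) :=
    ⟨⟨by positivity, by linarith [Real.pi_pos]⟩, trivial, hw⟩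
  exact ⟨F (Real.pi / 2, Real.pi / 2, w), ⟨_, hp, rfl⟩, _, ⟨_, hp, rfl⟩, rfl⟩

theorem torusOfModel_injective (s : Bool) {ε : ℝ} (hε : ε ^ 2 = 1) {p p' : ℝ × ℝ} (hp : 0 < p.1)
    (hp' : 0 < p'.1) {w w' : Fin (n + 1) → R3} (hw : w ∈ nonCoax (n + 1))
    (hw' : w' ∈ nonCoax (n + 1))
    (h : swapIf s (torusOfModel θ ε (p', w')) = swapIf s (torusOfModel θ ε (p, w))) :
    p' = p ∧ w' = w := by
  have h1 := congrArg (fun q => torusModel θ ε (swapIf s q)) h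
  simp only [swapIf_swapIf] at h1
  rw [torusModel_ofModel hθ hε hp hw, torusModel_ofModel hθ hε hp' hw'] at h1
  exact ⟨congrArg Prod.fst h1, congrArg Prod.snd h1⟩

theorem homConnectedManifold_genus_one (hn : 0 < n) :
    HomConnectedManifold (genericLocus θ) (2 * n + 4) := by
  have hconn := isConnected_genericLocus hθ hc he hn
  have h1 : IsConnected (genericLocus θ) :=
    ⟨hconn.nonempty.of_image, isInducing_coords.isPreconnected_image.1 hconn.isPreconnected⟩
  haveI : T2Space (DecHom 1 n) := T2Space.of_injective_continuous coords_injective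
    isInducing_coords.continuous
  refine ⟨Function.surjective_id, inferInstance, inferInstance,
    isConnected_iff_connectedSpace.1 h1, ?_⟩
  obtain ⟨inst, h2, h3, -⟩ := exists_chartedSpace
    (isInducing_coords_subtype (genericLocus θ)) IsOpenQuotientMap.id
    (Set.univ : Set (QuotChart _ (id : genericLocus θ → genericLocus θ) (2 * n + 4))) (by
      intro x
      obtain ⟨T, hT⟩ := exists_modelPatch hθ hc he (π := id) (r := Eq)
        (fun s ε hε p p' hp hp' w hw w' hw' x x' hx hx' => by
          constructor
          · intro h
            have h' : x' = x := h
            rw [h', hx] at hx'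
            exact (torusOfModel_injective hθ hc he s hε hp hp' hw hw' hx'.symm)
          · rintro ⟨rfl, rfl⟩
            exact Subtype.ext (coords_injective (hx'.trans hx.symm)))
        (fun s ε x x' h h1 h2 => by
          have h' : x' = x := h
          rw [h']
          exact ⟨h1, h2⟩) x
      obtain ⟨ε, hε, h⟩ := exists_stereoChart (T.toModel_mem x hT).2
      -- Two torus parameters and two coordinates for each of the n + 1 sphere points.
      have L : ((ℝ × ℝ) × (Fin (n + 1) → ℝ × ℝ)) ≃L[ℝ] EuclideanSpace ℝ (Fin (2 * n + 4)) :=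
        ContinuousLinearEquiv.ofFinrankEq (by
          simp only [Module.finrank_prod, Module.finrank_self, Module.finrank_pi_fintype,
            Finset.sum_const, Finset.card_univ, Fintype.card_fin, finrank_euclideanSpace_fin,
            smul_eq_mul]
          ring)
      exact ⟨T.quotChart (isInducing_coords_subtype _) (stereoChart ε hε) L, Set.mem_univ _,
        T.mem_quotChart_range _ _ _ hT h⟩)
  exact ⟨inst, h2, h3⟩

theorem repConnectedManifold_genus_one (hn : 0 < n) :
    RepConnectedManifold (genericLocus θ) (2 * n + 1) := by
  have hS : ∀ x ∈ genericLocus θ, ∀ y, x.Conj y → y ∈ genericLocus θ :=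
    fun x hx y h => genericLocus_conj hθ hc he hx h
  obtain ⟨h1, h2, h3, h4⟩ := isConnectedManifold_aux hS (isConnected_genericLocus hθ hc he hn)
  refine ⟨h1, h2, h3, h4, ?_⟩
  have hπ : ∀ x x' : genericLocus θ, Set.imageFactorization toRep (genericLocus θ) x' =
      Set.imageFactorization toRep (genericLocus θ) x ↔
      ∃ U, (x : DecHom 1 n).coords = actCoords U (x' : DecHom 1 n).coords := by
    intro x x'
    have e1 : Set.imageFactorization toRep (genericLocus θ) x' =
        Set.imageFactorization toRep (genericLocus θ) x ↔ (x' : DecHom 1 n).Conj x := by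
      rw [← toRep_eq_iff]
      exact Subtype.ext_iff
    rw [e1, conj_iff_exists]
    simp only [coords_conjBy]
  have hact : ∀ (U : SU2) (ε : ℝ) (p : ℝ × ℝ) (w : Fin (n + 1) → R3),
      actCoords U (torusOfModel θ ε (p, w)) = torusOfModel θ ε (p, fun k => _root_.adj U (w k)) :=
    fun U ε p w => actCoords_torusPt _ _ _ _ _ _ _
  obtain ⟨inst, h5, h6, -⟩ := exists_chartedSpace
    (isInducing_coords_subtype (genericLocus θ)) (isOpenQuotientMap_imageFactorization hS)
    (Set.univ : Set (QuotChart _ (Set.imageFactorization toRep (genericLocus θ)) (2 * n + 1))) (by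
      intro x
      obtain ⟨T, hT⟩ := exists_modelPatch hθ hc he
        (π := Set.imageFactorization toRep (genericLocus θ)) (r := RotRel)
        (fun s ε hε p p' hp hp' w hw w' hw' x x' hx hx' => by
          rw [hπ, hx, hx']
          simp only [← swapIf_actCoords, hact]
          constructor
          · rintro ⟨U, hU⟩
            obtain ⟨h7, h8⟩ := torusOfModel_injective hθ hc he s hε hp' hp
              (adj_mem_nonCoax U hw') hw hU
            exact ⟨h7.symm, U, fun k => congrFun h8 k⟩
          · rintro ⟨rfl, U, hU⟩
            exact ⟨U, by rw [funext hU]⟩)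
        (fun s ε x x' h h1 h2 => by
          obtain ⟨U, hU⟩ := (hπ x x').1 h
          rw [hU, swapIf_actCoords] at h1 h2
          obtain ⟨a, b, c, d, u, y, hr, hw, hq⟩ := (mem_locus_genericLocus_iff hθ hc he).1
            (swapIf_mem_locus hθ hc he s ⟨x', x'.2, rfl⟩)
          rw [hq, actCoords_torusPt] at h1 h2
          rw [hq]
          have e1 : ∀ v y', vecPart ((torusPt θ a b c d v y').1 0).1 = b • v :=
            fun v y' => vecPart_quatMat _ _
          have e2 : ∀ v y', rePart ((torusPt θ a b c d v y').1 0).2 = c :=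
            fun v y' => rePart_quatMat _ _
          rw [e1] at h1 ⊢
          rw [e2] at h2 ⊢
          refine ⟨fun h0 => h1 ?_, h2⟩
          rw [← map_smul, h0, map_zero]) x
      obtain ⟨i, j, hij, ε, hε, h⟩ := exists_frameChart (T.toModel_mem x hT).2
      -- Two torus parameters and 2(n + 1) - 3 coordinates of a configuration modulo rotations.
      have L : ((ℝ × ℝ) × (ℝ × ({k : Fin (n + 1) // k ≠ i ∧ k ≠ j} → ℝ × ℝ))) ≃L[ℝ]
          EuclideanSpace ℝ (Fin (2 * n + 1)) :=
        ContinuousLinearEquiv.ofFinrankEq (by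
          rw [Module.finrank_prod, finrank_frameSpace hij, finrank_euclideanSpace_fin,
            Module.finrank_prod, Module.finrank_self]
          omega)
      exact ⟨T.quotChart (isInducing_coords_subtype _) (frameChart hij hε) L, Set.mem_univ _,
        T.mem_quotChart_range _ _ _ hT h⟩)
  exact ⟨inst, h5, h6⟩

end

end DecHom

/-! ### Difference quotients of analytic maps -/

section Hadamard

variable {G H : Type*} [NormedAddCommGroup G] [NormedSpace ℝ G]
  [NormedAddCommGroup H] [NormedSpace ℝ H]

/-- Telescoping: the arguments w are replaced by z one at a time, and the k-th summand is the change
in the k-th slot. -/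
theorem ContinuousMultilinearMap.sum_insertNth_sub {n : ℕ}
    (f : ContinuousMultilinearMap ℝ (fun _ : Fin (n + 1) => G) H) (z w : G) :
    ∑ k : Fin (n + 1), f (k.insertNth (z - w) fun i : Fin n => if i.castSucc < k then z else w) =
      f (fun _ => z) - f fun _ => w := by
  let s : ℕ → Fin (n + 1) → G := fun m i => if i.val < m then z else w
  have h1 : ∀ k : Fin (n + 1), f (k.insertNth (z - w) fun i : Fin n =>
      if i.castSucc < k then z else w) = f (s (k.val + 1)) - f (s k.val) := by
    intro k
    have e1 : ∀ x : G, (k.insertNth x fun i : Fin n => if i.castSucc < k then z else w) =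
        Function.update (s k.val) k x := by
      intro x
      funext i
      refine Fin.succAboveCases k ?_ (fun j => ?_) i
      · simp
      · rw [Fin.insertNth_apply_succAbove, Function.update_of_ne (Fin.succAbove_ne k j)]
        simp only [s]
        by_cases hj : j.castSucc < k
        · rw [if_pos hj, Fin.succAbove_of_castSucc_lt k j hj, if_pos (Fin.lt_def.1 hj)]
        · rw [if_neg hj, Fin.succAbove_of_le_castSucc k j (not_lt.1 hj), if_neg]
          have := Fin.le_def.1 (not_lt.1 hj)
          simp only [Fin.val_castSucc, Fin.val_succ] at this ⊢
          omega
    have e2 : s (k.val + 1) = Function.update (s k.val) k z := by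
      funext i
      by_cases hi : i = k
      · subst hi; simp [s]
      · rw [Function.update_of_ne hi]
        have : i.val ≠ k.val := fun h => hi (Fin.ext h)
        simp only [s]
        congr 1
        exact propext (by omega)
    have e3 : s k.val = Function.update (s k.val) k w := by
      rw [eq_comm, Function.update_eq_self_iff]
      simp [s]
    rw [e1, f.map_update_sub, ← e2, ← e3]
  rw [Finset.sum_congr rfl fun k _ => h1 k,
    Fin.sum_univ_eq_sum_range (fun k => f (s (k + 1)) - f (s k)),
    Finset.sum_range_sub fun k => f (s k)]
  congr 2
  · funext i; simp only [s]; rw [if_pos i.2]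

/-- The difference quotient series of a formal multilinear series. -/
def FormalMultilinearSeries.diffQuot (p : FormalMultilinearSeries ℝ G H) :
    FormalMultilinearSeries ℝ (G × G) (G →L[ℝ] H) := fun n =>
  ∑ k : Fin (n + 1), ((p (n + 1)).curryMid k).flipMultilinear.compContinuousLinearMap
    fun i : Fin n => if i.castSucc < k then ContinuousLinearMap.fst ℝ G G
      else ContinuousLinearMap.snd ℝ G G

theorem FormalMultilinearSeries.diffQuot_apply (p : FormalMultilinearSeries ℝ G H) (n : ℕ)
    (z w : G) : p.diffQuot n (fun _ => (z, w)) (z - w) =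
      p (n + 1) (fun _ => z) - p (n + 1) fun _ => w := by
  rw [← ContinuousMultilinearMap.sum_insertNth_sub, diffQuot, ContinuousMultilinearMap.sum_apply,
    ContinuousLinearMap.sum_apply]
  refine Finset.sum_congr rfl fun k _ => ?_
  change p (n + 1) (k.insertNth (z - w) _) = _
  congr 2
  funext i
  beta_reduce
  split_ifs <;> rfl

theorem FormalMultilinearSeries.norm_diffQuot_le (p : FormalMultilinearSeries ℝ G H) (n : ℕ) :
    ‖p.diffQuot n‖ ≤ (n + 1) * ‖p (n + 1)‖ := by
  have h1 : ∀ k : Fin (n + 1),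
      ‖((p (n + 1)).curryMid k).flipMultilinear.compContinuousLinearMap
        fun i : Fin n => if i.castSucc < k then ContinuousLinearMap.fst ℝ G G
          else ContinuousLinearMap.snd ℝ G G‖ ≤ ‖p (n + 1)‖ := by
    intro k
    refine (ContinuousMultilinearMap.norm_compContinuousLinearMap_le _ _).trans ?_
    have h2 : ‖((p (n + 1)).curryMid k).flipMultilinear‖ ≤ ‖p (n + 1)‖ := by
      refine (MultilinearMap.mkContinuous_norm_le _ (norm_nonneg _) _).trans ?_
      exact MultilinearMap.mkContinuousLinear_norm_le _ (norm_nonneg _) _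
    refine (mul_le_mul h2 (Finset.prod_le_one (fun _ _ => norm_nonneg _) fun i _ => ?_)
      (Finset.prod_nonneg fun _ _ => norm_nonneg _) (norm_nonneg _)).trans (mul_one _).le
    split_ifs
    · exact ContinuousLinearMap.norm_fst_le ℝ G G
    · exact ContinuousLinearMap.norm_snd_le ℝ G G
  rw [diffQuot]
  refine (norm_sum_le_of_le (E := (G × G) [×n]→L[ℝ] (G →L[ℝ] H)) Finset.univ
    fun k _ => h1 k).trans ?_
  rw [Finset.sum_const, Finset.card_univ, Fintype.card_fin, nsmul_eq_mul]
  push_cast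
  exact le_rfl

/-- The factor n + 1 in the norm bound is at most 2^n, which only halves the radius obtained from a
geometric bound on the coefficients. -/
theorem FormalMultilinearSeries.radius_diffQuot_pos {p : FormalMultilinearSeries ℝ G H}
    (hp : 0 < p.radius) : 0 < p.diffQuot.radius := by
  obtain ⟨C, r, hC, hr, h⟩ := p.le_mul_pow_of_radius_pos hp
  let s : NNReal := ⟨(2 * r)⁻¹, by positivity⟩
  refine lt_of_lt_of_le (b := (s : ENNReal)) ?_ (p.diffQuot.le_radius_of_bound (C * r) fun n => ?_)
  · rw [ENNReal.coe_pos, ← NNReal.coe_pos]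
    change 0 < (2 * r)⁻¹
    positivity
  · have h1 : ((n : ℝ) + 1) ≤ 2 ^ n := by exact_mod_cast Nat.lt_two_pow_self (n := n)
    calc ‖p.diffQuot n‖ * ((2 * r)⁻¹) ^ n ≤ 2 ^ n * (C * r ^ (n + 1)) * ((2 * r)⁻¹) ^ n := by
          refine mul_le_mul_of_nonneg_right ((p.norm_diffQuot_le n).trans ?_) (by positivity)
          exact mul_le_mul h1 (h _) (norm_nonneg _) (by positivity)
      _ = C * r := by
          rw [inv_pow, mul_pow]
          field_simp
          ring

/-- Hadamard's lemma in analytic form: divide the power series termwise by z - w. It turns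
membership of differences in the ideal into membership after applying an analytic map. -/
theorem AnalyticAt.exists_difference_quotient [CompleteSpace H] {Ψ : G → H} {x : G}
    (h : AnalyticAt ℝ Ψ x) : ∃ C : G × G → (G →L[ℝ] H), AnalyticAt ℝ C (x, x) ∧
      ∀ᶠ v in 𝓝 (x, x), Ψ v.1 - Ψ v.2 = C v (v.1 - v.2) := by
  obtain ⟨p, R, hp⟩ := h
  have hq := p.diffQuot.hasFPowerSeriesOnBall
    (FormalMultilinearSeries.radius_diffQuot_pos (hp.r_pos.trans_le hp.r_le))
  refine ⟨fun v => p.diffQuot.sum (v - (x, x)), ?_, ?_⟩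
  · refine AnalyticAt.comp (g := p.diffQuot.sum) (f := fun v : G × G => v - (x, x)) ?_
      (analyticAt_id.sub analyticAt_const)
    rw [sub_self]
    exact hq.analyticAt
  · have h1 : ∀ᶠ v : G × G in 𝓝 (x, x), v.1 - x ∈ Metric.eball 0 R := by
      have : Filter.Tendsto (fun v : G × G => v.1 - x) (𝓝 (x, x)) (𝓝 0) :=
        (continuous_fst.sub continuous_const).tendsto' _ _ (sub_self _)
      exact this.eventually (Metric.eball_mem_nhds 0 hp.r_pos)
    have h2 : ∀ᶠ v : G × G in 𝓝 (x, x), v.2 - x ∈ Metric.eball 0 R := by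
      have : Filter.Tendsto (fun v : G × G => v.2 - x) (𝓝 (x, x)) (𝓝 0) :=
        (continuous_snd.sub continuous_const).tendsto' _ _ (sub_self _)
      exact this.eventually (Metric.eball_mem_nhds 0 hp.r_pos)
    have h3 : ∀ᶠ v : G × G in 𝓝 (x, x), v - (x, x) ∈ Metric.eball 0 p.diffQuot.radius := by
      have : Filter.Tendsto (fun v : G × G => v - (x, x)) (𝓝 (x, x)) (𝓝 0) :=
        (continuous_id.sub continuous_const).tendsto' _ _ (sub_self _)
      exact this.eventually (Metric.eball_mem_nhds 0 hq.r_pos)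
    filter_upwards [h1, h2, h3] with v hv1 hv2 hv3
    have e1 := (hp.hasSum hv1).sub (hp.hasSum hv2)
    rw [add_sub_cancel, add_sub_cancel] at e1
    have e2 := (ContinuousLinearMap.apply ℝ H (v.1 - v.2)).hasSum (hq.hasSum hv3)
    rw [zero_add] at e2
    -- The terms of degree zero cancel, and degree n + 1 of the series corresponds to degree n of
    -- its difference quotient.
    have e3 := (hasSum_nat_add_iff' 1).2 e1
    rw [Finset.sum_range_one, Subsingleton.elim (fun _ : Fin 0 => v.1 - x) fun _ => v.2 - x,
      sub_self, sub_zero] at e3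
    refine e3.unique ?_
    change HasSum _ (ContinuousLinearMap.apply ℝ H (v.1 - v.2) (p.diffQuot.sum (v - (x, x))))
    convert e2 using 1
    funext n
    have := p.diffQuot_apply n (v.1 - x) (v.2 - x)
    rw [sub_sub_sub_cancel_right] at this
    exact this.symm

end Hadamard

/-! ### Analytic functions in the ideal generated by the components of a map -/

section Ideal

variable {E F G H : Type*} [NormedAddCommGroup E] [NormedSpace ℝ E]
  [NormedAddCommGroup F] [NormedSpace ℝ F] [NormedAddCommGroup G] [NormedSpace ℝ G]
  [NormedAddCommGroup H] [NormedSpace ℝ H] {f : E → F} {p : E}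

/-- Near `p`, the components of `h` lie in the ideal generated by the components of `f`. -/
def IdealMem (f : E → F) (p : E) (h : E → G) : Prop :=
  ∃ c : E → (F →L[ℝ] G), ContDiffAt ℝ ω c p ∧ ∀ᶠ q in 𝓝 p, h q = c q (f q)

theorem IdealMem.clm (L : F →L[ℝ] G) : IdealMem f p fun q => L (f q) :=
  ⟨fun _ => L, contDiffAt_const, Filter.Eventually.of_forall fun _ => rfl⟩

theorem IdealMem.congr {h h' : E → G} (hh : IdealMem f p h) (e : ∀ᶠ q in 𝓝 p, h' q = h q) :
    IdealMem f p h' := by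
  obtain ⟨c, hc, hq⟩ := hh
  exact ⟨c, hc, by filter_upwards [e, hq] with q h1 h2 using h1.trans h2⟩

theorem IdealMem.eq_zero {h : E → G} (hh : IdealMem f p h) (h0 : f p = 0) : h p = 0 := by
  obtain ⟨c, -, hq⟩ := hh
  rw [hq.self_of_nhds, h0, map_zero]

theorem IdealMem.add {h h' : E → G} (hh : IdealMem f p h) (hh' : IdealMem f p h') :
    IdealMem f p fun q => h q + h' q := by
  obtain ⟨c, hc, hq⟩ := hh
  obtain ⟨c', hc', hq'⟩ := hh'
  exact ⟨fun q => c q + c' q, hc.add hc', by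
    filter_upwards [hq, hq'] with q h1 h2
    rw [h1, h2, ContinuousLinearMap.add_apply]⟩

theorem IdealMem.zero : IdealMem f p fun _ => (0 : G) :=
  ⟨fun _ => 0, contDiffAt_const, Filter.Eventually.of_forall fun _ => rfl⟩

theorem IdealMem.sum {ι : Type*} {h : ι → E → G} (s : Finset ι) (hh : ∀ i, IdealMem f p (h i)) :
    IdealMem f p fun q => ∑ i ∈ s, h i q := by
  classical
  induction s using Finset.induction_on with
  | empty => exact IdealMem.zero
  | insert a s ha ih => simp only [Finset.sum_insert ha]; exact (hh a).add ih

theorem IdealMem.apply {B : E → (G →L[ℝ] H)} (hB : ContDiffAt ℝ ω B p) {h : E → G}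
    (hh : IdealMem f p h) : IdealMem f p fun q => B q (h q) := by
  obtain ⟨c, hc, hq⟩ := hh
  exact ⟨fun q => (B q).comp (c q), hB.clm_comp hc, by
    filter_upwards [hq] with q h1
    rw [h1, ContinuousLinearMap.comp_apply]⟩

theorem IdealMem.map (L : G →L[ℝ] H) {h : E → G} (hh : IdealMem f p h) :
    IdealMem f p fun q => L (h q) :=
  hh.apply contDiffAt_const

theorem IdealMem.neg {h : E → G} (hh : IdealMem f p h) : IdealMem f p fun q => -h q :=
  hh.map (-ContinuousLinearMap.id ℝ G)

theorem IdealMem.pi {ι : Type*} [Fintype ι] {h : E → ι → G}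
    (hh : ∀ i, IdealMem f p fun q => h q i) : IdealMem f p h := by
  classical
  refine (IdealMem.sum Finset.univ fun i =>
    (hh i).map (ContinuousLinearMap.single ℝ (fun _ : ι => G) i)).congr
    (Filter.Eventually.of_forall fun q => ?_)
  exact (Finset.univ_sum_single (h q)).symm

theorem IdealMem.smul {h : E → ℝ} (hh : IdealMem f p h) {v : E → G} (hv : ContDiffAt ℝ ω v p) :
    IdealMem f p fun q => h q • v q :=
  hh.apply (B := fun q => (ContinuousLinearMap.lsmul ℝ ℝ).flip (v q))
    (((ContinuousLinearMap.lsmul ℝ ℝ).flip : G →L[ℝ] ℝ →L[ℝ] G).contDiff.contDiffAt.comp p hv)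

theorem IdealMem.mul_left {A : Type*} [NormedRing A] [NormedAlgebra ℝ A] {h a : E → A}
    (hh : IdealMem f p h) (ha : ContDiffAt ℝ ω a p) : IdealMem f p fun q => a q * h q :=
  hh.apply (B := fun q => ContinuousLinearMap.mul ℝ A (a q))
    ((ContinuousLinearMap.mul ℝ A).contDiff.contDiffAt.comp p ha)

theorem IdealMem.comp_sub_comp [CompleteSpace H] {Ψ : G → H} {a b : E → G} {x : G}
    (hΨ : AnalyticAt ℝ Ψ x) (ha : ContDiffAt ℝ ω a p) (hb : ContDiffAt ℝ ω b p) (hax : a p = x)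
    (hbx : b p = x) (h : IdealMem f p fun q => a q - b q) :
    IdealMem f p fun q => Ψ (a q) - Ψ (b q) := by
  obtain ⟨C, hC, hCe⟩ := hΨ.exists_difference_quotient
  have h1 : Filter.Tendsto (fun q => (a q, b q)) (𝓝 p) (𝓝 (x, x)) := by
    have := (ha.prodMk hb).continuousAt.tendsto
    rwa [hax, hbx] at this
  have hC' : ContDiffAt ℝ ω C (a p, b p) := by rw [hax, hbx]; exact hC.contDiffAt
  refine (h.apply (B := fun q => C (a q, b q))
    (ContDiffAt.comp (g := C) (f := fun q => (a q, b q)) p hC' (ha.prodMk hb))).congr ?_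
  filter_upwards [h1.eventually hCe] with q hq using hq

/-- Since u vanishes at R(q), one has u(q) = u(q) - u(R(q)), a difference quotient applied to q -
R(q). -/
theorem IdealMem.of_retraction {Z : Set E} {R : E → E} (hR : ContDiffAt ℝ ω R p) (hRp : R p = p)
    (hRZ : ∀ᶠ q in 𝓝 p, R q ∈ Z) (h : IdealMem f p fun q => q - R q) {u : E → ℝ}
    (hu : AnalyticAt ℝ u p) (hZ : ∀ᶠ q in 𝓝 p, q ∈ Z → u q = 0) : IdealMem f p u := by
  have h1 : Filter.Tendsto R (𝓝 p) (𝓝 p) := by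
    have := hR.continuousAt.tendsto
    rwa [hRp] at this
  refine (IdealMem.comp_sub_comp hu contDiffAt_id hR rfl hRp h).congr ?_
  filter_upwards [hRZ, h1.eventually hZ] with q h3 h4
  rw [h4 h3, sub_zero]; rfl

theorem isReducedStructure_of_idealMem {Z : Set E}
    (h : ∀ p ∈ Z, ∀ u : E → ℝ, AnalyticAt ℝ u p → (∀ᶠ q in 𝓝 p, q ∈ Z → u q = 0) →
      IdealMem f p u) : IsReducedStructure Z f := by
  intro p hp u hu hZ
  obtain ⟨c, hc, hq⟩ := h p hp u hu hZ
  exact ⟨c, hc.analyticAt, hq⟩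

end Ideal

/-! ### Products of lists with two varying factors -/

theorem exists_ofFn_prod_eq_mul {M : Type*} [Monoid M] (S : Submonoid M) {n : ℕ} {L : Fin n → M}
    (b : Fin n) (hL : ∀ i, i ≠ b → L i ∈ S) :
    ∃ A ∈ S, ∃ B ∈ S, ∀ L' : Fin n → M, (∀ i, i ≠ b → L' i = L i) →
      (List.ofFn L').prod = A * L' b * B := by
  induction n with
  | zero => exact b.elim0
  | succ n ih =>
    refine Fin.cases (fun hL => ?_) (fun b hL => ?_) b hL
    · refine ⟨1, S.one_mem, (List.ofFn fun i : Fin n => L i.succ).prod,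
        S.list_prod_mem fun x hx => ?_, fun L' h => ?_⟩
      · obtain ⟨i, rfl⟩ := (List.mem_ofFn' _ _).1 hx
        exact hL _ (Fin.succ_ne_zero i)
      · rw [List.ofFn_succ, List.prod_cons, one_mul]
        simp only [h _ (Fin.succ_ne_zero _)]
    · obtain ⟨A, hA, B, hB, h⟩ := ih (L := fun i => L i.succ) b
        fun i hi => hL _ fun h => hi (Fin.succ_injective _ h)
      refine ⟨L 0 * A, S.mul_mem (hL _ (Fin.succ_ne_zero b).symm) hA, B, hB, fun L' h' => ?_⟩
      rw [List.ofFn_succ, List.prod_cons, h' _ (Fin.succ_ne_zero b).symm,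
        h (fun i => L' i.succ) fun i hi => h' _ fun h => hi (Fin.succ_injective _ h)]
      simp only [mul_assoc]

/-- Isolates two factors of an ordered product. The submonoid keeps track of the blocks in between:
scalars in the reducedness proof, torus elements in the counterexample. -/
theorem exists_ofFn_prod_eq_mul_mul {M : Type*} [Monoid M] (S : Submonoid M) {n : ℕ}
    {L : Fin n → M} {b c : Fin n} (hbc : b < c) (hL : ∀ i, i ≠ b → i ≠ c → L i ∈ S) :
    ∃ A ∈ S, ∃ B ∈ S, ∃ C ∈ S, ∀ L' : Fin n → M, (∀ i, i ≠ b → i ≠ c → L' i = L i) →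
      (List.ofFn L').prod = A * L' b * B * L' c * C := by
  induction n with
  | zero => exact b.elim0
  | succ n ih =>
    revert hbc hL
    refine Fin.cases (fun hbc => ?_) (fun c hbc => ?_) c
    · exact absurd hbc (Fin.not_lt_zero b)
    refine Fin.cases (fun hbc hL => ?_) (fun b hbc hL => ?_) b hbc
    · obtain ⟨B, hB, C, hC, h⟩ := exists_ofFn_prod_eq_mul S (L := fun i => L i.succ) c
        fun i hi => hL _ (Fin.succ_ne_zero i) fun h => hi (Fin.succ_injective _ h)
      refine ⟨1, S.one_mem, B, hB, C, hC, fun L' h' => ?_⟩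
      rw [List.ofFn_succ, List.prod_cons, h (fun i => L' i.succ) fun i hi =>
        h' _ (Fin.succ_ne_zero i) fun h => hi (Fin.succ_injective _ h)]
      simp only [mul_assoc, one_mul]
    · obtain ⟨A, hA, B, hB, C, hC, h⟩ := ih (L := fun i => L i.succ) (Fin.succ_lt_succ_iff.1 hbc)
        fun i hi hi' => hL _ (fun h => hi (Fin.succ_injective _ h))
          fun h => hi' (Fin.succ_injective _ h)
      refine ⟨L 0 * A, S.mul_mem (hL _ (Fin.succ_ne_zero b).symm (Fin.succ_ne_zero c).symm) hA,
        B, hB, C, hC, fun L' h' => ?_⟩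
      rw [List.ofFn_succ, List.prod_cons,
        h' _ (Fin.succ_ne_zero b).symm (Fin.succ_ne_zero c).symm,
        h (fun i => L' i.succ) fun i hi hi' => h' _ (fun h => hi (Fin.succ_injective _ h))
          fun h => hi' (Fin.succ_injective _ h)]
      simp only [mul_assoc]

/-! ### The equations in genus zero -/

theorem contDiffAt_list_ofFn_prod {E : Type*} [NormedAddCommGroup E] [NormedSpace ℝ E] {p : E}
    {n : ℕ} {F : Fin n → E → Mat2} (h : ∀ i, ContDiffAt ℝ ω (F i) p) :
    ContDiffAt ℝ ω (fun q => (List.ofFn fun i => F i q).prod) p := by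
  induction n with
  | zero => simp only [List.ofFn_zero, List.prod_nil]; exact contDiffAt_const
  | succ n ih =>
    simp only [List.ofFn_succ, List.prod_cons]
    exact (h 0).mul (ih fun i => h i.succ)

theorem contDiffAt_eMap (X : su2) : ContDiffAt ℝ ω eMap X := by
  have h1 : AnalyticAt ℝ (NormedSpace.exp : Mat2 → Mat2) ((2 * Real.pi : ℝ) • (X : Mat2)) :=
    NormedSpace.exp_analytic _
  have h2 : ContDiffAt ℝ ω (fun X : su2 => (2 * Real.pi : ℝ) • (X : Mat2)) X :=
    ((2 * Real.pi : ℝ) • su2.subtypeL).contDiff.contDiffAt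
  exact (ContDiffAt.comp (g := (NormedSpace.exp : Mat2 → Mat2)) X h1.contDiffAt h2).neg

namespace DecHom

variable {n : ℕ} {θ : Fin n → ℝ}

theorem equations_genus_zero (q : Ambient 0 n) : equations 0 θ q =
    (0, (List.ofFn fun i => eMap (q.2 i)).prod - 1, fun i => killingNorm (q.2 i) ^ 2 - θ i ^ 2) := by
  refine Prod.ext (funext fun j => j.elim0) ?_
  simp only [equations, List.ofFn_zero, List.prod_nil, one_mul]

/-- The element of the ambient space in genus zero with prescribed directions. -/
def ofDirs (θ : Fin n → ℝ) (y : Fin n → R3) : Ambient 0 n := ofSphereCoords θ id (fun _ => 1) y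

theorem ofDirs_apply (y : Fin n → R3) (i : Fin n) :
    (ofDirs θ y).2 i = suEquiv ((θ i / 2) • y i) := by
  simp [ofDirs, ofSphereCoords]

theorem isLinearMap_ofDirs (θ : Fin n → ℝ) : IsLinearMap ℝ (ofDirs θ) :=
  isLinearMap_ofSphereCoords θ id fun _ => 1

theorem ofDirs_ambDir (hθ : ∀ i, 0 < θ i) (q : Ambient 0 n) : ofDirs θ (ambDir θ q) = q := by
  refine Prod.ext (funext fun j => j.elim0) (funext fun i => ?_)
  have := (hθ i).ne'
  rw [ofDirs_apply, ambDir, smul_smul, show θ i / 2 * (2 / θ i) = 1 by field_simp, one_smul,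
    suEquiv.apply_symm_apply]

theorem ambDir_ofDirs (hθ : ∀ i, 0 < θ i) (y : Fin n → R3) : ambDir θ (ofDirs θ y) = y := by
  funext i
  have := (hθ i).ne'
  rw [ambDir, ofDirs_apply, suEquiv.symm_apply_apply, smul_smul,
    show 2 / θ i * (θ i / 2) = 1 by field_simp, one_smul]

theorem coords_eq_ofDirs (hθ : ∀ i, 0 < θ i) (x : DecHom 0 n) : x.coords = ofDirs θ (x.dir θ) :=
  coords_eq_ofSphereCoords hθ fun _ => (one_smul _ _).symm

theorem equations_eq_zero (hθ : ∀ i, 0 < θ i) {x : DecHom 0 n} (hx : x ∈ rel 0 θ) :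
    equations 0 θ x.coords = 0 := by
  rw [equations_genus_zero]
  have h1 : (List.ofFn fun i => eMap (x.coords.2 i)).prod = 1 := by
    rw [← perMat_prod_eq_one hθ hx]
    congr 2
    funext i
    rw [← rho_betaElt_eq hθ hx]
    exact (x.exp_eq (betaPer i)).symm
  rw [h1, sub_self]
  refine Prod.ext rfl (Prod.ext rfl (funext fun i => ?_))
  change killingNorm (x.A (betaPer i)) ^ 2 - θ i ^ 2 = 0
  rw [hx i, sub_self]

theorem sq_killingNorm_sub (hθ : ∀ i, 0 < θ i) (q : Ambient 0 n) (i : Fin n) :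
    killingNorm (q.2 i) ^ 2 - θ i ^ 2 = θ i ^ 2 * (‖ambDir θ q i‖ ^ 2 - 1) := by
  have := hθ i
  have h1 : q.2 i = suEquiv (suEquiv.symm (q.2 i)) := (suEquiv.apply_symm_apply _).symm
  rw [h1, killingNorm_suEquiv, ambDir, norm_smul, Real.norm_of_nonneg (by positivity)]
  field_simp

/-- The normalized directions. -/
def unitDir (θ : Fin n → ℝ) (q : Ambient 0 n) (i : Fin n) : R3 :=
  ‖ambDir θ q i‖⁻¹ • ambDir θ q i

section Point

variable (hθ : ∀ i, 0 < θ i) {x : DecHom 0 n} (hx : x ∈ rel 0 θ)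
include hθ hx

theorem ambDir_ne_zero (i : Fin n) : ambDir θ x.coords i ≠ 0 := by
  rw [ambDir_coords, ← norm_ne_zero_iff, (mem_rel_iff_dir hθ).1 hx]
  exact one_ne_zero

theorem unitDir_coords : unitDir θ x.coords = x.dir θ := by
  funext i
  rw [unitDir, ambDir_coords, (mem_rel_iff_dir hθ).1 hx, inv_one, one_smul]

theorem contDiffAt_ambDir (i : Fin n) :
    ContDiffAt ℝ ω (fun q : Ambient 0 n => ambDir θ q i) x.coords :=
  contDiffAt_pi.1 ((isLinearMap_ambDir θ).contDiffAt x.coords) i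

theorem contDiffAt_unitDir (i : Fin n) :
    ContDiffAt ℝ ω (fun q : Ambient 0 n => unitDir θ q i) x.coords := by
  have h1 := contDiffAt_ambDir hθ hx i
  have h2 := ambDir_ne_zero hθ hx i
  have h3 : ‖ambDir θ x.coords i‖ ≠ 0 := norm_ne_zero_iff.2 h2
  exact ((h1.norm ℝ h2).inv h3).smul h1

theorem eventually_ambDir_ne_zero : ∀ᶠ q in 𝓝 x.coords, ∀ i, ambDir θ q i ≠ 0 :=
  Filter.eventually_all.2 fun i =>
    (contDiffAt_ambDir hθ hx i).continuousAt.eventually_ne (ambDir_ne_zero hθ hx i)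

theorem eventually_norm_unitDir : ∀ᶠ q in 𝓝 x.coords, ∀ i, ‖unitDir θ q i‖ = 1 := by
  filter_upwards [eventually_ambDir_ne_zero hθ hx] with q hq i
  exact norm_smul_inv_norm (𝕜 := ℝ) (hq i)

/-- For a nonzero vector v one has v - v/|v| = (|v|² - 1) v/(|v|(|v| + 1)), and |v|² - 1 is an
equation up to a nonzero constant. -/
theorem idealMem_ambDir_sub_unitDir (i : Fin n) :
    IdealMem (equations 0 θ) x.coords fun q => ambDir θ q i - unitDir θ q i := by
  have h1 : IdealMem (equations 0 θ) x.coords fun q => killingNorm (q.2 i) ^ 2 - θ i ^ 2 :=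
    (IdealMem.clm (f := equations 0 θ) (p := x.coords) ((ContinuousLinearMap.proj i).comp
      ((ContinuousLinearMap.snd ℝ _ _).comp (ContinuousLinearMap.snd ℝ _ _)))).congr
      (Filter.Eventually.of_forall fun q => rfl)
  have h2 := contDiffAt_ambDir hθ hx i
  have h3 := ambDir_ne_zero hθ hx i
  have h4 := h2.norm ℝ h3
  have h5 : θ i ^ 2 * (‖ambDir θ x.coords i‖ * (‖ambDir θ x.coords i‖ + 1)) ≠ 0 := by
    have := hθ i
    have := norm_pos_iff.2 h3
    positivity
  have h6 : ContDiffAt ℝ ω (fun q : Ambient 0 n =>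
      (θ i ^ 2 * (‖ambDir θ q i‖ * (‖ambDir θ q i‖ + 1)))⁻¹ • ambDir θ q i) x.coords :=
    ((contDiffAt_const.mul (h4.mul (h4.add contDiffAt_const))).inv h5).smul h2
  refine (h1.smul h6).congr ?_
  filter_upwards [eventually_ambDir_ne_zero hθ hx] with q hq
  have h7 := norm_pos_iff.2 (hq i)
  have h8 := (hθ i).ne'
  rw [sq_killingNorm_sub hθ, unitDir, smul_smul]
  nth_rewrite 1 [← one_smul ℝ (ambDir θ q i)]
  rw [← sub_smul]
  congr 1
  field_simp
  ring

/-- Modulo the ideal the vectors may be normalized inside the analytic function given by the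
product, so the relation can be used with the explicit trigonometric form of its factors. -/
theorem idealMem_perMat_prod : IdealMem (equations 0 θ) x.coords fun q =>
    (List.ofFn fun i => perMat (θ i) (unitDir θ q i)).prod - 1 := by
  let Ψ : (Fin n → R3) → Mat2 := fun y => (List.ofFn fun i => eMap ((ofDirs θ y).2 i)).prod
  have hΨ : ContDiffAt ℝ ω Ψ (x.dir θ) := by
    refine contDiffAt_list_ofFn_prod (F := fun i (y : Fin n → R3) => eMap ((ofDirs θ y).2 i))
      fun i => ?_
    refine ContDiffAt.comp (g := eMap) (f := fun y : Fin n → R3 => (ofDirs θ y).2 i) _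
      (contDiffAt_eMap _) ?_
    exact contDiffAt_pi.1 ((isLinearMap_ofDirs θ).contDiffAt (x.dir θ)).snd i
  have h1 := IdealMem.comp_sub_comp (f := equations 0 θ) (p := x.coords) (a := unitDir θ)
    (b := ambDir θ) hΨ.analyticAt (contDiffAt_pi.2 fun i => contDiffAt_unitDir hθ hx i)
    ((isLinearMap_ambDir θ).contDiffAt x.coords) (unitDir_coords hθ hx) rfl
    (IdealMem.pi fun i => by
      refine (idealMem_ambDir_sub_unitDir hθ hx i).neg.congr (Filter.Eventually.of_forall fun q => ?_)
      exact (neg_sub _ _).symm)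
  have h2 : IdealMem (equations 0 θ) x.coords fun q => Ψ (ambDir θ q) - 1 := by
    refine (IdealMem.clm (f := equations 0 θ) (p := x.coords)
      ((ContinuousLinearMap.fst ℝ _ _).comp (ContinuousLinearMap.snd ℝ _ _))).congr
      (Filter.Eventually.of_forall fun q => ?_)
    simp only [Ψ, ofDirs_ambDir hθ, equations_genus_zero]
    rfl
  refine (h1.add h2).congr ?_
  filter_upwards [eventually_norm_unitDir hθ hx] with q hq
  rw [sub_add_sub_cancel]
  congr 3
  funext i
  rw [ofDirs_apply, eMap_suEquiv _ (hq i), perMat]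

theorem idealMem_of_dir_retraction {R : Ambient 0 n → Fin n → R3}
    (hR : ∀ i, ContDiffAt ℝ ω (fun q => R q i) x.coords) (hRx : R x.coords = x.dir θ)
    (hRZ : ∀ᶠ q in 𝓝 x.coords, ofDirs θ (R q) ∈ locus (rel 0 θ))
    (h : ∀ i, IdealMem (equations 0 θ) x.coords fun q => ambDir θ q i - R q i)
    {u : Ambient 0 n → ℝ} (hu : AnalyticAt ℝ u x.coords)
    (hZ : ∀ᶠ q in 𝓝 x.coords, q ∈ locus (rel 0 θ) → u q = 0) :
    IdealMem (equations 0 θ) x.coords u := by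
  let L := LinearMap.toContinuousLinearMap ((isLinearMap_ofDirs θ).mk' (ofDirs θ))
  refine IdealMem.of_retraction (R := fun q => ofDirs θ (R q)) ?_ ?_ hRZ ?_ hu hZ
  · exact ContDiffAt.comp (g := ofDirs θ) (f := R) x.coords L.contDiff.contDiffAt
      (contDiffAt_pi.2 hR)
  · rw [hRx, ← coords_eq_ofDirs hθ]
  · refine ((IdealMem.pi h).map L).congr (Filter.Eventually.of_forall fun q => ?_)
    change _ = ofDirs θ (ambDir θ q - R q)
    rw [(isLinearMap_ofDirs θ).map_sub, ofDirs_ambDir hθ]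

end Point

theorem ofDirs_mem_locus (hθ : ∀ i, 0 < θ i) {σ : Fin n → ℝ} (hσ : IsCoaxialModel θ σ)
    {y : Fin n → R3} {u : R3} (hy : ∀ i, ‖y i‖ = 1) (hu : ‖u‖ = 1)
    (hyu : ∀ i, (¬ ∃ m : ℤ, θ i = m) → y i = σ i • u) : ofDirs θ y ∈ locus (rel 0 θ) := by
  obtain ⟨x, hx, hxy⟩ := exists_mem_rel_of_model hθ hσ hy hu hyu
  refine ⟨x, hx, ?_⟩
  rw [coords_eq_ofDirs hθ, funext hxy]

/-- All directions are free here, so normalization of the vectors is already a retraction onto the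
space. -/
theorem isReducedStructure_of_integral (hθ : ∀ i, 0 < θ i) {σ : Fin n → ℝ}
    (hσ : IsCoaxialModel θ σ) (hi : ∀ i, ∃ m : ℤ, θ i = m) :
    IsReducedStructure (locus (rel 0 θ)) (equations 0 θ) := by
  refine isReducedStructure_of_idealMem ?_
  rintro _ ⟨x, hx, rfl⟩ u hu hZ
  refine idealMem_of_dir_retraction hθ hx (fun i => contDiffAt_unitDir hθ hx i)
    (unitDir_coords hθ hx) ?_ (idealMem_ambDir_sub_unitDir hθ hx) hu hZ
  filter_upwards [eventually_norm_unitDir hθ hx] with q hq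
  obtain ⟨v, hv, -⟩ := exists_unit_orthogonal 0
  exact ofDirs_mem_locus hθ hσ hq hv fun i h => absurd (hi i) h

/-- All factors other than b and c are real scalars, so the relation reads λ P_b P_c = 1. Multiplied
by P_b⁻¹, its vector part is a linear relation between the two unit vectors. -/
theorem idealMem_unitDir_sub (hθ : ∀ i, 0 < θ i) {x : DecHom 0 n} (hx : x ∈ rel 0 θ) {b c : Fin n}
    (hbc : b < c) (hb : ¬ ∃ m : ℤ, θ b = m) (hi : ∀ i, i ≠ b → i ≠ c → ∃ m : ℤ, θ i = m) {s : ℝ}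
    (hxs : x.dir θ c = s • x.dir θ b) :
    IdealMem (equations 0 θ) x.coords fun q => unitDir θ q c - s • unitDir θ q b := by
  have hmem : ∀ i, i ≠ b → i ≠ c → perMat (θ i) 0 ∈ MonoidHom.mrange (algebraMap ℝ Mat2) :=
    fun i _ _ => ⟨Real.cos (Real.pi * (θ i - 1)), by
      rw [perMat, smul_zero, quatMat, map_zero, add_zero]
      exact Algebra.algebraMap_eq_smul_one _⟩
  obtain ⟨_, ⟨a₁, rfl⟩, _, ⟨a₂, rfl⟩, _, ⟨a₃, rfl⟩, hprod⟩ :=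
    exists_ofFn_prod_eq_mul_mul (MonoidHom.mrange (algebraMap ℝ Mat2)) hbc hmem
  set sb := Real.sin (Real.pi * (θ b - 1)) with hsb
  set sc := Real.sin (Real.pi * (θ c - 1)) with hsc
  have hsb0 : sb ≠ 0 := fun h => hb (sin_eq_zero_iff_int.1 h)
  have h1 : IdealMem (equations 0 θ) x.coords fun q =>
      (a₁ * a₂ * a₃) • (perMat (θ b) (unitDir θ q b) * perMat (θ c) (unitDir θ q c)) - 1 := by
    refine (idealMem_perMat_prod hθ hx).congr (Filter.Eventually.of_forall fun q => ?_)
    rw [hprod (fun i => perMat (θ i) (unitDir θ q i)) fun i h1 h2 => by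
      rw [perMat, perMat, sin_eq_zero_iff_int.2 (hi i h1 h2), zero_smul, zero_smul]]
    change _ = algebraMap ℝ Mat2 a₁ * _ * algebraMap ℝ Mat2 a₂ * _ * algebraMap ℝ Mat2 a₃ - 1
    simp only [Algebra.algebraMap_eq_smul_one, smul_mul_assoc, mul_smul_comm, one_mul, mul_one,
      smul_smul]
    congr 2
    ring
  -- The conjugate quaternion, which is the inverse of the b-th factor because the direction has
  -- been normalized.
  have h2 : ContDiffAt ℝ ω (fun q : Ambient 0 n =>
      quatMat (Real.cos (Real.pi * (θ b - 1))) (-(sb • unitDir θ q b))) x.coords := by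
    have := contDiffAt_unitDir hθ hx b
    fun_prop
  have h3 : IdealMem (equations 0 θ) x.coords fun q =>
      (a₁ * a₂ * a₃ * sc) • unitDir θ q c + sb • unitDir θ q b := by
    refine ((h1.mul_left h2).map (LinearMap.toContinuousLinearMap vecPart)).congr ?_
    filter_upwards [eventually_norm_unitDir hθ hx] with q hq
    have e1 : quatMat (Real.cos (Real.pi * (θ b - 1))) (-(sb • unitDir θ q b)) *
        perMat (θ b) (unitDir θ q b) = 1 := by
      have := coe_inv_mul ⟨_, perMat_mem (θ b) (hq b)⟩
      rw [coe_inv_SU2] at this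
      change (perMat (θ b) (unitDir θ q b)).conjTranspose * perMat (θ b) (unitDir θ q b) = 1 at this
      rw [perMat, conjTranspose_quatMat] at this
      rw [perMat]
      exact this
    change _ = vecPart _
    rw [mul_sub, mul_smul_comm, ← mul_assoc, e1, one_mul, mul_one, map_sub, map_smul, perMat,
      vecPart_quatMat, vecPart_quatMat, smul_smul, sub_neg_eq_add]
  -- Evaluation at the point itself identifies the unknown coefficient; it is nonzero because `sb`
  -- is.
  have h4 := h3.eq_zero (equations_eq_zero hθ hx)
  simp only [unitDir_coords hθ hx] at h4
  have h5 : x.dir θ b ≠ 0 := ambDir_ne_zero hθ hx b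
  rw [hxs, smul_smul, ← add_smul, smul_eq_zero, or_iff_left h5] at h4
  have h6 : a₁ * a₂ * a₃ * sc ≠ 0 := fun h => hsb0 (by rw [h] at h4; linarith)
  refine (h3.map ((a₁ * a₂ * a₃ * sc)⁻¹ • ContinuousLinearMap.id ℝ R3)).congr
    (Filter.Eventually.of_forall fun q => ?_)
  change _ = (a₁ * a₂ * a₃ * sc)⁻¹ • ((a₁ * a₂ * a₃ * sc) • unitDir θ q c + sb • unitDir θ q b)
  rw [smul_add, smul_smul, smul_smul, inv_mul_cancel₀ h6, one_smul,
    show sb = -(a₁ * a₂ * a₃ * sc * s) by linarith, mul_neg, ← mul_assoc, inv_mul_cancel₀ h6,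
    one_mul, neg_smul, sub_eq_add_neg]

open Classical in
-- The retraction normalizes all vectors and replaces the c-th one by the signed b-th one. The error
-- at c lies in the ideal by the linear relation between the two.
theorem isReducedStructure_of_two (hθ : ∀ i, 0 < θ i) {σ : Fin n → ℝ} (hσ : IsCoaxialModel θ σ)
    {b c : Fin n} (hbc : b < c) (hb : ¬ ∃ m : ℤ, θ b = m) (hc : ¬ ∃ m : ℤ, θ c = m)
    (hi : ∀ i, i ≠ b → i ≠ c → ∃ m : ℤ, θ i = m) :
    IsReducedStructure (locus (rel 0 θ)) (equations 0 θ) := by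
  refine isReducedStructure_of_idealMem ?_
  rintro _ ⟨x, hx, rfl⟩ u hu hZ
  have hσ2 : ∀ i, σ i * σ i = 1 := fun i => by rcases hσ.1 i with h | h <;> rw [h] <;> norm_num
  have hxs : x.dir θ c = (σ c * σ b) • x.dir θ b := by
    obtain ⟨v, -, hv⟩ := hσ.2.1 x hx
    rw [hv b hb, hv c hc, smul_smul, mul_assoc, hσ2, mul_one]
  let R : Ambient 0 n → Fin n → R3 := fun q i =>
    if i = c then (σ c * σ b) • unitDir θ q b else unitDir θ q i
  refine idealMem_of_dir_retraction (R := R) hθ hx (fun i => ?_) (funext fun i => ?_) ?_ (fun i => ?_)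
    hu hZ
  · by_cases h : i = c
    · simp only [R, if_pos h]
      exact (contDiffAt_unitDir hθ hx b).const_smul _
    · simp only [R, if_neg h]
      exact contDiffAt_unitDir hθ hx i
  · simp only [R, unitDir_coords hθ hx]
    split_ifs with h
    · rw [h, hxs]
    · rfl
  · filter_upwards [eventually_norm_unitDir hθ hx] with q hq
    refine ofDirs_mem_locus hθ hσ (u := σ b • unitDir θ q b) (fun i => ?_) ?_ fun i h => ?_
    · simp only [R]
      split_ifs with h
      · rw [mul_smul, norm_sign_smul (hσ.1 _), norm_sign_smul (hσ.1 _), hq]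
      · exact hq i
    · rw [norm_sign_smul (hσ.1 _), hq]
    · simp only [R]
      split_ifs with h'
      · rw [h', mul_smul]
      · have : i = b := by
          by_contra h''
          exact h (hi i h'' h')
        rw [this, smul_smul, hσ2, one_smul]
  · by_cases h : i = c
    · simp only [R, if_pos h]
      refine ((idealMem_ambDir_sub_unitDir hθ hx c).add (idealMem_unitDir_sub hθ hx hbc hb hi
        (s := σ c * σ b) hxs)).congr (Filter.Eventually.of_forall fun q => ?_)
      rw [h, sub_add_sub_cancel]
    · simp only [R, if_neg h]
      exact idealMem_ambDir_sub_unitDir hθ hx i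

end DecHom

/-! ### Genus zero spaces that are not reduced -/

namespace DecHom

variable {n : ℕ} {θ : Fin n → ℝ}

/-- The unit quaternions in the plane spanned by `1` and `x`. -/
def torusMats (x : R3) : Submonoid Mat2 := (torus x).toSubmonoid.map (Submonoid.subtype _)

theorem perMat_mem_torusMats {x : R3} (hx : ‖x‖ = 1) {s : ℝ} (hs : s = 1 ∨ s = -1) (r : ℝ) :
    perMat r (s • x) ∈ torusMats x :=
  ⟨⟨perMat r (s • x), perMat_mem r (by rw [norm_sign_smul hs, hx])⟩,
    ⟨Real.sin (Real.pi * (r - 1)) * s, by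
      change vecPart (perMat r (s • x)) = _
      rw [perMat, vecPart_quatMat, smul_smul]⟩, rfl⟩

theorem exists_of_mem_torusMats {x : R3} (hx : ‖x‖ = 1) {X : Mat2} (hX : X ∈ torusMats x) :
    ∃ a b : ℝ, a ^ 2 + b ^ 2 = 1 ∧ X = quatMat a (b • x) := by
  obtain ⟨U, hU, rfl⟩ := hX
  obtain ⟨r, hr⟩ := torus_param hx hU
  exact ⟨_, _, Real.cos_sq_add_sin_sq r, hr⟩

/-- The plane of quaternions orthogonal to 1 and x is stable under multiplication by the torus of x
from either side, so -X⁻¹zY is again a unit vector orthogonal to x. -/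
theorem exists_mul_imMat {x z : R3} (hx : ‖x‖ = 1) (hz : ‖z‖ = 1) (hxz : inner ℝ x z = 0)
    {X Y : Mat2} (hX : X ∈ torusMats x) (hY : Y ∈ torusMats x) :
    ∃ w : R3, ‖w‖ = 1 ∧ inner ℝ x w = 0 ∧ X * imMat w = -(imMat z * Y) := by
  obtain ⟨a, b, h1, rfl⟩ := exists_of_mem_torusMats hx hX
  obtain ⟨c, d, h2, rfl⟩ := exists_of_mem_torusMats hx hY
  set v := crossR3 z x with hv
  have hzx : inner ℝ z x = 0 := by rw [real_inner_comm, hxz]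
  have hxv : inner ℝ x v = 0 := inner_crossR3_right z x
  have hzv : inner ℝ z v = 0 := inner_crossR3_left z x
  have hv1 : ‖v‖ ^ 2 = 1 := by rw [hv, norm_sq_crossR3, hx, hz, hzx]; norm_num
  have e1 : crossR3 x z = -v := crossR3_swap x z
  have e2 : crossR3 x v = z := by
    rw [hv, crossR3_crossR3, real_inner_self_eq_norm_sq, hx, hxz]; simp
  refine ⟨-((a * c - b * d) • z + (a * d + b * c) • v), ?_, ?_, ?_⟩
  · rw [norm_neg, ← sq_eq_sq₀ (norm_nonneg _) zero_le_one, norm_add_sq_real, norm_smul, norm_smul,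
      mul_pow, mul_pow, hv1, hz, inner_smul_left, inner_smul_right, hzv, Real.norm_eq_abs,
      Real.norm_eq_abs, sq_abs, sq_abs]
    simp only [mul_zero, one_pow, mul_one, add_zero]
    calc (a * c - b * d) ^ 2 + (a * d + b * c) ^ 2 = (a ^ 2 + b ^ 2) * (c ^ 2 + d ^ 2) := by ring
      _ = 1 := by rw [h1, h2, one_mul]
  · rw [inner_neg_right, inner_add_right, inner_smul_right, inner_smul_right, hxz, hxv]; simp
  · rw [← quatMat_zero_left, ← quatMat_zero_left, quatMat_mul, quatMat_mul, neg_quatMat,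
      inner_smul_left, inner_smul_right, inner_neg_right, inner_add_right, inner_smul_right,
      inner_smul_right, hxz, hxv, hzx, crossR3_smul_left, crossR3_smul_right, ← hv]
    have e3 : crossR3 x (-((a * c - b * d) • z + (a * d + b * c) • v)) =
        (a * c - b * d) • v - (a * d + b * c) • z := by
      rw [← neg_one_smul ℝ (_ + _), crossR3_smul_right, crossR3_add_right, crossR3_smul_right,
        crossR3_smul_right, e1, e2]
      module
    rw [e3]
    congr 1
    · simp
    · match_scalars
      · linear_combination (-c) * h1
      · linear_combination (-d) * h1
      · ring

theorem hasDerivAt_perMat_curve (r m : ℝ) (x z : R3) :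
    HasDerivAt (fun t : ℝ => perMat r (Real.cos (m * t) • x + Real.sin (m * t) • z))
      ((Real.sin (Real.pi * (r - 1)) * m) • imMat z) 0 := by
  have h0 : HasDerivAt (fun t : ℝ => m * t) m 0 := by
    simpa using (hasDerivAt_id (0 : ℝ)).const_mul m
  have h1 : HasDerivAt (fun t : ℝ => Real.cos (m * t)) 0 0 := by
    have := h0.cos
    rwa [mul_zero, Real.sin_zero, neg_zero, zero_mul] at this
  have h2 : HasDerivAt (fun t : ℝ => Real.sin (m * t)) m 0 := by
    have := h0.sin
    rwa [mul_zero, Real.cos_zero, one_mul] at this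
  have h3 := (((h1.smul_const (imMat x)).add (h2.smul_const (imMat z))).const_smul
    (Real.sin (Real.pi * (r - 1)))).const_add (Real.cos (Real.pi * (r - 1)) • (1 : Mat2))
  rw [zero_smul, zero_add, smul_smul] at h3
  refine h3.congr_of_eventuallyEq (Filter.Eventually.of_forall fun t => ?_)
  simp only [perMat, quatMat, map_smul, map_add, Pi.smul_apply, Pi.add_apply]

open Classical in
-- Tilt the b-th and c-th axes so that the unit length equations hold exactly and the relation to
-- first order, keeping the a-th axis fixed. The component along z of the signed difference of axes
-- a and b vanishes on the space, but its derivative along this curve is nonzero; for a member of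
-- the ideal that derivative would be zero.
theorem not_isReducedStructure (hθ : ∀ i, 0 < θ i) {σ : Fin n → ℝ} (hσ : IsCoaxialModel θ σ)
    {a b c : Fin n} (hab : a ≠ b) (hac : a ≠ c) (hbc : b < c) (ha : ¬ ∃ m : ℤ, θ a = m)
    (hb : ¬ ∃ m : ℤ, θ b = m) (hc : ¬ ∃ m : ℤ, θ c = m) :
    ¬ IsReducedStructure (locus (rel 0 θ)) (equations 0 θ) := by
  intro hred
  obtain ⟨x, hx, -⟩ := exists_unit_orthogonal 0
  obtain ⟨z, hz, hxz⟩ := exists_unit_orthogonal x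
  obtain ⟨A, -, B, hB, C, -, hprod⟩ := exists_ofFn_prod_eq_mul_mul (torusMats x)
    (L := fun i => perMat (θ i) (σ i • x)) hbc fun i _ _ => perMat_mem_torusMats hx (hσ.1 i) _
  set X := perMat (θ b) (σ b • x) with hX
  set Y := perMat (θ c) (σ c • x) with hY
  -- The direction in which the c-th axis must move so that its contribution to the derivative of
  -- the product is opposite to that of the b-th axis.
  obtain ⟨w, hw, hxw, hwz⟩ := exists_mul_imMat hx hz hxz
    ((torusMats x).mul_mem (perMat_mem_torusMats hx (hσ.1 b) (θ b)) hB)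
    ((torusMats x).mul_mem hB (perMat_mem_torusMats hx (hσ.1 c) (θ c)))
  rw [← hX, ← hY] at hwz
  have hsc : Real.sin (Real.pi * (θ c - 1)) ≠ 0 := fun h => hc (sin_eq_zero_iff_int.1 h)
  -- The relative speed that equalizes the sizes of the two contributions; the denominator is
  -- nonzero since ϑ_c is not an integer.
  set m : ℝ := Real.sin (Real.pi * (θ b - 1)) / Real.sin (Real.pi * (θ c - 1)) with hm
  let y : ℝ → Fin n → R3 := fun t i =>
    if i = b then Real.cos (1 * t) • σ b • x + Real.sin (1 * t) • z
    else if i = c then Real.cos (m * t) • σ c • x + Real.sin (m * t) • w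
    else σ i • x
  have hyb : ∀ t, y t b = Real.cos (1 * t) • σ b • x + Real.sin (1 * t) • z := fun t => if_pos rfl
  have hyc : ∀ t, y t c = Real.cos (m * t) • σ c • x + Real.sin (m * t) • w := fun t => by
    simp only [y, if_neg hbc.ne', if_true]
  have hyi : ∀ t i, i ≠ b → i ≠ c → y t i = σ i • x := fun t i h h' => by
    simp only [y, if_neg h, if_neg h']
  have hy0 : y 0 = fun i => σ i • x := by
    funext i
    simp only [y, mul_zero, Real.cos_zero, Real.sin_zero, one_smul, zero_smul, add_zero]
    split_ifs with h h'
    · rw [h]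
    · rw [h']
    · rfl
  have hnorm : ∀ (r : ℝ) (s : ℝ) (v : R3), s = 1 ∨ s = -1 → ‖v‖ = 1 → inner ℝ x v = 0 →
      ‖Real.cos r • s • x + Real.sin r • v‖ = 1 := by
    intro r s v hs hv hxv
    rw [← sq_eq_sq₀ (norm_nonneg _) zero_le_one, norm_add_sq_real, norm_smul (Real.cos r),
      norm_smul (Real.sin r), mul_pow, mul_pow, norm_sign_smul hs, hv, hx, inner_smul_left, inner_smul_right, inner_smul_left, hxv,
      Real.norm_eq_abs, Real.norm_eq_abs, sq_abs, sq_abs]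
    simp
  have hy1 : ∀ t i, ‖y t i‖ = 1 := by
    intro t i
    simp only [y]
    split_ifs
    · exact hnorm _ _ _ (hσ.1 b) hz hxz
    · exact hnorm _ _ _ (hσ.1 c) hw hxw
    · rw [norm_sign_smul (hσ.1 i), hx]
  have hydiff : Differentiable ℝ y := by
    rw [differentiable_pi]
    intro i
    simp only [y]
    split_ifs <;> fun_prop
  let γ : ℝ → Ambient 0 n := fun t => ofDirs θ (y t)
  have hγ : DifferentiableAt ℝ γ 0 :=
    (((isLinearMap_ofDirs θ).contDiffAt (y 0)).differentiableAt (by simp)).comp (0 : ℝ) (hydiff 0)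
  have hγ0 : γ 0 ∈ locus (rel 0 θ) := by
    refine ofDirs_mem_locus hθ hσ (hy1 0) hx fun i _ => ?_
    rw [hy0]
  have hf0 : equations 0 θ (γ 0) = 0 := by
    obtain ⟨p, hp, h⟩ := hγ0
    rw [← h]
    exact equations_eq_zero hθ hp
  have hfγ : ∀ t, equations 0 θ (γ t) =
      (0, A * perMat (θ b) (y t b) * B * perMat (θ c) (y t c) * C - 1, 0) := by
    intro t
    rw [equations_genus_zero]
    refine Prod.ext rfl (Prod.ext ?_ (funext fun i => ?_))
    · change _ - (1 : Mat2) = _ - 1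
      rw [← hprod (fun i => perMat (θ i) (y t i)) fun i h h' => by rw [hyi t i h h']]
      congr 3
      funext i
      rw [ofDirs_apply, eMap_suEquiv _ (hy1 t i), perMat]
    · change killingNorm ((γ t).2 i) ^ 2 - θ i ^ 2 = 0
      rw [sq_killingNorm_sub hθ, ambDir_ofDirs hθ, hy1]
      simp
  have hderiv : HasDerivAt (fun t => equations 0 θ (γ t)) 0 0 := by
    have h1 := hasDerivAt_perMat_curve (θ b) 1 (σ b • x) z
    have h2 := hasDerivAt_perMat_curve (θ c) m (σ c • x) w
    have h3 := ((((h1.const_mul A).mul_const B).mul h2).mul_const C).sub_const (1 : Mat2)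
    have h4 : (A * ((Real.sin (Real.pi * (θ b - 1)) * 1) • imMat z) * B * Y +
        A * X * B * ((Real.sin (Real.pi * (θ c - 1)) * m) • imMat w)) * C = 0 := by
      have e1 : Real.sin (Real.pi * (θ c - 1)) * m = Real.sin (Real.pi * (θ b - 1)) := by
        rw [hm, mul_div_cancel₀ _ hsc]
      have e2 : A * X * B * imMat w = -(A * imMat z * B * Y) := by
        calc A * X * B * imMat w = A * (X * B * imMat w) := by simp only [mul_assoc]
          _ = -(A * imMat z * B * Y) := by rw [hwz, mul_neg]; simp only [mul_assoc]
      rw [e1, mul_one, mul_smul_comm, smul_mul_assoc, smul_mul_assoc, mul_smul_comm, e2, smul_neg,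
        add_neg_cancel, zero_mul]
    have h5 := ((hasDerivAt_const (0 : ℝ) (0 : Fin 0 → (Mat2 × ℂ) × Mat2 × ℂ)).prodMk
      (h3.prodMk (hasDerivAt_const (0 : ℝ) (0 : Fin n → ℝ))))
    have h6 : (fun t => equations 0 θ (γ t)) = _ := funext fun t => by
      rw [hfγ, hyb, hyc]
    rw [h6]
    refine h5.congr_deriv ?_
    refine Prod.ext rfl (Prod.ext ?_ rfl)
    simp only [mul_zero, Real.cos_zero, Real.sin_zero, one_smul, zero_smul, add_zero]
    exact h4
  let u : Ambient 0 n → ℝ := fun q => inner ℝ (σ a • ambDir θ q a - σ b • ambDir θ q b) z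
  have hu : IsLinearMap ℝ u := by
    have h := isLinearMap_ambDir (g := 0) θ
    constructor
    · intro p q
      simp only [u, h.map_add, Pi.add_apply, inner_sub_left, inner_smul_left, inner_add_left]
      simp
      ring
    · intro r q
      simp only [u, h.map_smul, Pi.smul_apply, inner_sub_left, inner_smul_left]
      simp
      ring
  have hσ2 : ∀ i, σ i * σ i = 1 := fun i => by rcases hσ.1 i with h | h <;> rw [h] <;> norm_num
  obtain ⟨k, hk, hke⟩ := hred _ hγ0 u (hu.analyticAt _) (Filter.Eventually.of_forall (by
    rintro _ ⟨p, hp, rfl⟩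
    obtain ⟨v, -, hv⟩ := hσ.2.1 p hp
    simp only [u, ambDir_coords, hv a ha, hv b hb, smul_smul, hσ2, sub_self, inner_zero_left]))
  have huγ : ∀ t, u (γ t) = -σ b * Real.sin t := by
    intro t
    simp only [u, γ, ambDir_ofDirs hθ, hyb, hyi t a hab hac, one_mul, smul_smul,
      inner_sub_left, inner_add_left, inner_smul_left, hxz, real_inner_self_eq_norm_sq, hz]
    simp
  have hd1 : HasDerivAt (fun t => u (γ t)) (-σ b) 0 := by
    have := (Real.hasDerivAt_sin 0).const_mul (-σ b)
    rw [Real.cos_zero, mul_one] at this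
    exact this.congr_of_eventuallyEq (Filter.Eventually.of_forall huγ)
  -- Product rule for an element of the ideal: both the equations and their derivative along the
  -- curve vanish at t = 0.
  have hd2 : HasDerivAt (fun t => u (γ t)) 0 0 := by
    have h1 : DifferentiableAt ℝ (fun t => k (γ t)) 0 :=
      DifferentiableAt.comp (g := k) (f := γ) (0 : ℝ) hk.differentiableAt hγ
    have h2 := h1.hasDerivAt.clm_apply hderiv
    rw [hf0, map_zero, map_zero, add_zero] at h2
    exact h2.congr_of_eventuallyEq (hγ.continuousAt.eventually hke)
  have := hd1.unique hd2
  rcases hσ.1 b with h | h <;> rw [h] at this <;> norm_num at this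

/-- Exactly one non-integral entry is excluded by `hne`, so apart from zero or two such entries
there are at least three, and the counterexample applies. -/
theorem isReducedStructure_iff (hθ : ∀ i, 0 < θ i) {σ : Fin n → ℝ} (hσ : IsCoaxialModel θ σ)
    (hne : numIntegral θ + 1 ≠ n) :
    IsReducedStructure (locus (rel 0 θ)) (equations 0 θ) ↔
      numIntegral θ = n ∨ numIntegral θ + 2 = n := by
  have hcard : numIntegral θ + {i : Fin n | ∃ m : ℤ, θ i = m}ᶜ.ncard = n := by
    have := Set.ncard_add_ncard_compl {i : Fin n | ∃ m : ℤ, θ i = m}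
    rwa [Nat.card_eq_fintype_card, Fintype.card_fin] at this
  constructor
  · contrapose!
    rintro ⟨h1, h2⟩
    obtain ⟨a, b, c, ha, hb, hc, hab, hac, hbc⟩ :=
      (Set.two_lt_ncard_iff (Set.toFinite _)).1
        (by omega : 2 < {i : Fin n | ∃ m : ℤ, θ i = m}ᶜ.ncard)
    rcases lt_or_gt_of_ne hbc with h | h
    · exact not_isReducedStructure hθ hσ hab hac h ha hb hc
    · exact not_isReducedStructure hθ hσ hac hab h ha hc hb
  · rintro (h | h)
    · exact isReducedStructure_of_integral hθ hσ (numIntegral_eq_iff.1 h)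
    · obtain ⟨b, c, hbc, hs⟩ := Set.ncard_eq_two.1
        (by omega : {i : Fin n | ∃ m : ℤ, θ i = m}ᶜ.ncard = 2)
      have hb : b ∈ {i : Fin n | ∃ m : ℤ, θ i = m}ᶜ := by rw [hs]; exact Or.inl rfl
      have hc : c ∈ {i : Fin n | ∃ m : ℤ, θ i = m}ᶜ := by rw [hs]; exact Or.inr rfl
      have hi : ∀ i, i ≠ b → i ≠ c → ∃ m : ℤ, θ i = m := by
        intro i h1 h2
        by_contra h'
        have h3 : i ∈ {i : Fin n | ∃ m : ℤ, θ i = m}ᶜ := h'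
        rw [hs] at h3
        rcases h3 with h3 | h3
        · exact h1 h3
        · exact h2 h3
      rcases lt_or_gt_of_ne hbc with h' | h'
      · exact isReducedStructure_of_two hθ hσ h' hb hc hi
      · exact isReducedStructure_of_two hθ hσ h' hc hb fun i h1 h2 => hi i h2 h1

end DecHom

end

/-! ### Non-emptiness and assembly of the theorem -/

namespace DecHom

theorem nonempty_rel_of_model {n : ℕ} {θ : Fin n → ℝ} (hθ : ∀ i, 0 < θ i) {σ : Fin n → ℝ}
    (hσ : IsCoaxialModel θ σ) : (rel 0 θ : Set (DecHom 0 n)).Nonempty := by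
  obtain ⟨u, hu, -⟩ := exists_unit_orthogonal 0
  obtain ⟨x, hx, -⟩ := exists_mem_rel_of_model hθ hσ (y := fun i => σ i • u)
    (fun i => by rw [norm_sign_smul (hσ.1 i), hu]) hu fun i _ => rfl
  exact ⟨x, hx⟩

end DecHom

theorem mainTheorem8 (g n : ℕ) (hn : 0 < n) (θ : Fin n → ℝ) (hθ : ∀ i, 0 < θ i)
    (hspecial : IsSpecial g θ) (k : ℕ) (hk : k = numIntegral θ) :
    (∀ x ∈ DecHom.rel g θ, x.IsCoaxial) ∧
    -- genus one
    (g = 1 →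
      -- the central locus and the central elementary locus
      (∃ Φ : Ambient g n → (Mat2 × Mat2) × (Fin n → EuclideanSpace ℝ (Fin 3)),
        IsAnalyticIso Φ (DecHom.locus {x ∈ DecHom.rel g θ | x.IsCentral})
          ((({1, -1} : Set Mat2) ×ˢ ({1, -1} : Set Mat2)) ×ˢ spherePow n) ∧
        Φ '' DecHom.locus {x ∈ DecHom.rel g θ | x.IsCentral ∧ x.IsElementary} =
          (({1, -1} : Set Mat2) ×ˢ ({1, -1} : Set Mat2)) ×ˢ coaxPow n) ∧
      -- the non-central locus and the non-central elementary locus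
      (∃ P ⊆ Metric.sphere (0 : EuclideanSpace ℝ (Fin 3)) 1, P.ncard = 4 ∧
        IsAnalyticBundlePair
          (DecHom.locus {x ∈ DecHom.rel g θ | ¬ x.IsCentral})
          (DecHom.locus {x ∈ DecHom.rel g θ | ¬ x.IsCentral ∧ x.IsElementary})
          (Metric.sphere (0 : EuclideanSpace ℝ (Fin 3)) 1 \ P)
          (spherePow (n + 1)) (coaxPow (n + 1))) ∧
      -- the non-elementary non-central loci
      DecHom.HomConnectedManifold
        {x ∈ DecHom.rel g θ | ¬ x.IsElementary ∧ ¬ x.IsCentral} (2 * n + 4) ∧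
      DecHom.RepConnectedManifold
        {x ∈ DecHom.rel g θ | ¬ x.IsElementary ∧ ¬ x.IsCentral} (2 * n + 1)) ∧
    -- genus zero, empty cases
    (g = 0 → (k + 1 = n ∨ distOdd θ < 1) → DecRep.rel g θ = ∅) ∧
    -- genus zero, non-empty cases
    (g = 0 → distOdd θ = 1 →
      (k = 0 →
        (∃ Φ : Ambient g n → EuclideanSpace ℝ (Fin 3),
          IsAnalyticIso Φ (DecHom.locus (DecHom.rel g θ))
            (Metric.sphere (0 : EuclideanSpace ℝ (Fin 3)) 1)) ∧
        (∀ x ∈ DecHom.rel g θ, x.IsElementary) ∧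
        (∀ x ∈ DecHom.rel g θ, ∀ y ∈ DecHom.rel g θ, x.Conj y)) ∧
      (1 ≤ k → k + 2 ≤ n →
        (∃ Φ : Ambient g n → (Fin (1 + k) → EuclideanSpace ℝ (Fin 3)),
          IsAnalyticIso Φ (DecHom.locus (DecHom.rel g θ)) (spherePow (1 + k)) ∧
          Φ '' DecHom.locus {x ∈ DecHom.rel g θ | x.IsElementary} = coaxPow (1 + k)) ∧
        DecHom.RepConnectedOrientedManifold
          {x ∈ DecHom.rel g θ | ¬ x.IsElementary} (2 * k - 1)) ∧
      (k = n → 3 ≤ n →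
        (∀ x ∈ DecHom.rel g θ, x.IsCentral) ∧
        (∃ Φ : Ambient g n → (Fin n → EuclideanSpace ℝ (Fin 3)),
          IsAnalyticIso Φ (DecHom.locus (DecHom.rel g θ)) (spherePow n) ∧
          Φ '' DecHom.locus {x ∈ DecHom.rel g θ | x.IsElementary} = coaxPow n) ∧
        DecHom.RepConnectedOrientedManifold
          {x ∈ DecHom.rel g θ | ¬ x.IsElementary} (2 * n - 3)) ∧
      -- the underlying homomorphisms form one conjugacy class; reducedness
      ((DecHom.rel g θ).Nonempty ∧
        ∀ x ∈ DecHom.rel g θ, ∀ y ∈ DecHom.rel g θ, x.RhoConj y) ∧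
      (IsReducedStructure (DecHom.locus (DecHom.rel g θ)) (DecHom.equations g θ) ↔
        k = n ∨ k + 2 = n)) := by
  subst hk
  have hsmall : g = 0 → (numIntegral θ + 1 = n ∨ distOdd θ < 1) → DecRep.rel g θ = ∅ := by
    rintro rfl h
    have hle : distOdd θ ≤ 1 := by
      rcases hspecial with ⟨h0, -⟩ | ⟨-, h0⟩
      · exact absurd h0 zero_ne_one
      · exact h0
    -- The case k = n - 1 is reduced to δ < 1: with δ = 1 it cannot occur.
    have hlt : distOdd θ < 1 := by
      rcases h with h | h
      · exact lt_of_le_of_ne hle fun h1 => (DecHom.exists_isCoaxialModel hn hθ h1).2 h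
      · exact h
    rw [DecRep.rel, DecHom.rel_eq_empty hn hθ hlt, Set.image_empty]
  rcases hspecial with ⟨rfl, c, hc, he⟩ | ⟨rfl, hle⟩
  · exact ⟨fun x hx => DecHom.isCoaxial_genus_one hθ hc he hx,
      fun _ => ⟨DecHom.central_locus_genus_one hθ hc he,
        DecHom.noncentral_bundle_genus_one hθ hc he,
        DecHom.homConnectedManifold_genus_one hθ hc he hn,
        DecHom.repConnectedManifold_genus_one hθ hc he hn⟩, hsmall,
      fun h => absurd h one_ne_zero⟩
  · refine ⟨?_, fun h => absurd h zero_ne_one, hsmall, fun _ h1 => ?_⟩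
    · intro x hx
      rcases hle.lt_or_eq with h | h
      · rw [DecHom.rel_eq_empty hn hθ h] at hx
        exact absurd hx (Set.notMem_empty x)
      · obtain ⟨⟨σ, hσ⟩, -⟩ := DecHom.exists_isCoaxialModel hn hθ h
        exact DecHom.isCoaxial_of_model hθ hσ hx
    obtain ⟨⟨σ, hσ⟩, hne⟩ := DecHom.exists_isCoaxialModel hn hθ h1
    refine ⟨fun h0 => ?_, fun hk1 hk2 => ?_, fun hk hk3 => ?_,
      ⟨DecHom.nonempty_rel_of_model hθ hσ, fun x hx y hy => DecHom.rhoConj_of_model hθ hσ hx hy⟩,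
      DecHom.isReducedStructure_iff hθ hσ hne⟩
    · obtain ⟨a, b, s, hs⟩ := DecHom.exists_isSphereModel hθ hσ (by omega)
      have hno : ∀ i, ¬ ∃ m : ℤ, θ i = m := by
        intro i hi
        rw [numIntegral, Set.ncard_eq_zero] at h0
        exact (h0 ▸ Set.notMem_empty i) hi
      refine ⟨?_, DecHom.genus_zero_no_integral hθ hσ hno⟩
      -- Turns the number of spheres into the literal `1 + 0`, for which evaluation at the single
      -- index is available.
      generalize numIntegral θ = m at h0 a b hs
      subst h0
      exact ⟨_, DecHom.isAnalyticIso_eval.comp (hs.isAnalyticIso hθ)⟩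
    · obtain ⟨a, b, s, hs⟩ := DecHom.exists_isSphereModel hθ hσ (by omega)
      refine ⟨⟨_, hs.isAnalyticIso hθ, hs.image_elementary hθ⟩, ?_⟩
      have := hs.repConnectedOrientedManifold hθ (by omega)
      rwa [show 2 * (1 + numIntegral θ) - 3 = 2 * numIntegral θ - 1 by omega] at this
    · have hint := DecHom.numIntegral_eq_iff.1 hk
      have hs := DecHom.isSphereModel_of_integral hθ hσ hint
      refine ⟨fun x hx => ?_, ⟨_, hs.isAnalyticIso hθ, hs.image_elementary hθ⟩,
        hs.repConnectedOrientedManifold hθ (by omega)⟩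
      choose c hc using hint
      exact DecHom.isCentral_iff.2 ⟨fun j => j.elim0, fun j => j.elim0,
        DecHom.vecPart_beta_int hθ hc hx⟩
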